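/- Let $g$ be a smooth Riemannian metric on the oriented sphere $S^2$ with area form $\mu$ and Gaussian curvature $K$, let $f:S^2\to(0,\infty)$ be smooth, and put $\sigma=f\mu$. Let $j$ be the rotation by $\pi/2$ in the tangent planes, $E(x,v)=\frac12 g_x(v,v)$, $\Sigma_m=\{E=\frac{m^2}{2}\}\subset TS^2$ and $SS^2=\Sigma_1$, with projection $\pi$ to $S^2$. Let $X$ be the geodesic vector field on $TS^2$ and $V$ the generator of the rotation of the fibres. The magnetic vector field is $X+fV$; on $\Sigma_m$, $m>0$, it corresponds under $(x,v)\mapsto(x,mv)$ to the field $X^m:=mX+fV$ on $SS^2$. Let $\lambda$ be the Liouville form, $\lambda_{(x,v)}(\xi)=g_x(v,d\pi\,\xi)$, and $\tau$ the angular form of the Levi-Civita connection, $\tau(\xi)=g(jv,\tfrac{\nabla v}{dt})$. **(1)** Let $\beta$ be a smooth $1$-form on $S^2$ with $d\beta=\sigma-K\mu$ (such $\beta$ exists exactly when $\int_{S^2}\sigma=4\pi$) and put $\lambda_m:=m\lambda-\pi^*\beta+\tau$ on $SS^2$. Then for some $m_0>0$ there is a family of diffeomorphisms $F_m:SS^2\to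 SS^2$ and functions $q_m:SS^2\to\mathbb R$, smooth in $(m,z)\in[0,m_0)\times SS^2$, with $F_0=\mathrm{id}$, $F_m^*\lambda_m=e^{q_m}\lambda_0$ and $\lambda_m(\partial_mF_m)=0$. Put $\check\lambda_m:=e^{q_m}\lambda_0$, and let $\check R^m$ be its Reeb vector field. For $\delta>0$ and $z=(x,v)\in SS^2$, consider the local section of $SS^2$ over the geodesic ball $B_\delta(x)$ obtained by transporting $v$, parallel for the connection form $\lambda_0$, along the $g$-geodesics issuing from $x$. Let $t_m(z)$ be the first positive time at which the $\check R^m$-orbit of $z$ meets this section, and let $S_m(z)$ be the integral of $\check\lambda_m$ over the loop which follows this orbit from $z$ up to time $t_m(z)$ and returns to $z$ inside the section along the inverse of the parallel path. Then, for every sufficiently small $\delta>0$, there is $m_1\in(0,m_0]$ such that $S_m$ is well defined on $SS^2$ for $m\in[0,m_1)$, $(m,z)\mapsto S_m(z)$ is smooth on $[0,m_1)\times SS^2$, and * for every sufficiently small $\varepsilon>0$ there is $m_2\in(0,m_1]$ such that, for all $m\in[0,m_2)$, a point $z\in SS^2$ is critical for $S_m$ if and only if $w=(y,u):=F_m(z)$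 lies on a periodic orbit of $X^m$ that is $\varepsilon$-close to the fibre through $w$ traversed once, that is, $X^m$ has a $T$-periodic solution $c$ with $c(0)=w$, $T>0$, $|f(y)T-2\pi|<\varepsilon$ and $\|c(t)-\Phi^V_{f(y)t}(w)\|<\varepsilon$ for $t\in[0,T]$, where $\Phi^V$ is the flow of $V$ and the norm comes from an embedding $TS^2\subset\mathbb R^3\times\mathbb R^3$; * uniformly in $(x,v)\in SS^2$, as $m\to0^+$, $$S_m(x,v)=2\pi+\frac{\pi}{f(x)}m^2+o(m^2).$$ Moreover, for every non-degenerate critical point $x$ of $f$ there are $m_1\in(0,m_0]$ and loops $\gamma_m:\mathbb R/2\pi\mathbb Z\to SS^2$, smooth in $(m,\psi)\in[0,m_1)\times\mathbb R/2\pi\mathbb Z$, such that $\gamma_0(\psi)=\Phi^V_\psi(x,v)$ for some unit vector $v\in T_xS^2$ (so $\gamma_0$ winds uniformly once around $S_xS^2$ in the positive sense), for all $m\in[0,m_1)$ the support of $F_m(\gamma_m)$ is the support of a periodic orbit of $X^m$ on $SS^2$, and for $0<m<m_1$ its image under $(x,v)\mapsto(x,mv)$ is the support of a periodic orbit of the magnetic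 vector field on $\Sigma_m$. **(2)** For every non-degenerate critical point $x$ of $f$ (with no reference to any $\beta$) there are $m_1>0$ and a smooth family of loops $\gamma_m$ in $SS^2$, $m\in[0,m_1)$, such that $\gamma_0$ is as in (1), the support of $\gamma_m$ is the support of a periodic orbit of $X^m$ for all $m\in[0,m_1)$, and for $0<m<m_1$ its image under $(x,v)\mapsto(x,mv)$ is the support of a periodic orbit of the magnetic vector field on $\Sigma_m$. -/

import Mathlib

open Set
open scoped Manifold ContDiff

noncomputable section

namespace LowEnergyMagnetic

/-! ### The sphere, its Riemannian metrics, functions and one-forms -/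

/-- The ambient Euclidean space `ℝ³`. -/
abbrev E3 : Type := EuclideanSpace ℝ (Fin 3)

/-- The model space `ℝ²` of the sphere. -/
abbrev E2 : Type := EuclideanSpace ℝ (Fin 2)

/-- The two-sphere, as a smooth manifold. -/
abbrev S2 : Type := Metric.sphere (0 : E3) 1

/-- Smooth Riemannian metrics on the two-sphere. -/
abbrev SphereMetric : Type :=
  Bundle.ContMDiffRiemannianMetric (𝓡 2) ∞ E2 (fun x : S2 => TangentSpace (𝓡 2) x)

/-- Smooth real functions on the two-sphere. -/
abbrev SphereFun : Type := C^∞⟮𝓡 2, S2; 𝓘(ℝ, ℝ), ℝ⟯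

/-- Smooth one-forms on the two-sphere. -/
structure SphereOneForm where
  form : ∀ x : S2, TangentSpace (𝓡 2) x →L[ℝ] ℝ
  smooth : ContMDiff (𝓡 2) ((𝓡 2).prod 𝓘(ℝ, E2 →L[ℝ] ℝ)) ∞
    (fun x : S2 => Bundle.TotalSpace.mk' (E2 →L[ℝ] ℝ)
      (E := fun x : S2 => TangentSpace (𝓡 2) x →L[ℝ] ℝ) x (form x))

/-- The `i`-th vector of the standard basis of `ℝ³`. -/
def basisVec (i : Fin 3) : E3 := EuclideanSpace.single i 1

lemma norm_basisVec (i : Fin 3) : ‖basisVec i‖ = 1 := by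
  simp [basisVec]

/-- The radial projection `p ↦ p / |p|` onto the sphere (a junk value at the origin). -/
def radial (p : E3) : S2 :=
  if h : p = 0 then ⟨basisVec 0, by simp [norm_basisVec]⟩
  else ⟨‖p‖⁻¹ • p, by
    have : ‖p‖ ≠ 0 := norm_ne_zero_iff.mpr h
    simp [norm_smul, this]⟩

/-- The differential of the radial projection. At a point `x` of the sphere its restriction to
`x^⊥` is the usual identification of the plane `x^⊥ ⊆ ℝ³` with the tangent space of the sphere. -/
def dradial (p : E3) : E3 →L[ℝ] TangentSpace (𝓡 2) (radial p) :=
  mfderiv 𝓘(ℝ, E3) (𝓡 2) radial p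

/-- The pull-back of a function on the sphere under the radial projection. -/
def funExt (f : SphereFun) (p : E3) : ℝ := f (radial p)

/-- The pull-back of a one-form on the sphere under the radial projection. -/
def formExt (β : SphereOneForm) (p u : E3) : ℝ := β.form (radial p) (dradial p u)

/-- The cylinder metric `dr² + g` on `ℝ³ \ {0} ≅ (0, ∞) × S²`. It restricts to `g` on the tangent
planes of the unit sphere, which is a totally geodesic slice; hence the Levi-Civita connection and
the sectional curvature of `g` are obtained from those of this metric by restriction. -/
def metric (g : SphereMetric) (p u w : E3) : ℝ :=
  inner ℝ (radial p : E3) u * inner ℝ (radial p : E3) w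
    + g.inner (radial p) (dradial p u) (dradial p w)

/-- The matrix of the cylinder metric in the standard coordinates of `ℝ³`. -/
def gram (g : SphereMetric) (p : E3) : Matrix (Fin 3) (Fin 3) ℝ :=
  Matrix.of fun i j => metric g p (basisVec i) (basisVec j)

/-- The vector dual, with respect to the metric, to the covector with the given components. -/
def sharp (g : SphereMetric) (p : E3) (φ : Fin 3 → ℝ) : E3 :=
  WithLp.toLp 2 ((gram g p)⁻¹.mulVec φ)

/-- The Christoffel symbols: the Levi-Civita derivative of a vector field `v` along a curve `x` is
`v' + christoffel x x' v`. -/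
def christoffel (g : SphereMetric) (p u w : E3) : E3 :=
  sharp g p fun l => (1 / 2 : ℝ) *
    (fderiv ℝ (fun q => metric g q w (basisVec l)) p u
      + fderiv ℝ (fun q => metric g q u (basisVec l)) p w
      - fderiv ℝ (fun q => metric g q u w) p (basisVec l))

/-- The Riemannian area form `μ` of `g` at a point `x` of the sphere, on `u, w ∈ x^⊥`; the sphere
is oriented by the outward normal. -/
def area (g : SphereMetric) (x u w : E3) : ℝ :=
  Real.sqrt (gram g x).det * (Matrix.of ![⇑x, ⇑u, ⇑w]).det

/-- The rotation `j` by the angle `π / 2` in the oriented tangent plane at `x`: the vector `j v` is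
determined by `g (j v, w) = μ (v, w)`. -/
def rot (g : SphereMetric) (x v : E3) : E3 :=
  sharp g x fun l => area g x v (basisVec l)

/-- The Riemann curvature tensor `R(u, w) a`. -/
def riemann (g : SphereMetric) (p u w a : E3) : E3 :=
  fderiv ℝ (fun q => christoffel g q w a) p u - fderiv ℝ (fun q => christoffel g q u a) p w
    + christoffel g p u (christoffel g p w a) - christoffel g p w (christoffel g p u a)

/-- The Gaussian curvature at `x`, computed in the basis `(u, w)` of the tangent plane `x^⊥`. -/
def gaussCurvature (g : SphereMetric) (x u w : E3) : ℝ :=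
  metric g x (riemann g x u w w) u
    / (metric g x u u * metric g x w w - metric g x u w ^ 2)

/-- The curvature form `σ_g = K μ` at `x`, on `u, w ∈ x^⊥` (it is zero if `u, w` are linearly
dependent, since then the area is). -/
def curvatureForm (g : SphereMetric) (x u w : E3) : ℝ :=
  gaussCurvature g x u w * area g x u w

/-- The exterior derivative of a one-form on the sphere. -/
def extDerivForm (β : SphereOneForm) (x u w : E3) : ℝ :=
  fderiv ℝ (fun q => formExt β q w) x u - fderiv ℝ (fun q => formExt β q u) x w

/-- `dβ = σ - σ_g` on the sphere, where `σ = f μ` and `σ_g = K μ`. -/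
def IsPrimitive (g : SphereMetric) (f : SphereFun) (β : SphereOneForm) : Prop :=
  ∀ (x : S2) (u w : E3), inner ℝ (x : E3) u = 0 → inner ℝ (x : E3) w = 0 →
    extDerivForm β x u w = f x * area g x u w - curvatureForm g x u w

/-- `x` is a non-degenerate critical point of `f`: the differential vanishes at `x` and the Hessian
on the tangent plane is non-degenerate. -/
def IsNondegCrit (f : SphereFun) (x : S2) : Prop :=
  fderiv ℝ (funExt f) x = 0 ∧
    ∀ u : E3, inner ℝ (x : E3) u = 0 →
      (∀ w : E3, inner ℝ (x : E3) w = 0 →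
        fderiv ℝ (fun q => fderiv ℝ (funExt f) q u) x w = 0) → u = 0

/-! ### The tangent bundle, its energy levels, vector fields and one-forms

The tangent bundle of the sphere is the set of pairs `(x, v)` with `|x| = 1` and `v ∈ x^⊥`. -/

/-- The space `ℝ³ × ℝ³` of pairs `(x, v)`. -/
abbrev Phase : Type := E3 × E3

/-- The kinetic energy `E(x, v) = g_x(v, v) / 2`. -/
def energy (g : SphereMetric) (z : Phase) : ℝ := metric g z.1 z.2 z.2 / 2

/-- The energy level `Σ_m = {E = m² / 2}` in the tangent bundle of the sphere. -/
def energyLevel (g : SphereMetric) (m : ℝ) : Set Phase :=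
  {z | ‖z.1‖ = 1 ∧ inner ℝ z.1 z.2 = 0 ∧ energy g z = m ^ 2 / 2}

/-- The unit tangent bundle `SS² = Σ_1`. -/
def unitBundle (g : SphereMetric) : Set Phase := energyLevel g 1

/-- The geodesic vector field `X`, the horizontal lift of `v` at `(x, v)`. -/
def geodesicField (g : SphereMetric) (z : Phase) : Phase :=
  (z.2, - christoffel g z.1 z.2 z.2)

/-- The vertical vector field `V`, the generator of the rotation of the fibres. -/
def verticalField (g : SphereMetric) (z : Phase) : Phase := (0, rot g z.1 z.2)

/-- The flow of `V`: rotation by the angle `θ` in the fibres. -/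
def fibreRotation (g : SphereMetric) (θ : ℝ) (z : Phase) : Phase :=
  (z.1, Real.cos θ • z.2 + Real.sin θ • rot g z.1 z.2)

/-- The vector field `X^m = m X + f V`. For `m = 1` it is the magnetic vector field `X + f V`, whose
trajectories are the solutions of `∇_γ' γ' = f j γ'`; on `Σ_m`, `m > 0`, the latter corresponds to
`X^m` on `SS²` under the rescaling `(x, v) ↦ (x, m v)`. -/
def magneticField (g : SphereMetric) (f : SphereFun) (m : ℝ) (z : Phase) : Phase :=
  m • geodesicField g z + funExt f z.1 • verticalField g z

/-- The rescaling `(x, v) ↦ (x, m v)` from `Σ_1` to `Σ_m`. -/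
def rescale (m : ℝ) (z : Phase) : Phase := (z.1, m • z.2)

/-- The Liouville one-form `λ`. -/
def liouville (g : SphereMetric) (z ξ : Phase) : ℝ := metric g z.1 z.2 ξ.1

/-- The angular form `τ` of the Levi-Civita connection, `τ(ξ) = g(j v, ∇v/dt)`. -/
def angular (g : SphereMetric) (z ξ : Phase) : ℝ :=
  metric g z.1 (rot g z.1 z.2) (ξ.2 + christoffel g z.1 ξ.1 z.2)

/-- The one-form `λ_m = m λ - π^*β + τ`. -/
def lam (g : SphereMetric) (β : SphereOneForm) (m : ℝ) (z ξ : Phase) : ℝ :=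
  m * liouville g z ξ - formExt β z.1 ξ.1 + angular g z ξ

/-! ### Vector fields and forms on a submanifold of the phase space -/

/-- Tangent vectors to a submanifold `N` at `z`. -/
def tangentVectors (N : Set Phase) (z : Phase) : Set Phase :=
  {ξ | ∃ c : ℝ → Phase, ContDiff ℝ ∞ c ∧ (∀ t, c t ∈ N) ∧ c 0 = z ∧ HasDerivAt c ξ 0}

/-- `c` is an integral curve in `N` of the vector field `W`. -/
def IsFlowLine (N : Set Phase) (W : Phase → Phase) (c : ℝ → Phase) : Prop :=
  ∀ t, c t ∈ N ∧ HasDerivAt c (W (c t)) t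

/-- `K` is the support of a periodic orbit in `N` of the vector field `W`. -/
def IsPeriodicOrbitSupport (N : Set Phase) (W : Phase → Phase) (K : Set Phase) : Prop :=
  ∃ T : ℝ, 0 < T ∧ ∃ c : ℝ → Phase, IsFlowLine N W c ∧ Function.Periodic c T ∧ range c = K

/-- `z` is a critical point of the restriction of `h` to `N`. -/
def IsCritOn (N : Set Phase) (h : Phase → ℝ) (z : Phase) : Prop :=
  ∀ c : ℝ → Phase, ContDiff ℝ ∞ c → (∀ t, c t ∈ N) → c 0 = z →
    HasDerivAt (fun t => h (c t)) 0 0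

/-- The value `dα(∂_s Φ, ∂_t Φ)` of the exterior derivative of a one-form `α` at the point
`Φ (0, 0)` of a parametrised surface `Φ`. -/
def extDerivAlong (α : Phase → Phase → ℝ) (Φ : ℝ × ℝ → Phase) : ℝ :=
  deriv (fun s => α (Φ (s, 0)) (deriv (fun t => Φ (s, t)) 0)) 0
    - deriv (fun t => α (Φ (0, t)) (deriv (fun s => Φ (s, t)) 0)) 0

/-- `R` is the Reeb vector field on `N` of the one-form `α`: `α(R) = 1` and `dα(R, ·) = 0`. -/
def IsReebField (N : Set Phase) (α : Phase → Phase → ℝ) (R : Phase → Phase) : Prop :=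
  ∀ z ∈ N, R z ∈ tangentVectors N z ∧ α z (R z) = 1 ∧
    ∀ Φ : ℝ × ℝ → Phase, ContDiff ℝ ∞ Φ → (∀ p, Φ p ∈ N) → Φ (0, 0) = z →
      HasDerivAt (fun s => Φ (s, 0)) (R z) 0 → extDerivAlong α Φ = 0

/-- The integral of the one-form `α` along the path `c` on `[0, 1]`. -/
def pathIntegral (α : Phase → Phase → ℝ) (c : ℝ → Phase) : ℝ :=
  ∫ r in (0 : ℝ)..1, α (c r) (deriv c r)

/-! ### The contact isotopy and the action function -/

/-- `(F, q)` is the Gray isotopy of the family `λ_m`, `0 ≤ m < m₀`, on `SS²`: a smooth family of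
diffeomorphisms `F_m` starting at the identity, generated by a vector field in `ker λ_m`, such that
`F_m^* λ_m = e^{q_m} λ_0`. -/
structure IsGrayIsotopy (g : SphereMetric) (β : SphereOneForm) (m₀ : ℝ)
    (F : ℝ → Phase → Phase) (q : ℝ → Phase → ℝ) : Prop where
  smooth_map : ContDiffOn ℝ ∞ (fun p : ℝ × Phase => F p.1 p.2) (Ico 0 m₀ ×ˢ unitBundle g)
  smooth_fun : ContDiffOn ℝ ∞ (fun p : ℝ × Phase => q p.1 p.2) (Ico 0 m₀ ×ˢ unitBundle g)
  bijective : ∀ m ∈ Ico 0 m₀, BijOn (F m) (unitBundle g) (unitBundle g)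
  smooth_inverse : ∀ m ∈ Ico 0 m₀,
    ContDiffOn ℝ ∞ (Function.invFunOn (F m) (unitBundle g)) (unitBundle g)
  initial : ∀ z ∈ unitBundle g, F 0 z = z
  generator : ∀ m ∈ Ico 0 m₀, ∀ z ∈ unitBundle g,
    lam g β m (F m z) (derivWithin (fun s => F s z) (Ico 0 m₀) m) = 0
  pullback : ∀ m ∈ Ico 0 m₀, ∀ c : ℝ → Phase, ContDiff ℝ ∞ c → (∀ t, c t ∈ unitBundle g) →
    ∀ t, lam g β m (F m (c t)) (deriv (fun s => F m (c s)) t)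
      = Real.exp (q m (c t)) * lam g β 0 (c t) (deriv c t)

/-- The one-form `e^{q_m} λ_0`, which is equal to `F_m^* λ_m` for the Gray isotopy. -/
def lamCheck (g : SphereMetric) (β : SphereOneForm) (q : ℝ → Phase → ℝ) (m : ℝ)
    (z ξ : Phase) : ℝ :=
  Real.exp (q m z) * lam g β 0 z ξ

/-- `c` is a lift to `SS²`, starting at `z` and parallel for the connection form `α₀`, of a
`g`-geodesic `y` whose restriction to `[0, 1]` has length less than `δ`. The end points `c 1` of
these lifts form the local section of `SS²` over the geodesic ball of radius `δ`. -/
def IsParallelRadialLift (g : SphereMetric) (α₀ : Phase → Phase → ℝ) (δ : ℝ) (z : Phase)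
    (c : ℝ → Phase) : Prop :=
  ContDiff ℝ ∞ c ∧ c 0 = z ∧ (∀ r, c r ∈ unitBundle g) ∧ (∀ r, α₀ (c r) (deriv c r) = 0) ∧
    ∃ y : ℝ → E3, (∀ r, y r = (c r).1) ∧
      (∀ r, HasDerivAt (deriv y) (- christoffel g (y r) (deriv y r) (deriv y r)) r) ∧
      Real.sqrt (metric g (y 0) (deriv y 0) (deriv y 0)) < δ

/-- `a` is the value at `z` of the action function of the contact form `α` on `SS²`. Let `t` be the
first positive time at which the Reeb orbit `φ` of `z` meets the local section through `z`, and let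
`c` be the parallel path in that section from `z` to `φ t`. Then `a` is the integral of `α` over the
loop which follows `φ` from `z` to `φ t` and returns to `z` along the inverse of `c`. -/
def IsActionValue (g : SphereMetric) (α₀ α : Phase → Phase → ℝ) (δ : ℝ) (z : Phase)
    (a : ℝ) : Prop :=
  ∃ R : Phase → Phase, IsReebField (unitBundle g) α R ∧
    ∃ φ : ℝ → Phase, φ 0 = z ∧ IsFlowLine (unitBundle g) R φ ∧
      ∃ t : ℝ, IsLeast {s | 0 < s ∧ ∃ c, IsParallelRadialLift g α₀ δ z c ∧ c 1 = φ s} t ∧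
        ∃ c : ℝ → Phase, IsParallelRadialLift g α₀ δ z c ∧ c 1 = φ t ∧
          a = pathIntegral α (fun r => φ (t * r)) + pathIntegral α (fun r => c (1 - r))

/-- The point `w` of `SS²` lies on a periodic orbit of `X^m` which is `ε`-close to the fibre of
`SS²` through `w`, traversed once with the speed of `X^0 = f V`. -/
def IsOnShortOrbit (g : SphereMetric) (f : SphereFun) (ε m : ℝ) (w : Phase) : Prop :=
  ∃ T : ℝ, 0 < T ∧ |funExt f w.1 * T - 2 * Real.pi| < ε ∧
    ∃ c : ℝ → Phase, c 0 = w ∧ IsFlowLine (unitBundle g) (magneticField g f m) c ∧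
      Function.Periodic c T ∧
      ∀ t ∈ Icc 0 T, ‖c t - fibreRotation g (funExt f w.1 * t) w‖ < ε

/-- `γ` is a smooth family of loops `γ_m` in `SS²`, `0 ≤ m < m₁`, such that `γ_0` winds uniformly
once in the positive sense around the fibre over `x`, and such that the image under `G_m` of the
support of `γ_m` is the support of a periodic orbit of `X^m` on `SS²`; equivalently, for `m > 0`,
after rescaling it is the support of a periodic orbit of the magnetic vector field on `Σ_m`. -/
structure IsOrbitFamily (g : SphereMetric) (f : SphereFun) (m₁ : ℝ) (G : ℝ → Phase → Phase)
    (x : S2) (γ : ℝ → ℝ → Phase) : Prop where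
  smooth : ContDiffOn ℝ ∞ (fun p : ℝ × ℝ => γ p.1 p.2) (Ico 0 m₁ ×ˢ univ)
  mem : ∀ m ∈ Ico 0 m₁, ∀ ψ, γ m ψ ∈ unitBundle g
  loop : ∀ m ∈ Ico 0 m₁, Function.Periodic (γ m) (2 * Real.pi)
  initial : ∃ v : E3, ((x : E3), v) ∈ unitBundle g ∧ ∀ ψ, γ 0 ψ = fibreRotation g ψ ((x : E3), v)
  orbit : ∀ m ∈ Ico 0 m₁,
    IsPeriodicOrbitSupport (unitBundle g) (magneticField g f m) (G m '' range (γ m))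
  orbit_level : ∀ m ∈ Ioo 0 m₁,
    IsPeriodicOrbitSupport (energyLevel g m) (magneticField g f 1)
      (rescale m '' (G m '' range (γ m)))

end LowEnergyMagnetic

end

open LowEnergyMagnetic

/-! For small `m` the orbits of `X^m = mX + fV` are reparametrised Reeb orbits of the contact form
`λ_m = mλ - π^*β + τ`: since `dλ_m` is `m dλ - f (λ ∧ g(jv, dπ ·))`, its kernel is spanned by `X^m`,
and `λ_m(X^m) = f - m β(v) + m² > 0`. At `m = 0` the Reeb field is `V`, all of whose orbits close up
after the time `2π`, and the theorem is a perturbation result for this circle action.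

*The isotopy.* The Gray vector field is an explicit multiple of the lift of `jv` to `ker λ_0`, so
that its flow gives `F_m` (`isGrayIsotopy`).

*The return.* The section through `z` consists of the end points of the curves tangent to `ker λ_0`
over geodesics, and is parametrised by the initial direction `w ∈ ℝ²`. The implicit function
theorem along the compact bundle, applied to "orbit point minus section point", gives the first
return `u = (t, W)`, a time and a direction that depend smoothly on `(m, z)` and are `(2π, 0)` at
`m = 0` (`exists_isReturn`). The Reeb orbit contributes its length to the action, and the section
contributes nothing, since `λ_0` vanishes on it: the action is the return time `t`
(`isActionValue`).

*The first variation.* Stokes' theorem on the strips swept by the orbits and by the radial curves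
expresses `dt` through the fluxes of `dλ_m` along the radial curve in the direction `W`
(`IsReturn.first_variation`). On a fixed level `m` it is a linear function of `W`, and its matrix at
`m = 0` is `f` times the rotation by a right angle, hence is invertible for small `m`. Thus `z` is a
critical point of the action if and only if `W = 0`, that is, if and only if the orbit of `z` closes
up at its first return (`IsReturn.eventually_critical_iff`), and such orbits are exactly the periodic
orbits close to a fibre (`IsReturn.eventually_short_orbit_iff`). In the direction of `m` the fluxes
cancel to second order, and the dependence of `λ_m` on `m` contributes `2π m / f`, whence
`t = 2π + m² k` with `k = π / f` at `m = 0` (`IsReturn.exists_expansion`).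

*The periodic orbits.* For `m ≠ 0` the critical points of `t` and `k` agree, and at a non-degenerate
critical point of `f` the implicit function theorem for the differential of `k` along the section
gives a smooth family of them (`IsReturn.exists_direction_zero`); the orbits through these points are
the loops `γ_m`. The argument uses `dλ_0` only near one fibre, so a primitive of `σ - Kμ` on a
neighbourhood of the critical point is enough (`exists_localPrimitive`), and the second part does not
need `∫ σ = 4π`.

The only geometric inputs are the frame `X, H, V` of the unit bundle and its structure equations, so
the dynamics is carried out for the abstract `ContactData`. The concrete bundle lies in `ℝ³ × ℝ³`, and the
structure equations follow from the Levi-Civita connection and the curvature of the cylinder metric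
(`contactData`). The smoothness of flows in time and initial point comes from the implicit function
theorem in the Banach space of curves on `[0, 1]` (`IsTame.contDiff_flow`). -/

namespace LowEnergyMagnetic

open Set Filter
open scoped Manifold ContDiff Topology NNReal

noncomputable section

set_option linter.unusedSectionVars false

/-! ### Superposition operators and parametric integrals -/

section Superposition

variable {K : Type} [TopologicalSpace K] [CompactSpace K]
  {E : Type} [NormedAddCommGroup E] [NormedSpace ℝ E]
  {F : Type} [NormedAddCommGroup F] [NormedSpace ℝ F]

/-- Pointwise application of a continuous family of linear maps, as a bounded bilinear map. -/
def pointwiseApply : C(K, E →L[ℝ] F) →L[ℝ] C(K, E) →L[ℝ] C(K, F) :=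
  LinearMap.mkContinuous₂
    (LinearMap.mk₂ ℝ (fun (A : C(K, E →L[ℝ] F)) (h : C(K, E)) =>
        (⟨fun t => A t (h t), A.continuous.clm_apply h.continuous⟩ : C(K, F)))
      (fun _ _ _ => by ext; simp) (fun _ _ _ => by ext; simp)
      (fun _ _ _ => by ext; simp) (fun _ _ _ => by ext; simp)) 1 (by
    intro A h
    refine (ContinuousMap.norm_le _ (by positivity)).2 fun t => ?_
    simp only [LinearMap.mk₂_apply, ContinuousMap.coe_mk, one_mul]
    exact (ContinuousLinearMap.le_opNorm _ _).trans
      (mul_le_mul (A.norm_coe_le_norm t) (h.norm_coe_le_norm t) (norm_nonneg (h t)) (norm_nonneg A)))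

@[simp] lemma pointwiseApply_apply (A : C(K, E →L[ℝ] F)) (h : C(K, E)) (t : K) :
    pointwiseApply A h t = A t (h t) := rfl

lemma norm_pointwiseApply_le (A : C(K, E →L[ℝ] F)) {C : ℝ} (hC : 0 ≤ C) (hA : ∀ t, ‖A t‖ ≤ C) :
    ‖pointwiseApply A‖ ≤ C := by
  refine ContinuousLinearMap.opNorm_le_bound _ hC fun h => ?_
  refine (ContinuousMap.norm_le _ (by positivity)).2 fun t => ?_
  rw [pointwiseApply_apply]
  exact (ContinuousLinearMap.le_opNorm _ _).trans
    (mul_le_mul (hA t) (h.norm_coe_le_norm t) (norm_nonneg _) hC)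

/-- The superposition operator `γ ↦ g ∘ γ` on spaces of continuous maps. -/
def superpose (g : C(E, F)) (γ : C(K, E)) : C(K, F) := g.comp γ

lemma hasFDerivAt_superpose {g : C(E, F)} (hg : ContDiff ℝ 1 g) (γ : C(K, E)) :
    HasFDerivAt (superpose (K := K) g)
      (pointwiseApply (superpose (⟨fderiv ℝ g, hg.continuous_fderiv one_ne_zero⟩ : C(E, E →L[ℝ] F)) γ))
      γ := by
  rw [hasFDerivAt_iff_isLittleO_nhds_zero, Asymptotics.isLittleO_iff]
  intro c hc
  have hK : IsCompact (range γ) := isCompact_range γ.continuous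
  have hu := hK.uniformContinuousAt_of_continuousAt (fderiv ℝ g)
    (fun a _ => (hg.continuous_fderiv one_ne_zero).continuousAt) (Metric.dist_mem_uniformity hc)
  obtain ⟨δ, hδ, hδ'⟩ := Metric.mem_uniformity_dist.1 hu
  filter_upwards [Metric.ball_mem_nhds (0 : C(K, E)) hδ] with h hh
  refine (ContinuousMap.norm_le _ (by positivity)).2 fun t => ?_
  have hht : ‖h t‖ < δ := (h.norm_coe_le_norm t).trans_lt (by simpa using hh)
  have key : ‖g (γ t + h t) - g (γ t) - fderiv ℝ g (γ t) (γ t + h t - γ t)‖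
      ≤ c * ‖γ t + h t - γ t‖ := by
    refine (convex_ball (γ t) δ).norm_image_sub_le_of_norm_hasFDerivWithin_le'
      (f' := fderiv ℝ g) (fun x _ => ((hg.differentiable one_ne_zero) x).hasFDerivAt.hasFDerivWithinAt)
      (fun x hx => ?_) (Metric.mem_ball_self hδ) (by simpa using hht)
    have := hδ' (a := γ t) (b := x) (by rw [dist_comm]; exact hx) (mem_range_self t)
    rw [← dist_eq_norm, dist_comm]
    exact le_of_lt this
  simp only [add_sub_cancel_left] at key
  calc _ = ‖g (γ t + h t) - g (γ t) - fderiv ℝ g (γ t) (h t)‖ := rfl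
    _ ≤ c * ‖h t‖ := key
    _ ≤ c * ‖h‖ := by gcongr; exact h.norm_coe_le_norm t

/-- Superposition with a smooth map is smooth: its derivative is pointwise application of the
superposition with the derivative. -/
theorem contDiff_superpose {g : C(E, F)} (hg : ContDiff ℝ ∞ g) :
    ContDiff ℝ ∞ (superpose (K := K) g) := by
  rw [contDiff_infty]
  intro n
  induction n generalizing F with
  | zero =>
    exact contDiff_zero.2 (ContinuousMap.continuous_postcomp g)
  | succ n ih =>
    rw [Nat.cast_succ, contDiff_succ_iff_hasFDerivAt]
    refine ⟨_, ?_, fun γ => hasFDerivAt_superpose (hg.of_le (by exact_mod_cast le_top)) γ⟩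
    exact pointwiseApply.contDiff.comp
      (ih (g := ⟨fderiv ℝ g, _⟩) (hg.fderiv_right (m := ∞) (by simp)))

end Superposition

section Integral

variable {E : Type} [NormedAddCommGroup E] [NormedSpace ℝ E]
  {F : Type} [NormedAddCommGroup F] [NormedSpace ℝ F]

/-- The primitive vanishing at `0` of a continuous curve on `[0, 1]`, as a bounded operator. -/
def primitive : C(Icc (0 : ℝ) 1, E) →L[ℝ] C(Icc (0 : ℝ) 1, E) :=
  LinearMap.mkContinuous
    { toFun := fun γ => ⟨fun t => ∫ s in (0 : ℝ)..t, IccExtend zero_le_one γ s,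
        ((intervalIntegral.continuous_primitive (fun a b =>
          (γ.continuous.Icc_extend' (h := zero_le_one)).intervalIntegrable a b) 0).comp
            continuous_subtype_val)⟩
      map_add' := fun γ η => by
        ext t
        simp only [ContinuousMap.coe_mk, ContinuousMap.add_apply]
        rw [← intervalIntegral.integral_add
          ((γ.continuous.Icc_extend' (h := zero_le_one)).intervalIntegrable _ _)
          ((η.continuous.Icc_extend' (h := zero_le_one)).intervalIntegrable _ _)]
        rfl
      map_smul' := fun c γ => by
        ext t
        simp only [ContinuousMap.coe_mk, ContinuousMap.smul_apply, RingHom.id_apply]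
        rw [← intervalIntegral.integral_smul]
        rfl } 1 (by
    intro γ
    refine (ContinuousMap.norm_le _ (by positivity)).2 fun t => ?_
    have h := intervalIntegral.norm_integral_le_of_norm_le_const (a := (0 : ℝ)) (b := t)
      (f := IccExtend zero_le_one γ) (C := ‖γ‖) (fun s _ => γ.norm_coe_le_norm _)
    refine (show _ ≤ _ from h).trans ?_
    rw [sub_zero, abs_of_nonneg t.2.1, one_mul]
    exact mul_le_of_le_one_right (norm_nonneg _) t.2.2)

lemma primitive_apply (γ : C(Icc (0 : ℝ) 1, E)) (t : Icc (0 : ℝ) 1) :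
    primitive γ t = ∫ s in (0 : ℝ)..t, IccExtend zero_le_one γ s := rfl

lemma norm_primitive_le : ‖(primitive : C(Icc (0 : ℝ) 1, E) →L[ℝ] _)‖ ≤ 1 :=
  LinearMap.mkContinuous_norm_le _ zero_le_one _

lemma norm_primitive_apply_le (γ : C(Icc (0 : ℝ) 1, E)) : ‖primitive γ‖ ≤ ‖γ‖ := by
  have h := ContinuousLinearMap.le_opNorm (primitive : C(Icc (0 : ℝ) 1, E) →L[ℝ] _) γ
  exact h.trans (mul_le_of_le_one_left (norm_nonneg _) norm_primitive_le)

/-- An integral over `[0, 1]` depends smoothly on parameters. -/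
theorem contDiff_parametricIntegral {P : Type} [NormedAddCommGroup P] [NormedSpace ℝ P]
    {g : P × ℝ → F} (hg : ContDiff ℝ ∞ g) :
    ContDiff ℝ ∞ fun p => ∫ s in (0 : ℝ)..1, g (p, s) := by
  let I := Icc (0 : ℝ) 1
  let one : I := ⟨1, by simp [I]⟩
  let cst : P →L[ℝ] C(I, P) := ContinuousLinearMap.const ℝ I
  let c : P → C(I, P × ℝ) := fun p => (ContinuousMap.const I p).prodMk ⟨Subtype.val, by fun_prop⟩
  have hc : ContDiff ℝ ∞ c := by
    have h1 : c = fun p => (ContinuousLinearMap.compLeftContinuous ℝ I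
        (ContinuousLinearMap.inl ℝ P ℝ)) (cst p) + c 0 := by
      ext p t <;> simp [c, cst]
    rw [h1]
    exact ((ContinuousLinearMap.contDiff _).comp cst.contDiff).add contDiff_const
  have h := ((ContinuousMap.evalCLM ℝ one : C(I, F) →L[ℝ] F).contDiff.comp
    ((primitive : C(I, F) →L[ℝ] _).contDiff.comp
      ((contDiff_superpose (K := I) (g := ⟨g, hg.continuous⟩) hg).comp hc)))
  convert! h using 1
  funext p
  simp only [Function.comp, ContinuousMap.evalCLM_apply]
  refine intervalIntegral.integral_congr fun s hs => ?_
  rw [uIcc_of_le zero_le_one] at hs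
  change _ = IccExtend zero_le_one _ s
  rw [IccExtend_of_mem _ _ hs]
  rfl

end Integral

/-! ### Flows of globally Lipschitz smooth vector fields -/

section Flow

variable {E : Type} [NormedAddCommGroup E] [NormedSpace ℝ E] [CompleteSpace E]

lemma exists_integralCurve {W : E → E} {L : ℝ≥0} (hW : ContDiff ℝ 1 W) (hL : LipschitzWith L W)
    (x : E) : ∃ c : ℝ → E, c 0 = x ∧ ∀ t, HasDerivAt c (W (c t)) t := by
  -- a global Lipschitz constant gives a time of existence independent of the initial point
  have hε : (0 : ℝ) < 1 / (2 * (L + 1)) := by positivity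
  have hloc : ∀ y : E, ∃ γ : ℝ → E, γ 0 = y ∧
      IsMIntegralCurveOn (I := 𝓘(ℝ, E)) γ W (Ioo (-(1 / (2 * (L + 1)) : ℝ)) (1 / (2 * (L + 1)))) := by
    intro y
    let a : ℝ≥0 := ‖W y‖₊ + 1
    have hP : IsPicardLindelof (fun _ => W) (tmin := -(1 / (2 * (L + 1)) : ℝ))
        (tmax := 1 / (2 * (L + 1))) ⟨0, by constructor <;> linarith⟩ y a 0 (‖W y‖₊ + L * a) L := by
      refine IsPicardLindelof.of_time_independent (fun z hz => ?_) hL.lipschitzOnWith ?_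
      · have h1 := hL.dist_le_mul z y
        have h2 : ‖W z‖ ≤ ‖W y‖ + dist (W z) (W y) := by
          rw [dist_eq_norm]; simpa using norm_add_le (W y) (W z - W y)
        have h3 : (L : ℝ) * dist z y ≤ L * a := by
          gcongr; exact hz
        simp only [NNReal.coe_add, coe_nnnorm, NNReal.coe_mul]
        linarith
      · simp only [sub_zero, zero_sub, neg_neg, max_self, NNReal.coe_add, coe_nnnorm,
          NNReal.coe_mul, NNReal.coe_zero, a, NNReal.coe_one]
        rw [mul_one_div, div_le_iff₀ (by positivity)]
        have := norm_nonneg (W y)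
        have hLn : (0 : ℝ) ≤ L := L.2
        nlinarith [mul_nonneg hLn this]
    obtain ⟨γ, h0, hγ⟩ := hP.exists_eq_forall_mem_Icc_hasDerivWithinAt₀
    refine ⟨γ, h0, fun t ht => ?_⟩
    have h := (hγ t (Ioo_subset_Icc_self ht)).mono Ioo_subset_Icc_self
    exact h.hasFDerivWithinAt.hasMFDerivWithinAt
  obtain ⟨γ, h0, hγ⟩ := exists_isMIntegralCurve_of_isMIntegralCurveOn (I := 𝓘(ℝ, E)) (v := W)
    (contMDiff_vectorSpace_iff_contDiff.2 hW) hε hloc x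
  refine ⟨γ, h0, fun t => ?_⟩
  have h : HasFDerivAt γ ((1 : ℝ →L[ℝ] ℝ).smulRight (W (γ t)) : ℝ →L[ℝ] E) t := (hγ t).hasFDerivAt
  simpa using h.hasDerivAt

omit [CompleteSpace E] in
lemma integralCurve_unique {W : E → E} {L : ℝ≥0} (hL : LipschitzWith L W) {c d : ℝ → E}
    (hc : ∀ t, HasDerivAt c (W (c t)) t) (hd : ∀ t, HasDerivAt d (W (d t)) t) {t₀ : ℝ}
    (h0 : c t₀ = d t₀) : c = d :=
  ODE_solution_unique_univ (v := fun _ => W) (s := fun _ => univ) (fun _ => hL.lipschitzOnWith)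
    (fun t => ⟨hc t, mem_univ _⟩) (fun t => ⟨hd t, mem_univ _⟩) h0

/-- The flow of a vector field: `flow W t x` is the value at time `t` of the integral curve through
`x` (a junk value if there is no global integral curve). -/
def flow (W : E → E) (t : ℝ) (x : E) : E :=
  open Classical in
  if h : ∃ c : ℝ → E, c 0 = x ∧ ∀ t, HasDerivAt c (W (c t)) t then h.choose t else x

/-- The class of vector fields whose flows are used: smooth and globally Lipschitz. -/
def IsTame (W : E → E) : Prop := ContDiff ℝ ∞ W ∧ ∃ L : ℝ≥0, LipschitzWith L W

variable {W : E → E}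

lemma IsTame.flow_spec (hW : IsTame W) (x : E) :
    flow W 0 x = x ∧ ∀ t, HasDerivAt (fun s => flow W s x) (W (flow W t x)) t := by
  obtain ⟨hs, L, hL⟩ := hW
  have h := exists_integralCurve (hs.of_le (by exact_mod_cast le_top)) hL x
  have he : (fun s => flow W s x) = h.choose := by
    funext s; simp only [flow, dif_pos h]
  have he' : ∀ t, flow W t x = h.choose t := fun t => congrFun he t
  rw [he, he']
  exact ⟨h.choose_spec.1, fun t => by rw [he']; exact h.choose_spec.2 t⟩

lemma IsTame.flow_zero (hW : IsTame W) (x : E) : flow W 0 x = x := (hW.flow_spec x).1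

lemma IsTame.hasDerivAt_flow (hW : IsTame W) (t : ℝ) (x : E) :
    HasDerivAt (fun s => flow W s x) (W (flow W t x)) t := (hW.flow_spec x).2 t

lemma IsTame.eq_flow (hW : IsTame W) {c : ℝ → E} (hc : ∀ t, HasDerivAt c (W (c t)) t) (t : ℝ) :
    c t = flow W t (c 0) := by
  obtain ⟨L, hL⟩ := hW.2
  exact congrFun (integralCurve_unique hL hc (fun t => hW.hasDerivAt_flow t (c 0)) (t₀ := 0)
    (hW.flow_zero _).symm) t

lemma IsTame.flow_add (hW : IsTame W) (s t : ℝ) (x : E) :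
    flow W (s + t) x = flow W s (flow W t x) := by
  have h : ∀ r, HasDerivAt (fun r => flow W (r + t) x) (W (flow W (r + t) x)) r := fun r => by
    simpa using (hW.hasDerivAt_flow (r + t) x).comp_add_const r t
  simpa using hW.eq_flow h s

lemma IsTame.hasDerivAt_flow_mul (hW : IsTame W) (τ t : ℝ) (x : E) :
    HasDerivAt (fun s => flow W (τ * s) x) (τ • W (flow W (τ * t) x)) t := by
  have := (hW.hasDerivAt_flow (τ * t) x).scomp t ((hasDerivAt_id t).const_mul τ)
  simpa [Function.comp_def] using this

lemma IsTame.continuous_flow_curve (hW : IsTame W) (x : E) : Continuous fun s => flow W s x :=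
  continuous_iff_continuousAt.2 fun t => (hW.hasDerivAt_flow t x).continuousAt

lemma hasFDerivAt_id_sub_smul_comp {B : Type} [NormedAddCommGroup B] [NormedSpace ℝ B] {N : B → B}
    {N' : B →L[ℝ] B} {y : B} (hN : HasFDerivAt N N' y) (a : B) (τ : ℝ) (I : B →L[ℝ] B) :
    HasFDerivAt (fun γ => γ - a - τ • I (N γ)) (1 - τ • (I ∘L N')) y :=
  ((hasFDerivAt_id y).sub_const a).sub ((I.hasFDerivAt.comp y hN).const_smul τ)

/-- For short times the orbit of `x`, rescaled to `[0, 1]`, is the unique solution of a smooth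
equation in the Banach space of curves, to which the implicit function theorem applies. -/
lemma IsTame.contDiffAt_flow_short (hW : IsTame W) {L : ℝ≥0} (hL : LipschitzWith L W) {τ : ℝ}
    (hτ : |τ| * L < 1) (x : E) :
    ContDiffAt ℝ ∞ (fun p : ℝ × E => flow W p.1 p.2) (τ, x) := by
  let I := Icc (0 : ℝ) 1
  let one : I := ⟨1, by simp [I]⟩
  let w : C(E, E) := ⟨W, hW.1.continuous⟩
  let cst : E →L[ℝ] C(I, E) := ContinuousLinearMap.const ℝ I
  let orb : ℝ × E → C(I, E) := fun p => ⟨fun t => flow W (p.1 * t) p.2,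
    (hW.continuous_flow_curve p.2).comp (by fun_prop)⟩
  let G : (ℝ × E) × C(I, E) → C(I, E) := fun p =>
    p.2 - cst p.1.2 - p.1.1 • primitive (superpose w p.2)
  have hG : ContDiff ℝ ∞ G := by
    have h1 : ContDiff ℝ ∞ (superpose (K := I) w) := contDiff_superpose hW.1
    have h2 : ContDiff ℝ ∞ fun p : (ℝ × E) × C(I, E) => primitive (superpose w p.2) :=
      (primitive : C(I, E) →L[ℝ] _).contDiff.comp (h1.comp contDiff_snd)
    have h3 : ContDiff ℝ ∞ fun p : (ℝ × E) × C(I, E) => cst p.1.2 :=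
      cst.contDiff.comp (contDiff_snd.comp contDiff_fst)
    exact (contDiff_snd.sub h3).sub ((contDiff_fst.comp contDiff_fst).smul h2)
  have horb : ∀ p, G (p, orb p) = 0 := by
    intro p
    ext t
    have hint : ∫ s in (0 : ℝ)..t, p.1 • W (flow W (p.1 * s) p.2)
        = flow W (p.1 * t) p.2 - flow W (p.1 * 0) p.2 :=
      intervalIntegral.integral_eq_sub_of_hasDerivAt
        (fun s _ => hW.hasDerivAt_flow_mul p.1 s p.2)
        (Continuous.intervalIntegrable (by
          have := hW.1.continuous.comp ((hW.continuous_flow_curve p.2).comp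
            (continuous_const.mul continuous_id : Continuous fun s : ℝ => p.1 * s))
          exact this.const_smul _) _ _)
    rw [mul_zero, hW.flow_zero, intervalIntegral.integral_smul] at hint
    have h2 : ∫ s in (0 : ℝ)..t, IccExtend zero_le_one (superpose w (orb p)) s
        = ∫ s in (0 : ℝ)..t, W (flow W (p.1 * s) p.2) := by
      refine intervalIntegral.integral_congr fun s hs => ?_
      rw [uIcc_of_le t.2.1] at hs
      rw [IccExtend_of_mem _ _ ⟨hs.1, hs.2.trans t.2.2⟩]
      rfl
    change flow W (p.1 * t) p.2 - p.2 - p.1 • (primitive (superpose w (orb p))) t = 0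
    rw [primitive_apply, h2, hint]
    abel
  have huniq : ∀ p : ℝ × E, |p.1| * L < 1 → ∀ γ, G (p, γ) = 0 → γ = orb p := by
    intro p hp γ hγ
    have h1 : γ - orb p = p.1 • primitive (superpose w γ - superpose w (orb p)) := by
      have h2 := horb p
      simp only [G] at hγ h2
      rw [map_sub, smul_sub]
      rw [sub_eq_zero] at hγ h2
      rw [← hγ, ← h2]
      abel
    have h3 : ‖superpose w γ - superpose w (orb p)‖ ≤ L * ‖γ - orb p‖ := by
      refine (ContinuousMap.norm_le _ (by positivity)).2 fun t => ?_
      have := hL.dist_le_mul (γ t) (orb p t)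
      rw [dist_eq_norm, dist_eq_norm] at this
      exact this.trans (by gcongr; exact (γ - orb p).norm_coe_le_norm t)
    have h4 : ‖γ - orb p‖ ≤ |p.1| * (L * ‖γ - orb p‖) := by
      have h6 := (norm_primitive_apply_le (superpose w γ - superpose w (orb p))).trans h3
      calc ‖γ - orb p‖ = |p.1| * ‖primitive (superpose w γ - superpose w (orb p))‖ := by
            rw [h1, norm_smul, Real.norm_eq_abs]
        _ ≤ _ := mul_le_mul_of_nonneg_left h6 (abs_nonneg _)
    have h5 : ‖γ - orb p‖ = 0 := by
      by_contra hne
      have : 0 < ‖γ - orb p‖ := lt_of_le_of_ne (norm_nonneg _) (Ne.symm hne)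
      nlinarith
    exact sub_eq_zero.1 (norm_eq_zero.1 h5)
  set u : (ℝ × E) × C(I, E) := ((τ, x), orb (τ, x)) with hu
  have hGu : ContDiffAt ℝ ∞ G u := hG.contDiffAt
  -- the derivative in the direction of curves is a perturbation of the identity
  let w' : C(E, E →L[ℝ] E) := ⟨fderiv ℝ W, hW.1.continuous_fderiv (by simp)⟩
  let T : C(I, E) →L[ℝ] C(I, E) :=
    τ • (primitive ∘L pointwiseApply (superpose w' (orb (τ, x))))
  have hT : ‖T‖ < 1 := by
    have h1 : ‖pointwiseApply (superpose w' (orb (τ, x)))‖ ≤ L :=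
      norm_pointwiseApply_le _ L.2 fun t => norm_fderiv_le_of_lipschitz (𝕜 := ℝ) (f := W) hL
    calc ‖T‖ ≤ |τ| * (‖(primitive : C(I, E) →L[ℝ] _)‖
          * ‖pointwiseApply (superpose w' (orb (τ, x)))‖) := by
            refine (ContinuousLinearMap.opNorm_smul_le _ _).trans ?_
            exact mul_le_mul_of_nonneg_left (ContinuousLinearMap.opNorm_comp_le _ _) (abs_nonneg _)
      _ ≤ |τ| * (1 * L) := mul_le_mul_of_nonneg_left
          (mul_le_mul norm_primitive_le h1 (ContinuousLinearMap.opNorm_nonneg _) zero_le_one) (abs_nonneg _)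
      _ < 1 := by rwa [one_mul]
  have hfd : fderiv ℝ G u ∘L .inr ℝ (ℝ × E) C(I, E) = 1 - T := by
    have h1 : HasFDerivAt (fun γ : C(I, E) => G ((τ, x), γ)) (1 - T) (orb (τ, x)) := by
      have h2 := hasFDerivAt_superpose (K := I) (g := w) (hW.1.of_le (by exact_mod_cast le_top))
        (orb (τ, x))
      exact hasFDerivAt_id_sub_smul_comp h2 (cst x) τ primitive
    have h4 := (hGu.differentiableAt (by simp)).hasFDerivAt.comp (orb (τ, x))
      (hasFDerivAt_prodMk_right (τ, x) (orb (τ, x)))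
    exact h4.unique h1
  have hinv : (fderiv ℝ G u ∘L .inr ℝ (ℝ × E) C(I, E)).IsInvertible := by
    rw [hfd]
    exact ⟨ContinuousLinearEquiv.unitsEquiv ℝ _ (Units.oneSub T hT), by ext1; simp⟩
  have hψ := hGu.contDiffAt_implicitFunction (by simp) hinv
  have hev := hGu.eventually_apply_implicitFunction (by simp) hinv
  have hopen : ∀ᶠ p : ℝ × E in 𝓝 (τ, x), |p.1| * L < 1 :=
    ContinuousAt.eventually_lt (by fun_prop) continuousAt_const hτ
  have heq : (fun p : ℝ × E => flow W p.1 p.2) =ᶠ[𝓝 (τ, x)]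
      fun p => ContinuousMap.evalCLM ℝ one (hGu.implicitFunction (by simp) hinv p) := by
    filter_upwards [hev, hopen] with p hp hp'
    rw [huniq p hp' _ (hp.trans (horb (τ, x)))]
    change _ = flow W (p.1 * 1) p.2
    rw [mul_one]
  exact ((ContinuousMap.evalCLM ℝ one : C(I, E) →L[ℝ] E).contDiff.contDiffAt.comp _
    hψ).congr_of_eventuallyEq heq

/-- The flow of a smooth globally Lipschitz vector field is smooth in time and initial point. -/
theorem IsTame.contDiff_flow (hW : IsTame W) : ContDiff ℝ ∞ fun p : ℝ × E => flow W p.1 p.2 := by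
  obtain ⟨L, hL⟩ := hW.2
  have h : ∀ n : ℕ, ∀ τ : ℝ, |τ| * L < 2 ^ n → ∀ x : E,
      ContDiffAt ℝ ∞ (fun p : ℝ × E => flow W p.1 p.2) (τ, x) := by
    intro n
    induction n with
    | zero => intro τ hτ x; exact hW.contDiffAt_flow_short hL (by simpa using hτ) x
    | succ n ih =>
      intro τ hτ x
      have hτ' : |τ / 2| * L < 2 ^ n := by
        rw [abs_div, abs_two, div_mul_eq_mul_div, div_lt_iff₀ two_pos, ← pow_succ]; exact hτ
      have h2 : (fun p : ℝ × E => flow W p.1 p.2)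
          = fun p : ℝ × E => flow W (p.1 / 2) (flow W (p.1 / 2) p.2) := by
        funext p
        rw [← hW.flow_add, add_halves]
      rw [h2]
      have h3 : ContDiffAt ℝ ∞ (fun p : ℝ × E => (p.1 / 2, p.2)) (τ, x) := by fun_prop
      have h4 : ContDiffAt ℝ ∞ (fun p : ℝ × E => flow W (p.1 / 2) p.2) (τ, x) :=
        ContDiffAt.comp (g := fun p : ℝ × E => flow W p.1 p.2) (τ, x) (ih (τ / 2) hτ' x) h3
      have h5 : ContDiffAt ℝ ∞ (fun p : ℝ × E => (p.1 / 2, flow W (p.1 / 2) p.2)) (τ, x) :=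
        (show ContDiffAt ℝ ∞ (fun p : ℝ × E => p.1 / 2) (τ, x) by fun_prop).prodMk h4
      exact ContDiffAt.comp (g := fun p : ℝ × E => flow W p.1 p.2) (τ, x) (ih (τ / 2) hτ' _) h5
  rw [contDiff_iff_contDiffAt]
  rintro ⟨τ, x⟩
  obtain ⟨n, hn⟩ := pow_unbounded_of_one_lt (|τ| * L) one_lt_two
  exact h n τ hn x

end Flow

/-! ### Cut-offs and the implicit function theorem along a compact set -/

section Cutoff

variable {E : Type} [NormedAddCommGroup E] [NormedSpace ℝ E]
  {F : Type} [NormedAddCommGroup F] [NormedSpace ℝ F]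

lemma IsTame.of_hasCompactSupport {W : E → E} (hW : ContDiff ℝ ∞ W) (hc : HasCompactSupport W) :
    IsTame W :=
  ⟨hW, ContDiff.lipschitzWith_of_hasCompactSupport (𝕂 := ℝ) hc hW (by simp)⟩

lemma IsTame.const_add {W : E → E} (hW : IsTame W) (a : E) : IsTame fun x => a + W x := by
  obtain ⟨h, L, hL⟩ := hW
  refine ⟨contDiff_const.add h, L, LipschitzWith.of_dist_le_mul fun x y => ?_⟩
  rw [dist_add_left]
  exact hL.dist_le_mul x y

/-- Cut-off functions: equal to `1` near a compact set, supported in a given neighbourhood. -/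
lemma exists_cutoff [FiniteDimensional ℝ E] {K U : Set E} (hK : IsCompact K) (hU : IsOpen U)
    (hKU : K ⊆ U) :
    ∃ χ : E → ℝ, ContDiff ℝ ∞ χ ∧ HasCompactSupport χ ∧ tsupport χ ⊆ U ∧
      ∀ᶠ x in 𝓝ˢ K, χ x = 1 := by
  obtain ⟨V, hVo, hKV, hVU, hVc⟩ := exists_open_between_and_isCompact_closure hK hU hKU
  obtain ⟨V', hVo', hKV', hVU', hVc'⟩ := exists_open_between_and_isCompact_closure hK hVo hKV
  obtain ⟨χ, hχ, -, hs, h1⟩ := exists_contMDiff_support_eq_eq_one_iff (n := (⊤ : ℕ∞)) 𝓘(ℝ, E) hVo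
    (isClosed_closure (s := V')) hVU'
  have hts : tsupport χ = closure V := by rw [tsupport, hs]
  refine ⟨χ, contMDiff_iff_contDiff.1 hχ, ?_, hts ▸ hVU, ?_⟩
  · rw [HasCompactSupport, hts]; exact hVc
  · filter_upwards [hVo'.mem_nhdsSet.2 hKV'] with x hx
    exact (h1 x).1 (subset_closure hx)

lemma contDiff_cutoff_smul {χ : E → ℝ} {U : Set E} {g : E → F} (hχ : ContDiff ℝ ∞ χ)
    (hU : IsOpen U) (hs : tsupport χ ⊆ U) (hg : ContDiffOn ℝ ∞ g U) :
    ContDiff ℝ ∞ fun x => χ x • g x := by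
  rw [← contMDiff_iff_contDiff]
  refine contMDiff_of_tsupport fun x hx => ?_
  have hxU : x ∈ U := hs (tsupport_smul_subset_left χ g hx)
  exact (hχ.contDiffAt.smul (hg.contDiffAt (hU.mem_nhds hxU))).contMDiffAt

omit [NormedSpace ℝ E] in
lemma hasCompactSupport_cutoff_smul {χ : E → ℝ} (hc : HasCompactSupport χ) (g : E → F) :
    HasCompactSupport fun x => χ x • g x := hc.smul_right

lemma isTame_cutoff_smul {χ : E → ℝ} {U : Set E} {g : E → E} (hχ : ContDiff ℝ ∞ χ)
    (hc : HasCompactSupport χ) (hU : IsOpen U) (hs : tsupport χ ⊆ U) (hg : ContDiffOn ℝ ∞ g U) :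
    IsTame fun x => χ x • g x :=
  .of_hasCompactSupport (contDiff_cutoff_smul hχ hU hs hg) (hasCompactSupport_cutoff_smul hc g)

lemma _root_.IsCompact.exists_open_nhds_of_eventually {X Z : Type} [TopologicalSpace X]
    [TopologicalSpace Z] {K : Set X} (hK : IsCompact K) {z₀ : Z} {P : X × Z → Prop}
    (h : ∀ p ∈ K, ∀ᶠ q in 𝓝 (p, z₀), P q) :
    ∃ O : Set X, IsOpen O ∧ K ⊆ O ∧ ∃ V ∈ 𝓝 z₀, ∀ p ∈ O, ∀ z ∈ V, P (p, z) := by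
  have h1 : ∀ᶠ q in 𝓝ˢ (K ×ˢ {z₀}), P q := by
    rw [eventually_nhdsSet_iff_forall]
    rintro ⟨p, z⟩ ⟨hp, hz⟩
    obtain rfl : z = z₀ := hz
    exact h p hp
  rw [hK.nhdsSet_prod_eq isCompact_singleton, nhdsSet_singleton] at h1
  obtain ⟨A, hA, V, hV, hAV⟩ := mem_prod_iff.1 h1
  obtain ⟨O, hO, hKO, hOA⟩ := mem_nhdsSet_iff_exists.1 hA
  exact ⟨O, hO, hKO, V, hV, fun p hp z hz => hAV ⟨hOA hp, hz⟩⟩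

lemma contDiffAt_of_implicit [CompleteSpace E] [CompleteSpace F]
    {Y : Type} [NormedAddCommGroup Y] [NormedSpace ℝ Y] [CompleteSpace Y]
    {G : E × Y → F} (hG : ContDiff ℝ ∞ G) {ψ : E → Y} {x : E}
    (hinv : (fderiv ℝ G (x, ψ x) ∘L .inr ℝ E Y).IsInvertible) (hψ : ContinuousAt ψ x)
    (h0 : ∀ᶠ x' in 𝓝 x, G (x', ψ x') = 0) : ContDiffAt ℝ ∞ ψ x := by
  have hGp : ContDiffAt ℝ ∞ G (x, ψ x) := hG.contDiffAt
  refine (hGp.contDiffAt_implicitFunction (by simp) hinv).congr_of_eventuallyEq ?_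
  have ht : Tendsto (fun x' => (x', ψ x')) (𝓝 x) (𝓝 (x, ψ x)) :=
    (continuousAt_id.prodMk hψ).tendsto
  filter_upwards [ht.eventually (hGp.eventually_apply_eq_iff_implicitFunction (by simp) hinv), h0]
    with x' hx' hx0
  exact (hx'.1 (by rw [hx0, h0.self_of_nhds])).symm

/-- The implicit function theorem along a compact set of parameters at which the solution has a
common value `y₀`: there are one smooth solution near the compact set and one radius of
uniqueness. -/
theorem exists_implicit_of_isCompact [CompleteSpace E] [CompleteSpace F]
    {Y : Type} [NormedAddCommGroup Y] [NormedSpace ℝ Y] [CompleteSpace Y]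
    {G : E × Y → F} (hG : ContDiff ℝ ∞ G) {K : Set E} (hK : IsCompact K) (y₀ : Y)
    (h0 : ∀ p ∈ K, G (p, y₀) = 0)
    (hinv : ∀ p ∈ K, (fderiv ℝ G (p, y₀) ∘L .inr ℝ E Y).IsInvertible) :
    ∃ r > 0, ∃ O : Set E, IsOpen O ∧ K ⊆ O ∧ ∃ u : E → Y, ContDiffOn ℝ ∞ u O ∧
      ∀ p ∈ O, dist (u p) y₀ < r ∧ G (p, u p) = 0 ∧
        ∀ y, dist y y₀ < r → G (p, y) = 0 → y = u p := by
  -- pointwise implicit functions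
  have hloc : ∀ p ∈ K, ∃ ψ : E → Y, ContDiffAt ℝ ∞ ψ p ∧ ψ p = y₀ ∧
      (∀ᶠ x in 𝓝 p, G (x, ψ x) = 0) ∧ ∀ᶠ v : E × Y in 𝓝 (p, y₀), G v = 0 → v.2 = ψ v.1 := by
    intro p hp
    have hGp : ContDiffAt ℝ ∞ G (p, y₀) := hG.contDiffAt
    refine ⟨hGp.implicitFunction (by simp) (hinv p hp),
      hGp.contDiffAt_implicitFunction (by simp) (hinv p hp),
      hGp.implicitFunction_apply_self (by simp) (hinv p hp), ?_, ?_⟩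
    · filter_upwards [hGp.eventually_apply_implicitFunction (by simp) (hinv p hp)] with x hx
      rw [hx, h0 p hp]
    · filter_upwards [hGp.eventually_apply_eq_iff_implicitFunction (by simp) (hinv p hp)]
        with v hv hv0
      exact (hv.1 (by rw [hv0, h0 p hp])).symm
  choose! ψ hψs hψ0 hψG hψu using hloc
  -- a common radius of uniqueness
  obtain ⟨O₁, hO₁, hKO₁, V, hV, hOV⟩ := hK.exists_open_nhds_of_eventually (z₀ := (y₀, y₀))
    (P := fun q : E × (Y × Y) => G (q.1, q.2.1) = 0 → G (q.1, q.2.2) = 0 → q.2.1 = q.2.2) (by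
      intro p hp
      have h1 : Tendsto (fun q : E × (Y × Y) => (q.1, q.2.1)) (𝓝 (p, (y₀, y₀))) (𝓝 (p, y₀)) :=
        Continuous.tendsto (by fun_prop) (p, (y₀, y₀))
      have h2 : Tendsto (fun q : E × (Y × Y) => (q.1, q.2.2)) (𝓝 (p, (y₀, y₀))) (𝓝 (p, y₀)) :=
        Continuous.tendsto (by fun_prop) (p, (y₀, y₀))
      filter_upwards [h1.eventually (hψu p hp), h2.eventually (hψu p hp)] with q hq hq' hG hG'
      exact (hq hG).trans (hq' hG').symm)
  obtain ⟨r, hr, hrV⟩ := Metric.mem_nhds_iff.1 hV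
  have huniq : ∀ p ∈ O₁, ∀ y y', dist y y₀ < r → dist y' y₀ < r →
      G (p, y) = 0 → G (p, y') = 0 → y = y' := fun p hp y y' hy hy' =>
    hOV p hp (y, y') (hrV (by rw [Metric.mem_ball, Prod.dist_eq]; exact max_lt hy hy'))
  -- near every point of `K` the pointwise implicit function is a solution
  have hsol : ∀ p ∈ K, ∀ᶠ x in 𝓝 p, x ∈ O₁ ∧ dist (ψ p x) y₀ < r ∧ G (x, ψ p x) = 0 ∧
      ContDiffAt ℝ ∞ (ψ p) x := by
    intro p hp
    have h1 : ∀ᶠ x in 𝓝 p, dist (ψ p x) y₀ < r := by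
      have := (hψs p hp).continuousAt.tendsto
      rw [hψ0 p hp] at this
      exact this.eventually (Metric.ball_mem_nhds y₀ hr)
    have h2 : ∀ᶠ x in 𝓝 p, ContinuousAt (ψ p) x := by
      have h3 := (hψs p hp).of_le (m := 1) (by exact_mod_cast le_top)
      exact (h3.eventually (by simp)).mono fun x hx => hx.continuousAt
    have h3 : ∀ᶠ x in 𝓝 p, (fderiv ℝ G (x, ψ p x) ∘L .inr ℝ E Y).IsInvertible := by
      obtain ⟨e, he⟩ := hinv p hp
      have hc : ContinuousAt (fun x => fderiv ℝ G (x, ψ p x) ∘L .inr ℝ E Y) p := by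
        have hc1 : ContinuousAt (fun x => fderiv ℝ G (x, ψ p x)) p :=
          ContinuousAt.comp (g := fderiv ℝ G) (hG.continuous_fderiv (by simp)).continuousAt
            (continuousAt_id.prodMk (hψs p hp).continuousAt)
        exact hc1.clm_comp continuousAt_const
      have hc2 : Tendsto (fun x => fderiv ℝ G (x, ψ p x) ∘L .inr ℝ E Y) (𝓝 p)
          (𝓝 (e : Y →L[ℝ] F)) := by
        have := hc.tendsto
        rwa [hψ0 p hp, ← he] at this
      filter_upwards [hc2.eventually (ContinuousLinearEquiv.nhds e)] with x hx
      obtain ⟨e', he'⟩ := hx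
      exact ⟨e', he'⟩
    filter_upwards [hO₁.mem_nhds (hKO₁ hp), h1, hψG p hp, h2, h3,
      (hψG p hp).eventually_nhds] with x hx hx1 hx2 hx3 hx4 hx5
    exact ⟨hx, hx1, hx2, contDiffAt_of_implicit hG hx4 hx3 hx5⟩
  classical
  let u : E → Y := fun x => if h : ∃ y, dist y y₀ < r ∧ G (x, y) = 0 then h.choose else y₀
  have hu : ∀ x ∈ O₁, ∀ y, dist y y₀ < r → G (x, y) = 0 → u x = y := by
    intro x hx y hy hy0
    have h : ∃ y, dist y y₀ < r ∧ G (x, y) = 0 := ⟨y, hy, hy0⟩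
    simp only [u, dif_pos h]
    exact huniq x hx _ _ h.choose_spec.1 hy h.choose_spec.2 hy0
  have hU : ∀ p ∈ K, ∃ U : Set E, IsOpen U ∧ p ∈ U ∧ ∀ x ∈ U, x ∈ O₁ ∧ dist (ψ p x) y₀ < r ∧
      G (x, ψ p x) = 0 ∧ ContDiffAt ℝ ∞ (ψ p) x := fun p hp => by
    obtain ⟨U, hU, hUo, hpU⟩ := eventually_nhds_iff.1 (hsol p hp)
    exact ⟨U, hUo, hpU, hU⟩
  choose! U hUo hpU hUs using hU
  refine ⟨r, hr, ⋃ p ∈ K, U p, isOpen_biUnion hUo, fun p hp => mem_biUnion hp (hpU p hp), u, ?_, ?_⟩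
  · intro x hx
    obtain ⟨p, hp, hxp⟩ := mem_iUnion₂.1 hx
    refine ((hUs p hp x hxp).2.2.2.congr_of_eventuallyEq ?_).contDiffWithinAt
    filter_upwards [(hUo p hp).mem_nhds hxp] with x' hx'
    obtain ⟨h1, h2, h3, -⟩ := hUs p hp x' hx'
    exact hu x' h1 _ h2 h3
  · intro x hx
    obtain ⟨p, hp, hxp⟩ := mem_iUnion₂.1 hx
    obtain ⟨h1, h2, h3, -⟩ := hUs p hp x hxp
    rw [hu x h1 _ h2 h3]
    exact ⟨h2, h3, fun y hy hy0 => huniq x h1 _ _ hy h2 hy0 h3⟩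

/-- A family of maps which are immersive at the points of a compact set is uniformly injective near
them. -/
theorem exists_uniform_injOn [FiniteDimensional ℝ E] {G : E × E → E} {K : Set E} (hK : IsCompact K)
    (hG : ∀ z ∈ K, ContDiffAt ℝ ∞ G (z, z))
    (hinj : ∀ z ∈ K, ∀ ξ, fderiv ℝ G (z, z) (0, ξ) = 0 → ξ = 0) :
    ∃ r > 0, ∀ z ∈ K, ∀ w w', dist w z < r → dist w' z < r → G (z, w) = G (z, w') → w = w' := by
  have hloc : ∀ z ∈ K, ∀ᶠ q : E × (E × E) in 𝓝 (z, (z, z)), G (q.1, q.2.1) = G (q.1, q.2.2) →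
      q.2.1 = q.2.2 := by
    intro z hz
    let T : E × E →L[ℝ] E × E := (ContinuousLinearMap.fst ℝ E E).prod (fderiv ℝ G (z, z))
    have hT : Function.Injective (T : E × E →ₗ[ℝ] E × E) := by
      rw [← LinearMap.ker_eq_bot, LinearMap.ker_eq_bot']
      rintro ⟨a, b⟩ hab
      have ha : a = 0 := congrArg Prod.fst hab
      subst ha
      rw [hinj z hz b (congrArg Prod.snd hab)]
      rfl
    let e := (LinearEquiv.ofInjectiveEndo (T : E × E →ₗ[ℝ] E × E) hT).toContinuousLinearEquiv
    have hs : HasStrictFDerivAt (fun p : E × E => (p.1, G p)) (e : E × E →L[ℝ] E × E) (z, z) := by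
      have h1 := hasStrictFDerivAt_fst (𝕜 := ℝ) (E := E) (F := E) (p := (z, z))
      have h2 := (hG z hz).hasStrictFDerivAt (by simp)
      have h3 := h1.prodMk h2
      convert! h3 using 1
    have hnh := (hs.toOpenPartialHomeomorph _).open_source.mem_nhds
      hs.mem_toOpenPartialHomeomorph_source
    have hio := (hs.toOpenPartialHomeomorph _).injOn
    have h1 : Tendsto (fun q : E × (E × E) => (q.1, q.2.1)) (𝓝 (z, (z, z))) (𝓝 (z, z)) :=
      Continuous.tendsto (by fun_prop) (z, (z, z))
    have h2 : Tendsto (fun q : E × (E × E) => (q.1, q.2.2)) (𝓝 (z, (z, z))) (𝓝 (z, z)) :=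
      Continuous.tendsto (by fun_prop) (z, (z, z))
    filter_upwards [h1.eventually hnh, h2.eventually hnh] with q hq hq' heq
    have := hio hq hq' (by
      rw [hs.toOpenPartialHomeomorph_coe]
      exact Prod.ext rfl heq)
    exact congrArg Prod.snd this
  let Δ : Set (E × (E × E)) := (fun z => (z, (z, z))) '' K
  have hΔ : IsCompact Δ := hK.image (by fun_prop)
  have hev : {q : E × (E × E) | G (q.1, q.2.1) = G (q.1, q.2.2) → q.2.1 = q.2.2} ∈ 𝓝ˢ Δ := by
    rw [← eventually_mem_set, eventually_nhdsSet_iff_forall]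
    rintro _ ⟨z, hz, rfl⟩
    exact hloc z hz
  obtain ⟨U, hU, hΔU, hUs⟩ := mem_nhdsSet_iff_exists.1 hev
  obtain ⟨r, hr, hrU⟩ := hΔ.exists_thickening_subset_open hU hΔU
  refine ⟨r, hr, fun z hz w w' hw hw' heq => ?_⟩
  have hmem : (z, (w, w')) ∈ Metric.thickening r Δ := by
    rw [Metric.mem_thickening_iff]
    refine ⟨(z, (z, z)), mem_image_of_mem _ hz, ?_⟩
    rw [Prod.dist_eq, Prod.dist_eq]
    simp [hw, hw']
  exact hUs (hrU hmem) heq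

end Cutoff

/-! ### One-forms along parametrised surfaces -/

section Forms

variable {E : Type} [NormedAddCommGroup E] [NormedSpace ℝ E]

/-- The exterior derivative of a one-form on a vector space. -/
def extD (α : E → E →L[ℝ] ℝ) (z ξ η : E) : ℝ := fderiv ℝ α z ξ η - fderiv ℝ α z η ξ

lemma extD_swap (α : E → E →L[ℝ] ℝ) (z ξ η : E) : extD α z ξ η = - extD α z η ξ := by
  simp [extD]

lemma extD_add_right (α : E → E →L[ℝ] ℝ) (z ξ η η' : E) :
    extD α z ξ (η + η') = extD α z ξ η + extD α z ξ η' := by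
  simp only [extD, map_add, add_apply]; ring

lemma extD_smul_right (α : E → E →L[ℝ] ℝ) (z ξ η : E) (c : ℝ) :
    extD α z ξ (c • η) = c * extD α z ξ η := by
  simp only [extD, map_smul, smul_apply, smul_eq_mul]; ring

lemma extD_smul_left (α : E → E →L[ℝ] ℝ) (z ξ η : E) (c : ℝ) :
    extD α z (c • ξ) η = c * extD α z ξ η := by
  simp only [extD, map_smul, smul_apply, smul_eq_mul]; ring

/-- `∂_s (α(∂_r Ψ)) - ∂_r (α(∂_s Ψ)) = dα(∂_s Ψ, ∂_r Ψ)`. -/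
lemma exists_hasDerivAt_form {α : E → E →L[ℝ] ℝ} {Ψ : ℝ × ℝ → E} {s r : ℝ}
    (hΨ : ContDiffAt ℝ 2 Ψ (s, r)) (hα : DifferentiableAt ℝ α (Ψ (s, r))) :
    ∃ a b : ℝ, HasDerivAt (fun s' => α (Ψ (s', r)) (fderiv ℝ Ψ (s', r) (0, 1))) a s ∧
      HasDerivAt (fun r' => α (Ψ (s, r')) (fderiv ℝ Ψ (s, r') (1, 0))) b r ∧
      a - b = extD α (Ψ (s, r)) (fderiv ℝ Ψ (s, r) (1, 0)) (fderiv ℝ Ψ (s, r) (0, 1)) := by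
  have h1 : HasFDerivAt Ψ (fderiv ℝ Ψ (s, r)) (s, r) :=
    (hΨ.differentiableAt (by norm_num)).hasFDerivAt
  have h2 : HasFDerivAt (fderiv ℝ Ψ) (fderiv ℝ (fderiv ℝ Ψ) (s, r)) (s, r) :=
    ((hΨ.fderiv_right (m := 1) (by norm_num)).differentiableAt (by norm_num)).hasFDerivAt
  have h3 := hα.hasFDerivAt.comp (s, r) h1
  have hsym : IsSymmSndFDerivAt ℝ Ψ (s, r) := hΨ.isSymmSndFDerivAt (by simp)
  have key : ∀ v : ℝ × ℝ, HasFDerivAt (fun p => α (Ψ p) (fderiv ℝ Ψ p v))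
      ((α (Ψ (s, r))).comp ((fderiv ℝ (fderiv ℝ Ψ) (s, r)).flip v)
        + ((fderiv ℝ α (Ψ (s, r))).comp (fderiv ℝ Ψ (s, r))).flip (fderiv ℝ Ψ (s, r) v)) (s, r) := by
    intro v
    have h4 : HasFDerivAt (fun p => fderiv ℝ Ψ p v)
        ((fderiv ℝ (fderiv ℝ Ψ) (s, r)).flip v) (s, r) := by
      convert! h2.clm_apply (hasFDerivAt_const v (s, r)) using 1
      ext <;> simp
    exact h3.clm_apply h4
  have hs : HasDerivAt (fun s' : ℝ => (s', r)) ((1 : ℝ), (0 : ℝ)) s :=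
    (hasDerivAt_id s).prodMk (hasDerivAt_const s r)
  have hr : HasDerivAt (fun r' : ℝ => (s, r')) ((0 : ℝ), (1 : ℝ)) r :=
    (hasDerivAt_const r s).prodMk (hasDerivAt_id r)
  refine ⟨_, _, HasFDerivAt.comp_hasDerivAt (l := fun p => α (Ψ p) (fderiv ℝ Ψ p (0, 1))) s (key (0, 1)) hs,
    HasFDerivAt.comp_hasDerivAt (l := fun p => α (Ψ p) (fderiv ℝ Ψ p (1, 0))) r (key (1, 0)) hr, ?_⟩
  simp only [add_apply, ContinuousLinearMap.comp_apply,
    ContinuousLinearMap.flip_apply, extD]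
  rw [hsym (1, 0) (0, 1)]
  ring

lemma fderiv_apply_one_zero {Ψ : ℝ × ℝ → E} {s r : ℝ} (hΨ : DifferentiableAt ℝ Ψ (s, r)) :
    HasDerivAt (fun s' => Ψ (s', r)) (fderiv ℝ Ψ (s, r) (1, 0)) s :=
  hΨ.hasFDerivAt.comp_hasDerivAt s ((hasDerivAt_id s).prodMk (hasDerivAt_const s r))

lemma fderiv_apply_zero_one {Ψ : ℝ × ℝ → E} {s r : ℝ} (hΨ : DifferentiableAt ℝ Ψ (s, r)) :
    HasDerivAt (fun r' => Ψ (s, r')) (fderiv ℝ Ψ (s, r) (0, 1)) r :=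
  hΨ.hasFDerivAt.comp_hasDerivAt r ((hasDerivAt_const r s).prodMk (hasDerivAt_id r))

end Forms

/-! ### Circle bundles with a contact form and a magnetic field -/

/-- The features of the unit tangent bundle of an oriented Riemannian surface, with its magnetic
fields, on which the dynamics depends. The bundle is a compact subset `N` of a vector space. The
data are: a frame `X, H, V` of `N` (the geodesic field, its rotation, and the vertical field); the
forms `L` (the Liouville form) and `B` (its rotation); the form `L₀ = τ - π^*β` and the
functions `bX = β(v)`, `bH = β(jv)`; the density `f`; and the fibre rotation `rot`.

Vector fields, forms and functions are extended smoothly to the ambient space in an arbitrary way.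
The identity `dL₀ = - f L ∧ B` is only required over the open set `U`, so that a local primitive `β`
can be used. -/
structure ContactData (E : Type) [NormedAddCommGroup E] [NormedSpace ℝ E] where
  N : Set E
  X : E → E
  H : E → E
  V : E → E
  L : E → E →L[ℝ] ℝ
  B : E → E →L[ℝ] ℝ
  L₀ : E → E →L[ℝ] ℝ
  f : E → ℝ
  bX : E → ℝ
  bH : E → ℝ
  U : Set E
  rot : ℝ → E → E
  isCompact : IsCompact N
  smooth_X : ContDiff ℝ ∞ X
  smooth_H : ContDiff ℝ ∞ H
  smooth_V : ContDiff ℝ ∞ V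
  smooth_L : ContDiff ℝ ∞ L
  smooth_B : ContDiff ℝ ∞ B
  smooth_L₀ : ContDiff ℝ ∞ L₀
  smooth_f : ContDiff ℝ ∞ f
  smooth_bX : ContDiff ℝ ∞ bX
  smooth_bH : ContDiff ℝ ∞ bH
  f_pos : ∀ z ∈ N, 0 < f z
  L_X : ∀ z ∈ N, L z (X z) = 1
  L_H : ∀ z ∈ N, L z (H z) = 0
  L_V : ∀ z ∈ N, L z (V z) = 0
  B_X : ∀ z ∈ N, B z (X z) = 0
  B_H : ∀ z ∈ N, B z (H z) = 1
  B_V : ∀ z ∈ N, B z (V z) = 0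
  L₀_X : ∀ z ∈ N, L₀ z (X z) = - bX z
  L₀_H : ∀ z ∈ N, L₀ z (H z) = - bH z
  L₀_V : ∀ z ∈ N, L₀ z (V z) = 1
  tangent : ∀ (c : ℝ → E) (t : ℝ) (ξ : E), (∀ᶠ s in 𝓝 t, c s ∈ N) → HasDerivAt c ξ t →
    ξ = L (c t) ξ • X (c t) + B (c t) ξ • H (c t)
      + (L₀ (c t) ξ + bX (c t) * L (c t) ξ + bH (c t) * B (c t) ξ) • V (c t)
  invariant : ∀ (c : ℝ → E) (α β γ : ℝ → ℝ),
    (∀ t, HasDerivAt c (α t • X (c t) + β t • H (c t) + γ t • V (c t)) t) → c 0 ∈ N → ∀ t, c t ∈ N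
  isOpen_U : IsOpen U
  extD_L : ∀ z ∈ N, ∀ a b c a' b' c' : ℝ,
    extD L z (a • X z + b • H z + c • V z) (a' • X z + b' • H z + c' • V z) = c * b' - c' * b
  extD_L₀ : ∀ z ∈ N, z ∈ U → ∀ a b c a' b' c' : ℝ,
    extD L₀ z (a • X z + b • H z + c • V z) (a' • X z + b' • H z + c' • V z)
      = - f z * (a * b' - a' * b)
  rot_zero : ∀ z, rot 0 z = z
  rot_mem : ∀ z ∈ N, ∀ θ, rot θ z ∈ N
  hasDerivAt_rot : ∀ z ∈ N, ∀ θ, HasDerivAt (fun θ => rot θ z) (V (rot θ z)) θ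
  rot_two_pi : ∀ z ∈ N, rot (2 * Real.pi) z = z
  rot_ne : ∀ z ∈ N, ∀ θ ∈ Ioo 0 (2 * Real.pi), rot θ z ≠ z
  f_rot : ∀ z ∈ N, ∀ θ, f (rot θ z) = f z
  rot_mem_U : ∀ z ∈ N, z ∈ U → ∀ θ, rot θ z ∈ U
  injective : ∃ r > 0, ∀ z ∈ N, ∀ w ∈ N, ∀ w' ∈ N, dist w z < r → dist w' z < r →
    L z (w - w') = 0 → B z (w - w') = 0 → L₀ z (w - w') = 0 → w = w'

/-! ### The flows of the magnetic, Reeb and Gray vector fields -/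

namespace ContactData

variable {E : Type} [NormedAddCommGroup E] [NormedSpace ℝ E] [FiniteDimensional ℝ E]
  [CompleteSpace E] (D : ContactData E)

omit [FiniteDimensional ℝ E] [CompleteSpace E] in
lemma smooth_frame : ContDiff ℝ ∞ D.X ∧ ContDiff ℝ ∞ D.H ∧ ContDiff ℝ ∞ D.V ∧ ContDiff ℝ ∞ D.f ∧
    ContDiff ℝ ∞ D.bX ∧ ContDiff ℝ ∞ D.bH :=
  ⟨D.smooth_X, D.smooth_H, D.smooth_V, D.smooth_f, D.smooth_bX, D.smooth_bH⟩

/-- The value `λ_m(mX + fV) = f - m β(v) + m²` at `z`, as a function of `(m, z)`. Where it is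
positive, `λ_m` is a contact form and `mX + fV` is a positive multiple of its Reeb field. -/
def dens (p : ℝ × E) : ℝ := D.f p.2 - p.1 * D.bX p.2 + p.1 ^ 2

omit [FiniteDimensional ℝ E] [CompleteSpace E] in
lemma smooth_dens : ContDiff ℝ ∞ D.dens := by
  obtain ⟨-, -, -, hf, hb, -⟩ := D.smooth_frame
  unfold dens
  fun_prop

omit [CompleteSpace E] in
lemma exists_chi : ∃ χ : ℝ × E → ℝ, (ContDiff ℝ ∞ χ ∧ HasCompactSupport χ ∧
    tsupport χ ⊆ {p | 0 < D.dens p}) ∧ ∃ m₀ > 0, ∀ m, |m| < m₀ → ∀ z ∈ D.N,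
      χ (m, z) = 1 ∧ 0 < D.dens (m, z) := by
  have hU : IsOpen {p | 0 < D.dens p} := isOpen_lt continuous_const D.smooth_dens.continuous
  have hK : IsCompact (({0} : Set ℝ) ×ˢ D.N) := isCompact_singleton.prod D.isCompact
  obtain ⟨χ, h1, h2, h3, h4⟩ := exists_cutoff hK hU (by
    rintro ⟨m, z⟩ ⟨hm, hz⟩
    obtain rfl : m = 0 := hm
    simpa [dens] using D.f_pos z hz)
  refine ⟨χ, ⟨h1, h2, h3⟩, ?_⟩
  rw [eventually_nhdsSet_iff_forall] at h4
  have h5 := D.isCompact.eventually_forall_of_forall_eventually (x₀ := (0 : ℝ))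
    (P := fun m z => χ (m, z) = 1) fun z hz => h4 (0, z) ⟨rfl, hz⟩
  obtain ⟨m₀, hm₀, h6⟩ := Metric.eventually_nhds_iff.1 h5
  refine ⟨m₀, hm₀, fun m hm z hz => ?_⟩
  have h7 := h6 (y := m) (by simpa using hm) z hz
  exact ⟨h7, h3 (subset_tsupport _ (by simp [h7]))⟩

/-- A cut-off function of `(m, z)`, equal to `1` near `{0} × N`. -/
def chi : ℝ × E → ℝ := D.exists_chi.choose

/-- A bound on the parameters `m` at which the cut-off plays no role on `N`. -/
def mb : ℝ := D.exists_chi.choose_spec.2.choose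

omit [CompleteSpace E] in
lemma mb_pos : 0 < D.mb := D.exists_chi.choose_spec.2.choose_spec.1

variable {D} in
omit [CompleteSpace E] in
lemma chi_eq {m : ℝ} (hm : |m| < D.mb) {z : E} (hz : z ∈ D.N) : D.chi (m, z) = 1 :=
  (D.exists_chi.choose_spec.2.choose_spec.2 m hm z hz).1

variable {D} in
omit [CompleteSpace E] in
lemma dens_pos {m : ℝ} (hm : |m| < D.mb) {z : E} (hz : z ∈ D.N) : 0 < D.dens (m, z) :=
  (D.exists_chi.choose_spec.2.choose_spec.2 m hm z hz).2

omit [CompleteSpace E] in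
lemma isTame_chi_smul {g : ℝ × E → ℝ × E} (hg : ContDiffOn ℝ ∞ g {p | 0 < D.dens p}) :
    IsTame fun p => D.chi p • g p :=
  isTame_cutoff_smul D.exists_chi.choose_spec.1.1 D.exists_chi.choose_spec.1.2.1
    (isOpen_lt continuous_const D.smooth_dens.continuous) D.exists_chi.choose_spec.1.2.2 hg

omit [CompleteSpace E] in
lemma contDiff_chi_smul {F : Type} [NormedAddCommGroup F] [NormedSpace ℝ F] {g : ℝ × E → F}
    (hg : ContDiffOn ℝ ∞ g {p | 0 < D.dens p}) : ContDiff ℝ ∞ fun p => D.chi p • g p :=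
  contDiff_cutoff_smul D.exists_chi.choose_spec.1.1
    (isOpen_lt continuous_const D.smooth_dens.continuous) D.exists_chi.choose_spec.1.2.2 hg

omit [FiniteDimensional ℝ E] [CompleteSpace E] in
lemma contDiffOn_inv_dens : ContDiffOn ℝ ∞ (fun p => (D.dens p)⁻¹) {p | 0 < D.dens p} :=
  D.smooth_dens.contDiffOn.inv fun _ hp => ne_of_gt hp

/-- The Gray vector field `∂_m + Z`, generating the contact isotopy, as a field of `(m, z)`. The
component `Z` is a multiple of the lift of `jv` to `ker L₀`; it is determined by `λ_m(Z) = 0` and by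
`∂_m λ_m + ι_Z dλ_m` being a multiple of `λ_m`. -/
def grayField (p : ℝ × E) : ℝ × E :=
  (1, 0) + D.chi p • (0, -((D.dens p)⁻¹ • (D.H p.2 + D.bH p.2 • D.V p.2)))

/-- The Reeb vector field of `λ_m`, as a field of `(m, z)`. -/
def reebField (p : ℝ × E) : ℝ × E :=
  D.chi p • (0, (D.dens p)⁻¹ • (p.1 • D.X p.2 + D.f p.2 • D.V p.2))

/-- The field `mX + fV`, as a field of `(m, z)`. -/
def magField (p : ℝ × E) : ℝ × E :=
  D.chi p • (0, p.1 • D.X p.2 + D.f p.2 • D.V p.2)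

omit [CompleteSpace E] in
lemma isTame_grayField : IsTame D.grayField := by
  obtain ⟨hX, hH, hV, hf, hbX, hbH⟩ := D.smooth_frame
  refine (D.isTame_chi_smul (contDiffOn_const.prodMk (D.contDiffOn_inv_dens.smul
    (ContDiff.contDiffOn ?_)).neg)).const_add (1, 0)
  fun_prop

omit [CompleteSpace E] in
lemma isTame_reebField : IsTame D.reebField := by
  obtain ⟨hX, hH, hV, hf, hbX, hbH⟩ := D.smooth_frame
  refine D.isTame_chi_smul (contDiffOn_const.prodMk (D.contDiffOn_inv_dens.smul
    (ContDiff.contDiffOn ?_)))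
  fun_prop

omit [CompleteSpace E] in
lemma isTame_magField : IsTame D.magField := by
  obtain ⟨hX, hH, hV, hf, hbX, hbH⟩ := D.smooth_frame
  refine D.isTame_chi_smul (contDiffOn_const.prodMk (ContDiff.contDiffOn ?_))
  fun_prop

lemma flow_fst_of_const {W : ℝ × E → ℝ × E} (hW : IsTame W) {a : ℝ} (ha : ∀ p, (W p).1 = a)
    (s : ℝ) (p : ℝ × E) : (flow W s p).1 = p.1 + a * s := by
  have h : ∀ t, HasDerivAt (fun t => (flow W t p).1 - a * t) 0 t := fun t => by
    have h1 : HasDerivAt (fun t => (flow W t p).1) (W (flow W t p)).1 t :=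
      (ContinuousLinearMap.fst ℝ ℝ E).hasFDerivAt.comp_hasDerivAt t (hW.hasDerivAt_flow t p)
    rw [ha] at h1
    refine (h1.sub ((hasDerivAt_id t).const_mul a)).congr_deriv ?_
    simp
  have h2 := is_const_of_deriv_eq_zero (fun t => (h t).differentiableAt) (fun t => (h t).deriv) s 0
  simp only [hW.flow_zero, mul_zero, sub_zero] at h2
  linarith

lemma hasDerivAt_flow_snd {W : ℝ × E → ℝ × E} (hW : IsTame W) (t : ℝ) (p : ℝ × E) :
    HasDerivAt (fun t => (flow W t p).2) (W (flow W t p)).2 t :=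
  (ContinuousLinearMap.snd ℝ ℝ E).hasFDerivAt.comp_hasDerivAt t (hW.hasDerivAt_flow t p)

/-- The contact isotopy. -/
def F (m : ℝ) (z : E) : E := (flow D.grayField m (0, z)).2

/-- The inverse of the contact isotopy. -/
def Finv (m : ℝ) (w : E) : E := (flow D.grayField (-m) (m, w)).2

/-- The Reeb flow of `λ_m`. -/
def psi (m s : ℝ) (z : E) : E := (flow D.reebField s (m, z)).2

/-- The flow of `mX + fV`. -/
def mag (m u : ℝ) (z : E) : E := (flow D.magField u (m, z)).2

omit [CompleteSpace E] in
lemma grayField_fst (p : ℝ × E) : (D.grayField p).1 = 1 := by simp [grayField]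

omit [CompleteSpace E] in
lemma grayField_snd (p : ℝ × E) : (D.grayField p).2
    = -(D.chi p * (D.dens p)⁻¹) • (D.H p.2 + D.bH p.2 • D.V p.2) := by
  simp [grayField, smul_smul, add_comm, mul_assoc]

omit [CompleteSpace E] in
lemma reebField_fst (p : ℝ × E) : (D.reebField p).1 = 0 := by simp [reebField]

omit [CompleteSpace E] in
lemma magField_fst (p : ℝ × E) : (D.magField p).1 = 0 := by simp [magField]

lemma flow_grayField (m : ℝ) (z : E) : flow D.grayField m (0, z) = (m, D.F m z) :=
  Prod.ext (by simp [flow_fst_of_const D.isTame_grayField D.grayField_fst]) rfl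

lemma flow_grayField_neg (m : ℝ) (w : E) : flow D.grayField (-m) (m, w) = (0, D.Finv m w) :=
  Prod.ext (by simp [flow_fst_of_const D.isTame_grayField D.grayField_fst]) rfl

lemma flow_reebField (m s : ℝ) (z : E) : flow D.reebField s (m, z) = (m, D.psi m s z) :=
  Prod.ext (by simp [flow_fst_of_const D.isTame_reebField D.reebField_fst]) rfl

lemma flow_magField (m s : ℝ) (z : E) : flow D.magField s (m, z) = (m, D.mag m s z) :=
  Prod.ext (by simp [flow_fst_of_const D.isTame_magField D.magField_fst]) rfl

lemma smooth_F : ContDiff ℝ ∞ fun p : ℝ × E => D.F p.1 p.2 :=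
  contDiff_snd.comp (D.isTame_grayField.contDiff_flow.comp
    (contDiff_fst.prodMk (contDiff_const.prodMk contDiff_snd)))

lemma smooth_Finv : ContDiff ℝ ∞ fun p : ℝ × E => D.Finv p.1 p.2 :=
  contDiff_snd.comp (D.isTame_grayField.contDiff_flow.comp
    (contDiff_fst.neg.prodMk (contDiff_fst.prodMk contDiff_snd)))

lemma smooth_psi : ContDiff ℝ ∞ fun p : ℝ × ℝ × E => D.psi p.1 p.2.1 p.2.2 :=
  contDiff_snd.comp (D.isTame_reebField.contDiff_flow.comp
    ((contDiff_fst.comp contDiff_snd).prodMk (contDiff_fst.prodMk (contDiff_snd.comp contDiff_snd))))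

lemma smooth_mag : ContDiff ℝ ∞ fun p : ℝ × ℝ × E => D.mag p.1 p.2.1 p.2.2 :=
  contDiff_snd.comp (D.isTame_magField.contDiff_flow.comp
    ((contDiff_fst.comp contDiff_snd).prodMk (contDiff_fst.prodMk (contDiff_snd.comp contDiff_snd))))

@[simp] lemma F_zero (z : E) : D.F 0 z = z := by simp [F, D.isTame_grayField.flow_zero]

@[simp] lemma Finv_zero (z : E) : D.Finv 0 z = z := by simp [Finv, D.isTame_grayField.flow_zero]

@[simp] lemma psi_zero (m : ℝ) (z : E) : D.psi m 0 z = z := by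
  simp [psi, D.isTame_reebField.flow_zero]

@[simp] lemma mag_zero (m : ℝ) (z : E) : D.mag m 0 z = z := by
  simp [mag, D.isTame_magField.flow_zero]

lemma Finv_F (m : ℝ) (z : E) : D.Finv m (D.F m z) = z := by
  rw [Finv, ← flow_grayField, ← D.isTame_grayField.flow_add]
  simp [D.isTame_grayField.flow_zero]

lemma F_Finv (m : ℝ) (z : E) : D.F m (D.Finv m z) = z := by
  rw [F, ← flow_grayField_neg, ← D.isTame_grayField.flow_add]
  simp [D.isTame_grayField.flow_zero]

lemma psi_add (m s t : ℝ) (z : E) : D.psi m (s + t) z = D.psi m s (D.psi m t z) := by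
  rw [psi, psi, ← flow_reebField, ← D.isTame_reebField.flow_add]

lemma mag_add (m s t : ℝ) (z : E) : D.mag m (s + t) z = D.mag m s (D.mag m t z) := by
  rw [mag, mag, ← flow_magField, ← D.isTame_magField.flow_add]

lemma hasDerivAt_F (m : ℝ) (z : E) :
    HasDerivAt (fun m => D.F m z) (D.grayField (m, D.F m z)).2 m := by
  have := hasDerivAt_flow_snd D.isTame_grayField m (0, z)
  rwa [flow_grayField] at this

lemma hasDerivAt_psi' (m s : ℝ) (z : E) :
    HasDerivAt (fun s => D.psi m s z) (D.reebField (m, D.psi m s z)).2 s := by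
  have := hasDerivAt_flow_snd D.isTame_reebField s (m, z)
  rwa [flow_reebField] at this

lemma hasDerivAt_mag' (m s : ℝ) (z : E) :
    HasDerivAt (fun s => D.mag m s z) (D.magField (m, D.mag m s z)).2 s := by
  have := hasDerivAt_flow_snd D.isTame_magField s (m, z)
  rwa [flow_magField] at this

variable {D}

lemma psi_mem {z : E} (hz : z ∈ D.N) (m s : ℝ) : D.psi m s z ∈ D.N := by
  refine D.invariant (fun s => D.psi m s z)
    (fun s => D.chi (m, D.psi m s z) * (D.dens (m, D.psi m s z))⁻¹ * m) (fun _ => 0)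
    (fun s => D.chi (m, D.psi m s z) * (D.dens (m, D.psi m s z))⁻¹ * D.f (D.psi m s z))
    (fun t => ?_) (by simpa using hz) s
  refine (D.hasDerivAt_psi' m t z).congr_deriv ?_
  simp [reebField, smul_smul, mul_assoc]

lemma mag_mem {z : E} (hz : z ∈ D.N) (m s : ℝ) : D.mag m s z ∈ D.N := by
  refine D.invariant (fun s => D.mag m s z)
    (fun s => D.chi (m, D.mag m s z) * m) (fun _ => 0)
    (fun s => D.chi (m, D.mag m s z) * D.f (D.mag m s z))
    (fun t => ?_) (by simpa using hz) s
  refine (D.hasDerivAt_mag' m t z).congr_deriv ?_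
  simp [magField, smul_smul]

lemma flow_grayField_mem {p : ℝ × E} (hz : p.2 ∈ D.N) (m : ℝ) : (flow D.grayField m p).2 ∈ D.N := by
  refine D.invariant (fun m => (flow D.grayField m p).2) (fun _ => 0)
    (fun m => -(D.chi (flow D.grayField m p) * (D.dens (flow D.grayField m p))⁻¹))
    (fun m => -(D.chi (flow D.grayField m p) * (D.dens (flow D.grayField m p))⁻¹)
      * D.bH (flow D.grayField m p).2)
    (fun t => ?_) (by simpa [D.isTame_grayField.flow_zero] using hz) m
  refine (hasDerivAt_flow_snd D.isTame_grayField t p).congr_deriv ?_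
  rw [grayField_snd]
  simp [smul_smul]

lemma F_mem {z : E} (hz : z ∈ D.N) (m : ℝ) : D.F m z ∈ D.N := flow_grayField_mem (p := (0, z)) hz m

lemma Finv_mem {z : E} (hz : z ∈ D.N) (m : ℝ) : D.Finv m z ∈ D.N :=
  flow_grayField_mem (p := (m, z)) hz (-m)

omit [CompleteSpace E] in
lemma reebField_snd {m : ℝ} (hm : |m| < D.mb) {z : E} (hz : z ∈ D.N) :
    (D.reebField (m, z)).2 = (D.dens (m, z))⁻¹ • (m • D.X z + D.f z • D.V z) := by
  simp [reebField, chi_eq hm hz]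

lemma hasDerivAt_mag {m : ℝ} (hm : |m| < D.mb) {z : E} (hz : z ∈ D.N) (s : ℝ) :
    HasDerivAt (fun s => D.mag m s z)
      (m • D.X (D.mag m s z) + D.f (D.mag m s z) • D.V (D.mag m s z)) s := by
  refine (D.hasDerivAt_mag' m s z).congr_deriv ?_
  simp [magField, chi_eq hm (mag_mem hz m s)]

omit [FiniteDimensional ℝ E] [CompleteSpace E] in
lemma dens_zero (z : E) : D.dens (0, z) = D.f z := by simp [dens]

lemma psi_zero_left {z : E} (hz : z ∈ D.N) (s : ℝ) : D.psi 0 s z = D.rot s z := by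
  have h := D.isTame_reebField.eq_flow (c := fun s => (0, D.rot s z)) (fun t => by
    have h1 : D.reebField (0, D.rot t z) = (0, D.V (D.rot t z)) := by
      refine Prod.ext (by simp [reebField_fst]) ?_
      rw [reebField_snd (by simpa using D.mb_pos) (D.rot_mem z hz t), dens_zero, zero_smul,
        zero_add, smul_smul, inv_mul_cancel₀ (D.f_pos _ (D.rot_mem z hz t)).ne', one_smul]
    rw [h1]
    exact (hasDerivAt_const t (0 : ℝ)).prodMk (D.hasDerivAt_rot z hz t)) s
  rw [psi]
  simpa [D.rot_zero] using (congrArg Prod.snd h).symm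

lemma mag_zero_left {z : E} (hz : z ∈ D.N) (u : ℝ) : D.mag 0 u z = D.rot (D.f z * u) z := by
  have h := D.isTame_magField.eq_flow (c := fun u => (0, D.rot (D.f z * u) z)) (fun t => by
    have h1 : D.magField (0, D.rot (D.f z * t) z) = (0, D.f z • D.V (D.rot (D.f z * t) z)) := by
      simp [magField, chi_eq (m := 0) (by simpa using D.mb_pos) (D.rot_mem z hz _), D.f_rot z hz]
    rw [h1]
    have h2 := (D.hasDerivAt_rot z hz (D.f z * t)).scomp t ((hasDerivAt_id t).const_mul (D.f z))
    simp only [mul_one] at h2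
    exact (hasDerivAt_const t (0 : ℝ)).prodMk h2) u
  rw [mag]
  simpa [D.rot_zero] using (congrArg Prod.snd h).symm

end ContactData

/-! ### The local section: parallel transport along geodesics -/

namespace ContactData

variable {E : Type} [NormedAddCommGroup E] [NormedSpace ℝ E] [FiniteDimensional ℝ E]
  [CompleteSpace E] (D : ContactData E)

/-- The lift of the direction `v` to `ker L₀`. -/
def hA (z : E) : E := D.X z + D.bX z • D.V z

/-- The lift of the direction `jv` to `ker L₀`. -/
def hB (z : E) : E := D.H z + D.bH z • D.V z

lemma smooth_hA : ContDiff ℝ ∞ D.hA := by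
  obtain ⟨hX, hH, hV, hf, hbX, hbH⟩ := D.smooth_frame
  unfold hA; fun_prop

lemma smooth_hB : ContDiff ℝ ∞ D.hB := by
  obtain ⟨hX, hH, hV, hf, hbX, hbH⟩ := D.smooth_frame
  unfold hB; fun_prop

/-- The first coordinate of the vector `w` in the frame rotated by `(C, S)`; a point is
`(z, (C, S), w)`. -/
def coefA (q : E × (ℝ × ℝ) × (ℝ × ℝ)) : ℝ := q.2.1.1 * q.2.2.1 - q.2.1.2 * q.2.2.2

/-- The second coordinate of `w` in the frame rotated by `(C, S)`. -/
def coefB (q : E × (ℝ × ℝ) × (ℝ × ℝ)) : ℝ := q.2.1.2 * q.2.2.1 + q.2.1.1 * q.2.2.2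

/-- The speed at which the parallel frame rotates with respect to the frame carried by a curve in
`ker L₀`. -/
def spin (q : E × (ℝ × ℝ) × (ℝ × ℝ)) : ℝ := coefA q * D.bX q.1 + coefB q * D.bH q.1

/-- The vector field whose integral curves are the lifts to `ker L₀` of the geodesics, with the
position of the parallel frame relative to the lift. -/
def sectionField (q : E × (ℝ × ℝ) × (ℝ × ℝ)) : E × (ℝ × ℝ) × (ℝ × ℝ) :=
  (coefA q • D.hA q.1 + coefB q • D.hB q.1,
    (D.spin q * q.2.1.2, -(D.spin q * q.2.1.1)), (0, 0))

lemma smooth_coef : ContDiff ℝ ∞ (coefA (E := E)) ∧ ContDiff ℝ ∞ (coefB (E := E)) := by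
  constructor
  · unfold coefA; fun_prop
  · unfold coefB; fun_prop

lemma smooth_sectionField : ContDiff ℝ ∞ D.sectionField := by
  obtain ⟨hX, hH, hV, hf, hbX, hbH⟩ := D.smooth_frame
  have h1 := D.smooth_hA
  have h2 := D.smooth_hB
  obtain ⟨h3, h4⟩ := smooth_coef (E := E)
  have h5 : ContDiff ℝ ∞ D.spin := by unfold spin; fun_prop
  unfold sectionField; fun_prop

lemma exists_sectionCutoff : ∃ χ : E × (ℝ × ℝ) × (ℝ × ℝ) → ℝ, ContDiff ℝ ∞ χ ∧
    HasCompactSupport χ ∧ ∀ z ∈ D.N, ∀ e w : ℝ × ℝ, ‖e‖ ≤ 1 → ‖w‖ ≤ 1 → χ (z, e, w) = 1 := by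
  obtain ⟨χ, h1, h2, -, h4⟩ := exists_cutoff (E := E × (ℝ × ℝ) × (ℝ × ℝ))
    (D.isCompact.prod ((isCompact_closedBall (0 : ℝ × ℝ) 1).prod
      (isCompact_closedBall (0 : ℝ × ℝ) 1))) isOpen_univ (subset_univ _)
  refine ⟨χ, h1, h2, fun z hz e w he hw => h4.self_of_nhdsSet _ ⟨hz, ?_, ?_⟩⟩ <;> simpa

/-- A cut-off function for the section field. -/
def sectionCutoff : E × (ℝ × ℝ) × (ℝ × ℝ) → ℝ := D.exists_sectionCutoff.choose

lemma sectionCutoff_eq {z : E} (hz : z ∈ D.N) {e w : ℝ × ℝ} (he : ‖e‖ ≤ 1) (hw : ‖w‖ ≤ 1) :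
    D.sectionCutoff (z, e, w) = 1 := D.exists_sectionCutoff.choose_spec.2.2 z hz e w he hw

/-- The section field, cut off to a complete field. -/
def sectionFieldCut (q : E × (ℝ × ℝ) × (ℝ × ℝ)) : E × (ℝ × ℝ) × (ℝ × ℝ) :=
  D.sectionCutoff q • D.sectionField q

lemma isTame_sectionFieldCut : IsTame D.sectionFieldCut :=
  isTame_cutoff_smul D.exists_sectionCutoff.choose_spec.1 D.exists_sectionCutoff.choose_spec.2.1
    isOpen_univ (subset_univ _) D.smooth_sectionField.contDiffOn

/-- The lift to `ker L₀`, starting at `z`, of the geodesic with initial direction `w` relative to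
the frame `(v, jv)`. -/
def sec (z : E) (w : ℝ × ℝ) (r : ℝ) : E := (flow D.sectionFieldCut r (z, ((1, 0), w))).1

/-- The position of the parallel frame relative to the lift `sec`. -/
def secFrame (z : E) (w : ℝ × ℝ) (r : ℝ) : ℝ × ℝ :=
  (flow D.sectionFieldCut r (z, ((1, 0), w))).2.1

lemma smooth_sec : ContDiff ℝ ∞ fun p : E × (ℝ × ℝ) × ℝ => D.sec p.1 p.2.1 p.2.2 :=
  contDiff_fst.comp (D.isTame_sectionFieldCut.contDiff_flow.comp
    ((contDiff_snd.comp contDiff_snd).prodMk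
      (contDiff_fst.prodMk (contDiff_const.prodMk (contDiff_fst.comp contDiff_snd)))))

lemma smooth_secFrame : ContDiff ℝ ∞ fun p : E × (ℝ × ℝ) × ℝ => D.secFrame p.1 p.2.1 p.2.2 :=
  (contDiff_fst.comp contDiff_snd).comp (D.isTame_sectionFieldCut.contDiff_flow.comp
    ((contDiff_snd.comp contDiff_snd).prodMk
      (contDiff_fst.prodMk (contDiff_const.prodMk (contDiff_fst.comp contDiff_snd)))))

@[simp] lemma sec_zero_right (z : E) (w : ℝ × ℝ) : D.sec z w 0 = z := by
  simp [sec, D.isTame_sectionFieldCut.flow_zero]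

@[simp] lemma secFrame_zero_right (z : E) (w : ℝ × ℝ) : D.secFrame z w 0 = (1, 0) := by
  simp [secFrame, D.isTame_sectionFieldCut.flow_zero]

lemma hasDerivAt_flow_section (q : E × (ℝ × ℝ) × (ℝ × ℝ)) (r : ℝ) :
    HasDerivAt (fun r => (flow D.sectionFieldCut r q).1)
      (D.sectionFieldCut (flow D.sectionFieldCut r q)).1 r ∧
    HasDerivAt (fun r => (flow D.sectionFieldCut r q).2.1)
      (D.sectionFieldCut (flow D.sectionFieldCut r q)).2.1 r ∧
    HasDerivAt (fun r => (flow D.sectionFieldCut r q).2.2)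
      (D.sectionFieldCut (flow D.sectionFieldCut r q)).2.2 r := by
  have h := D.isTame_sectionFieldCut.hasDerivAt_flow r q
  have h2 := (ContinuousLinearMap.snd ℝ E ((ℝ × ℝ) × (ℝ × ℝ))).hasFDerivAt.comp_hasDerivAt r h
  exact ⟨(ContinuousLinearMap.fst ℝ E ((ℝ × ℝ) × (ℝ × ℝ))).hasFDerivAt.comp_hasDerivAt r h,
    (ContinuousLinearMap.fst ℝ (ℝ × ℝ) (ℝ × ℝ)).hasFDerivAt.comp_hasDerivAt r h2,
    (ContinuousLinearMap.snd ℝ (ℝ × ℝ) (ℝ × ℝ)).hasFDerivAt.comp_hasDerivAt r h2⟩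

lemma flow_section_snd_snd (q : E × (ℝ × ℝ) × (ℝ × ℝ)) (r : ℝ) :
    (flow D.sectionFieldCut r q).2.2 = q.2.2 := by
  have h : ∀ r, HasDerivAt (fun r => (flow D.sectionFieldCut r q).2.2) 0 r := fun r =>
    (D.hasDerivAt_flow_section q r).2.2.congr_deriv (by simp [sectionFieldCut, sectionField])
  have h2 := is_const_of_deriv_eq_zero (fun t => (h t).differentiableAt) (fun t => (h t).deriv) r 0
  simpa [D.isTame_sectionFieldCut.flow_zero] using h2

lemma flow_section (z : E) (w : ℝ × ℝ) (r : ℝ) :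
    flow D.sectionFieldCut r (z, ((1, 0), w)) = (D.sec z w r, (D.secFrame z w r, w)) :=
  Prod.ext rfl (Prod.ext rfl (D.flow_section_snd_snd _ _))

lemma secFrame_sq (z : E) (w : ℝ × ℝ) (r : ℝ) :
    (D.secFrame z w r).1 ^ 2 + (D.secFrame z w r).2 ^ 2 = 1 := by
  have h : ∀ r, HasDerivAt (fun r => (D.secFrame z w r).1 ^ 2 + (D.secFrame z w r).2 ^ 2) 0 r := by
    intro r
    have h1 := (D.hasDerivAt_flow_section (z, ((1, 0), w)) r).2.1
    have h2 := (ContinuousLinearMap.fst ℝ ℝ ℝ).hasFDerivAt.comp_hasDerivAt r h1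
    have h3 := (ContinuousLinearMap.snd ℝ ℝ ℝ).hasFDerivAt.comp_hasDerivAt r h1
    rw [flow_section] at h2 h3
    refine ((h2.pow 2).add (h3.pow 2)).congr_deriv ?_
    simp [sectionFieldCut, sectionField, secFrame]
    ring
  have h2 := is_const_of_deriv_eq_zero (fun t => (h t).differentiableAt) (fun t => (h t).deriv) r 0
  simpa using h2

lemma norm_secFrame_le (z : E) (w : ℝ × ℝ) (r : ℝ) : ‖D.secFrame z w r‖ ≤ 1 := by
  have h := D.secFrame_sq z w r
  rw [Prod.norm_def, max_le_iff, Real.norm_eq_abs, Real.norm_eq_abs, abs_le_one_iff_mul_self_le_one,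
    abs_le_one_iff_mul_self_le_one]
  constructor <;> nlinarith [sq_nonneg (D.secFrame z w r).1, sq_nonneg (D.secFrame z w r).2]

variable {D}

lemma sec_mem {z : E} (hz : z ∈ D.N) (w : ℝ × ℝ) (r : ℝ) : D.sec z w r ∈ D.N := by
  let q : ℝ → E × (ℝ × ℝ) × (ℝ × ℝ) := fun r => flow D.sectionFieldCut r (z, ((1, 0), w))
  refine D.invariant (D.sec z w) (fun r => D.sectionCutoff (q r) * coefA (q r))
    (fun r => D.sectionCutoff (q r) * coefB (q r))
    (fun r => D.sectionCutoff (q r) * D.spin (q r)) (fun r => ?_) (by simpa using hz) r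
  refine (D.hasDerivAt_flow_section (z, ((1, 0), w)) r).1.congr_deriv ?_
  simp only [sectionFieldCut, sectionField, spin, hA, hB, Prod.smul_fst, sec, q]
  module

lemma sectionFieldCut_eq {z : E} (hz : z ∈ D.N) {e w : ℝ × ℝ} (he : ‖e‖ ≤ 1) (hw : ‖w‖ ≤ 1) :
    D.sectionFieldCut (z, e, w) = D.sectionField (z, e, w) := by
  rw [sectionFieldCut, sectionCutoff_eq _ hz he hw, one_smul]

lemma hasDerivAt_sec {z : E} (hz : z ∈ D.N) {w : ℝ × ℝ} (hw : ‖w‖ ≤ 1) (r : ℝ) :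
    HasDerivAt (D.sec z w)
      (w.1 • ((D.secFrame z w r).1 • D.hA (D.sec z w r) + (D.secFrame z w r).2 • D.hB (D.sec z w r))
      + w.2 • (-(D.secFrame z w r).2 • D.hA (D.sec z w r)
        + (D.secFrame z w r).1 • D.hB (D.sec z w r))) r := by
  refine (D.hasDerivAt_flow_section (z, ((1, 0), w)) r).1.congr_deriv ?_
  rw [flow_section, sectionFieldCut_eq (sec_mem hz w r) (D.norm_secFrame_le z w r) hw]
  simp only [sectionField, coefA, coefB]
  module

lemma hasDerivAt_sec_zero {z : E} (hz : z ∈ D.N) {w : ℝ × ℝ} (hw : ‖w‖ ≤ 1) :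
    HasDerivAt (D.sec z w) (w.1 • D.hA z + w.2 • D.hB z) 0 := by
  simpa using hasDerivAt_sec hz hw 0

/-- A curve with the differential equations of the lifts is a lift. -/
lemma eq_sec {z : E} {w : ℝ × ℝ} (hw : ‖w‖ ≤ 1) {y : ℝ → E} {e : ℝ → ℝ × ℝ}
    (hy0 : y 0 = z) (he0 : e 0 = (1, 0)) (hy : ∀ r, y r ∈ D.N) (he : ∀ r, ‖e r‖ ≤ 1)
    (hd : ∀ r, HasDerivAt (fun r => (y r, (e r, w))) (D.sectionField (y r, (e r, w))) r) (r : ℝ) :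
    y r = D.sec z w r ∧ e r = D.secFrame z w r := by
  have h := D.isTame_sectionFieldCut.eq_flow (c := fun r => (y r, (e r, w))) (fun r => by
    rw [sectionFieldCut_eq (hy r) (he r) hw]; exact hd r) r
  rw [hy0, he0] at h
  exact ⟨congrArg Prod.fst h, congrArg (fun q => q.2.1) h⟩

lemma sec_smul {z : E} (hz : z ∈ D.N) {w : ℝ × ℝ} (hw : ‖w‖ ≤ 1) {k : ℝ} (hk : |k| ≤ 1) (r : ℝ) :
    D.sec z (k • w) r = D.sec z w (k * r) := by
  have hkw : ‖k • w‖ ≤ 1 := by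
    rw [norm_smul, Real.norm_eq_abs]
    exact mul_le_one₀ hk (norm_nonneg _) hw
  refine (eq_sec (D := D) (z := z) (w := k • w) hkw (y := fun r => D.sec z w (k * r))
    (e := fun r => D.secFrame z w (k * r)) (by simp) (by simp) (fun r => sec_mem hz _ _)
    (fun r => D.norm_secFrame_le _ _ _) (fun r => ?_) r).1.symm
  have h1 := D.isTame_sectionFieldCut.hasDerivAt_flow (k * r) (z, ((1, 0), w))
  rw [flow_section, sectionFieldCut_eq (sec_mem hz w _) (D.norm_secFrame_le z w _) hw] at h1
  have h2 := h1.scomp r ((hasDerivAt_id r).const_mul k)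
  have h3 := ((ContinuousLinearMap.fst ℝ E ((ℝ × ℝ) × (ℝ × ℝ))).hasFDerivAt.comp_hasDerivAt r h2)
  have h4 := ((ContinuousLinearMap.fst ℝ (ℝ × ℝ) (ℝ × ℝ)).hasFDerivAt.comp_hasDerivAt r
    ((ContinuousLinearMap.snd ℝ E ((ℝ × ℝ) × (ℝ × ℝ))).hasFDerivAt.comp_hasDerivAt r h2))
  refine (h3.prodMk (h4.prodMk (hasDerivAt_const r (k • w)))).congr_deriv ?_
  simp only [sectionField, coefA, coefB, spin]
  ext1
  · simp; module
  · ext <;> simp <;> ring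

lemma sec_zero {z : E} (hz : z ∈ D.N) (r : ℝ) : D.sec z 0 r = z := by
  have := sec_smul hz (w := 0) (by simp) (k := 0) (by simp) r
  simpa using this

lemma secFrame_zero {z : E} (hz : z ∈ D.N) (r : ℝ) : D.secFrame z 0 r = (1, 0) := by
  refine (eq_sec (D := D) (z := z) (w := 0) (by simp) (y := fun r => z)
    (e := fun r => (1, 0)) rfl rfl (fun r => hz)
    (fun r => by simp) (fun r => ?_) r).2.symm
  refine (hasDerivAt_const r _).congr_deriv ?_
  simp [sectionField, coefA, coefB, spin]
  rfl

/-- The derivative of the section with respect to the direction, at the zero direction. -/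
lemma fderiv_sec_zero {z : E} (hz : z ∈ D.N) (r : ℝ) (w : ℝ × ℝ) :
    fderiv ℝ (fun w => D.sec z w r) 0 w = r • (w.1 • D.hA z + w.2 • D.hB z) := by
  have hs : DifferentiableAt ℝ (fun w => D.sec z w r) 0 :=
    (D.smooth_sec.comp (contDiff_const.prodMk (contDiff_id.prodMk contDiff_const))
      |>.differentiable (by simp)) 0
  have key : ∀ w : ℝ × ℝ, ‖w‖ ≤ 1 →
      fderiv ℝ (fun w => D.sec z w r) 0 w = r • (w.1 • D.hA z + w.2 • D.hB z) := by
    intro w hw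
    have h0 : HasDerivAt (fun k : ℝ => k • w) w 0 := by
      simpa using (hasDerivAt_id (0 : ℝ)).smul_const w
    have h1 : HasDerivAt (fun k : ℝ => D.sec z (k • w) r) (fderiv ℝ (fun w => D.sec z w r) 0 w) 0 :=
      HasFDerivAt.comp_hasDerivAt (l := fun w => D.sec z w r) 0
        (by rw [zero_smul]; exact hs.hasFDerivAt) h0
    have h2 : HasDerivAt (fun k : ℝ => D.sec z w (k * r)) (r • (w.1 • D.hA z + w.2 • D.hB z)) 0 := by
      have h3 : HasDerivAt (fun k : ℝ => k * r) r 0 := by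
        simpa using (hasDerivAt_id (0 : ℝ)).mul_const r
      exact HasDerivAt.scomp (g₁ := D.sec z w) 0 (by rw [zero_mul]; exact hasDerivAt_sec_zero hz hw) h3
    refine h1.unique (h2.congr_of_eventuallyEq ?_)
    filter_upwards [Metric.ball_mem_nhds (0 : ℝ) one_pos] with k hk
    rw [sec_smul hz hw (by simpa using (Metric.mem_ball.1 hk).le)]
  have h1 := key (1, 0) (by simp)
  have h2 := key (0, 1) (by simp)
  have h3 : w = w.1 • ((1 : ℝ), (0 : ℝ)) + w.2 • ((0 : ℝ), (1 : ℝ)) := by ext <;> simp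
  conv_lhs => rw [h3, map_add, map_smul, map_smul, h1, h2]
  simp only [one_smul, zero_smul, add_zero, zero_add]
  module

end ContactData

/-! ### The family of contact forms and its pull-back under the contact isotopy -/

namespace ContactData

variable {E : Type} [NormedAddCommGroup E] [NormedSpace ℝ E] [FiniteDimensional ℝ E]
  [CompleteSpace E] (D : ContactData E)

/-- The family `λ_m = m L + L₀`, as a one-form on `ℝ × E` with no `dm`-component. -/
def Lam (p : ℝ × E) : ℝ × E →L[ℝ] ℝ :=
  (p.1 • D.L p.2 + D.L₀ p.2).comp (.snd ℝ ℝ E)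

lemma smooth_Lam : ContDiff ℝ ∞ D.Lam := by
  have h1 := D.smooth_L
  have h2 := D.smooth_L₀
  unfold Lam
  exact ((contDiff_fst.smul (h1.comp contDiff_snd)).add (h2.comp contDiff_snd)).clm_comp
    contDiff_const

/-- The vector with the given components in the frame of `ℝ × N`. -/
def vec (z : E) (ν a b c : ℝ) : ℝ × E := (ν, a • D.X z + b • D.H z + c • D.V z)

lemma fderiv_Lam (m : ℝ) (z : E) (ξ η : ℝ × E) :
    fderiv ℝ D.Lam (m, z) ξ η
      = ξ.1 * D.L z η.2 + m * fderiv ℝ D.L z ξ.2 η.2 + fderiv ℝ D.L₀ z ξ.2 η.2 := by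
  have h1 : HasFDerivAt D.L (fderiv ℝ D.L z) z := (D.smooth_L.differentiable (by simp) z).hasFDerivAt
  have h2 : HasFDerivAt D.L₀ (fderiv ℝ D.L₀ z) z :=
    (D.smooth_L₀.differentiable (by simp) z).hasFDerivAt
  have hs : HasFDerivAt (fun p : ℝ × E => p.2) (.snd ℝ ℝ E) (m, z) := hasFDerivAt_snd
  have h1' := HasFDerivAt.comp (g := D.L) (m, z) h1 hs
  have h2' := HasFDerivAt.comp (g := D.L₀) (m, z) h2 hs
  have h3 := (((hasFDerivAt_fst (𝕜 := ℝ) (p := (m, z))).smul h1').add h2').clm_comp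
    (hasFDerivAt_const (ContinuousLinearMap.snd ℝ ℝ E) (m, z))
  have h4 : fderiv ℝ D.Lam (m, z) = _ := h3.fderiv
  rw [h4]
  simp
  ring

variable {D}

lemma Lam_vec {z : E} (hz : z ∈ D.N) (m ν a b c : ℝ) :
    D.Lam (m, z) (D.vec z ν a b c) = m * a - D.bX z * a - D.bH z * b + c := by
  simp [Lam, vec, D.L_X z hz, D.L_H z hz, D.L_V z hz, D.L₀_X z hz, D.L₀_H z hz, D.L₀_V z hz]
  ring

lemma extD_Lam {z : E} (hz : z ∈ D.N) (hU : z ∈ D.U) (m μ a b c ν a' b' c' : ℝ) :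
    extD D.Lam (m, z) (D.vec z μ a b c) (D.vec z ν a' b' c')
      = μ * a' - ν * a + m * (c * b' - c' * b) - D.f z * (a * b' - a' * b) := by
  have h1 := D.extD_L z hz a b c a' b' c'
  have h2 := D.extD_L₀ z hz hU a b c a' b' c'
  simp only [extD] at h1 h2 ⊢
  rw [fderiv_Lam, fderiv_Lam]
  have h3 : ∀ a b c : ℝ, D.L z (a • D.X z + b • D.H z + c • D.V z) = a := fun a b c => by
    simp [D.L_X z hz, D.L_H z hz, D.L_V z hz]
  simp only [vec, h3]
  linear_combination m * h1 + h2

variable (D) in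
/-- The conformal rate: `d/dm (F_m^* λ_m) = h F_m^* λ_m`. -/
def rate (p : ℝ × E) : ℝ := p.1 * (D.chi p • (D.dens p)⁻¹)

variable (D) in
lemma smooth_rate : ContDiff ℝ ∞ D.rate :=
  contDiff_fst.mul (D.contDiff_chi_smul D.contDiffOn_inv_dens)

lemma rate_eq {m : ℝ} (hm : |m| < D.mb) {z : E} (hz : z ∈ D.N) :
    D.rate (m, z) = m * (D.dens (m, z))⁻¹ := by
  simp [rate, chi_eq hm hz]

lemma grayField_eq {m : ℝ} (hm : |m| < D.mb) {z : E} (hz : z ∈ D.N) :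
    D.grayField (m, z)
      = D.vec z 1 0 (-(D.dens (m, z))⁻¹) (-((D.dens (m, z))⁻¹ * D.bH z)) := by
  refine Prod.ext (by simp [grayField_fst, vec]) ?_
  rw [grayField_snd, chi_eq hm hz]
  simp only [vec]
  module

lemma reebField_eq {m : ℝ} (hm : |m| < D.mb) {z : E} (hz : z ∈ D.N) :
    D.reebField (m, z)
      = D.vec z 0 ((D.dens (m, z))⁻¹ * m) 0 ((D.dens (m, z))⁻¹ * D.f z) := by
  refine Prod.ext (by simp [reebField_fst, vec]) ?_
  rw [reebField_snd hm hz]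
  simp only [vec]
  module

lemma Lam_grayField {m : ℝ} (hm : |m| < D.mb) {z : E} (hz : z ∈ D.N) :
    D.Lam (m, z) (D.grayField (m, z)) = 0 := by
  rw [grayField_eq hm hz, Lam_vec hz]; ring

lemma Lam_reebField {m : ℝ} (hm : |m| < D.mb) {z : E} (hz : z ∈ D.N) :
    D.Lam (m, z) (D.reebField (m, z)) = 1 := by
  have h := (dens_pos hm hz).ne'
  rw [reebField_eq hm hz, Lam_vec hz]
  field_simp
  simp only [dens]; ring

lemma extD_grayField {m : ℝ} (hm : |m| < D.mb) {z : E} (hz : z ∈ D.N) (hU : z ∈ D.U)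
    (ν a b c : ℝ) : extD D.Lam (m, z) (D.grayField (m, z)) (D.vec z ν a b c)
      = D.rate (m, z) * D.Lam (m, z) (D.vec z ν a b c) := by
  have h := (dens_pos hm hz).ne'
  rw [grayField_eq hm hz, extD_Lam hz hU, Lam_vec hz, rate_eq hm hz]
  field_simp
  simp only [dens]; ring

lemma extD_reebField {m : ℝ} (hm : |m| < D.mb) {z : E} (hz : z ∈ D.N) (hU : z ∈ D.U)
    (ν a b c : ℝ) : extD D.Lam (m, z) (D.vec z ν a b c) (D.reebField (m, z))
      = ν * D.rate (m, z) := by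
  have h := (dens_pos hm hz).ne'
  rw [reebField_eq hm hz, extD_Lam hz hU, rate_eq hm hz]
  field_simp
  ring

/-- The velocity of a curve in `ℝ × N` is a combination of the frame. -/
lemma exists_eq_vec {c : ℝ → ℝ × E} {t : ℝ} {ξ : ℝ × E} (hc : ∀ᶠ s in 𝓝 t, (c s).2 ∈ D.N)
    (h : HasDerivAt c ξ t) : ∃ a b e, ξ = D.vec (c t).2 ξ.1 a b e := by
  have h2 := (ContinuousLinearMap.snd ℝ ℝ E).hasFDerivAt.comp_hasDerivAt t h
  have h3 := D.tangent (fun s => (c s).2) t ξ.2 hc h2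
  exact ⟨_, _, _, Prod.ext rfl h3⟩

variable (D) in
/-- The contact isotopy as a map of `ℝ × E`. -/
def FF (p : ℝ × E) : ℝ × E := (p.1, D.F p.1 p.2)

variable (D) in
lemma smooth_FF : ContDiff ℝ ∞ D.FF := contDiff_fst.prodMk D.smooth_F

variable (D) in
/-- The logarithm of the conformal factor of the contact isotopy:
`q_m(z) = ∫_0^m h(μ, F_μ z) dμ`. -/
def conf (m : ℝ) (z : E) : ℝ := m * ∫ σ in (0 : ℝ)..1, D.rate (D.FF (σ * m, z))

variable (D) in
lemma smooth_conf : ContDiff ℝ ∞ fun p : ℝ × E => D.conf p.1 p.2 := by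
  refine contDiff_fst.mul (contDiff_parametricIntegral
    (g := fun q : (ℝ × E) × ℝ => D.rate (D.FF (q.2 * q.1.1, q.1.2))) ?_)
  exact D.smooth_rate.comp (D.smooth_FF.comp (by fun_prop))

variable (D) in
lemma conf_mul (m σ : ℝ) (z : E) :
    HasDerivAt (fun σ => D.conf (σ * m) z) (m * D.rate (D.FF (σ * m, z))) σ := by
  have hcont : Continuous fun x => D.rate (D.FF (x, z)) :=
    (D.smooth_rate.comp (D.smooth_FF.comp (contDiff_id.prodMk contDiff_const))).continuous
  have h1 : ∀ y, D.conf y z = ∫ x in (0 : ℝ)..y, D.rate (D.FF (x, z)) := fun y => by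
    rw [conf]
    have := intervalIntegral.mul_integral_comp_mul_right (a := 0) (b := 1)
      (f := fun x => D.rate (D.FF (x, z))) y
    rw [zero_mul, one_mul] at this
    exact this
  simp only [h1]
  have h2 := (hcont.integral_hasStrictDerivAt 0 (σ * m)).hasDerivAt
  refine (HasDerivAt.scomp (g₁ := fun y => ∫ x in (0 : ℝ)..y, D.rate (D.FF (x, z))) σ h2
    ((hasDerivAt_id σ).mul_const m)).congr_deriv ?_
  simp

/-- `F_m^* λ_m = e^{q_m} λ_0` along a curve. -/
lemma pullback {c : ℝ → E} (hc : ContDiff ℝ ∞ c) (hN : ∀ r, c r ∈ D.N) {m : ℝ} (hm : |m| < D.mb)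
    (r : ℝ) (hU : ∀ σ ∈ Icc (0 : ℝ) 1, D.F (σ * m) (c r) ∈ D.U) :
    D.Lam (m, D.F m (c r)) (fderiv ℝ D.FF (m, c r) (0, deriv c r))
      = Real.exp (D.conf m (c r)) * D.L₀ (c r) (deriv c r) := by
  let Ψ : ℝ × ℝ → ℝ × E := fun p => D.FF (p.1 * m, c p.2)
  have hΨ : ContDiff ℝ ∞ Ψ := D.smooth_FF.comp (by fun_prop)
  have hΨd : ∀ p, DifferentiableAt ℝ Ψ p := fun p => hΨ.differentiable (by simp) p
  have hσm : ∀ σ ∈ Icc (0 : ℝ) 1, |σ * m| < D.mb := fun σ hσ => by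
    rw [abs_mul, abs_of_nonneg hσ.1]
    exact (mul_le_of_le_one_left (abs_nonneg m) hσ.2).trans_lt hm
  have hgray : ∀ σ r, fderiv ℝ Ψ (σ, r) (1, 0) = m • D.grayField (Ψ (σ, r)) := by
    intro σ r
    refine (fderiv_apply_one_zero (hΨd (σ, r))).unique ?_
    have h1 := ((hasDerivAt_id (σ * m)).prodMk (D.hasDerivAt_F (σ * m) (c r)))
    have h2 := h1.scomp σ ((hasDerivAt_id σ).mul_const m)
    simp only [one_mul] at h2
    refine h2.congr_deriv ?_
    congr 1
    exact Prod.ext (by simp [grayField_fst]) rfl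
  have hr : ∀ σ, fderiv ℝ Ψ (σ, r) (0, 1) = fderiv ℝ D.FF (σ * m, c r) (0, deriv c r) := by
    intro σ
    refine (fderiv_apply_zero_one (hΨd (σ, r))).unique ?_
    have h1 : HasDerivAt (fun r => (σ * m, c r)) (0, deriv c r) r :=
      (hasDerivAt_const r (σ * m)).prodMk (hc.differentiable (by simp) r).hasDerivAt
    exact (D.smooth_FF.differentiable (by simp) (σ * m, c r)).hasFDerivAt.comp_hasDerivAt r h1
  have hderiv : ∀ σ ∈ Icc (0 : ℝ) 1, HasDerivAt
      (fun σ => D.Lam (Ψ (σ, r)) (fderiv ℝ Ψ (σ, r) (0, 1)))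
      (m * D.rate (Ψ (σ, r)) * D.Lam (Ψ (σ, r)) (fderiv ℝ Ψ (σ, r) (0, 1))) σ := by
    intro σ hσ
    obtain ⟨a, b, ha, hb, hab⟩ := exists_hasDerivAt_form (α := D.Lam) (Ψ := Ψ) (s := σ) (r := r)
      (hΨ.contDiffAt.of_le (by norm_cast)) (D.smooth_Lam.differentiable (by simp) _)
    have hb0 : b = 0 := by
      refine hb.unique ((hasDerivAt_const r (0 : ℝ)).congr_of_eventuallyEq
        (Eventually.of_forall fun r' => ?_))
      change D.Lam (Ψ (σ, r')) (fderiv ℝ Ψ (σ, r') (1, 0)) = 0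
      rw [hgray, map_smul]
      rw [show D.Lam (Ψ (σ, r')) (D.grayField (Ψ (σ, r'))) = 0 from
        Lam_grayField (hσm σ hσ) (F_mem (hN r') _), smul_zero]
    obtain ⟨a', b', e', hv⟩ := exists_eq_vec (c := fun r' => Ψ (σ, r')) (t := r)
      (Eventually.of_forall fun r' => F_mem (hN r') _) (fderiv_apply_zero_one (hΨd (σ, r)))
    rw [hb0, sub_zero, hgray, extD_smul_left] at hab
    have h5 := extD_grayField (hσm σ hσ) (F_mem (hN r) (σ * m)) (hU σ hσ)
      (fderiv ℝ Ψ (σ, r) (0, 1)).1 a' b' e'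
    rw [show D.vec (D.F (σ * m) (c r)) (fderiv ℝ Ψ (σ, r) (0, 1)).1 a' b' e'
      = fderiv ℝ Ψ (σ, r) (0, 1) from hv.symm] at h5
    have h6 : a = m * D.rate (Ψ (σ, r)) * D.Lam (Ψ (σ, r)) (fderiv ℝ Ψ (σ, r) (0, 1)) := by
      rw [hab, mul_assoc]
      exact congrArg (m * ·) h5
    exact h6 ▸ ha
  have hconst : ∀ σ ∈ Icc (0 : ℝ) 1, HasDerivAt
      (fun σ => Real.exp (-D.conf (σ * m) (c r)) * D.Lam (Ψ (σ, r)) (fderiv ℝ Ψ (σ, r) (0, 1)))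
      0 σ := by
    intro σ hσ
    refine (((D.conf_mul m σ (c r)).neg.exp).mul (hderiv σ hσ)).congr_deriv ?_
    simp only [Ψ]; ring
  have h7 := constant_of_has_deriv_right_zero (a := 0) (b := 1)
    (fun σ hσ => (hconst σ hσ).continuousAt.continuousWithinAt)
    (fun σ hσ => (hconst σ (Ico_subset_Icc_self hσ)).hasDerivWithinAt) 1 (by simp)
  simp only [hr, one_mul, zero_mul] at h7
  have h8 : D.Lam (Ψ (0, r)) (fderiv ℝ D.FF (0, c r) (0, deriv c r)) = D.L₀ (c r) (deriv c r) := by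
    have h9 := (hr 0).symm
    rw [zero_mul] at h9
    have h10 : HasDerivAt (fun r' => Ψ (0, r')) (0, deriv c r) r := by
      have : (fun r' => Ψ (0, r')) = fun r' => ((0 : ℝ), c r') := by
        funext r'; simp [Ψ, FF]
      rw [this]
      exact (hasDerivAt_const r (0 : ℝ)).prodMk (hc.differentiable (by simp) r).hasDerivAt
    rw [h9, (fderiv_apply_zero_one (hΨd (0, r))).unique h10]
    simp [Lam, Ψ, FF]
  have h9 : Ψ (1, r) = (m, D.F m (c r)) := by simp [Ψ, FF]
  have h10 : D.conf 0 (c r) = 0 := by simp [conf]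
  rw [h8, h9, h10, neg_zero, Real.exp_zero, one_mul, Real.exp_neg] at h7
  rw [← h7, mul_inv_cancel_left₀ (Real.exp_pos _).ne']

end ContactData

/-! ### The return to the local section -/

lemma _root_.IsCompact.exists_nhds_forall_of_eventually {X Z : Type} [TopologicalSpace X]
    [TopologicalSpace Z] {K : Set X} (hK : IsCompact K) {z₀ : Z} {P : X × Z → Prop}
    (h : ∀ p ∈ K, ∀ᶠ q in 𝓝 (p, z₀), P q) : ∀ᶠ z in 𝓝 z₀, ∀ p ∈ K, P (p, z) := by
  obtain ⟨O, -, hKO, V, hV, hOV⟩ := hK.exists_open_nhds_of_eventually h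
  filter_upwards [hV] with z hz p hp using hOV p (hKO hp) z hz

namespace ContactData

variable {E : Type} [NormedAddCommGroup E] [NormedSpace ℝ E] [FiniteDimensional ℝ E]
  [CompleteSpace E] (D : ContactData E)

/-- The Reeb flow of `F_m^* λ_m`. -/
def phi (m s : ℝ) (z : E) : E := D.Finv m (D.psi m s (D.F m z))

lemma smooth_phi : ContDiff ℝ ∞ fun p : ℝ × ℝ × E => D.phi p.1 p.2.1 p.2.2 := by
  have h1 := D.smooth_F
  have h2 := D.smooth_psi
  have h3 := D.smooth_Finv
  have h4 : ContDiff ℝ ∞ fun p : ℝ × ℝ × E => D.F p.1 p.2.2 :=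
    h1.comp (contDiff_fst.prodMk (contDiff_snd.comp contDiff_snd))
  have h5 : ContDiff ℝ ∞ fun p : ℝ × ℝ × E => D.psi p.1 p.2.1 (D.F p.1 p.2.2) :=
    h2.comp (contDiff_fst.prodMk ((contDiff_fst.comp contDiff_snd).prodMk h4))
  exact h3.comp (contDiff_fst.prodMk h5)

@[simp] lemma phi_zero (m : ℝ) (z : E) : D.phi m 0 z = z := by simp [phi, Finv_F]

lemma F_phi (m s : ℝ) (z : E) : D.F m (D.phi m s z) = D.psi m s (D.F m z) := by
  simp [phi, F_Finv]

lemma phi_add (m s t : ℝ) (z : E) : D.phi m (s + t) z = D.phi m s (D.phi m t z) := by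
  rw [phi, phi, F_phi, psi_add]

variable {D}

lemma phi_mem {z : E} (hz : z ∈ D.N) (m s : ℝ) : D.phi m s z ∈ D.N :=
  Finv_mem (psi_mem (F_mem hz m) m s) m

lemma phi_zero_left {z : E} (hz : z ∈ D.N) (s : ℝ) : D.phi 0 s z = D.rot s z := by
  simp [phi, psi_zero_left hz]

lemma L_hA {z : E} (hz : z ∈ D.N) : D.L z (D.hA z) = 1 ∧ D.B z (D.hA z) = 0 ∧
    D.L₀ z (D.hA z) = 0 := by
  simp [hA, D.L_X z hz, D.L_V z hz, D.B_X z hz, D.B_V z hz, D.L₀_X z hz, D.L₀_V z hz]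

lemma L_hB {z : E} (hz : z ∈ D.N) : D.L z (D.hB z) = 0 ∧ D.B z (D.hB z) = 1 ∧
    D.L₀ z (D.hB z) = 0 := by
  simp [hB, D.L_H z hz, D.L_V z hz, D.B_H z hz, D.B_V z hz, D.L₀_H z hz, D.L₀_V z hz]

variable (D) in
/-- The difference between a point of a Reeb orbit and a point of the section, measured by the
three forms `L`, `B`, `L₀`. -/
def gap (q : (ℝ × E) × (ℝ × (ℝ × ℝ))) : ℝ × ℝ × ℝ :=
  (D.L q.1.2 (D.phi q.1.1 q.2.1 q.1.2 - D.sec q.1.2 q.2.2 1),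
    D.B q.1.2 (D.phi q.1.1 q.2.1 q.1.2 - D.sec q.1.2 q.2.2 1),
    D.L₀ q.1.2 (D.phi q.1.1 q.2.1 q.1.2 - D.sec q.1.2 q.2.2 1))

variable (D) in
lemma smooth_gap : ContDiff ℝ ∞ D.gap := by
  have h1 : ContDiff ℝ ∞ fun q : (ℝ × E) × (ℝ × (ℝ × ℝ)) =>
      D.phi q.1.1 q.2.1 q.1.2 - D.sec q.1.2 q.2.2 1 := by
    refine ContDiff.sub ?_ ?_
    · exact D.smooth_phi.comp (by fun_prop :
        ContDiff ℝ ∞ fun q : (ℝ × E) × (ℝ × (ℝ × ℝ)) => (q.1.1, q.2.1, q.1.2))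
    · exact D.smooth_sec.comp (by fun_prop :
        ContDiff ℝ ∞ fun q : (ℝ × E) × (ℝ × (ℝ × ℝ)) => (q.1.2, q.2.2, (1 : ℝ)))
  have hs : ContDiff ℝ ∞ fun q : (ℝ × E) × (ℝ × (ℝ × ℝ)) => q.1.2 := by fun_prop
  exact ((D.smooth_L.comp hs).clm_apply h1).prodMk
    (((D.smooth_B.comp hs).clm_apply h1).prodMk ((D.smooth_L₀.comp hs).clm_apply h1))

/-- The value of the derivative of the gap with respect to the time and the direction. -/
def gapEquiv : (ℝ × (ℝ × ℝ)) ≃L[ℝ] (ℝ × ℝ × ℝ) :=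
  LinearEquiv.toContinuousLinearEquiv
    { toFun := fun y => (-y.2.1, -y.2.2, y.1)
      invFun := fun x => (x.2.2, (-x.1, -x.2.1))
      map_add' := fun x y => by ext <;> simp <;> ring
      map_smul' := fun c x => by ext <;> simp
      left_inv := fun x => by simp
      right_inv := fun x => by simp }

lemma isInvertible_fderiv_gap {s₀ : ℝ} {z : E} (hz : z ∈ D.N) (hs : D.rot s₀ z = z) :
    (fderiv ℝ D.gap ((0, z), (s₀, (0, 0))) ∘L .inr ℝ (ℝ × E) (ℝ × (ℝ × ℝ))).IsInvertible := by
  refine ⟨gapEquiv, ?_⟩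
  have h1 : HasFDerivAt (fun y : ℝ × (ℝ × ℝ) => D.gap ((0, z), y))
      (fderiv ℝ D.gap ((0, z), (s₀, (0, 0))) ∘L .inr ℝ (ℝ × E) (ℝ × (ℝ × ℝ))) (s₀, (0, 0)) :=
    HasFDerivAt.comp (g := D.gap) (s₀, (0, 0))
      (D.smooth_gap.differentiable (by simp) _).hasFDerivAt
      (hasFDerivAt_prodMk_right (0, z) (s₀, ((0 : ℝ), (0 : ℝ))))
  have hrot : HasDerivAt (fun s => D.rot s z) (D.V z) s₀ := by
    simpa [hs] using D.hasDerivAt_rot z hz s₀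
  have hphi : HasFDerivAt (fun y : ℝ × (ℝ × ℝ) => D.phi 0 y.1 z)
      ((ContinuousLinearMap.toSpanSingleton ℝ (D.V z)).comp (.fst ℝ ℝ (ℝ × ℝ)))
      (s₀, (0, 0)) := by
    simp only [phi_zero_left hz]
    exact HasFDerivAt.comp (g := fun s => D.rot s z) (s₀, (0, 0)) hrot.hasFDerivAt hasFDerivAt_fst
  have hsec : HasFDerivAt (fun y : ℝ × (ℝ × ℝ) => D.sec z y.2 1)
      ((fderiv ℝ (fun w => D.sec z w 1) 0).comp (.snd ℝ ℝ (ℝ × ℝ))) (s₀, (0, 0)) := by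
    have hd : DifferentiableAt ℝ (fun w => D.sec z w 1) 0 :=
      (D.smooth_sec.comp (contDiff_const.prodMk (contDiff_id.prodMk contDiff_const))
        |>.differentiable (by simp)) 0
    exact HasFDerivAt.comp (g := fun w => D.sec z w 1) (s₀, ((0 : ℝ), (0 : ℝ)))
      hd.hasFDerivAt hasFDerivAt_snd
  have h2 := hphi.sub hsec
  have h3 := (((D.L z).hasFDerivAt.comp (s₀, ((0 : ℝ), (0 : ℝ))) h2)).prodMk
    (((D.B z).hasFDerivAt.comp (s₀, ((0 : ℝ), (0 : ℝ))) h2).prodMk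
      ((D.L₀ z).hasFDerivAt.comp (s₀, ((0 : ℝ), (0 : ℝ))) h2))
  have h4 := h1.unique h3
  rw [h4]
  obtain ⟨a1, a2, a3⟩ := L_hA hz
  obtain ⟨b1, b2, b3⟩ := L_hB hz
  refine ContinuousLinearMap.ext fun y => ?_
  simp [gapEquiv, fderiv_sec_zero hz, D.L_V z hz, D.B_V z hz, D.L₀_V z hz, a1, a2, a3, b1, b2, b3]

variable (D) in
/-- Near a time at which the fibre rotation is the identity, every orbit has exactly one
intersection with the local section. -/
lemma exists_local_return {s₀ : ℝ} (hs : ∀ z ∈ D.N, D.rot s₀ z = z) :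
    ∃ ρ₀ > 0, ∀ ρ, 0 < ρ → ρ ≤ ρ₀ → ∃ u : ℝ × E → ℝ × (ℝ × ℝ), ContDiff ℝ ∞ u ∧
      ∀ᶠ m in 𝓝 (0 : ℝ), ∀ z ∈ D.N, dist (u (m, z)) (s₀, (0, 0)) < ρ ∧
        D.phi m (u (m, z)).1 z = D.sec z (u (m, z)).2 1 ∧
        ∀ y : ℝ × (ℝ × ℝ), dist y (s₀, (0, 0)) < ρ → D.phi m y.1 z = D.sec z y.2 1 →
          y = u (m, z) := by
  have hK : IsCompact (({0} : Set ℝ) ×ˢ D.N) := isCompact_singleton.prod D.isCompact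
  obtain ⟨r, hr, O, hO, hKO, u, hu, hur⟩ := exists_implicit_of_isCompact D.smooth_gap hK
    (s₀, ((0 : ℝ), (0 : ℝ))) (by
      rintro ⟨m, z⟩ ⟨hm, hz⟩
      obtain rfl : m = 0 := hm
      have h0 : D.sec z (0, 0) 1 = z := sec_zero hz 1
      simp [gap, phi_zero_left hz, hs z hz, h0]) (by
      rintro ⟨m, z⟩ ⟨hm, hz⟩
      obtain rfl : m = 0 := hm
      exact isInvertible_fderiv_gap hz (hs z hz))
  obtain ⟨r₁, hr₁, hinj⟩ := D.injective
  have hu0 : ∀ z ∈ D.N, u (0, z) = (s₀, (0, 0)) := fun z hz => by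
    refine ((hur (0, z) (hKO ⟨rfl, hz⟩)).2.2 (s₀, (0, 0)) (by simpa using hr) ?_).symm
    have h0 : D.sec z (0, 0) 1 = z := sec_zero hz 1
    simp [gap, phi_zero_left hz, hs z hz, h0]
  -- the orbit and the section are close to the base point
  have hclose : ∀ᶠ q : ℝ × (ℝ × (ℝ × ℝ)) in 𝓝 (0, (s₀, (0, 0))), ∀ z ∈ D.N,
      dist (D.phi q.1 q.2.1 z) z < r₁ ∧ dist (D.sec z q.2.2 1) z < r₁ := by
    refine D.isCompact.exists_nhds_forall_of_eventually (P := fun x : E × (ℝ × (ℝ × (ℝ × ℝ))) =>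
      dist (D.phi x.2.1 x.2.2.1 x.1) x.1 < r₁ ∧ dist (D.sec x.1 x.2.2.2 1) x.1 < r₁) fun z hz => ?_
    have c1 : Continuous fun x : E × (ℝ × (ℝ × (ℝ × ℝ))) => dist (D.phi x.2.1 x.2.2.1 x.1) x.1 :=
      (D.smooth_phi.continuous.comp (by fun_prop :
        Continuous fun x : E × (ℝ × (ℝ × (ℝ × ℝ))) => (x.2.1, x.2.2.1, x.1))).dist continuous_fst
    have c2 : Continuous fun x : E × (ℝ × (ℝ × (ℝ × ℝ))) => dist (D.sec x.1 x.2.2.2 1) x.1 :=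
      (D.smooth_sec.continuous.comp (by fun_prop :
        Continuous fun x : E × (ℝ × (ℝ × (ℝ × ℝ))) => (x.1, x.2.2.2, (1 : ℝ)))).dist continuous_fst
    have h0 : D.sec z (0, 0) 1 = z := sec_zero hz 1
    refine (c1.continuousAt.eventually_lt continuousAt_const ?_).and
      (c2.continuousAt.eventually_lt continuousAt_const ?_)
    · simpa [phi_zero_left hz, hs z hz] using hr₁
    · simpa [h0] using hr₁
  rw [nhds_prod_eq] at hclose
  obtain ⟨A, hA, Y, hY, hAY⟩ := mem_prod_iff.1 hclose
  obtain ⟨ρ₁, hρ₁, hρY⟩ := Metric.mem_nhds_iff.1 hY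
  obtain ⟨χ, hχ, -, hχO, hχ1⟩ := exists_cutoff hK hO hKO
  refine ⟨min r ρ₁, lt_min hr hρ₁, fun ρ hρ hρ₀ =>
    ⟨fun p => (s₀, (0, 0)) + χ p • (u p - (s₀, (0, 0))), contDiff_const.add
      (contDiff_cutoff_smul hχ hO hχO (hu.sub contDiffOn_const)), ?_⟩⟩
  have hev : ∀ᶠ m in 𝓝 (0 : ℝ), ∀ z ∈ D.N,
      (m, z) ∈ O ∧ χ (m, z) = 1 ∧ dist (u (m, z)) (s₀, (0, 0)) < ρ := by
    refine D.isCompact.exists_nhds_forall_of_eventually (P := fun x : E × ℝ =>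
      (x.2, x.1) ∈ O ∧ χ (x.2, x.1) = 1 ∧ dist (u (x.2, x.1)) (s₀, (0, 0)) < ρ) fun z hz => ?_
    have hsw : Tendsto (fun x : E × ℝ => (x.2, x.1)) (𝓝 (z, 0)) (𝓝 (0, z)) :=
      Continuous.tendsto (by fun_prop) (z, (0 : ℝ))
    have hOz : O ∈ 𝓝 ((0 : ℝ), z) := hO.mem_nhds (hKO ⟨rfl, hz⟩)
    have h1 : ContinuousAt u (0, z) := (hu.continuousOn).continuousAt hOz
    have h2 := h1.tendsto
    rw [hu0 z hz] at h2
    exact (hsw.eventually hOz).and ((hsw.eventually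
      (eventually_nhdsSet_iff_forall.1 hχ1 (0, z) ⟨rfl, hz⟩)).and
        (hsw.eventually (h2.eventually (Metric.ball_mem_nhds _ hρ))))
  filter_upwards [hev, hA] with m hm hmA z hz
  obtain ⟨h1, h2, h3⟩ := hm z hz
  obtain ⟨-, h5, h6⟩ := hur (m, z) h1
  have hueq : (s₀, ((0 : ℝ), (0 : ℝ))) + χ (m, z) • (u (m, z) - (s₀, (0, 0))) = u (m, z) := by
    rw [h2, one_smul]; abel
  simp only [hueq]
  have hYmem : ∀ y : ℝ × (ℝ × ℝ), dist y (s₀, (0, 0)) < ρ → y ∈ Y := fun y hy =>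
    hρY (Metric.mem_ball.2 (hy.trans_le (hρ₀.trans (min_le_right _ _))))
  refine ⟨h3, ?_, fun y hy hy0 => h6 y (hy.trans_le (hρ₀.trans (min_le_left _ _))) ?_⟩
  · obtain ⟨h7, h8⟩ := hAY (mk_mem_prod hmA (hYmem _ h3)) z hz
    simp only [gap, Prod.mk_eq_zero] at h5
    exact hinj z hz _ (phi_mem hz _ _) _ (sec_mem hz _ _) h7 h8 h5.1 h5.2.1 h5.2.2
  · simp [gap, hy0]

variable (D) in
/-- The first return to the local section: time `u.1` and direction `u.2`. There are no
intersections at the times in `(0, ρ)`, where the intersection at the time `0` is the only one, nor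
at the times in `[ρ, 2π - ρ]`, by compactness, since the fibre rotation by such an angle has no
fixed points. -/
theorem exists_return : ∃ ρ > 0, ρ ≤ 1 ∧ ∃ u : ℝ × E → ℝ × (ℝ × ℝ), ContDiff ℝ ∞ u ∧
    ∃ δ₀ > 0, ∀ᶠ m in 𝓝 (0 : ℝ), ∀ z ∈ D.N, dist (u (m, z)) (2 * Real.pi, (0, 0)) < ρ ∧
      D.phi m (u (m, z)).1 z = D.sec z (u (m, z)).2 1 ∧
      (∀ y : ℝ × (ℝ × ℝ), dist y (2 * Real.pi, (0, 0)) < ρ → D.phi m y.1 z = D.sec z y.2 1 →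
        y = u (m, z)) ∧
      ∀ y : ℝ × (ℝ × ℝ), 0 < y.1 → y.1 < 2 * Real.pi + ρ → ‖y.2‖ < δ₀ →
        D.phi m y.1 z = D.sec z y.2 1 → y = u (m, z) := by
  obtain ⟨ρ₁, hρ₁, h1⟩ := D.exists_local_return (s₀ := 2 * Real.pi) D.rot_two_pi
  obtain ⟨ρ₂, hρ₂, h2⟩ := D.exists_local_return (s₀ := 0) fun z _ => D.rot_zero z
  let ρ := min 1 (min ρ₁ ρ₂)
  have hρ : 0 < ρ := lt_min one_pos (lt_min hρ₁ hρ₂)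
  obtain ⟨u, hu, hu1⟩ := h1 ρ hρ ((min_le_right _ _).trans (min_le_left _ _))
  obtain ⟨u', -, hu2⟩ := h2 ρ hρ ((min_le_right _ _).trans (min_le_right _ _))
  have hnohit : ∀ᶠ q : ℝ × (ℝ × ℝ) in 𝓝 (0, (0, 0)),
      ∀ x ∈ Icc ρ (2 * Real.pi - ρ) ×ˢ D.N, D.phi q.1 x.1 x.2 ≠ D.sec x.2 q.2 1 := by
    refine (isCompact_Icc.prod D.isCompact).exists_nhds_forall_of_eventually
      (P := fun x : (ℝ × E) × (ℝ × (ℝ × ℝ)) => D.phi x.2.1 x.1.1 x.1.2 ≠ D.sec x.1.2 x.2.2 1) ?_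
    rintro ⟨s, z⟩ ⟨hs, hz⟩
    have c1 : Continuous fun x : (ℝ × E) × (ℝ × (ℝ × ℝ)) => D.phi x.2.1 x.1.1 x.1.2 :=
      D.smooth_phi.continuous.comp (by fun_prop :
        Continuous fun x : (ℝ × E) × (ℝ × (ℝ × ℝ)) => (x.2.1, x.1.1, x.1.2))
    have c2 : Continuous fun x : (ℝ × E) × (ℝ × (ℝ × ℝ)) => D.sec x.1.2 x.2.2 1 :=
      D.smooth_sec.continuous.comp (by fun_prop :
        Continuous fun x : (ℝ × E) × (ℝ × (ℝ × ℝ)) => (x.1.2, x.2.2, (1 : ℝ)))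
    refine (isOpen_ne_fun c1 c2).mem_nhds ?_
    have h0 : D.sec z (0, 0) 1 = z := sec_zero hz 1
    simp only [mem_ofPred_eq, h0, phi_zero_left hz]
    exact D.rot_ne z hz s ⟨hρ.trans_le hs.1, by linarith [hs.2]⟩
  rw [nhds_prod_eq] at hnohit
  obtain ⟨A, hA, Y, hY, hAY⟩ := mem_prod_iff.1 hnohit
  obtain ⟨δ, hδ, hδY⟩ := Metric.mem_nhds_iff.1 hY
  refine ⟨ρ, hρ, min_le_left _ _, u, hu, min ρ δ, lt_min hρ hδ, ?_⟩
  filter_upwards [hu1, hu2, hA] with m hm1 hm2 hmA z hz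
  obtain ⟨h3, h4, h5⟩ := hm1 z hz
  obtain ⟨h6, h7, h8⟩ := hm2 z hz
  refine ⟨h3, h4, h5, fun y hy hy' hw hyz => ?_⟩
  have hw0 : ‖y.2‖ < ρ := hw.trans_le (min_le_left _ _)
  have hdist : ∀ s₀, |y.1 - s₀| < ρ → dist y (s₀, (0, 0)) < ρ := fun s₀ hs => by
    rw [Prod.dist_eq]
    refine max_lt (by simpa [Real.dist_eq] using hs) ?_
    rw [show ((s₀, ((0 : ℝ), (0 : ℝ))) : ℝ × (ℝ × ℝ)).2 = 0 from rfl, dist_zero_right]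
    exact hw0
  by_cases ha : y.1 < ρ
  · have e1 := h8 y (hdist 0 (by rw [sub_zero, abs_of_pos hy]; exact ha)) hyz
    have h0 : D.sec z (0, 0) 1 = z := sec_zero hz 1
    have e2 := h8 (0, (0, 0)) (by simpa using hρ) (by simp [h0])
    exact absurd (congrArg Prod.fst (e1.trans e2.symm)) (by simpa using hy.ne')
  · by_cases hb : y.1 ≤ 2 * Real.pi - ρ
    · refine absurd hyz (hAY (mk_mem_prod hmA (hδY ?_)) (y.1, z) ⟨⟨not_lt.1 ha, hb⟩, hz⟩)
      rw [show ((0 : ℝ), (0 : ℝ)) = 0 from rfl, Metric.mem_ball, dist_zero_right]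
      exact hw.trans_le (min_le_right _ _)
    · refine h5 y (hdist _ ?_) hyz
      rw [abs_lt]; constructor <;> linarith [not_le.1 hb]

end ContactData

/-! ### The first variation of the return time -/

section Integral

variable {E : Type} [NormedAddCommGroup E] [NormedSpace ℝ E]

lemma contDiff_extD {P : Type} [NormedAddCommGroup P] [NormedSpace ℝ P] {α : E → E →L[ℝ] ℝ}
    (hα : ContDiff ℝ ∞ α) {f g h : P → E} (hf : ContDiff ℝ ∞ f) (hg : ContDiff ℝ ∞ g)
    (hh : ContDiff ℝ ∞ h) : ContDiff ℝ ∞ fun p => extD α (f p) (g p) (h p) := by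
  have h1 : ContDiff ℝ ∞ (fderiv ℝ α) := hα.fderiv_right (by simp)
  have h2 := h1.comp hf
  exact ((h2.clm_apply hg).clm_apply hh).sub ((h2.clm_apply hh).clm_apply hg)

/-- Stokes' theorem on a strip, differentiated: if `α(∂_r Ψ)` is independent of `r`, its derivative
in `s` is given by the flux of `dα` and the boundary terms. -/
lemma integral_extD {α : E → E →L[ℝ] ℝ} (hα : ContDiff ℝ ∞ α) {Ψ : ℝ × ℝ → E}
    (hΨ : ContDiff ℝ ∞ Ψ) {τ : ℝ → ℝ} {τ' : ℝ} (hτ : HasDerivAt τ τ' 0)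
    (h : ∀ r ∈ Icc (0 : ℝ) 1, ∀ᶠ s in 𝓝 (0 : ℝ), α (Ψ (s, r)) (fderiv ℝ Ψ (s, r) (0, 1)) = τ s) :
    ∫ r in (0 : ℝ)..1, extD α (Ψ (0, r)) (fderiv ℝ Ψ (0, r) (1, 0)) (fderiv ℝ Ψ (0, r) (0, 1))
      = τ' - (α (Ψ (0, 1)) (fderiv ℝ Ψ (0, 1) (1, 0)) - α (Ψ (0, 0)) (fderiv ℝ Ψ (0, 0) (1, 0))) := by
  have hd : ContDiff ℝ ∞ (fderiv ℝ Ψ) := hΨ.fderiv_right (by simp)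
  have hline : ContDiff ℝ ∞ fun r : ℝ => ((0 : ℝ), r) := contDiff_const.prodMk contDiff_id
  have hcont : Continuous fun r =>
      extD α (Ψ (0, r)) (fderiv ℝ Ψ (0, r) (1, 0)) (fderiv ℝ Ψ (0, r) (0, 1)) :=
    (contDiff_extD hα (hΨ.comp hline) ((hd.comp hline).clm_apply contDiff_const)
      ((hd.comp hline).clm_apply contDiff_const)).continuous
  have key : ∀ r ∈ uIcc (0 : ℝ) 1, HasDerivAt (fun r => α (Ψ (0, r)) (fderiv ℝ Ψ (0, r) (1, 0)))
      (τ' - extD α (Ψ (0, r)) (fderiv ℝ Ψ (0, r) (1, 0)) (fderiv ℝ Ψ (0, r) (0, 1))) r := by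
    intro r hr
    rw [uIcc_of_le zero_le_one] at hr
    obtain ⟨a, b, ha, hb, hab⟩ := exists_hasDerivAt_form (α := α) (Ψ := Ψ) (s := 0) (r := r)
      (hΨ.contDiffAt.of_le (by norm_cast)) (hα.differentiable (by simp) _)
    have ha' : a = τ' := ha.unique (hτ.congr_of_eventuallyEq (h r hr))
    rw [← hab, ← ha', sub_sub_cancel]
    exact hb
  have h1 := intervalIntegral.integral_eq_sub_of_hasDerivAt key
    ((continuous_const.sub hcont).intervalIntegrable _ _)
  rw [intervalIntegral.integral_sub (by simp) (hcont.intervalIntegrable _ _)] at h1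
  simp only [intervalIntegral.integral_const, sub_zero, smul_eq_mul, one_mul] at h1
  linarith

end Integral

namespace ContactData

variable {E : Type} [NormedAddCommGroup E] [NormedSpace ℝ E] [FiniteDimensional ℝ E]
  [CompleteSpace E] (D : ContactData E)

/-- `u = (t, W)` is a smooth family of return times and return directions, for `|m| < m₁`. -/
structure IsReturn (u : ℝ × E → ℝ × (ℝ × ℝ)) (m₁ : ℝ) : Prop where
  smooth : ContDiff ℝ ∞ u
  pos : 0 < m₁
  le : m₁ ≤ D.mb
  norm_le : ∀ m, |m| < m₁ → ∀ z ∈ D.N, ‖(u (m, z)).2‖ ≤ 1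
  phi_eq : ∀ m, |m| < m₁ → ∀ z ∈ D.N, D.phi m (u (m, z)).1 z = D.sec z (u (m, z)).2 1
  zero : ∀ z ∈ D.N, u (0, z) = (2 * Real.pi, (0, 0))

/-- The strips swept by the orbits from the points of `ℝ × N` to the local sections. -/
def orbStrip (u : ℝ × E → ℝ × (ℝ × ℝ)) (q : (ℝ × E) × ℝ) : ℝ × E :=
  (q.1.1, D.psi q.1.1 ((u q.1).1 * q.2) (D.F q.1.1 q.1.2))

/-- The strips swept by the radial lifts in the local sections. -/
def secStrip (u : ℝ × E → ℝ × (ℝ × ℝ)) (q : (ℝ × E) × ℝ) : ℝ × E :=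
  D.FF (q.1.1, D.sec q.1.2 (u q.1).2 q.2)

/-- The parallel frame along a radial lift, lifted to `ker L₀`. -/
def parA (z : E) (w : ℝ × ℝ) (r : ℝ) : E :=
  (D.secFrame z w r).1 • D.hA (D.sec z w r) + (D.secFrame z w r).2 • D.hB (D.sec z w r)

/-- The rotated parallel frame along a radial lift, lifted to `ker L₀`. -/
def parB (z : E) (w : ℝ × ℝ) (r : ℝ) : E :=
  -(D.secFrame z w r).2 • D.hA (D.sec z w r) + (D.secFrame z w r).1 • D.hB (D.sec z w r)

variable {u : ℝ × E → ℝ × (ℝ × ℝ)}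

lemma smooth_par : (ContDiff ℝ ∞ fun p : E × (ℝ × ℝ) × ℝ => D.parA p.1 p.2.1 p.2.2) ∧
    ContDiff ℝ ∞ fun p : E × (ℝ × ℝ) × ℝ => D.parB p.1 p.2.1 p.2.2 := by
  have h1 := D.smooth_sec
  have h2 := D.smooth_secFrame
  have h3 := D.smooth_hA.comp h1
  have h4 := D.smooth_hB.comp h1
  have h5 := contDiff_fst.comp h2
  have h6 := contDiff_snd.comp h2
  exact ⟨(h5.smul h3).add (h6.smul h4), (h6.neg.smul h3).add (h5.smul h4)⟩

lemma smooth_orbStrip (hu : ContDiff ℝ ∞ u) : ContDiff ℝ ∞ (D.orbStrip u) := by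
  have h0 : ContDiff ℝ ∞ fun q : (ℝ × E) × ℝ => u q.1 := hu.comp contDiff_fst
  have h1 : ContDiff ℝ ∞ fun q : (ℝ × E) × ℝ => D.F q.1.1 q.1.2 := D.smooth_F.comp contDiff_fst
  refine ContDiff.prodMk (by fun_prop) (D.smooth_psi.comp
    (g := fun p : ℝ × ℝ × E => D.psi p.1 p.2.1 p.2.2)
    (f := fun q : (ℝ × E) × ℝ => (q.1.1, (u q.1).1 * q.2, D.F q.1.1 q.1.2)) ?_)
  fun_prop

lemma smooth_sec_return (hu : ContDiff ℝ ∞ u) :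
    ContDiff ℝ ∞ fun q : (ℝ × E) × ℝ => (q.1.2, (u q.1).2, q.2) := by
  have h0 : ContDiff ℝ ∞ fun q : (ℝ × E) × ℝ => u q.1 := hu.comp contDiff_fst
  fun_prop

lemma smooth_secStrip (hu : ContDiff ℝ ∞ u) : ContDiff ℝ ∞ (D.secStrip u) := by
  have h1 := D.smooth_sec.comp (smooth_sec_return hu)
  exact D.smooth_FF.comp ((contDiff_fst.comp contDiff_fst).prodMk h1)

/-- The flux of `dλ` through the strip swept by a radial lift, for the component of the lift along
a frame vector `e`; the argument is a point of `ℝ × N` with the velocity of a variation. -/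
def flux (u : ℝ × E → ℝ × (ℝ × ℝ)) (e : E → ℝ × ℝ → ℝ → E) (q : (ℝ × E) × (ℝ × E)) : ℝ :=
  ∫ r in (0 : ℝ)..1, extD D.Lam (D.secStrip u (q.1, r)) (fderiv ℝ (D.secStrip u) (q.1, r) (q.2, 0))
    (fderiv ℝ D.FF (q.1.1, D.sec q.1.2 (u q.1).2 r) (0, e q.1.2 (u q.1).2 r))

lemma smooth_flux (hu : ContDiff ℝ ∞ u) {e : E → ℝ × ℝ → ℝ → E}
    (he : ContDiff ℝ ∞ fun p : E × (ℝ × ℝ) × ℝ => e p.1 p.2.1 p.2.2) :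
    ContDiff ℝ ∞ (D.flux u e) := by
  refine contDiff_parametricIntegral (g := fun x : ((ℝ × E) × (ℝ × E)) × ℝ =>
    extD D.Lam (D.secStrip u (x.1.1, x.2)) (fderiv ℝ (D.secStrip u) (x.1.1, x.2) (x.1.2, 0))
    (fderiv ℝ D.FF (x.1.1.1, D.sec x.1.1.2 (u x.1.1).2 x.2) (0, e x.1.1.2 (u x.1.1).2 x.2))) ?_
  have hp : ContDiff ℝ ∞ fun x : ((ℝ × E) × (ℝ × E)) × ℝ => (x.1.1, x.2) := by fun_prop
  have hs := D.smooth_secStrip hu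
  have hds : ContDiff ℝ ∞ (fderiv ℝ (D.secStrip u)) := hs.fderiv_right (by simp)
  have hdF : ContDiff ℝ ∞ (fderiv ℝ D.FF) := D.smooth_FF.fderiv_right (by simp)
  have h1 := (D.smooth_sec.comp (smooth_sec_return hu)).comp hp
  have h2 := (he.comp (smooth_sec_return hu)).comp hp
  refine contDiff_extD D.smooth_Lam (hs.comp hp) ((hds.comp hp).clm_apply (by fun_prop))
    ((hdF.comp (ContDiff.prodMk (by fun_prop) h1)).clm_apply (contDiff_const.prodMk h2))

/-- The strips over `p` stay in the region where `dL₀ = - f L ∧ B`. -/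
def StripsIn (u : ℝ × E → ℝ × (ℝ × ℝ)) (p : ℝ × E) : Prop :=
  (∀ r ∈ Icc (0 : ℝ) 1, (D.orbStrip u (p, r)).2 ∈ D.U) ∧
    ∀ x ∈ Icc (0 : ℝ) 1 ×ˢ Icc (0 : ℝ) 1, D.F (x.2 * p.1) (D.sec p.2 (u p).2 x.1) ∈ D.U

lemma eventually_stripsIn (hu : ContDiff ℝ ∞ u) {p : ℝ × E} (hp : D.StripsIn u p) :
    ∀ᶠ q in 𝓝 p, D.StripsIn u q := by
  refine Filter.Eventually.and ?_ ?_
  · refine isCompact_Icc.exists_nhds_forall_of_eventually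
      (P := fun x : ℝ × (ℝ × E) => (D.orbStrip u (x.2, x.1)).2 ∈ D.U) fun r hr => ?_
    have hc : Continuous fun x : ℝ × (ℝ × E) => (D.orbStrip u (x.2, x.1)).2 :=
      continuous_snd.comp ((D.smooth_orbStrip hu).continuous.comp (by fun_prop))
    exact hc.continuousAt.eventually (D.isOpen_U.mem_nhds (hp.1 r hr))
  · refine (isCompact_Icc.prod isCompact_Icc).exists_nhds_forall_of_eventually
      (P := fun y : (ℝ × ℝ) × (ℝ × E) =>
        D.F (y.1.2 * y.2.1) (D.sec y.2.2 (u y.2).2 y.1.1) ∈ D.U) fun x hx => ?_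
    have h1 := D.smooth_sec.continuous.comp ((smooth_sec_return hu).continuous.comp
      (by fun_prop : Continuous fun y : (ℝ × ℝ) × (ℝ × E) => (y.2, y.1.1)))
    have hc : Continuous fun y : (ℝ × ℝ) × (ℝ × E) =>
        D.F (y.1.2 * y.2.1) (D.sec y.2.2 (u y.2).2 y.1.1) :=
      D.smooth_F.continuous.comp (Continuous.prodMk (by fun_prop) h1)
    exact hc.continuousAt.eventually (D.isOpen_U.mem_nhds (hp.2 x hx))

variable {D} {m₁ : ℝ}

lemma IsReturn.abs_lt (h : D.IsReturn u m₁) {m : ℝ} (hm : |m| < m₁) : |m| < D.mb :=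
  hm.trans_le h.le

lemma IsReturn.stripsIn_zero (h : D.IsReturn u m₁) {z : E} (hz : z ∈ D.N) (hU : z ∈ D.U) :
    D.StripsIn u (0, z) := by
  have h0 : D.sec z (0, 0) = fun _ => z := funext fun r => sec_zero hz r
  refine ⟨fun r _ => ?_, fun x _ => ?_⟩
  · simp only [orbStrip, F_zero, psi_zero_left hz]
    exact D.rot_mem_U z hz hU _
  · simpa [h.zero z hz, h0] using hU

/-- The first variation of the return time, along a curve in `ℝ × N`. The orbits and the radial lifts
through the points of the curve sweep two surfaces with the same boundary; the integral of `λ` is the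
return time over the former paths and zero over the latter, and Stokes' theorem on both surfaces
gives the formula. The term with `rate` comes from the dependence of `λ_m` on `m`. -/
theorem IsReturn.first_variation (h : D.IsReturn u m₁) {c : ℝ → ℝ × E} (hc : ContDiff ℝ ∞ c)
    (hN : ∀ s, (c s).2 ∈ D.N) (hm : |(c 0).1| < m₁) (hU : D.StripsIn u (c 0)) :
    HasDerivAt (fun s => (u (c s)).1)
      ((deriv c 0).1 * ((u (c 0)).1 * ∫ r in (0 : ℝ)..1, D.rate (D.orbStrip u (c 0, r)))
        - ((u (c 0)).2.1 * D.flux u D.parA (c 0, deriv c 0)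
          + (u (c 0)).2.2 * D.flux u D.parB (c 0, deriv c 0))) 0 := by
  have hu := h.smooth
  have hUev : ∀ᶠ s in 𝓝 (0 : ℝ), D.StripsIn u (c s) :=
    hc.continuous.continuousAt.eventually (D.eventually_stripsIn hu hU)
  have hmev : ∀ᶠ s in 𝓝 (0 : ℝ), |(c s).1| < m₁ :=
    (continuous_abs.comp (continuous_fst.comp hc.continuous)).continuousAt.eventually_lt
      continuousAt_const hm
  have hdc : HasDerivAt c (deriv c 0) 0 := (hc.differentiable (by simp) 0).hasDerivAt
  have hτ : HasDerivAt (fun s => (u (c s)).1) (deriv (fun s => (u (c s)).1) 0) 0 :=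
    ((contDiff_fst.comp (hu.comp hc)).differentiable (by simp) 0).hasDerivAt
  -- the two surfaces
  let Ψ₁ : ℝ × ℝ → ℝ × E := fun p => D.orbStrip u (c p.1, p.2)
  let Ψ₂ : ℝ × ℝ → ℝ × E := fun p => D.secStrip u (c p.1, p.2)
  have hcp : ContDiff ℝ ∞ fun p : ℝ × ℝ => (c p.1, p.2) := by fun_prop
  have hΨ₁ : ContDiff ℝ ∞ Ψ₁ := (D.smooth_orbStrip hu).comp hcp
  have hΨ₂ : ContDiff ℝ ∞ Ψ₂ := (D.smooth_secStrip hu).comp hcp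
  have hd₁ : ∀ p, DifferentiableAt ℝ Ψ₁ p := fun p => hΨ₁.differentiable (by simp) p
  have hd₂ : ∀ p, DifferentiableAt ℝ Ψ₂ p := fun p => hΨ₂.differentiable (by simp) p
  have hr₁ : ∀ s r, fderiv ℝ Ψ₁ (s, r) (0, 1) = (u (c s)).1 • D.reebField (Ψ₁ (s, r)) := by
    intro s r
    refine (fderiv_apply_zero_one (hd₁ (s, r))).unique ?_
    have h1 := (D.hasDerivAt_psi' (c s).1 ((u (c s)).1 * r) (D.F (c s).1 (c s).2)).scomp r
      ((hasDerivAt_id r).const_mul (u (c s)).1)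
    refine ((hasDerivAt_const r (c s).1).prodMk h1).congr_deriv ?_
    refine Prod.ext (by simp [reebField_fst]) ?_
    simp only [mul_one]
    rfl
  have hr₂ : ∀ s r, |(c s).1| < m₁ → fderiv ℝ Ψ₂ (s, r) (0, 1)
      = fderiv ℝ D.FF ((c s).1, D.sec (c s).2 (u (c s)).2 r)
        (0, deriv (D.sec (c s).2 (u (c s)).2) r) ∧
      deriv (D.sec (c s).2 (u (c s)).2) r
        = (u (c s)).2.1 • D.parA (c s).2 (u (c s)).2 r
          + (u (c s)).2.2 • D.parB (c s).2 (u (c s)).2 r := by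
    intro s r hs
    have h1 := hasDerivAt_sec (hN s) (h.norm_le _ hs _ (hN s)) r
    refine ⟨(fderiv_apply_zero_one (hd₂ (s, r))).unique ?_, h1.deriv⟩
    have h2 : HasDerivAt (fun r => ((c s).1, D.sec (c s).2 (u (c s)).2 r))
        (0, deriv (D.sec (c s).2 (u (c s)).2) r) r := (hasDerivAt_const r _).prodMk
          h1.differentiableAt.hasDerivAt
    exact (D.smooth_FF.differentiable (by simp) _).hasFDerivAt.comp_hasDerivAt r h2
  -- the form along the two surfaces
  have hL₁ : ∀ r ∈ Icc (0 : ℝ) 1, ∀ᶠ s in 𝓝 (0 : ℝ),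
      D.Lam (Ψ₁ (s, r)) (fderiv ℝ Ψ₁ (s, r) (0, 1)) = (u (c s)).1 := by
    intro r _
    filter_upwards [hmev] with s hs
    rw [hr₁, map_smul]
    have := Lam_reebField (D := D) (h.abs_lt hs)
      (psi_mem (F_mem (hN s) (c s).1) (c s).1 ((u (c s)).1 * r))
    change (u (c s)).1 • D.Lam ((c s).1, _) (D.reebField ((c s).1, _)) = _
    rw [this]; simp
  have hL₂ : ∀ r ∈ Icc (0 : ℝ) 1, ∀ᶠ s in 𝓝 (0 : ℝ),
      D.Lam (Ψ₂ (s, r)) (fderiv ℝ Ψ₂ (s, r) (0, 1)) = 0 := by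
    intro r hr
    filter_upwards [hmev, hUev] with s hs hsU
    obtain ⟨h1, h2⟩ := hr₂ s r hs
    have hsec : ContDiff ℝ ∞ (D.sec (c s).2 (u (c s)).2) :=
      D.smooth_sec.comp (contDiff_const.prodMk (contDiff_const.prodMk contDiff_id))
    have h3 := pullback hsec (fun r => sec_mem (hN s) _ r) (h.abs_lt hs) r
      fun σ hσ => hsU.2 (r, σ) ⟨hr, hσ⟩
    rw [h1]
    refine h3.trans ?_
    obtain ⟨-, -, a3⟩ := L_hA (D := D) (sec_mem (hN s) (u (c s)).2 r)
    obtain ⟨-, -, b3⟩ := L_hB (D := D) (sec_mem (hN s) (u (c s)).2 r)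
    rw [h2]
    simp [parA, parB, a3, b3]
  have e₁ := integral_extD D.smooth_Lam hΨ₁ hτ hL₁
  have e₂ := integral_extD D.smooth_Lam hΨ₂ (hasDerivAt_const 0 (0 : ℝ)) hL₂
  -- the surfaces have the same boundary
  have hb : ∀ r, (∀ᶠ s in 𝓝 (0 : ℝ), Ψ₁ (s, r) = Ψ₂ (s, r)) →
      D.Lam (Ψ₁ (0, r)) (fderiv ℝ Ψ₁ (0, r) (1, 0))
        = D.Lam (Ψ₂ (0, r)) (fderiv ℝ Ψ₂ (0, r) (1, 0)) := by
    intro r hr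
    rw [hr.self_of_nhds, (fderiv_apply_one_zero (hd₁ (0, r))).unique
      ((fderiv_apply_one_zero (hd₂ (0, r))).congr_of_eventuallyEq hr)]
  have hb0 := hb 0 (Eventually.of_forall fun s => by simp [Ψ₁, Ψ₂, orbStrip, secStrip, FF])
  have hb1 := hb 1 (by
    filter_upwards [hmev] with s hs
    simp [Ψ₁, Ψ₂, orbStrip, secStrip, FF, ← F_phi, h.phi_eq _ hs _ (hN s)])
  -- the fluxes
  have f₁ : ∀ r ∈ uIcc (0 : ℝ) 1,
      extD D.Lam (Ψ₁ (0, r)) (fderiv ℝ Ψ₁ (0, r) (1, 0)) (fderiv ℝ Ψ₁ (0, r) (0, 1))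
        = (deriv c 0).1 * (u (c 0)).1 * D.rate (D.orbStrip u (c 0, r)) := by
    intro r hr
    rw [uIcc_of_le zero_le_one] at hr
    have h1 := fderiv_apply_one_zero (hd₁ (0, r))
    obtain ⟨a, b, e, hv⟩ := exists_eq_vec (D := D) (c := fun s => Ψ₁ (s, r)) (t := 0)
      (Eventually.of_forall fun s => psi_mem (F_mem (hN s) _) _ _) h1
    have h2 : (fderiv ℝ Ψ₁ (0, r) (1, 0)).1 = (deriv c 0).1 := by
      have h2 : HasDerivAt (fun s => (c s).1) (deriv c 0).1 0 :=
        (ContinuousLinearMap.fst ℝ ℝ E).hasFDerivAt.comp_hasDerivAt 0 hdc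
      have h3 : HasDerivAt (fun s => (c s).1) (fderiv ℝ Ψ₁ (0, r) (1, 0)).1 0 :=
        HasFDerivAt.comp_hasDerivAt (f := fun s => Ψ₁ (s, r)) 0
          (ContinuousLinearMap.fst ℝ ℝ E).hasFDerivAt h1
      exact h3.unique h2
    have h3 := extD_reebField (D := D) (h.abs_lt hm) (z := (Ψ₁ (0, r)).2)
      (psi_mem (F_mem (hN 0) _) _ _) (hU.1 r hr) (fderiv ℝ Ψ₁ (0, r) (1, 0)).1 a b e
    rw [← hv, h2] at h3
    rw [hr₁, extD_smul_right]
    rw [show D.orbStrip u (c 0, r) = ((c 0).1, (Ψ₁ (0, r)).2) from rfl,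
      mul_comm (deriv c 0).1, mul_assoc]
    exact congrArg ((u (c 0)).1 * ·) h3
  have f₂ : ∀ r, extD D.Lam (Ψ₂ (0, r)) (fderiv ℝ Ψ₂ (0, r) (1, 0)) (fderiv ℝ Ψ₂ (0, r) (0, 1))
      = (u (c 0)).2.1 * extD D.Lam (D.secStrip u (c 0, r))
          (fderiv ℝ (D.secStrip u) (c 0, r) (deriv c 0, 0))
          (fderiv ℝ D.FF ((c 0).1, D.sec (c 0).2 (u (c 0)).2 r)
            (0, D.parA (c 0).2 (u (c 0)).2 r))
        + (u (c 0)).2.2 * extD D.Lam (D.secStrip u (c 0, r))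
          (fderiv ℝ (D.secStrip u) (c 0, r) (deriv c 0, 0))
          (fderiv ℝ D.FF ((c 0).1, D.sec (c 0).2 (u (c 0)).2 r)
            (0, D.parB (c 0).2 (u (c 0)).2 r)) := by
    intro r
    obtain ⟨h1, h2⟩ := hr₂ 0 r hm
    have h3 : fderiv ℝ Ψ₂ (0, r) (1, 0) = fderiv ℝ (D.secStrip u) (c 0, r) (deriv c 0, 0) := by
      refine (fderiv_apply_one_zero (hd₂ (0, r))).unique ?_
      exact ((D.smooth_secStrip hu).differentiable (by simp) _).hasFDerivAt.comp_hasDerivAt 0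
        (hdc.prodMk (hasDerivAt_const 0 r))
    have h4 : ((0 : ℝ), deriv (D.sec (c 0).2 (u (c 0)).2) r)
        = (u (c 0)).2.1 • ((0 : ℝ), D.parA (c 0).2 (u (c 0)).2 r)
          + (u (c 0)).2.2 • ((0 : ℝ), D.parB (c 0).2 (u (c 0)).2 r) := by
      rw [h2]; ext <;> simp
    rw [h1, h3, h4, map_add, map_smul, map_smul, extD_add_right, extD_smul_right, extD_smul_right]
  rw [intervalIntegral.integral_congr f₁, intervalIntegral.integral_const_mul] at e₁
  have hint : ∀ e : E → ℝ × ℝ → ℝ → E,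
      (ContDiff ℝ ∞ fun p : E × (ℝ × ℝ) × ℝ => e p.1 p.2.1 p.2.2) →
      Continuous fun r => extD D.Lam (D.secStrip u (c 0, r))
          (fderiv ℝ (D.secStrip u) (c 0, r) (deriv c 0, 0))
          (fderiv ℝ D.FF ((c 0).1, D.sec (c 0).2 (u (c 0)).2 r)
            (0, e (c 0).2 (u (c 0)).2 r)) := by
    intro e he
    have hp : ContDiff ℝ ∞ fun r : ℝ => (c 0, r) := by fun_prop
    have hs := D.smooth_secStrip hu
    have hds : ContDiff ℝ ∞ (fderiv ℝ (D.secStrip u)) := hs.fderiv_right (by simp)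
    have hdF : ContDiff ℝ ∞ (fderiv ℝ D.FF) := D.smooth_FF.fderiv_right (by simp)
    have h1 := (D.smooth_sec.comp (smooth_sec_return hu)).comp hp
    have h2 := (he.comp (smooth_sec_return hu)).comp hp
    exact (contDiff_extD D.smooth_Lam (hs.comp hp) ((hds.comp hp).clm_apply contDiff_const)
      ((hdF.comp (contDiff_const.prodMk h1)).clm_apply (contDiff_const.prodMk h2))).continuous
  simp only [f₂] at e₂
  rw [intervalIntegral.integral_add
    (((hint _ D.smooth_par.1).const_mul _).intervalIntegrable _ _)
    (((hint _ D.smooth_par.2).const_mul _).intervalIntegrable _ _),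
    intervalIntegral.integral_const_mul, intervalIntegral.integral_const_mul] at e₂
  have e₂' : (u (c 0)).2.1 * D.flux u D.parA (c 0, deriv c 0)
      + (u (c 0)).2.2 * D.flux u D.parB (c 0, deriv c 0) = _ := e₂
  refine hτ.congr_deriv ?_
  rw [hb0, hb1] at e₁
  rw [e₂', ← mul_assoc, e₁]
  ring

end ContactData

/-! ### Expansion of the return time and its critical points -/

namespace ContactData

variable {E : Type} [NormedAddCommGroup E] [NormedSpace ℝ E] [FiniteDimensional ℝ E]
  [CompleteSpace E] {D : ContactData E} {u : ℝ × E → ℝ × (ℝ × ℝ)} {m₁ : ℝ}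

lemma fderiv_FF_zero (z ξ : E) : fderiv ℝ D.FF (0, z) (0, ξ) = (0, ξ) := by
  have h1 : HasDerivAt (fun s : ℝ => ((0 : ℝ), z + s • ξ)) (0, ξ) 0 := by
    have := ((hasDerivAt_id (0 : ℝ)).smul_const ξ).const_add z
    simp only [one_smul] at this
    exact (hasDerivAt_const (0 : ℝ) (0 : ℝ)).prodMk this
  have h2 : HasDerivAt (fun s : ℝ => D.FF (0, z + s • ξ)) (fderiv ℝ D.FF (0, z) (0, ξ)) 0 :=
    HasFDerivAt.comp_hasDerivAt (l := D.FF) 0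
      (by simpa using (D.smooth_FF.differentiable (by simp) (0, z)).hasFDerivAt) h1
  simp only [FF, F_zero] at h2
  exact h2.unique h1

lemma fderiv_FF_one (z : E) : fderiv ℝ D.FF (0, z) (1, 0) = D.grayField (0, z) := by
  have h1 : HasDerivAt (fun s : ℝ => (s, z)) (1, 0) 0 :=
    (hasDerivAt_id (0 : ℝ)).prodMk (hasDerivAt_const (0 : ℝ) z)
  have h2 := HasFDerivAt.comp_hasDerivAt (l := D.FF) 0
    (D.smooth_FF.differentiable (by simp) (0, z)).hasFDerivAt h1
  refine h2.unique (((hasDerivAt_id (0 : ℝ)).prodMk (D.hasDerivAt_F 0 z)).congr_deriv ?_)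
  exact Prod.ext (by simp [grayField_fst]) (by simp)

lemma IsReturn.secStrip_zero (h : D.IsReturn u m₁) {z : E} (hz : z ∈ D.N) (r : ℝ) :
    D.secStrip u ((0, z), r) = (0, z) := by
  have h0 : D.sec z (0, 0) r = z := sec_zero hz r
  simp [secStrip, FF, h.zero z hz, h0]

lemma parA_zero {z : E} (hz : z ∈ D.N) (r : ℝ) : D.parA z 0 r = D.hA z := by
  simp [parA, sec_zero hz, secFrame_zero hz]

lemma parB_zero {z : E} (hz : z ∈ D.N) (r : ℝ) : D.parB z 0 r = D.hB z := by
  simp [parB, sec_zero hz, secFrame_zero hz]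

lemma IsReturn.flux_zero (h : D.IsReturn u m₁) {c : ℝ → E} {ζ : E} (hc : HasDerivAt c ζ 0)
    (hN : ∀ s, c s ∈ D.N) {e : E → ℝ × ℝ → ℝ → E} {e₀ : E} (he : ∀ r, e (c 0) 0 r = e₀) :
    D.flux u e ((0, c 0), (0, ζ)) = extD D.Lam (0, c 0) (0, ζ) (0, e₀) := by
  have key : ∀ r, fderiv ℝ (D.secStrip u) ((0, c 0), r) ((0, ζ), 0) = (0, ζ) := by
    intro r
    have h1 : HasDerivAt (fun s => (((0 : ℝ), c s), r)) ((0, ζ), 0) 0 :=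
      ((hasDerivAt_const (0 : ℝ) (0 : ℝ)).prodMk hc).prodMk (hasDerivAt_const 0 r)
    have h2 := HasFDerivAt.comp_hasDerivAt (l := D.secStrip u) 0
      ((D.smooth_secStrip h.smooth).differentiable (by simp) ((0, c 0), r)).hasFDerivAt h1
    have h3 : (D.secStrip u ∘ fun s => (((0 : ℝ), c s), r)) = fun s => ((0 : ℝ), c s) :=
      funext fun s => h.secStrip_zero (hN s) r
    rw [h3] at h2
    exact h2.unique ((hasDerivAt_const (0 : ℝ) (0 : ℝ)).prodMk hc)
  have h0 : (u (0, c 0)).2 = 0 := by rw [h.zero _ (hN 0)]; rfl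
  simp [flux, key, h.secStrip_zero (hN 0), h0, sec_zero (hN 0), fderiv_FF_zero, he]

lemma vec_hA (z : E) (ν : ℝ) : (ν, D.hA z) = D.vec z ν 1 0 (D.bX z) := by
  simp [vec, hA]

lemma vec_hB (z : E) (ν : ℝ) : (ν, D.hB z) = D.vec z ν 0 1 (D.bH z) := by
  simp [vec, hB]

lemma smooth_sec_curve (z : E) (w : ℝ × ℝ) : ContDiff ℝ ∞ (D.sec z w) :=
  D.smooth_sec.comp (contDiff_const.prodMk (contDiff_const.prodMk contDiff_id))

lemma hasDerivAt_sec_A {z : E} (hz : z ∈ D.N) : HasDerivAt (D.sec z (1, 0)) (D.hA z) 0 := by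
  simpa using hasDerivAt_sec_zero hz (w := (1, 0)) (by simp)

lemma hasDerivAt_sec_B {z : E} (hz : z ∈ D.N) : HasDerivAt (D.sec z (0, 1)) (D.hB z) 0 := by
  simpa using hasDerivAt_sec_zero hz (w := (0, 1)) (by simp)

/-- The matrix of fluxes at `m = 0` is `f` times the rotation by a right angle. -/
lemma IsReturn.flux_matrix (h : D.IsReturn u m₁) {z : E} (hz : z ∈ D.N) (hU : z ∈ D.U) :
    D.flux u D.parA ((0, z), (0, D.hA z)) = 0 ∧ D.flux u D.parB ((0, z), (0, D.hA z)) = - D.f z ∧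
    D.flux u D.parA ((0, z), (0, D.hB z)) = D.f z ∧
    D.flux u D.parB ((0, z), (0, D.hB z)) = 0 := by
  have hA := hasDerivAt_sec_A hz
  have hB := hasDerivAt_sec_B hz
  have h1 := h.flux_zero hA (fun s => sec_mem hz _ s) (e := D.parA) (e₀ := D.hA z)
    (fun r => by rw [sec_zero_right]; exact parA_zero hz r)
  have h2 := h.flux_zero hA (fun s => sec_mem hz _ s) (e := D.parB) (e₀ := D.hB z)
    (fun r => by rw [sec_zero_right]; exact parB_zero hz r)
  have h3 := h.flux_zero hB (fun s => sec_mem hz _ s) (e := D.parA) (e₀ := D.hA z)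
    (fun r => by rw [sec_zero_right]; exact parA_zero hz r)
  have h4 := h.flux_zero hB (fun s => sec_mem hz _ s) (e := D.parB) (e₀ := D.hB z)
    (fun r => by rw [sec_zero_right]; exact parB_zero hz r)
  rw [sec_zero_right] at h1 h2 h3 h4
  rw [h1, h2, h3, h4]
  simp only [vec_hA, vec_hB]
  rw [extD_Lam hz hU, extD_Lam hz hU, extD_Lam hz hU, extD_Lam hz hU]
  refine ⟨?_, ?_, ?_, ?_⟩ <;> ring

/-- If the return direction vanishes, the return time is critical. -/
lemma IsReturn.hasDerivAt_of_direction_zero (h : D.IsReturn u m₁) {m : ℝ} (hm : |m| < m₁)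
    {c : ℝ → E} (hc : ContDiff ℝ ∞ c) (hN : ∀ s, c s ∈ D.N) (hU : D.StripsIn u (m, c 0))
    (hW : (u (m, c 0)).2 = 0) : HasDerivAt (fun s => (u (m, c s)).1) 0 0 := by
  have h1 := h.first_variation (c := fun s => (m, c s)) (contDiff_const.prodMk hc) hN hm hU
  have h2 : deriv (fun s => (m, c s)) 0 = (0, deriv c 0) :=
    ((hasDerivAt_const (0 : ℝ) m).prodMk (hc.differentiable (by simp) 0).hasDerivAt).deriv
  simpa [h2, hW] using h1

lemma IsReturn.fderiv_time (h : D.IsReturn u m₁) {m : ℝ} (hm : |m| < m₁)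
    {c : ℝ → E} {ζ : E} (hc : ContDiff ℝ ∞ c) (hζ : HasDerivAt c ζ 0) (hN : ∀ s, c s ∈ D.N)
    (hU : D.StripsIn u (m, c 0)) :
    fderiv ℝ (fun p => (u p).1) (m, c 0) (0, ζ)
      = -((u (m, c 0)).2.1 * D.flux u D.parA ((m, c 0), (0, ζ))
        + (u (m, c 0)).2.2 * D.flux u D.parB ((m, c 0), (0, ζ))) := by
  have h1 := h.first_variation (c := fun s => (m, c s)) (contDiff_const.prodMk hc) hN hm hU
  have h2 : HasDerivAt (fun s => (m, c s)) (0, ζ) 0 := (hasDerivAt_const (0 : ℝ) m).prodMk hζ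
  have hT : ContDiff ℝ ∞ fun p => (u p).1 := contDiff_fst.comp h.smooth
  have h3 := HasFDerivAt.comp_hasDerivAt (l := fun p => (u p).1) 0
    (hT.differentiable (by simp) (m, c 0)).hasFDerivAt h2
  rw [h2.deriv] at h1
  refine (h3.unique h1).trans ?_
  simp

/-- Critical points of the return time have vanishing return direction: by the first variation the
derivatives along the section are a linear map of the direction, which is invertible near `m = 0`
because its value there is `f` times a rotation. -/
lemma IsReturn.eventually_direction_zero (h : D.IsReturn u m₁) {z : E} (hz : z ∈ D.N)
    (hU : z ∈ D.U) : ∀ᶠ p in 𝓝 ((0 : ℝ), z), p.2 ∈ D.N →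
      fderiv ℝ (fun p => (u p).1) p (0, D.hA p.2) = 0 →
      fderiv ℝ (fun p => (u p).1) p (0, D.hB p.2) = 0 → (u p).2 = 0 := by
  have hA : ContDiff ℝ ∞ fun p : ℝ × E => (p, ((0 : ℝ), D.hA p.2)) :=
    contDiff_id.prodMk (contDiff_const.prodMk (D.smooth_hA.comp contDiff_snd))
  have hB : ContDiff ℝ ∞ fun p : ℝ × E => (p, ((0 : ℝ), D.hB p.2)) :=
    contDiff_id.prodMk (contDiff_const.prodMk (D.smooth_hB.comp contDiff_snd))
  have sA := D.smooth_flux h.smooth D.smooth_par.1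
  have sB := D.smooth_flux h.smooth D.smooth_par.2
  let det : ℝ × E → ℝ := fun p =>
    D.flux u D.parA (p, (0, D.hA p.2)) * D.flux u D.parB (p, (0, D.hB p.2))
      - D.flux u D.parB (p, (0, D.hA p.2)) * D.flux u D.parA (p, (0, D.hB p.2))
  have hdet : Continuous det := (((sA.comp hA).mul (sB.comp hB)).sub
    ((sB.comp hA).mul (sA.comp hB))).continuous
  have hdet0 : det (0, z) ≠ 0 := by
    obtain ⟨h1, h2, h3, h4⟩ := h.flux_matrix hz hU
    simp only [det, h1, h2, h3, h4]
    have := D.f_pos z hz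
    nlinarith [mul_pos this this]
  have hm : ∀ᶠ p : ℝ × E in 𝓝 (0, z), |p.1| < m₁ :=
    (continuous_abs.comp continuous_fst).continuousAt.eventually_lt continuousAt_const
      (by simpa using h.pos)
  filter_upwards [hm, D.eventually_stripsIn h.smooth (h.stripsIn_zero hz hU),
    hdet.continuousAt.eventually_ne hdet0] with p hp hpU hpd hpN e1 e2
  have f1 := h.fderiv_time hp (smooth_sec_curve p.2 (1, 0)) (hasDerivAt_sec_A hpN)
    (fun s => sec_mem hpN _ s) (by simpa using hpU)
  have f2 := h.fderiv_time hp (smooth_sec_curve p.2 (0, 1)) (hasDerivAt_sec_B hpN)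
    (fun s => sec_mem hpN _ s) (by simpa using hpU)
  simp only [sec_zero_right, Prod.mk.eta] at f1 f2
  rw [e1] at f1
  rw [e2] at f2
  have g1 : det p * (u p).2.1 = 0 := by
    simp only [det]
    linear_combination D.flux u D.parB (p, (0, D.hB p.2)) * f1
      - D.flux u D.parB (p, (0, D.hA p.2)) * f2
  have g2 : det p * (u p).2.2 = 0 := by
    simp only [det]
    linear_combination D.flux u D.parA (p, (0, D.hA p.2)) * f2
      - D.flux u D.parA (p, (0, D.hB p.2)) * f1
  exact Prod.ext ((mul_eq_zero.1 g1).resolve_left hpd) ((mul_eq_zero.1 g2).resolve_left hpd)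

/-- The fluxes in the direction of the parameter at `m = 0`. -/
lemma IsReturn.flux_param (h : D.IsReturn u m₁) {z : E} (hz : z ∈ D.N) (hU : z ∈ D.U)
    {υ : ℝ × ℝ} (hυ : HasDerivAt (fun m => (u (m, z)).2) υ 0) :
    D.flux u D.parA ((0, z), (1, 0)) = D.f z * υ.2 / 2 ∧
    D.flux u D.parB ((0, z), (1, 0)) = -(D.f z * υ.1 / 2) := by
  have h0 : (u (0, z)).2 = 0 := by rw [h.zero _ hz]; rfl
  have hmb : |(0 : ℝ)| < D.mb := by simpa using D.mb_pos
  have key : ∀ r, fderiv ℝ (D.secStrip u) ((0, z), r) ((1, 0), 0)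
      = D.vec z 1 (r * υ.1) (r * υ.2 - (D.f z)⁻¹)
        (r * υ.1 * D.bX z + (r * υ.2 - (D.f z)⁻¹) * D.bH z) := by
    intro r
    have h1 : HasDerivAt (fun s : ℝ => ((s, z), r)) ((1, 0), 0) 0 :=
      ((hasDerivAt_id (0 : ℝ)).prodMk (hasDerivAt_const (0 : ℝ) z)).prodMk (hasDerivAt_const 0 r)
    have h2 := HasFDerivAt.comp_hasDerivAt (l := D.secStrip u) 0
      ((D.smooth_secStrip h.smooth).differentiable (by simp) ((0, z), r)).hasFDerivAt h1
    have hd : DifferentiableAt ℝ (fun w => D.sec z w r) 0 :=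
      (D.smooth_sec.comp (contDiff_const.prodMk (contDiff_id.prodMk contDiff_const))
        |>.differentiable (by simp)) 0
    have h3 : HasDerivAt (fun s => D.sec z (u (s, z)).2 r)
        (r • (υ.1 • D.hA z + υ.2 • D.hB z)) 0 := by
      rw [← fderiv_sec_zero hz r υ]
      exact HasFDerivAt.comp_hasDerivAt (l := fun w => D.sec z w r) 0
        (by rw [h0]; exact hd.hasFDerivAt) hυ
    have h4 : HasDerivAt (fun s : ℝ => D.FF (s, D.sec z (u (s, z)).2 r))
        (fderiv ℝ D.FF (0, z) (1, r • (υ.1 • D.hA z + υ.2 • D.hB z))) 0 :=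
      HasFDerivAt.comp_hasDerivAt (l := D.FF) 0
        (by
          simp only [h0, sec_zero hz]
          exact (D.smooth_FF.differentiable (by simp) (0, z)).hasFDerivAt)
        ((hasDerivAt_id (0 : ℝ)).prodMk h3)
    rw [h2.unique h4, show ((1 : ℝ), r • (υ.1 • D.hA z + υ.2 • D.hB z))
      = (1, 0) + (0, r • (υ.1 • D.hA z + υ.2 • D.hB z)) by simp, map_add, fderiv_FF_one,
      fderiv_FF_zero, grayField_eq hmb hz, dens_zero]
    refine Prod.ext (by simp [vec]) ?_
    simp only [vec, hA, hB, Prod.snd_add]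
    module
  have i1 : ∫ r in (0 : ℝ)..1, D.f z * υ.2 * r = D.f z * υ.2 / 2 := by
    rw [intervalIntegral.integral_const_mul, integral_id]; ring
  have i2 : ∫ r in (0 : ℝ)..1, -(D.f z * υ.1) * r = -(D.f z * υ.1 / 2) := by
    rw [intervalIntegral.integral_const_mul, integral_id]; ring
  have hf := (D.f_pos z hz).ne'
  constructor
  · rw [← i1]
    refine intervalIntegral.integral_congr fun r _ => ?_
    simp only [key, h.secStrip_zero hz, h0, sec_zero hz, fderiv_FF_zero, parA_zero hz]
    rw [vec_hA, extD_Lam hz hU]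
    field_simp
    ring
  · rw [← i2]
    refine intervalIntegral.integral_congr fun r _ => ?_
    simp only [key, h.secStrip_zero hz, h0, sec_zero hz, fderiv_FF_zero, parB_zero hz]
    rw [vec_hB, extD_Lam hz hU]
    field_simp
    ring

/-- Hadamard's lemma in the first variable. -/
lemma exists_eq_add_mul {g : ℝ × E → ℝ} (hg : ContDiff ℝ ∞ g) : ∃ k : ℝ × E → ℝ,
    ContDiff ℝ ∞ k ∧ ∀ m z, g (m, z) = g (0, z) + m * k (m, z) := by
  have hd : ContDiff ℝ ∞ (fderiv ℝ g) := hg.fderiv_right (by simp)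
  have hk : ContDiff ℝ ∞ fun x : (ℝ × E) × ℝ => fderiv ℝ g (x.2 * x.1.1, x.1.2) (1, 0) :=
    (hd.comp (by fun_prop : ContDiff ℝ ∞ fun x : (ℝ × E) × ℝ => (x.2 * x.1.1, x.1.2))).clm_apply
      contDiff_const
  refine ⟨fun p => ∫ s in (0 : ℝ)..1, fderiv ℝ g (s * p.1, p.2) (1, 0),
    contDiff_parametricIntegral hk, fun m z => ?_⟩
  have h1 : ∀ s ∈ uIcc (0 : ℝ) 1, HasDerivAt (fun s => g (s * m, z))
      (m * fderiv ℝ g (s * m, z) (1, 0)) s := by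
    intro s _
    have h2 : HasDerivAt (fun s : ℝ => (s * m, z)) (m, 0) s := by
      simpa using ((hasDerivAt_id s).mul_const m).prodMk (hasDerivAt_const s z)
    have h3 := HasFDerivAt.comp_hasDerivAt (l := g) s
      (hg.differentiable (by simp) (s * m, z)).hasFDerivAt h2
    refine h3.congr_deriv ?_
    rw [show (m, (0 : E)) = m • ((1 : ℝ), (0 : E)) by simp, map_smul, smul_eq_mul]
  have hcont : Continuous fun s : ℝ => fderiv ℝ g (s * m, z) (1, 0) :=
    hk.continuous.comp (by fun_prop : Continuous fun s : ℝ => (((m, z) : ℝ × E), s))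
  have h4 := intervalIntegral.integral_eq_sub_of_hasDerivAt h1
    ((continuous_const.mul hcont).intervalIntegrable _ _)
  rw [intervalIntegral.integral_const_mul] at h4
  simp only [one_mul, zero_mul] at h4
  linarith

/-- The expansion `t = 2π + m² k`, with `k = π / f` at `m = 0`. -/
theorem IsReturn.exists_expansion (h : D.IsReturn u m₁) : ∃ k : ℝ × E → ℝ, ContDiff ℝ ∞ k ∧
    ∀ z ∈ D.N, z ∈ D.U → k (0, z) = Real.pi / D.f z ∧
      ∀ m, (u (m, z)).1 = 2 * Real.pi + m ^ 2 * k (m, z) := by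
  have hT : ContDiff ℝ ∞ fun p => (u p).1 := contDiff_fst.comp h.smooth
  obtain ⟨k₁, hk₁, e₁⟩ := exists_eq_add_mul hT
  obtain ⟨k₂, hk₂, e₂⟩ := exists_eq_add_mul hk₁
  refine ⟨k₂, hk₂, fun z hz hU => ?_⟩
  have hline : ∀ m : ℝ, HasDerivAt (fun m => (m, z)) ((1 : ℝ), (0 : E)) m := fun m =>
    (hasDerivAt_id m).prodMk (hasDerivAt_const m z)
  -- the derivative of the return time in the parameter, where `K` is the mean of `rate / m`
  let K : ℝ × E → ℝ := fun p => ∫ r in (0 : ℝ)..1,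
    D.chi (D.orbStrip u (p, r)) • (D.dens (D.orbStrip u (p, r)))⁻¹
  have hK : ContDiff ℝ ∞ K := contDiff_parametricIntegral
    (g := fun q => D.chi (D.orbStrip u q) • (D.dens (D.orbStrip u q))⁻¹)
    ((D.contDiff_chi_smul D.contDiffOn_inv_dens).comp (D.smooth_orbStrip h.smooth))
  let T' : ℝ → ℝ := fun m => (u (m, z)).1 * (m * K (m, z))
    - ((u (m, z)).2.1 * D.flux u D.parA ((m, z), (1, 0))
      + (u (m, z)).2.2 * D.flux u D.parB ((m, z), (1, 0)))
  have hTm : ∀ᶠ m in 𝓝 (0 : ℝ), HasDerivAt (fun m => (u (m, z)).1) (T' m) m := by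
    have hm : ∀ᶠ m : ℝ in 𝓝 0, |m| < m₁ := by
      filter_upwards [Metric.ball_mem_nhds (0 : ℝ) h.pos] with m hm using by simpa using hm
    have hs : ∀ᶠ m : ℝ in 𝓝 0, D.StripsIn u (m, z) :=
      (hline 0).continuousAt.eventually (D.eventually_stripsIn h.smooth (h.stripsIn_zero hz hU))
    filter_upwards [hm, hs] with m hm hs
    have h1 := h.first_variation (c := fun s => (m + s, z)) (by fun_prop) (fun _ => hz)
      (by simpa using hm) (by simpa using hs)
    have h2 : HasDerivAt (fun s => (m + s, z)) ((1 : ℝ), (0 : E)) 0 :=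
      ((hasDerivAt_id (0 : ℝ)).const_add m).prodMk (hasDerivAt_const 0 z)
    have h3 : ∀ r, D.rate (D.orbStrip u ((m, z), r))
        = m * (D.chi (D.orbStrip u ((m, z), r)) • (D.dens (D.orbStrip u ((m, z), r)))⁻¹) :=
      fun r => rfl
    simp only [h2.deriv, add_zero, one_mul, h3, intervalIntegral.integral_const_mul] at h1
    have h4 : HasDerivAt (fun x : ℝ => x - m) 1 m := (hasDerivAt_id m).sub_const m
    have h5 := HasDerivAt.comp (h₂ := fun s => (u (m + s, z)).1) m (by rwa [sub_self]) h4
    rw [mul_one] at h5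
    refine h5.congr_of_eventuallyEq (Eventually.of_forall fun x => ?_)
    simp
  have hu : HasDerivAt (fun m => (u (m, z)).2) (fderiv ℝ u (0, z) (1, 0)).2 0 :=
    (ContinuousLinearMap.snd ℝ ℝ (ℝ × ℝ)).hasFDerivAt.comp_hasDerivAt 0
      (HasFDerivAt.comp_hasDerivAt (l := u) 0
        (h.smooth.differentiable (by simp) (0, z)).hasFDerivAt (hline 0))
  set υ := (fderiv ℝ u (0, z) (1, 0)).2 with hυ
  obtain ⟨fA, fB⟩ := h.flux_param hz hU hu
  have hf := (D.f_pos z hz).ne'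
  have hK0 : K (0, z) = (D.f z)⁻¹ := by
    have : ∀ r, D.chi (D.orbStrip u ((0, z), r)) • (D.dens (D.orbStrip u ((0, z), r)))⁻¹
        = (D.f z)⁻¹ := by
      intro r
      simp only [orbStrip, F_zero, psi_zero_left hz, dens_zero, D.f_rot z hz]
      rw [chi_eq (by simpa using D.mb_pos) (D.rot_mem z hz _), one_smul]
    simp only [K, this]
    simp
  have hu0 := h.zero z hz
  have hT'0 : HasDerivAt T' (2 * Real.pi / D.f z) 0 := by
    have d1 : DifferentiableAt ℝ (fun m => (u (m, z)).1) 0 :=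
      (hT.comp (contDiff_id.prodMk contDiff_const)).differentiable (by simp) 0
    have d2 : DifferentiableAt ℝ (fun m => K (m, z)) 0 :=
      (hK.comp (contDiff_id.prodMk contDiff_const)).differentiable (by simp) 0
    have d3 : DifferentiableAt ℝ (fun m : ℝ => D.flux u D.parA ((m, z), (1, 0))) 0 :=
      ((D.smooth_flux h.smooth D.smooth_par.1).comp ((contDiff_id.prodMk contDiff_const).prodMk
        contDiff_const)).differentiable (by simp) 0
    have d4 : DifferentiableAt ℝ (fun m : ℝ => D.flux u D.parB ((m, z), (1, 0))) 0 :=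
      ((D.smooth_flux h.smooth D.smooth_par.2).comp ((contDiff_id.prodMk contDiff_const).prodMk
        contDiff_const)).differentiable (by simp) 0
    have w1 := (ContinuousLinearMap.fst ℝ ℝ ℝ).hasFDerivAt.comp_hasDerivAt 0 hu
    have w2 := (ContinuousLinearMap.snd ℝ ℝ ℝ).hasFDerivAt.comp_hasDerivAt 0 hu
    have := (d1.hasDerivAt.mul ((hasDerivAt_id (0 : ℝ)).mul d2.hasDerivAt)).sub
      ((w1.mul d3.hasDerivAt).add (w2.mul d4.hasDerivAt))
    refine this.congr_deriv ?_
    simp [hu0, hK0, fA, fB]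
    field_simp
    ring
  -- comparison with the Hadamard expansion
  have e3 : ∀ m, (u (m, z)).1 = 2 * Real.pi + m * (k₁ (0, z) + m * k₂ (m, z)) := fun m => by
    have h1 := e₁ m z
    rw [e₂ m z] at h1
    simp only [hu0] at h1
    exact h1
  have dk : ∀ m, HasDerivAt (fun m => k₂ (m, z)) (fderiv ℝ k₂ (m, z) (1, 0)) m := fun m =>
    HasFDerivAt.comp_hasDerivAt (l := k₂) m
      (hk₂.differentiable (by simp) (m, z)).hasFDerivAt (hline m)
  have e4 : ∀ m, HasDerivAt (fun m => (u (m, z)).1)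
      (k₁ (0, z) + m * (2 * k₂ (m, z) + m * fderiv ℝ k₂ (m, z) (1, 0))) m := by
    intro m
    have : (fun m => (u (m, z)).1)
      = fun m => 2 * Real.pi + m * (k₁ (0, z) + m * k₂ (m, z)) := funext e3
    rw [this]
    refine (((hasDerivAt_id m).mul (((hasDerivAt_id m).mul (dk m)).const_add
      (k₁ (0, z)))).const_add (2 * Real.pi)).congr_deriv ?_
    simp; ring
  have e5 : T' =ᶠ[𝓝 0] fun m =>
      k₁ (0, z) + m * (2 * k₂ (m, z) + m * fderiv ℝ k₂ (m, z) (1, 0)) := by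
    filter_upwards [hTm] with m hm using hm.unique (e4 m)
  have hk10 : k₁ (0, z) = 0 := by
    have := e5.self_of_nhds
    simp [T', hu0] at this
    exact this.symm
  have e6 : HasDerivAt (fun m => k₁ (0, z) + m * (2 * k₂ (m, z) + m * fderiv ℝ k₂ (m, z) (1, 0)))
      (2 * k₂ (0, z)) 0 := by
    have d5 : DifferentiableAt ℝ (fun m : ℝ => fderiv ℝ k₂ (m, z) (1, 0)) 0 :=
      (((hk₂.fderiv_right (m := ∞) (by simp)).comp (contDiff_id.prodMk contDiff_const)).clm_apply
        contDiff_const).differentiable (by simp) 0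
    refine (((hasDerivAt_id (0 : ℝ)).mul (((dk 0).const_mul 2).add
      ((hasDerivAt_id (0 : ℝ)).mul d5.hasDerivAt))).const_add (k₁ (0, z))).congr_deriv ?_
    simp
  have e7 := (hT'0.congr_of_eventuallyEq e5.symm).unique e6
  refine ⟨?_, fun m => ?_⟩
  · field_simp at e7 ⊢
    linarith
  · rw [e3 m, hk10]; ring

end ContactData

/-! ### Periodic orbits of the magnetic fields -/

namespace ContactData

variable {E : Type} [NormedAddCommGroup E] [NormedSpace ℝ E] [FiniteDimensional ℝ E]
  [CompleteSpace E] {D : ContactData E} {u : ℝ × E → ℝ × (ℝ × ℝ)} {m₁ : ℝ}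

lemma exists_bounds {g : E → ℝ} (hg : Continuous g) (hpos : ∀ z ∈ D.N, 0 < g z) :
    ∃ d > 0, ∃ C > 0, ∀ z ∈ D.N, d ≤ g z ∧ g z ≤ C := by
  rcases D.N.eq_empty_or_nonempty with hN | hN
  · exact ⟨1, one_pos, 1, one_pos, by simp [hN]⟩
  · obtain ⟨a, ha, hmin⟩ := D.isCompact.exists_isMinOn hN hg.continuousOn
    obtain ⟨b, hb, hmax⟩ := D.isCompact.exists_isMaxOn hN hg.continuousOn
    exact ⟨g a, hpos a ha, g b, hpos b hb, fun z hz => ⟨hmin hz, hmax hz⟩⟩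

variable (D) in
/-- The Reeb time spent by the orbit of `w` under `mX + fV` in the time `v`. -/
def reebTime (m : ℝ) (w : E) (v : ℝ) : ℝ := ∫ x in (0 : ℝ)..v, D.dens (m, D.mag m x w)

variable (D) in
lemma continuous_dens_mag (m : ℝ) (w : E) : Continuous fun x => D.dens (m, D.mag m x w) :=
  D.smooth_dens.continuous.comp (continuous_const.prodMk (D.smooth_mag.continuous.comp
    (by fun_prop : Continuous fun x : ℝ => (m, x, w))))

lemma hasDerivAt_reebTime (m : ℝ) (w : E) (v : ℝ) :
    HasDerivAt (D.reebTime m w) (D.dens (m, D.mag m v w)) v :=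
  ((D.continuous_dens_mag m w).integral_hasStrictDerivAt 0 v).hasDerivAt

lemma continuous_reebTime (m : ℝ) (w : E) : Continuous (D.reebTime m w) :=
  continuous_iff_continuousAt.2 fun v => (hasDerivAt_reebTime m w v).continuousAt

/-- The orbits of `mX + fV` are reparametrised Reeb orbits. -/
lemma mag_eq_psi {m : ℝ} (hm : |m| < D.mb) {w : E} (hw : w ∈ D.N) (v : ℝ) :
    D.mag m v w = D.psi m (D.reebTime m w v) w := by
  obtain ⟨d, hd, C, hC, hb⟩ := exists_bounds (D := D) (g := fun z => D.dens (m, z))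
    (D.smooth_dens.continuous.comp (by fun_prop)) (fun z hz => dens_pos hm hz)
  obtain ⟨L, hL⟩ := D.isTame_reebField.2
  have hlip : ∀ t, LipschitzOnWith (C.toNNReal * L)
      (fun x => D.dens (m, D.mag m t w) • (D.reebField (m, x)).2) univ := by
    intro t
    obtain ⟨h1, h2⟩ := hb _ (mag_mem hw m t)
    refine LipschitzWith.lipschitzOnWith (LipschitzWith.of_dist_le_mul fun x y => ?_)
    have h3 : dist (D.reebField (m, x)).2 (D.reebField (m, y)).2 ≤ L * dist x y := by
      refine (le_max_right _ _).trans ((hL.dist_le_mul (m, x) (m, y)).trans_eq ?_)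
      rw [Prod.dist_eq]; simp
    rw [dist_smul₀, Real.norm_eq_abs, abs_of_pos (hd.trans_le h1), NNReal.coe_mul,
      Real.coe_toNNReal C hC.le, mul_assoc]
    exact mul_le_mul h2 h3 dist_nonneg hC.le
  refine congrFun (ODE_solution_unique_univ (t₀ := 0) hlip
    (f := fun v => D.mag m v w) (g := fun v => D.psi m (D.reebTime m w v) w)
    (fun t => ⟨?_, mem_univ _⟩) (fun t => ⟨?_, mem_univ _⟩) (by simp [reebTime])) v
  · refine (hasDerivAt_mag hm hw t).congr_deriv ?_
    have hz := mag_mem hw m t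
    rw [reebField_snd hm hz, smul_smul, mul_inv_cancel₀ (dens_pos hm hz).ne', one_smul]
  · exact (D.hasDerivAt_psi' m (D.reebTime m w t) w).scomp t (hasDerivAt_reebTime m w t)

/-- Integral curves of `mX + fV` in `N` are given by the flow. -/
lemma eq_mag {m : ℝ} (hm : |m| < D.mb) {c : ℝ → E} (hN : ∀ t, c t ∈ D.N)
    (hc : ∀ t, HasDerivAt c (m • D.X (c t) + D.f (c t) • D.V (c t)) t) (t : ℝ) :
    c t = D.mag m t (c 0) := by
  have h := D.isTame_magField.eq_flow (c := fun t => (m, c t)) (fun t => by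
    refine ((hasDerivAt_const t m).prodMk (hc t)).congr_deriv ?_
    simp [magField, chi_eq hm (hN t)]) t
  exact congrArg Prod.snd h

lemma reebTime_bounds {m d C : ℝ} {w : E} (hw : w ∈ D.N)
    (hb : ∀ z ∈ D.N, d ≤ D.dens (m, z) ∧ D.dens (m, z) ≤ C) {v : ℝ} (hv : 0 ≤ v) :
    d * v ≤ D.reebTime m w v ∧ D.reebTime m w (-v) ≤ -(d * v) := by
  have hint : ∀ a b, IntervalIntegrable (fun x => D.dens (m, D.mag m x w)) MeasureTheory.volume a b :=
    fun a b => (D.continuous_dens_mag m w).intervalIntegrable a b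
  constructor
  · have := intervalIntegral.integral_mono_on hv (by simp : IntervalIntegrable (fun _ => d) _ 0 v)
      (hint 0 v) fun x _ => (hb _ (mag_mem hw m x)).1
    simpa [reebTime, mul_comm] using this
  · have := intervalIntegral.integral_mono_on (neg_nonpos.2 hv)
      (by simp : IntervalIntegrable (fun _ => d) _ (-v) 0)
      (hint (-v) 0) fun x _ => (hb _ (mag_mem hw m x)).1
    rw [reebTime, intervalIntegral.integral_symm]
    simp at this
    linarith

lemma reebTime_surjective {m : ℝ} (hm : |m| < D.mb) {w : E} (hw : w ∈ D.N) :
    Function.Surjective (D.reebTime m w) := by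
  obtain ⟨d, hd, C, -, hb⟩ := exists_bounds (D := D) (g := fun z => D.dens (m, z))
    (D.smooth_dens.continuous.comp (by fun_prop)) (fun z hz => dens_pos hm hz)
  refine (continuous_reebTime m w).surjective ?_ ?_
  · refine tendsto_atTop_mono' _ ?_ (tendsto_id.const_mul_atTop hd)
    filter_upwards [eventually_ge_atTop 0] with v hv using (reebTime_bounds hw hb hv).1
  · refine tendsto_atBot_mono' _ ?_ (tendsto_id.const_mul_atBot hd)
    filter_upwards [eventually_le_atBot 0] with v hv
    have := (reebTime_bounds hw hb (neg_nonneg.2 hv)).2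
    simpa using this

lemma reebTime_pos {m : ℝ} (hm : |m| < D.mb) {w : E} (hw : w ∈ D.N) {v : ℝ}
    (hv : 0 < D.reebTime m w v) : 0 < v := by
  obtain ⟨d, hd, C, -, hb⟩ := exists_bounds (D := D) (g := fun z => D.dens (m, z))
    (D.smooth_dens.continuous.comp (by fun_prop)) (fun z hz => dens_pos hm hz)
  by_contra! h
  have h1 := (reebTime_bounds hw hb (neg_nonneg.2 h)).2
  rw [neg_neg] at h1
  nlinarith

/-- A closed Reeb orbit is a closed orbit of `mX + fV`. -/
lemma exists_period {m : ℝ} (hm : |m| < D.mb) {w : E} (hw : w ∈ D.N) {t : ℝ} (ht : 0 < t)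
    (hp : D.psi m t w = w) : ∃ T > 0, D.reebTime m w T = t ∧ D.mag m T w = w := by
  obtain ⟨T, hT⟩ := reebTime_surjective hm hw t
  exact ⟨T, reebTime_pos hm hw (hT ▸ ht), hT, by rw [mag_eq_psi hm hw, hT, hp]⟩

lemma eventually_close (D : ContactData E) {ε : ℝ} (hε : 0 < ε) (T₀ : ℝ) :
    ∀ᶠ m in 𝓝 (0 : ℝ), ∀ w ∈ D.N, ∀ v ∈ Icc 0 T₀,
    |D.dens (m, D.mag m v w) - D.f w| < ε ∧ ‖D.mag m v w - D.rot (D.f w * v) w‖ < ε := by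
  have key : ∀ᶠ m in 𝓝 (0 : ℝ), ∀ x ∈ D.N ×ˢ Icc 0 T₀,
      |D.dens (m, D.mag m x.2 x.1) - D.f x.1| < ε ∧ ‖D.mag m x.2 x.1 - D.mag 0 x.2 x.1‖ < ε := by
    refine (D.isCompact.prod isCompact_Icc).exists_nhds_forall_of_eventually
      (P := fun y : (E × ℝ) × ℝ => |D.dens (y.2, D.mag y.2 y.1.2 y.1.1) - D.f y.1.1| < ε ∧
        ‖D.mag y.2 y.1.2 y.1.1 - D.mag 0 y.1.2 y.1.1‖ < ε) ?_
    rintro ⟨w, v⟩ ⟨hw, -⟩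
    have c1 : Continuous fun y : (E × ℝ) × ℝ => D.mag y.2 y.1.2 y.1.1 :=
      D.smooth_mag.continuous.comp (by fun_prop :
        Continuous fun y : (E × ℝ) × ℝ => (y.2, y.1.2, y.1.1))
    have c2 : Continuous fun y : (E × ℝ) × ℝ => D.mag 0 y.1.2 y.1.1 :=
      D.smooth_mag.continuous.comp (by fun_prop :
        Continuous fun y : (E × ℝ) × ℝ => ((0 : ℝ), y.1.2, y.1.1))
    have c3 : Continuous fun y : (E × ℝ) × ℝ => D.dens (y.2, D.mag y.2 y.1.2 y.1.1) :=
      D.smooth_dens.continuous.comp (continuous_snd.prodMk c1)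
    have c4 : Continuous fun y : (E × ℝ) × ℝ => D.f y.1.1 :=
      D.smooth_f.continuous.comp (by fun_prop)
    refine ((c3.sub c4).abs.continuousAt.eventually_lt continuousAt_const ?_).and
      ((c1.sub c2).norm.continuousAt.eventually_lt continuousAt_const ?_)
    · simpa [dens_zero, mag_zero_left hw, D.f_rot w hw] using hε
    · simpa using hε
  filter_upwards [key] with m hm w hw v hv
  have := hm (w, v) ⟨hw, hv⟩
  rwa [mag_zero_left hw] at this

/-- Closed orbits close to the fibres correspond to the zeros of the return direction. -/
theorem IsReturn.eventually_short_orbit_iff (h : D.IsReturn u m₁) {ρ : ℝ} (hρ : 0 < ρ)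
    (hρ1 : ρ ≤ 1) (huniq : ∀ᶠ m in 𝓝 (0 : ℝ), ∀ z ∈ D.N, ∀ y : ℝ × (ℝ × ℝ),
      dist y (2 * Real.pi, (0, 0)) < ρ → D.phi m y.1 z = D.sec z y.2 1 → y = u (m, z)) {ε : ℝ}
    (hε : 0 < ε) (hερ : ε < ρ / 2) :
    ∀ᶠ m in 𝓝 (0 : ℝ), ∀ z ∈ D.N, ((u (m, z)).2 = 0 ↔
      ∃ T > 0, |D.f (D.F m z) * T - 2 * Real.pi| < ε ∧ D.mag m T (D.F m z) = D.F m z ∧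
        ∀ v ∈ Icc 0 T, ‖D.mag m v (D.F m z) - D.rot (D.f (D.F m z) * v) (D.F m z)‖ < ε) := by
  obtain ⟨d, hd, C, hC, hb⟩ := exists_bounds (D := D) D.smooth_f.continuous D.f_pos
  have hπ := Real.pi_pos
  let T₀ : ℝ := 2 * (2 * Real.pi + 1) / d
  have hT₀ : 0 < T₀ := by positivity
  -- `T₀` bounds all the periods under consideration; over a time `T₀` an error `ε'` in the density
  -- accumulates to at most `ε / 4`
  let ε' : ℝ := min (ε / 2) (ε / (4 * T₀))
  have hε' : 0 < ε' := by positivity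
  have hε'T : ε' * T₀ ≤ ε / 4 := by
    calc ε' * T₀ ≤ ε / (4 * T₀) * T₀ := by gcongr; exact min_le_right _ _
      _ = ε / 4 := by field_simp
  have hdens : ∀ᶠ m in 𝓝 (0 : ℝ), ∀ z ∈ D.N, d / 2 < D.dens (m, z) := by
    refine D.isCompact.exists_nhds_forall_of_eventually
      (P := fun y : E × ℝ => d / 2 < D.dens (y.2, y.1)) fun z hz => ?_
    have c : Continuous fun y : E × ℝ => D.dens (y.2, y.1) :=
      D.smooth_dens.continuous.comp (by fun_prop)
    refine continuousAt_const.eventually_lt c.continuousAt ?_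
    simp only [dens_zero]
    linarith [(hb z hz).1]
  have htime : ∀ᶠ m in 𝓝 (0 : ℝ), ∀ z ∈ D.N, |(u (m, z)).1 - 2 * Real.pi| < ε / 2 := by
    refine D.isCompact.exists_nhds_forall_of_eventually
      (P := fun y : E × ℝ => |(u (y.2, y.1)).1 - 2 * Real.pi| < ε / 2) fun z hz => ?_
    have c : Continuous fun y : E × ℝ => |(u (y.2, y.1)).1 - 2 * Real.pi| := by
      have := h.smooth.continuous
      fun_prop
    refine c.continuousAt.eventually_lt continuousAt_const ?_
    simpa [h.zero z hz] using hε
  have hmev : ∀ᶠ m : ℝ in 𝓝 0, |m| < m₁ := by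
    filter_upwards [Metric.ball_mem_nhds (0 : ℝ) h.pos] with m hm using by simpa using hm
  filter_upwards [hmev, huniq, hdens, htime, D.eventually_close hε' T₀] with m hm hu hde ht hcl z hz
  have hmb := h.abs_lt hm
  set w := D.F m z with hwdef
  have hw : w ∈ D.N := F_mem hz m
  have h0 : D.sec z (0, 0) 1 = z := sec_zero hz 1
  obtain ⟨d', hd', C', hC', hb'⟩ := exists_bounds (D := D) (g := fun z => D.dens (m, z))
    (D.smooth_dens.continuous.comp (by fun_prop)) (fun z hz => dens_pos hmb hz)
  -- the Reeb time is close to `f` times the time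
  have hcomp : ∀ T, 0 ≤ T → T ≤ T₀ → |D.reebTime m w T - D.f w * T| ≤ ε / 4 := by
    intro T hT hTT
    have h1 : D.reebTime m w T - D.f w * T
        = ∫ x in (0 : ℝ)..T, (D.dens (m, D.mag m x w) - D.f w) := by
      rw [intervalIntegral.integral_sub ((D.continuous_dens_mag m w).intervalIntegrable _ _)
        (by simp), reebTime]
      simp [mul_comm]
    rw [h1, ← Real.norm_eq_abs]
    have h2 := intervalIntegral.norm_integral_le_of_norm_le_const (a := 0) (b := T) (C := ε')
      (f := fun x => D.dens (m, D.mag m x w) - D.f w) (fun x hx => by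
        rw [uIoc_of_le hT] at hx
        exact (hcl w hw x ⟨hx.1.le, hx.2.trans hTT⟩).1.le)
    rw [sub_zero, abs_of_nonneg hT] at h2
    exact h2.trans ((mul_le_mul_of_nonneg_left hTT hε'.le).trans hε'T)
  constructor
  · intro hW
    have htz := ht z hz
    have hpos : 0 < (u (m, z)).1 := by
      have := _root_.abs_lt.1 htz
      have := Real.pi_gt_three
      linarith
    have hphi := h.phi_eq m hm z hz
    rw [hW, sec_zero hz] at hphi
    have hpsi : D.psi m (u (m, z)).1 w = w := by rw [hwdef, ← F_phi, hphi]
    obtain ⟨T, hT, hTt, hTw⟩ := exists_period hmb hw hpos hpsi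
    have hTT : T ≤ T₀ := by
      have h1 := (reebTime_bounds (d := d / 2) (C := C') hw
        (fun z hz => ⟨(hde z hz).le, (hb' z hz).2⟩) hT.le).1
      rw [hTt] at h1
      have h2 : (u (m, z)).1 ≤ 2 * Real.pi + 1 := by
        have := _root_.abs_lt.1 htz
        linarith
      rw [le_div_iff₀ hd]
      linarith
    refine ⟨T, hT, ?_, hTw, fun v hv =>
      ((hcl w hw v ⟨hv.1, hv.2.trans hTT⟩).2).trans_le ((min_le_left _ _).trans (by linarith))⟩
    have h3 := hcomp T hT.le hTT
    rw [hTt] at h3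
    rw [_root_.abs_lt] at htz ⊢
    rw [abs_le] at h3
    constructor <;> linarith
  · rintro ⟨T, hT, hfT, hTw, -⟩
    have hTT : T ≤ T₀ := by
      have h1 := (hb w hw).1
      have h2 := (_root_.abs_lt.1 hfT).2
      have h3 : d * T ≤ D.f w * T := by gcongr
      rw [le_div_iff₀ hd]
      linarith
    have h3 := hcomp T hT.le hTT
    have h4 : D.psi m (D.reebTime m w T) w = w := by rw [← mag_eq_psi hmb hw, hTw]
    have h5 : D.phi m (D.reebTime m w T) z = z := by
      rw [phi, ← hwdef, h4, hwdef, Finv_F]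
    have h6 := hu z hz (D.reebTime m w T, (0, 0)) (by
      rw [Prod.dist_eq, dist_self, max_lt_iff, Real.dist_eq]
      refine ⟨?_, hρ⟩
      rw [_root_.abs_lt] at hfT ⊢
      rw [abs_le] at h3
      constructor <;> linarith) (by rw [h5, h0])
    rw [← h6]
    rfl

/-- Near a point at which the differential of `f` along the section vanishes and is non-degenerate,
there is a smooth family of points with vanishing return direction. Since the return time is
`2π + m² k`, the implicit function theorem is applied to the differential of `k` along the section,
which at `m = 0` is that of `π / f`. -/
theorem IsReturn.exists_direction_zero (h : D.IsReturn u m₁) {z₀ : E} (hz : z₀ ∈ D.N)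
    (hU : z₀ ∈ D.U) (hA : fderiv ℝ D.f z₀ (D.hA z₀) = 0) (hB : fderiv ℝ D.f z₀ (D.hB z₀) = 0)
    (hnd : ∀ w : ℝ × ℝ,
      fderiv ℝ (fun z => fderiv ℝ D.f z (D.hA z)) z₀ (w.1 • D.hA z₀ + w.2 • D.hB z₀) = 0 →
      fderiv ℝ (fun z => fderiv ℝ D.f z (D.hB z)) z₀ (w.1 • D.hA z₀ + w.2 • D.hB z₀) = 0 →
      w = 0) :
    ∃ ζ : ℝ → E, ζ 0 = z₀ ∧ ∃ O : Set ℝ, IsOpen O ∧ 0 ∈ O ∧ ContDiffOn ℝ ∞ ζ O ∧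
      ∀ m ∈ O, ζ m ∈ D.N ∧ (u (m, ζ m)).2 = 0 := by
  obtain ⟨k, hk, hkN⟩ := h.exists_expansion
  have hdk : ContDiff ℝ ∞ (fderiv ℝ k) := hk.fderiv_right (by simp)
  have hdf : ContDiff ℝ ∞ (fderiv ℝ D.f) := D.smooth_f.fderiv_right (by simp)
  have hs : ContDiff ℝ ∞ fun w : ℝ × ℝ => D.sec z₀ w 1 :=
    D.smooth_sec.comp (contDiff_const.prodMk (contDiff_id.prodMk contDiff_const))
  have hs2 : ContDiff ℝ ∞ fun q : ℝ × (ℝ × ℝ) => (q.1, D.sec z₀ q.2 1) :=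
    contDiff_fst.prodMk (hs.comp contDiff_snd)
  let Q : ℝ × (ℝ × ℝ) → ℝ × ℝ := fun q =>
    (fderiv ℝ k (q.1, D.sec z₀ q.2 1) (0, D.hA (D.sec z₀ q.2 1)),
      fderiv ℝ k (q.1, D.sec z₀ q.2 1) (0, D.hB (D.sec z₀ q.2 1)))
  have hQ : ContDiff ℝ ∞ Q :=
    ((hdk.comp hs2).clm_apply (contDiff_const.prodMk (D.smooth_hA.comp (hs.comp contDiff_snd)))).prodMk
      ((hdk.comp hs2).clm_apply (contDiff_const.prodMk (D.smooth_hB.comp (hs.comp contDiff_snd))))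
  have hs0 : D.sec z₀ 0 1 = z₀ := sec_zero hz 1
  -- at `m = 0` the derivatives of `k` are those of `π / f`
  have hk0 : ∀ (e : E → E) (c : E → ℝ → E), (∀ y ∈ D.N, ContDiff ℝ ∞ (c y) ∧ c y 0 = y ∧
      (∀ s, c y s ∈ D.N) ∧ HasDerivAt (c y) (e y) 0) → ∀ y ∈ D.N, y ∈ D.U →
      fderiv ℝ k (0, y) (0, e y) = -(Real.pi / D.f y ^ 2) * fderiv ℝ D.f y (e y) := by
    intro e c hc y hy hyU
    obtain ⟨c1, c2, c3, c4⟩ := hc y hy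
    have h1 : HasDerivAt (fun s => k (0, c y s)) (fderiv ℝ k (0, y) (0, e y)) 0 :=
      HasFDerivAt.comp_hasDerivAt (l := k) 0
        (by rw [c2]; exact (hk.differentiable (by simp) (0, y)).hasFDerivAt)
        ((hasDerivAt_const (0 : ℝ) (0 : ℝ)).prodMk c4)
    have h2 : HasDerivAt (fun s => D.f (c y s)) (fderiv ℝ D.f y (e y)) 0 :=
      HasFDerivAt.comp_hasDerivAt (l := D.f) 0
        (by rw [c2]; exact (D.smooth_f.differentiable (by simp) y).hasFDerivAt) c4
    have hf := D.f_pos y hy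
    have h3 := (h2.inv (by rw [c2]; exact hf.ne')).const_mul Real.pi
    have h4 : (fun s => k (0, c y s)) =ᶠ[𝓝 0] fun s => Real.pi * (D.f (c y s))⁻¹ := by
      have : ∀ᶠ s in 𝓝 (0 : ℝ), c y s ∈ D.U :=
        c1.continuous.continuousAt.eventually (by rw [c2]; exact D.isOpen_U.mem_nhds hyU)
      filter_upwards [this] with s hs
      rw [(hkN _ (c3 s) hs).1, div_eq_mul_inv]
    rw [h1.unique (h3.congr_of_eventuallyEq h4), c2]
    ring
  have cA : ∀ y ∈ D.N, ContDiff ℝ ∞ (D.sec y (1, 0)) ∧ D.sec y (1, 0) 0 = y ∧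
      (∀ s, D.sec y (1, 0) s ∈ D.N) ∧ HasDerivAt (D.sec y (1, 0)) (D.hA y) 0 := fun y hy =>
    ⟨smooth_sec_curve y _, by simp, sec_mem hy _, hasDerivAt_sec_A hy⟩
  have cB : ∀ y ∈ D.N, ContDiff ℝ ∞ (D.sec y (0, 1)) ∧ D.sec y (0, 1) 0 = y ∧
      (∀ s, D.sec y (0, 1) s ∈ D.N) ∧ HasDerivAt (D.sec y (0, 1)) (D.hB y) 0 := fun y hy =>
    ⟨smooth_sec_curve y _, by simp, sec_mem hy _, hasDerivAt_sec_B hy⟩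
  have hUw : ∀ᶠ w in 𝓝 (0 : ℝ × ℝ), D.sec z₀ w 1 ∈ D.U :=
    hs.continuous.continuousAt.eventually (by simp only [hs0]; exact D.isOpen_U.mem_nhds hU)
  have hdQ : ∀ w : ℝ × ℝ, fderiv ℝ Q (0, 0) (0, w) = (-(Real.pi / D.f z₀ ^ 2)) •
      (fderiv ℝ (fun z => fderiv ℝ D.f z (D.hA z)) z₀ (w.1 • D.hA z₀ + w.2 • D.hB z₀),
        fderiv ℝ (fun z => fderiv ℝ D.f z (D.hB z)) z₀ (w.1 • D.hA z₀ + w.2 • D.hB z₀)) := by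
    have gA : ContDiff ℝ ∞ fun z => fderiv ℝ D.f z (D.hA z) := hdf.clm_apply D.smooth_hA
    have gB : ContDiff ℝ ∞ fun z => fderiv ℝ D.f z (D.hB z) := hdf.clm_apply D.smooth_hB
    have ds := (hs.differentiable (by simp) 0).hasFDerivAt
    have hg : DifferentiableAt ℝ (fun w => -(Real.pi / D.f (D.sec z₀ w 1) ^ 2)) 0 := by
      have h1 : DifferentiableAt ℝ (fun w => D.f (D.sec z₀ w 1)) 0 :=
        (D.smooth_f.comp hs).differentiable (by simp) 0
      have h2 : D.f (D.sec z₀ 0 1) ^ 2 ≠ 0 := by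
        rw [hs0]; exact pow_ne_zero 2 (D.f_pos z₀ hz).ne'
      have h3 : DifferentiableAt ℝ (fun w => D.f (D.sec z₀ w 1) ^ 2) 0 := h1.pow 2
      simp only [div_eq_mul_inv]
      exact ((h3.fun_inv h2).const_mul Real.pi).neg
    have e : (fun w : ℝ × ℝ => Q (0, w)) =ᶠ[𝓝 0] fun w =>
        (-(Real.pi / D.f (D.sec z₀ w 1) ^ 2) * fderiv ℝ D.f (D.sec z₀ w 1) (D.hA (D.sec z₀ w 1)),
         -(Real.pi / D.f (D.sec z₀ w 1) ^ 2) * fderiv ℝ D.f (D.sec z₀ w 1) (D.hB (D.sec z₀ w 1))) := by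
      filter_upwards [hUw] with w hw
      exact Prod.ext (hk0 D.hA _ cA _ (sec_mem hz _ _) hw) (hk0 D.hB _ cB _ (sec_mem hz _ _) hw)
    have dA := HasFDerivAt.comp (g := fun z => fderiv ℝ D.f z (D.hA z)) (0 : ℝ × ℝ)
      (by rw [hs0]; exact (gA.differentiable (by simp) z₀).hasFDerivAt) ds
    have dB := HasFDerivAt.comp (g := fun z => fderiv ℝ D.f z (D.hB z)) (0 : ℝ × ℝ)
      (by rw [hs0]; exact (gB.differentiable (by simp) z₀).hasFDerivAt) ds
    have h1 := ((hg.hasFDerivAt.mul dA).prodMk (hg.hasFDerivAt.mul dB)).congr_of_eventuallyEq e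
    have h2 : HasFDerivAt (fun w : ℝ × ℝ => Q (0, w))
        (fderiv ℝ Q (0, 0) ∘L .inr ℝ ℝ (ℝ × ℝ)) 0 :=
      HasFDerivAt.comp (g := Q) (0 : ℝ × ℝ) (hQ.differentiable (by simp) _).hasFDerivAt
        (hasFDerivAt_prodMk_right (0 : ℝ) (0 : ℝ × ℝ))
    intro w
    have h3 := congrArg (fun L : ℝ × ℝ →L[ℝ] ℝ × ℝ => L w) (h2.unique h1)
    simpa [hs0, hA, hB, fderiv_sec_zero hz] using h3
  have hQ0 : Q (0, 0) = 0 := by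
    have a1 := hk0 D.hA _ cA z₀ hz hU
    have a2 := hk0 D.hB _ cB z₀ hz hU
    simp only [Q, hs0, a1, a2, hA, hB, mul_zero]
    rfl
  obtain ⟨r, -, O, hO, hKO, w, hw, hwr⟩ := exists_implicit_of_isCompact hQ
    (isCompact_singleton (x := (0 : ℝ))) (0 : ℝ × ℝ)
    (by rintro _ rfl; exact hQ0) (by
      rintro _ rfl
      have hinj : Function.Injective
          ((fderiv ℝ Q (0, 0) ∘L .inr ℝ ℝ (ℝ × ℝ) : ℝ × ℝ →L[ℝ] ℝ × ℝ) : ℝ × ℝ →ₗ[ℝ] ℝ × ℝ) := by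
        rw [← LinearMap.ker_eq_bot, LinearMap.ker_eq_bot']
        intro v hv
        have h1 : fderiv ℝ Q (0, 0) (0, v) = 0 := hv
        have h2 : -(Real.pi / D.f z₀ ^ 2) ≠ 0 :=
          neg_ne_zero.2 (div_ne_zero Real.pi_ne_zero (pow_ne_zero 2 (D.f_pos z₀ hz).ne'))
        rw [hdQ, smul_eq_zero] at h1
        have h3 := h1.resolve_left h2
        exact hnd v (congrArg Prod.fst h3) (congrArg Prod.snd h3)
      exact ⟨(LinearEquiv.ofInjectiveEndo _ hinj).toContinuousLinearEquiv, by ext <;> rfl⟩)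
  have h0O : (0 : ℝ) ∈ O := hKO rfl
  have hw0 : w 0 = 0 := ((hwr 0 h0O).2.2 0 (by
    have := (hwr 0 h0O).1
    simpa using dist_nonneg.trans_lt this) hQ0).symm
  have hζ : ContDiffOn ℝ ∞ (fun m => D.sec z₀ (w m) 1) O := hs.comp_contDiffOn hw
  -- close to `m = 0` the derivatives of the return time vanish
  have hcont : ContinuousAt (fun m => (m, D.sec z₀ (w m) 1)) 0 :=
    continuousAt_id.prodMk (hζ.continuousOn.continuousAt (hO.mem_nhds h0O))
  have hev : ∀ᶠ m in 𝓝 (0 : ℝ), D.sec z₀ (w m) 1 ∈ D.U ∧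
      (D.sec z₀ (w m) 1 ∈ D.N →
      fderiv ℝ (fun p => (u p).1) (m, D.sec z₀ (w m) 1) (0, D.hA (D.sec z₀ (w m) 1)) = 0 →
      fderiv ℝ (fun p => (u p).1) (m, D.sec z₀ (w m) 1) (0, D.hB (D.sec z₀ (w m) 1)) = 0 →
      (u (m, D.sec z₀ (w m) 1)).2 = 0) := by
    have h1 := hcont.tendsto
    simp only [hw0, hs0] at h1
    have h2 : ∀ᶠ p : ℝ × E in 𝓝 (0, z₀), p.2 ∈ D.U :=
      continuous_snd.continuousAt.eventually (D.isOpen_U.mem_nhds hU)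
    exact (h1.eventually h2).and (h1.eventually (h.eventually_direction_zero hz hU))
  obtain ⟨O', hO', hO'o, h0O'⟩ := eventually_nhds_iff.1 hev
  refine ⟨fun m => D.sec z₀ (w m) 1, by simp [hw0, hs0], O ∩ O', hO.inter hO'o, ⟨h0O, h0O'⟩,
    hζ.mono inter_subset_left, fun m hm => ⟨sec_mem hz _ _, ?_⟩⟩
  obtain ⟨hU', hd⟩ := hO' m hm.2
  have hQm : Q (m, w m) = 0 := (hwr m hm.1).2.1
  have hT : ContDiff ℝ ∞ fun p => (u p).1 := contDiff_fst.comp h.smooth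
  set y := D.sec z₀ (w m) 1 with hy
  have hyN : y ∈ D.N := sec_mem hz _ _
  have hTk : ∀ (e : E) (c : ℝ → E), ContDiff ℝ ∞ c ∧ c 0 = y ∧ (∀ s, c s ∈ D.N) ∧
      HasDerivAt c e 0 → fderiv ℝ (fun p => (u p).1) (m, y) (0, e)
        = m ^ 2 * fderiv ℝ k (m, y) (0, e) := by
    rintro e c ⟨c1, c2, c3, c4⟩
    have hl := (hasDerivAt_const (0 : ℝ) m).prodMk c4
    have h1 : HasDerivAt (fun s => (u (m, c s)).1) _ 0 :=
      HasFDerivAt.comp_hasDerivAt (l := fun p => (u p).1) 0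
        (by rw [c2]; exact (hT.differentiable (by simp) (m, y)).hasFDerivAt) hl
    have h2 : HasDerivAt (fun s => k (m, c s)) _ 0 :=
      HasFDerivAt.comp_hasDerivAt (l := k) 0
        (by rw [c2]; exact (hk.differentiable (by simp) (m, y)).hasFDerivAt) hl
    refine h1.unique (((h2.const_mul (m ^ 2)).const_add (2 * Real.pi)).congr_of_eventuallyEq ?_)
    have : ∀ᶠ s in 𝓝 (0 : ℝ), c s ∈ D.U :=
      c1.continuous.continuousAt.eventually (by rw [c2]; exact D.isOpen_U.mem_nhds hU')
    filter_upwards [this] with s hs using (hkN _ (c3 s) hs).2 m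
  refine hd hyN ?_ ?_
  · rw [hTk _ _ (cA y hyN), show fderiv ℝ k (m, y) (0, D.hA y) = 0 from congrArg Prod.fst hQm,
      mul_zero]
  · rw [hTk _ _ (cB y hyN), show fderiv ℝ k (m, y) (0, D.hB y) = 0 from congrArg Prod.snd hQm,
      mul_zero]

/-- The closed orbits through a smooth family of points with vanishing return direction,
parametrised proportionally to the Reeb time. -/
theorem IsReturn.exists_closed_orbits (h : D.IsReturn u m₁) {z₀ : E} (hz : z₀ ∈ D.N)
    {ζ : ℝ → E} (hζ0 : ζ 0 = z₀) {O : Set ℝ} (hO : IsOpen O) (h0O : (0 : ℝ) ∈ O)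
    (hζ : ContDiffOn ℝ ∞ ζ O) (hζm : ∀ m ∈ O, ζ m ∈ D.N ∧ (u (m, ζ m)).2 = 0) :
    ∃ γ : ℝ → ℝ → E, ∀ᶠ m₂ in 𝓝[>] (0 : ℝ),
      ContDiffOn ℝ ∞ (fun p : ℝ × ℝ => γ p.1 p.2) (Ico 0 m₂ ×ˢ univ) ∧
      (∀ ψ, γ 0 ψ = D.rot ψ z₀) ∧ ∀ m ∈ Ico 0 m₂, (∀ ψ, γ m ψ ∈ D.N) ∧
        Function.Periodic (γ m) (2 * Real.pi) ∧ ∃ w ∈ D.N, ∃ T > 0,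
          Function.Periodic (fun v => D.mag m v w) T ∧
          range (fun v => D.mag m v w) = D.F m '' range (γ m) := by
  have hπ := Real.pi_pos
  let γ : ℝ → ℝ → E := fun m ψ => D.phi m ((u (m, ζ m)).1 * (ψ / (2 * Real.pi))) (ζ m)
  have hev : ∀ᶠ m in 𝓝 (0 : ℝ), |m| < m₁ ∧ m ∈ O ∧ 0 < (u (m, ζ m)).1 := by
    have hm : ∀ᶠ m : ℝ in 𝓝 0, |m| < m₁ := by
      filter_upwards [Metric.ball_mem_nhds (0 : ℝ) h.pos] with m hm using by simpa using hm
    have hc : ContinuousAt (fun m => (u (m, ζ m)).1) 0 := by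
      have h1 : ContinuousAt (fun m => (m, ζ m)) 0 :=
        continuousAt_id.prodMk (hζ.continuousOn.continuousAt (hO.mem_nhds h0O))
      exact (continuous_fst.comp h.smooth.continuous).continuousAt.comp h1
    refine hm.and (Eventually.and (hO.mem_nhds h0O) (continuousAt_const.eventually_lt hc ?_))
    simpa [hζ0, h.zero z₀ hz] using hπ
  obtain ⟨ε, hε, hball⟩ := Metric.eventually_nhds_iff.1 hev
  refine ⟨γ, ?_⟩
  filter_upwards [Ioo_mem_nhdsGT hε] with m₂ hm₂
  have hall : ∀ m ∈ Ico 0 m₂, |m| < m₁ ∧ m ∈ O ∧ 0 < (u (m, ζ m)).1 := fun m hm => by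
    refine hball ?_
    rw [Real.dist_eq, sub_zero, abs_of_nonneg hm.1]
    exact hm.2.trans hm₂.2
  refine ⟨?_, ?_, fun m hm => ?_⟩
  · have h1 : ContDiffOn ℝ ∞ (fun p : ℝ × ℝ => ζ p.1) (Ico 0 m₂ ×ˢ univ) :=
      hζ.comp contDiff_fst.contDiffOn fun p hp => (hall p.1 hp.1).2.1
    have h2 : ContDiffOn ℝ ∞ (fun p : ℝ × ℝ => u (p.1, ζ p.1)) (Ico 0 m₂ ×ˢ univ) :=
      h.smooth.comp_contDiffOn (contDiff_fst.contDiffOn.prodMk h1)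
    refine (D.smooth_phi.comp_contDiffOn (f := fun p : ℝ × ℝ =>
      (p.1, (u (p.1, ζ p.1)).1 * (p.2 / (2 * Real.pi)), ζ p.1)) ?_)
    refine contDiff_fst.contDiffOn.prodMk (ContDiffOn.prodMk ?_ h1)
    exact (contDiff_fst.comp_contDiffOn h2).mul (ContDiff.contDiffOn (by fun_prop))
  · intro ψ
    simp only [γ, hζ0, h.zero z₀ hz, phi_zero_left hz]
    congr 1
    field_simp
  · obtain ⟨hm1, hmO, ht⟩ := hall m hm
    obtain ⟨hN, hW⟩ := hζm m hmO
    have hmb := h.abs_lt hm1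
    have hphi := h.phi_eq m hm1 _ hN
    rw [hW, sec_zero hN] at hphi
    refine ⟨fun ψ => phi_mem hN _ _, fun ψ => ?_, D.F m (ζ m), F_mem hN m, ?_⟩
    · simp only [γ]
      rw [show (u (m, ζ m)).1 * ((ψ + 2 * Real.pi) / (2 * Real.pi))
        = (u (m, ζ m)).1 * (ψ / (2 * Real.pi)) + (u (m, ζ m)).1 by field_simp, phi_add, hphi]
    · have hpsi : D.psi m (u (m, ζ m)).1 (D.F m (ζ m)) = D.F m (ζ m) := by rw [← F_phi, hphi]
      obtain ⟨T, hT, hTt, hTw⟩ := exists_period hmb (F_mem hN m) ht hpsi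
      refine ⟨T, hT, fun v => ?_, ?_⟩
      · simp only [mag_add, hTw]
      · rw [← range_comp]
        ext y
        simp only [mem_range, Function.comp_apply, γ, F_phi]
        constructor
        · rintro ⟨v, rfl⟩
          refine ⟨D.reebTime m (D.F m (ζ m)) v / (u (m, ζ m)).1 * (2 * Real.pi), ?_⟩
          rw [mag_eq_psi hmb (F_mem hN m)]
          congr 1
          field_simp
        · rintro ⟨ψ, rfl⟩
          obtain ⟨v, hv⟩ := reebTime_surjective hmb (F_mem hN m)
            ((u (m, ζ m)).1 * (ψ / (2 * Real.pi)))
          exact ⟨v, by rw [mag_eq_psi hmb (F_mem hN m), hv]⟩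

end ContactData

/-! ### The Reeb vector field of the pulled-back form -/

namespace ContactData

variable {E : Type} [NormedAddCommGroup E] [NormedSpace ℝ E] [FiniteDimensional ℝ E]
  [CompleteSpace E] {D : ContactData E}

variable (D) in
/-- The form `e^{q_m} L₀ = F_m^* λ_m`. -/
def lamPull (m : ℝ) (z ξ : E) : ℝ := Real.exp (D.conf m z) * D.L₀ z ξ

variable (D) in
/-- The Reeb vector field of `F_m^* λ_m`. -/
def reeb (m : ℝ) (z : E) : E := deriv (fun s => D.phi m s z) 0

variable (D) in
lemma smooth_phi_curve (m : ℝ) (z : E) : ContDiff ℝ ∞ fun s => D.phi m s z :=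
  D.smooth_phi.comp (contDiff_const.prodMk (contDiff_id.prodMk contDiff_const))

lemma hasDerivAt_phi (m s : ℝ) (z : E) :
    HasDerivAt (fun s => D.phi m s z) (D.reeb m (D.phi m s z)) s := by
  have h1 : HasDerivAt (fun r => D.phi m r (D.phi m s z)) (D.reeb m (D.phi m s z)) (s - s) := by
    rw [sub_self]
    exact ((D.smooth_phi_curve m _).differentiable (by simp) 0).hasDerivAt
  have h2 := HasDerivAt.scomp (g₁ := fun r => D.phi m r (D.phi m s z)) (h := fun r => r - s) s h1
    ((hasDerivAt_id s).sub_const s)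
  rw [one_smul] at h2
  refine h2.congr_of_eventuallyEq (Eventually.of_forall fun r => ?_)
  simp [← phi_add]

lemma fderiv_FF_reeb (m : ℝ) (z : E) :
    fderiv ℝ D.FF (m, z) (0, D.reeb m z) = D.reebField (m, D.F m z) := by
  have h1 : HasDerivAt (fun s => (m, D.phi m s z)) (0, D.reeb m z) 0 := by
    have := D.hasDerivAt_phi m 0 z
    rw [phi_zero] at this
    exact (hasDerivAt_const (0 : ℝ) m).prodMk this
  have h2 : HasDerivAt (fun s => D.FF (m, D.phi m s z)) _ 0 :=
    HasFDerivAt.comp_hasDerivAt (l := D.FF) 0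
      (by rw [phi_zero]; exact (D.smooth_FF.differentiable (by simp) (m, z)).hasFDerivAt) h1
  have h3 : HasDerivAt (fun s => D.FF (m, D.phi m s z)) (0, (D.reebField (m, D.F m z)).2) 0 := by
    have h4 := D.hasDerivAt_psi' m 0 (D.F m z)
    rw [psi_zero] at h4
    simp only [FF, F_phi]
    exact (hasDerivAt_const (0 : ℝ) m).prodMk h4
  rw [h2.unique h3]
  exact Prod.ext (by simp [reebField_fst]) rfl

/-- The velocity of the image of a curve. -/
lemma hasDerivAt_FF_comp {c : ℝ → E} {ξ : E} {r : ℝ} (m : ℝ) (hc : HasDerivAt c ξ r) :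
    HasDerivAt (fun r => D.FF (m, c r)) (fderiv ℝ D.FF (m, c r) (0, ξ)) r :=
  HasFDerivAt.comp_hasDerivAt (l := D.FF) r
    (D.smooth_FF.differentiable (by simp) (m, c r)).hasFDerivAt
    ((hasDerivAt_const r m).prodMk hc)

lemma lamPull_reeb (hU : D.U = univ) {m : ℝ} (hm : |m| < D.mb) {z : E} (hz : z ∈ D.N) :
    D.lamPull m z (D.reeb m z) = 1 := by
  have h := pullback (D.smooth_phi_curve m z) (fun s => phi_mem hz m s) hm 0
    (fun σ _ => by simp [hU])
  rw [(D.hasDerivAt_phi m 0 z).deriv] at h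
  simp only [phi_zero] at h
  rw [fderiv_FF_reeb] at h
  rw [lamPull, ← h]
  exact Lam_reebField hm (F_mem hz m)

/-- `d(F_m^* λ_m)` vanishes on the Reeb vector field, tested on parametrised surfaces. -/
lemma extDerivAlong_lamPull (hU : D.U = univ) {m : ℝ} (hm : |m| < D.mb) {Φ : ℝ × ℝ → E}
    (hΦ : ContDiff ℝ ∞ Φ) (hN : ∀ p, Φ p ∈ D.N)
    (hR : HasDerivAt (fun s => Φ (s, 0)) (D.reeb m (Φ (0, 0))) 0) :
    deriv (fun s => D.lamPull m (Φ (s, 0)) (deriv (fun t => Φ (s, t)) 0)) 0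
      - deriv (fun t => D.lamPull m (Φ (0, t)) (deriv (fun s => Φ (s, t)) 0)) 0 = 0 := by
  let Ψ : ℝ × ℝ → ℝ × E := fun p => D.FF (m, Φ p)
  have hΨ : ContDiff ℝ ∞ Ψ := D.smooth_FF.comp (contDiff_const.prodMk hΦ)
  have hΨd : ∀ p, DifferentiableAt ℝ Ψ p := fun p => hΨ.differentiable (by simp) p
  have hs : ∀ t, ContDiff ℝ ∞ fun s => Φ (s, t) := fun t =>
    hΦ.comp (contDiff_id.prodMk contDiff_const)
  have ht : ∀ s, ContDiff ℝ ∞ fun t => Φ (s, t) := fun s =>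
    hΦ.comp (contDiff_const.prodMk contDiff_id)
  have e1 : ∀ s, D.lamPull m (Φ (s, 0)) (deriv (fun t => Φ (s, t)) 0)
      = D.Lam (Ψ (s, 0)) (fderiv ℝ Ψ (s, 0) (0, 1)) := by
    intro s
    have h := pullback (ht s) (fun t => hN _) hm 0 (fun σ _ => by simp [hU])
    rw [lamPull, ← h, (fderiv_apply_zero_one (hΨd (s, 0))).unique
      (hasDerivAt_FF_comp m ((ht s).differentiable (by simp) 0).hasDerivAt)]
    rfl
  have e2 : ∀ t, D.lamPull m (Φ (0, t)) (deriv (fun s => Φ (s, t)) 0)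
      = D.Lam (Ψ (0, t)) (fderiv ℝ Ψ (0, t) (1, 0)) := by
    intro t
    have h := pullback (hs t) (fun s => hN _) hm 0 (fun σ _ => by simp [hU])
    rw [lamPull, ← h, (fderiv_apply_one_zero (hΨd (0, t))).unique
      (hasDerivAt_FF_comp m ((hs t).differentiable (by simp) 0).hasDerivAt)]
    rfl
  obtain ⟨a, b, ha, hb, hab⟩ := exists_hasDerivAt_form (α := D.Lam) (Ψ := Ψ) (s := 0) (r := 0)
    (hΨ.contDiffAt.of_le (by norm_cast)) (D.smooth_Lam.differentiable (by simp) _)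
  simp only [e1, e2]
  rw [ha.deriv, hb.deriv, hab]
  have h1 := (fderiv_apply_one_zero (hΨd (0, 0))).unique (hasDerivAt_FF_comp m hR)
  have h2 := fderiv_apply_zero_one (hΨd (0, 0))
  obtain ⟨a', b', e', hv⟩ := exists_eq_vec (D := D) (c := fun t => Ψ (0, t)) (t := 0)
    (Eventually.of_forall fun t => F_mem (hN _) m) h2
  have h3 : (fderiv ℝ Ψ (0, 0) (0, 1)).1 = 0 := by
    rw [h2.unique (hasDerivAt_FF_comp m ((ht 0).differentiable (by simp) 0).hasDerivAt)]
    have h4 : HasDerivAt (fun t => (Ψ (0, t)).1) _ 0 :=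
      HasFDerivAt.comp_hasDerivAt (f := fun t => Ψ (0, t)) 0
        (ContinuousLinearMap.fst ℝ ℝ E).hasFDerivAt
        (hasDerivAt_FF_comp m ((ht 0).differentiable (by simp) 0).hasDerivAt)
    exact h4.unique (hasDerivAt_const (0 : ℝ) m)
  rw [h1, fderiv_FF_reeb, extD_swap, hv, h3]
  have h5 := extD_reebField (D := D) hm (F_mem (hN (0, 0)) m) (by simp [hU]) 0 a' b' e'
  rw [zero_mul] at h5
  exact neg_eq_zero.2 h5

end ContactData

/-! ### The radial projection and the cylinder metric -/

instance : Fact (Module.finrank ℝ E3 = 2 + 1) := ⟨finrank_euclideanSpace_fin⟩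

lemma isOpen_ne_zero : IsOpen {p : E3 | p ≠ 0} := isOpen_ne

lemma radial_coe {p : E3} (hp : p ≠ 0) : (radial p : E3) = ‖p‖⁻¹ • p := by
  simp [radial, hp]

lemma radial_of_mem (x : S2) : radial (x : E3) = x := by
  have h : ‖(x : E3)‖ = 1 := by simp
  have h0 : (x : E3) ≠ 0 := by
    rw [← norm_ne_zero_iff, h]; exact one_ne_zero
  exact Subtype.ext (by rw [radial_coe h0, h, inv_one, one_smul])

lemma contMDiffAt_radial {p : E3} (hp : p ≠ 0) : ContMDiffAt 𝓘(ℝ, E3) (𝓡 2) ∞ radial p := by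
  let U : TopologicalSpace.Opens E3 := ⟨{p : E3 | p ≠ 0}, isOpen_ne_zero⟩
  have h1 : ContMDiff 𝓘(ℝ, E3) 𝓘(ℝ, E3) ∞ fun x : U => ‖(x : E3)‖⁻¹ • (x : E3) := by
    intro x
    have h2 : ContMDiffAt 𝓘(ℝ, E3) 𝓘(ℝ, E3) ∞ (fun p : E3 => ‖p‖⁻¹ • p) (x : E3) := by
      have hx : (x : E3) ≠ 0 := x.2
      exact (((contDiffAt_norm ℝ hx).inv (norm_ne_zero_iff.2 hx)).smul contDiffAt_id).contMDiffAt
    exact contMDiffAt_subtype_iff.2 h2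
  have h2 : ∀ x : U, ‖(x : E3)‖⁻¹ • (x : E3) ∈ Metric.sphere (0 : E3) 1 := fun x => by
    have hx : (x : E3) ≠ 0 := x.2
    rw [← radial_coe hx]
    exact (radial (x : E3)).2
  have h3 := ContMDiff.codRestrict_sphere (n := 2) h1 h2
  have h4 : Set.codRestrict _ _ h2 = fun x : U => radial (x : E3) := funext fun x => by
    have hx : (x : E3) ≠ 0 := x.2
    exact Subtype.ext (radial_coe hx).symm
  rw [h4] at h3
  exact contMDiffAt_subtype_iff.1 (h3 ⟨p, hp⟩)

lemma contMDiffAt_dradial {p : E3} (hp : p ≠ 0) (u : E3) :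
    ContMDiffAt 𝓘(ℝ, E3) ((𝓡 2).prod 𝓘(ℝ, E2)) ∞
      (fun p => Bundle.TotalSpace.mk' E2 (E := fun x : S2 => TangentSpace (𝓡 2) x)
        (radial p) (dradial p u)) p := by
  have h1 : ContMDiffOn 𝓘(ℝ, E3) (𝓡 2) ∞ radial {p : E3 | p ≠ 0} :=
    fun p hp => (contMDiffAt_radial hp).contMDiffWithinAt
  have h2 := h1.contMDiffOn_tangentMapWithin (m := ∞) (by simp) isOpen_ne_zero.uniqueMDiffOn
  have h3 : ContMDiff 𝓘(ℝ, E3) (𝓘(ℝ, E3).prod 𝓘(ℝ, E3)) ∞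
      (fun p : E3 => (⟨p, u⟩ : TangentBundle 𝓘(ℝ, E3) E3)) :=
    contMDiff_vectorSpace_iff_contDiff.2 (contDiff_const (c := u))
  have h4 := h2.comp (h3.contMDiffOn (s := {p : E3 | p ≠ 0})) (fun p hp => hp)
  refine (h4.contMDiffAt (isOpen_ne_zero.mem_nhds hp)).congr_of_eventuallyEq ?_
  filter_upwards [isOpen_ne_zero.mem_nhds hp] with q hq
  have h5 : mfderivWithin 𝓘(ℝ, E3) (𝓡 2) radial {p : E3 | p ≠ 0} q = dradial q :=
    mfderivWithin_of_isOpen isOpen_ne_zero hq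
  simp only [Function.comp_apply, tangentMapWithin, h5]
  rfl

lemma contDiffAt_funExt (f : SphereFun) {p : E3} (hp : p ≠ 0) : ContDiffAt ℝ ∞ (funExt f) p :=
  ((f.contMDiff.contMDiffAt (x := radial p)).comp p (contMDiffAt_radial hp)).contDiffAt

lemma contDiffAt_formExt (β : SphereOneForm) {p : E3} (hp : p ≠ 0) (u : E3) :
    ContDiffAt ℝ ∞ (fun p => formExt β p u) p := by
  have h1 := (β.smooth.contMDiffAt (x := radial p)).comp p (contMDiffAt_radial hp)
  have h2 : ContMDiffAt 𝓘(ℝ, E3) ((𝓡 2).prod 𝓘(ℝ, ℝ)) ∞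
      (fun p => Bundle.TotalSpace.mk' ℝ (E := Bundle.Trivial S2 ℝ) (radial p)
        (β.form (radial p) (dradial p u))) p :=
    ContMDiffAt.clm_bundle_apply (F₁ := E2) (F₂ := ℝ) h1 (contMDiffAt_dradial hp u)
  rw [Bundle.contMDiffAt_totalSpace] at h2
  exact h2.2.contDiffAt

lemma contDiffAt_inner_dradial (g : SphereMetric) {p : E3} (hp : p ≠ 0) (u w : E3) :
    ContDiffAt ℝ ∞ (fun p => g.inner (radial p) (dradial p u) (dradial p w)) p := by
  have h1 := (g.contMDiff.contMDiffAt (x := radial p)).comp p (contMDiffAt_radial hp)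
  have h2 : ContMDiffAt 𝓘(ℝ, E3) ((𝓡 2).prod 𝓘(ℝ, ℝ)) ∞
      (fun p => Bundle.TotalSpace.mk' ℝ (E := Bundle.Trivial S2 ℝ) (radial p)
        (g.inner (radial p) (dradial p u) (dradial p w))) p :=
    ContMDiffAt.clm_bundle_apply₂ (F₁ := E2) (F₂ := E2) h1 (contMDiffAt_dradial hp u)
      (contMDiffAt_dradial hp w)
  rw [Bundle.contMDiffAt_totalSpace] at h2
  exact h2.2.contDiffAt

lemma contDiffAt_radial_coe {p : E3} (hp : p ≠ 0) :
    ContDiffAt ℝ ∞ (fun p => (radial p : E3)) p :=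
  ((contMDiff_coe_sphere (n := 2) (m := ∞)).contMDiffAt.comp p (contMDiffAt_radial hp)).contDiffAt

lemma contDiffAt_metric (g : SphereMetric) {p : E3} (hp : p ≠ 0) (u w : E3) :
    ContDiffAt ℝ ∞ (fun p => metric g p u w) p := by
  have h := contDiffAt_radial_coe hp
  exact ((h.inner ℝ contDiffAt_const).mul (h.inner ℝ contDiffAt_const)).add
    (contDiffAt_inner_dradial g hp u w)

lemma norm_radial (p : E3) : ‖(radial p : E3)‖ = 1 := by simp

lemma norm_smul_radial {p : E3} (hp : p ≠ 0) : ‖p‖ • (radial p : E3) = p := by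
  rw [radial_coe hp, smul_smul, mul_inv_cancel₀ (norm_ne_zero_iff.2 hp), one_smul]

lemma hasFDerivAt_norm {p : E3} (hp : p ≠ 0) :
    HasFDerivAt (fun q : E3 => ‖q‖) (innerSL ℝ (radial p : E3)) p := by
  have h1 : DifferentiableAt ℝ (fun q : E3 => ‖q‖) p :=
    (contDiffAt_norm (n := 1) ℝ hp).differentiableAt (by simp)
  have h2 := h1.hasFDerivAt.pow 2
  have h3 : HasFDerivAt (fun q : E3 => ‖q‖ ^ 2) (2 • innerSL ℝ p) p :=
    (hasStrictFDerivAt_norm_sq p).hasFDerivAt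
  have h4 := h2.unique h3
  have h5 : fderiv ℝ (fun q : E3 => ‖q‖) p = innerSL ℝ (radial p : E3) := by
    ext u
    have h6 := congrArg (fun L : E3 →L[ℝ] ℝ => L u) h4
    simp at h6
    have h7 : ‖p‖ ≠ 0 := norm_ne_zero_iff.2 hp
    rw [innerSL_apply_apply, radial_coe hp, real_inner_smul_left]
    field_simp
    linarith
  rw [← h5]
  exact h1.hasFDerivAt

lemma fderiv_radial {p : E3} (hp : p ≠ 0) (u : E3) :
    fderiv ℝ (fun p => (radial p : E3)) p u
      = ‖p‖⁻¹ • (u - inner ℝ (radial p : E3) u • (radial p : E3)) := by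
  have h1 : HasFDerivAt (fun p => (radial p : E3)) (fderiv ℝ (fun p => (radial p : E3)) p) p :=
    ((contDiffAt_radial_coe hp).differentiableAt (by simp)).hasFDerivAt
  have h2 := (hasFDerivAt_norm hp).smul h1
  have h3 := h2.unique ((hasFDerivAt_id p).congr_of_eventuallyEq (by
    filter_upwards [isOpen_ne_zero.mem_nhds hp] with q hq
    exact norm_smul_radial hq))
  have h4 := congrArg (fun L : E3 →L[ℝ] E3 => L u) h3
  simp at h4
  rw [eq_inv_smul_iff₀ (norm_ne_zero_iff.2 hp), eq_sub_iff_add_eq]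
  exact h4

lemma eq_smul_radial_of_dradial_eq_zero {p : E3} (hp : p ≠ 0) {u : E3} (h : dradial p u = 0) :
    u = inner ℝ (radial p : E3) u • (radial p : E3) := by
  have h1 : fderiv ℝ (fun p => (radial p : E3)) p u = 0 := by
    have h2 : HasMFDerivAt (𝓡 2) 𝓘(ℝ, E3) ((↑) : S2 → E3) (radial p) _ :=
      ((contMDiff_coe_sphere (n := 2) (m := ∞)).mdifferentiableAt (by simp)).hasMFDerivAt
    have h3 : HasMFDerivAt 𝓘(ℝ, E3) (𝓡 2) radial p (dradial p) :=
      ((contMDiffAt_radial hp).mdifferentiableAt (by simp)).hasMFDerivAt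
    have h4 := (h2.comp p h3).mfderiv
    rw [mfderiv_eq_fderiv] at h4
    have h5 : fderiv ℝ (fun p => (radial p : E3)) p u
        = mfderiv (𝓡 2) 𝓘(ℝ, E3) ((↑) : S2 → E3) (radial p) (dradial p u) :=
      congrArg (fun L : E3 →L[ℝ] E3 => L u) h4
    rw [h5]
    rw [h, map_zero]
    rfl
  rw [fderiv_radial hp, smul_eq_zero, inv_eq_zero, norm_eq_zero, sub_eq_zero] at h1
  exact h1.resolve_left hp

lemma dradial_radial {p : E3} (hp : p ≠ 0) : dradial p (radial p : E3) = 0 := by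
  have h3 : HasMFDerivAt 𝓘(ℝ, E3) (𝓡 2) radial p (dradial p) :=
    ((contMDiffAt_radial hp).mdifferentiableAt (by simp)).hasMFDerivAt
  have h4 : HasFDerivAt (fun t : ℝ => p + t • (radial p : E3))
      ((1 : ℝ →L[ℝ] ℝ).smulRight (radial p : E3)) 0 := by
    have := ((hasDerivAt_id (0 : ℝ)).smul_const (radial p : E3)).const_add p
    simp only [one_smul] at this
    convert! this.hasFDerivAt using 1
  have h5 : HasMFDerivAt 𝓘(ℝ, ℝ) (𝓡 2) (radial ∘ fun t : ℝ => p + t • (radial p : E3)) 0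
      ((dradial p).comp ((1 : ℝ →L[ℝ] ℝ).smulRight (radial p : E3))) := by
    refine HasMFDerivAt.comp (I' := 𝓘(ℝ, E3)) (0 : ℝ) (g := radial)
      (f := fun t : ℝ => p + t • (radial p : E3)) ?_ h4.hasMFDerivAt
    rw [zero_smul, add_zero]
    exact h3
  have h6 : (radial ∘ fun t : ℝ => p + t • (radial p : E3)) =ᶠ[𝓝 0] fun _ => radial p := by
    have h7 : ∀ᶠ t : ℝ in 𝓝 0, 0 < ‖p‖ + t := by
      have : ContinuousAt (fun t : ℝ => ‖p‖ + t) 0 := by fun_prop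
      exact continuousAt_const.eventually_lt this (by simpa using norm_pos_iff.2 hp)
    filter_upwards [h7] with t ht
    have h8 : p + t • (radial p : E3) = (‖p‖ + t) • (radial p : E3) := by
      rw [add_smul, norm_smul_radial hp]
    refine Subtype.ext ?_
    have h9 : (‖p‖ + t) • (radial p : E3) ≠ 0 :=
      smul_ne_zero ht.ne' (norm_ne_zero_iff.1 (by rw [norm_radial]; exact one_ne_zero))
    rw [Function.comp_apply, h8, radial_coe h9, norm_smul, norm_radial, Real.norm_of_nonneg ht.le,
      mul_one, smul_smul, inv_mul_cancel₀ ht.ne', one_smul]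
  have h7 := h5.congr_of_eventuallyEq h6.symm
  have h8 := hasMFDerivAt_unique h7 (hasMFDerivAt_const (radial p) (0 : ℝ))
  have h9 := congrArg (fun L : ℝ →L[ℝ] E2 => L 1) h8
  have h10 : dradial p ((1 : ℝ) • (radial p : E3)) = 0 := h9
  rwa [one_smul] at h10

lemma inner_dradial_smul (g : SphereMetric) {p : E3} (hp : p ≠ 0) {c : ℝ} (hc : 0 < c) (u w : E3) :
    g.inner (radial (c • p)) (dradial (c • p) u) (dradial (c • p) w)
      = (c⁻¹) ^ 2 * g.inner (radial p) (dradial p u) (dradial p w) := by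
  have hcp : c • p ≠ 0 := smul_ne_zero hc.ne' hp
  have h1 : radial = radial ∘ fun q : E3 => c • q := by
    funext q
    by_cases hq : q = 0
    · simp [hq]
    · refine Subtype.ext ?_
      rw [Function.comp_apply, radial_coe hq, radial_coe (smul_ne_zero hc.ne' hq), norm_smul,
        Real.norm_of_nonneg hc.le, smul_smul, mul_inv, mul_comm c⁻¹, mul_assoc,
        inv_mul_cancel₀ hc.ne', mul_one]
  have h2 : HasMFDerivAt 𝓘(ℝ, E3) (𝓡 2) radial (c • p) (dradial (c • p)) :=
    ((contMDiffAt_radial hcp).mdifferentiableAt (by simp)).hasMFDerivAt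
  have h3 : HasFDerivAt (fun q : E3 => c • q) (c • ContinuousLinearMap.id ℝ E3) p :=
    (hasFDerivAt_id p).const_smul c
  have h4 : mfderiv 𝓘(ℝ, E3) (𝓡 2) (radial ∘ fun q : E3 => c • q) p
      = (dradial (c • p)).comp (c • ContinuousLinearMap.id ℝ E3) :=
    (HasMFDerivAt.comp (I' := 𝓘(ℝ, E3)) p h2 h3.hasMFDerivAt).mfderiv
  let G : (E3 → S2) → ℝ := fun F => g.inner (F p) (mfderiv 𝓘(ℝ, E3) (𝓡 2) F p u)
    (mfderiv 𝓘(ℝ, E3) (𝓡 2) F p w)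
  have h5 : G radial = G (radial ∘ fun q : E3 => c • q) := congrArg G h1
  have h6 : G (radial ∘ fun q : E3 => c • q) = g.inner (radial (c • p))
      (((dradial (c • p)).comp (c • ContinuousLinearMap.id ℝ E3)) u)
      (((dradial (c • p)).comp (c • ContinuousLinearMap.id ℝ E3)) w) := by
    simp only [G, h4]
    rfl
  have h7 : ∀ v : E3, ((dradial (c • p)).comp (c • ContinuousLinearMap.id ℝ E3)) v
      = c • dradial (c • p) v := fun v => map_smul (dradial (c • p)) c v
  rw [h7, h7, map_smul, map_smul] at h6
  simp only [smul_apply, smul_eq_mul] at h6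
  have h8 : g.inner (radial p) (dradial p u) (dradial p w) = G radial := rfl
  rw [h8, h5, h6]
  field_simp

/-! ### The Levi-Civita connection of the cylinder metric -/

lemma isBilinearMap_metric (g : SphereMetric) (p : E3) : IsBilinearMap ℝ (metric g p) where
  add_left x y z := by simp only [metric, map_add, inner_add_right, add_apply]; ring
  smul_left c x y := by
    simp only [metric, map_smul, inner_smul_right, smul_apply, smul_eq_mul]; ring
  add_right x y z := by simp only [metric, map_add, inner_add_right]; ring
  smul_right c x y := by simp only [metric, map_smul, inner_smul_right, smul_eq_mul]; ring

/-- The cylinder metric as a field of continuous bilinear forms. -/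
def metricL (g : SphereMetric) (p : E3) : E3 →L[ℝ] E3 →L[ℝ] ℝ :=
  (isBilinearMap_metric g p).toContinuousBilinearMap

lemma metricL_apply (g : SphereMetric) (p u w : E3) : metricL g p u w = metric g p u w := rfl

lemma contDiffOn_clm {E F : Type} [NormedAddCommGroup E] [NormedSpace ℝ E] [NormedAddCommGroup F]
    [NormedSpace ℝ F] {b : E3 → E →L[ℝ] F} [FiniteDimensional ℝ E]
    (h : ∀ u, ∀ p ≠ 0, ContDiffAt ℝ ∞ (fun p => b p u) p) {p : E3} (hp : p ≠ 0) :
    ContDiffAt ℝ ∞ b p :=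
  (contDiffOn_clm_apply.2 fun u p hp => (h u p hp).contDiffWithinAt).contDiffAt
    (isOpen_ne_zero.mem_nhds hp)

lemma contDiffAt_metricL (g : SphereMetric) {p : E3} (hp : p ≠ 0) :
    ContDiffAt ℝ ∞ (metricL g) p :=
  contDiffOn_clm (fun u _ hp => contDiffOn_clm (fun w _ hp => contDiffAt_metric g hp u w) hp) hp

lemma metricL_comm (g : SphereMetric) (p u w : E3) : metricL g p u w = metricL g p w u := by
  simp only [metricL_apply, metric]
  rw [g.symm, mul_comm]

lemma metricL_self_pos (g : SphereMetric) {p : E3} (hp : p ≠ 0) {u : E3} (hu : u ≠ 0) :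
    0 < metricL g p u u := by
  rw [metricL_apply, metric]
  by_cases h : dradial p u = 0
  · have h1 := eq_smul_radial_of_dradial_eq_zero hp h
    have h2 : inner ℝ (radial p : E3) u ≠ 0 := fun h3 => hu (by rw [h1, h3, zero_smul])
    rw [h, map_zero]
    have := mul_self_pos.2 h2
    simpa using this
  · exact add_pos_of_nonneg_of_pos (mul_self_nonneg _) (g.pos _ _ h)

lemma eq_zero_of_metricL (g : SphereMetric) {p : E3} (hp : p ≠ 0) {u : E3}
    (h : ∀ w, metricL g p u w = 0) : u = 0 := by
  by_contra hu
  exact (metricL_self_pos g hp hu).ne' (h u)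

lemma metricL_radial (g : SphereMetric) {p : E3} (hp : p ≠ 0) (w : E3) :
    metricL g p (radial p : E3) w = inner ℝ (radial p : E3) w := by
  have h := dradial_radial hp
  rw [metricL_apply, metric, h, map_zero, real_inner_self_eq_norm_sq, norm_radial]
  simp

lemma sum_smul_basisVec (u : E3) : ∑ i, u i • basisVec i = u := by
  ext j
  simp [basisVec, Finset.sum_apply, Pi.single_apply]

lemma gram_mulVec (g : SphereMetric) (p : E3) (u : E3) (i : Fin 3) :
    (gram g p).mulVec u i = metricL g p u (basisVec i) := by
  conv_rhs => rw [← sum_smul_basisVec u]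
  simp only [Matrix.mulVec, dotProduct, gram, Matrix.of_apply, map_sum, map_smul,
    FunLike.coe_sum, Finset.sum_apply, smul_apply, smul_eq_mul]
  refine Finset.sum_congr rfl fun j _ => ?_
  rw [← metricL_apply, metricL_comm, mul_comm]

lemma posDef_gram (g : SphereMetric) {p : E3} (hp : p ≠ 0) : (gram g p).PosDef := by
  refine Matrix.PosDef.of_dotProduct_mulVec_pos ?_ fun x hx => ?_
  · ext i j
    simp only [Matrix.conjTranspose_apply, gram, Matrix.of_apply, star_trivial]
    exact metricL_comm g p _ _
  · have h1 : (WithLp.toLp 2 x : E3) ≠ 0 := fun h => hx (by simpa using h)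
    have h2 := metricL_self_pos g hp h1
    convert! h2 using 1
    conv_rhs =>
      rw [metricL_comm, ← sum_smul_basisVec (WithLp.toLp 2 x), map_sum]
    simp only [dotProduct, star_trivial, map_smul, smul_eq_mul, sum_smul_basisVec]
    refine Finset.sum_congr rfl fun i _ => ?_
    rw [← gram_mulVec]

lemma det_gram_pos (g : SphereMetric) {p : E3} (hp : p ≠ 0) : 0 < (gram g p).det :=
  (posDef_gram g hp).det_pos

lemma metricL_sharp (g : SphereMetric) {p : E3} (hp : p ≠ 0) (φ : E3 →L[ℝ] ℝ) (w : E3) :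
    metricL g p (sharp g p fun l => φ (basisVec l)) w = φ w := by
  have h : ∀ l, metricL g p (sharp g p fun l => φ (basisVec l)) (basisVec l)
      = φ (basisVec l) := by
    intro l
    rw [← gram_mulVec]
    simp only [sharp, Matrix.mulVec_mulVec]
    rw [Matrix.mul_nonsing_inv _ (det_gram_pos g hp).ne'.isUnit, Matrix.one_mulVec]
  rw [← sum_smul_basisVec w]
  simp only [map_sum, map_smul, h]

lemma eq_of_metricL (g : SphereMetric) {p : E3} (hp : p ≠ 0) {u u' : E3}
    (h : ∀ w, metricL g p u w = metricL g p u' w) : u = u' := by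
  rw [← sub_eq_zero]
  exact eq_zero_of_metricL g hp fun w => by rw [map_sub, sub_apply, h, sub_self]

lemma contDiffAt_det_gram (g : SphereMetric) {p : E3} (hp : p ≠ 0) :
    ContDiffAt ℝ ∞ (fun p => (gram g p).det) p := by
  simp only [Matrix.det_fin_three, gram, Matrix.of_apply]
  have := fun i j => contDiffAt_metric g hp (basisVec i) (basisVec j)
  fun_prop (disch := assumption)

/-- The vector dual to a covector with respect to the cylinder metric. -/
def sharpL (g : SphereMetric) (p : E3) : (E3 →L[ℝ] ℝ) →L[ℝ] E3 :=
  ContinuousLinearMap.inverse (metricL g p)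

lemma exists_equiv_metricL (g : SphereMetric) {p : E3} (hp : p ≠ 0) :
    ∃ e : E3 ≃L[ℝ] (E3 →L[ℝ] ℝ), (e : E3 →L[ℝ] (E3 →L[ℝ] ℝ)) = metricL g p := by
  have hinj : Function.Injective (metricL g p).toLinearMap := fun u w h =>
    eq_of_metricL g hp fun a => congrArg (fun L : E3 →L[ℝ] ℝ => L a) h
  have hsurj : Function.Surjective (metricL g p).toLinearMap := fun φ =>
    ⟨_, ContinuousLinearMap.ext fun w => metricL_sharp g hp φ w⟩
  exact ⟨(LinearEquiv.ofBijective (metricL g p).toLinearMap ⟨hinj, hsurj⟩).toContinuousLinearEquiv,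
    rfl⟩

lemma metricL_sharpL (g : SphereMetric) {p : E3} (hp : p ≠ 0) (φ : E3 →L[ℝ] ℝ) :
    metricL g p (sharpL g p φ) = φ := by
  obtain ⟨e, he⟩ := exists_equiv_metricL g hp
  rw [sharpL, ← he, ContinuousLinearMap.inverse_equiv]
  exact e.apply_symm_apply φ

lemma sharp_eq (g : SphereMetric) {p : E3} (hp : p ≠ 0) (φ : E3 →L[ℝ] ℝ) :
    sharp g p (fun l => φ (basisVec l)) = sharpL g p φ :=
  eq_of_metricL g hp fun w => by rw [metricL_sharp g hp, metricL_sharpL g hp]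

lemma contDiffAt_sharpL (g : SphereMetric) {p : E3} (hp : p ≠ 0) :
    ContDiffAt ℝ ∞ (sharpL g) p := by
  obtain ⟨e, he⟩ := exists_equiv_metricL g hp
  have h := contDiffAt_map_inverse (𝕜 := ℝ) (n := ∞) e
  rw [he] at h
  exact h.comp p (contDiffAt_metricL g hp)

lemma hasFDerivAt_metricL (g : SphereMetric) {p : E3} (hp : p ≠ 0) :
    HasFDerivAt (metricL g) (fderiv ℝ (metricL g) p) p :=
  ((contDiffAt_metricL g hp).differentiableAt (by simp)).hasFDerivAt

lemma fderiv_metric (g : SphereMetric) {p : E3} (hp : p ≠ 0) (u w a : E3) :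
    fderiv ℝ (fun q => metric g q w a) p u = fderiv ℝ (metricL g) p u w a := by
  have h : HasFDerivAt (fun q => metricL g q w a) (((fderiv ℝ (metricL g) p).flip w).flip a) p := by
    have h1 := ((hasFDerivAt_metricL g hp).clm_apply (hasFDerivAt_const w p)).clm_apply
      (hasFDerivAt_const a p)
    convert! h1 using 1
    (ext; simp)
  exact congrArg (fun L : E3 →L[ℝ] ℝ => L u) h.fderiv

lemma contDiffAt_fderiv_metricL (g : SphereMetric) {p : E3} (u w a : E3) (hp : p ≠ 0) :
    ContDiffAt ℝ ∞ (fun p => fderiv ℝ (metricL g) p u w a) p := by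
  have h : ContDiffAt ℝ ∞ (fun p => fderiv ℝ (fun q => metric g q w a) p u) p :=
    ((contDiffAt_metric g hp w a).fderiv_right (m := ∞) (by simp)).clm_apply contDiffAt_const
  refine h.congr_of_eventuallyEq ?_
  filter_upwards [isOpen_ne_zero.mem_nhds hp] with q hq
  exact (fderiv_metric g hq u w a).symm

lemma fderiv_metricL_comm (g : SphereMetric) {p : E3} (hp : p ≠ 0) (u w a : E3) :
    fderiv ℝ (metricL g) p u w a = fderiv ℝ (metricL g) p u a w := by
  rw [← fderiv_metric g hp, ← fderiv_metric g hp]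
  congr 2
  funext q
  exact metricL_comm g q w a

/-- The Koszul formula. -/
lemma metricL_christoffel (g : SphereMetric) {p : E3} (hp : p ≠ 0) (u w a : E3) :
    metricL g p (christoffel g p u w) a = (1 / 2 : ℝ) * (fderiv ℝ (metricL g) p u w a
      + fderiv ℝ (metricL g) p w u a - fderiv ℝ (metricL g) p a u w) := by
  let φ : E3 →L[ℝ] ℝ := (1 / 2 : ℝ) • (fderiv ℝ (metricL g) p u w
      + fderiv ℝ (metricL g) p w u - ((fderiv ℝ (metricL g) p).flip u).flip w)
  have h : christoffel g p u w = sharp g p fun l => φ (basisVec l) := by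
    simp only [christoffel, fderiv_metric g hp]
    rfl
  rw [h, metricL_sharp g hp]
  rfl

lemma christoffel_comm (g : SphereMetric) {p : E3} (hp : p ≠ 0) (u w : E3) :
    christoffel g p u w = christoffel g p w u :=
  eq_of_metricL g hp fun a => by
    rw [metricL_christoffel g hp, metricL_christoffel g hp, fderiv_metricL_comm g hp a u w]
    ring

lemma fderiv_metricL_eq (g : SphereMetric) {p : E3} (hp : p ≠ 0) (u w a : E3) :
    fderiv ℝ (metricL g) p u w a
      = metricL g p (christoffel g p u w) a + metricL g p w (christoffel g p u a) := by
  rw [metricL_comm g p w, metricL_christoffel g hp, metricL_christoffel g hp,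
    fderiv_metricL_comm g hp u a w, fderiv_metricL_comm g hp w u a,
    fderiv_metricL_comm g hp a u w]
  ring

lemma isBilinearMap_christoffel (g : SphereMetric) {p : E3} (hp : p ≠ 0) :
    IsBilinearMap ℝ (christoffel g p) where
  add_left x y z := eq_of_metricL g hp fun a => by
    simp only [metricL_christoffel g hp, map_add, add_apply]; ring
  smul_left c x y := eq_of_metricL g hp fun a => by
    simp only [metricL_christoffel g hp, map_smul, smul_apply, smul_eq_mul]; ring
  add_right x y z := eq_of_metricL g hp fun a => by
    simp only [metricL_christoffel g hp, map_add, add_apply]; ring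
  smul_right c x y := eq_of_metricL g hp fun a => by
    simp only [metricL_christoffel g hp, map_smul, smul_apply, smul_eq_mul]; ring

open Classical in
/-- The Christoffel symbols as a field of continuous bilinear maps on `ℝ³ \ {0}`. -/
def christoffelL (g : SphereMetric) (p : E3) : E3 →L[ℝ] E3 →L[ℝ] E3 :=
  if hp : p = 0 then 0 else (isBilinearMap_christoffel g hp).toContinuousBilinearMap

lemma christoffelL_apply (g : SphereMetric) {p : E3} (hp : p ≠ 0) (u w : E3) :
    christoffelL g p u w = christoffel g p u w := by
  rw [christoffelL, dif_neg hp]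
  rfl

lemma contDiffAt_christoffelL (g : SphereMetric) {p : E3} (hp : p ≠ 0) :
    ContDiffAt ℝ ∞ (christoffelL g) p := by
  refine contDiffOn_clm (fun u _ hp => contDiffOn_clm (fun w p hp => ?_) hp) hp
  have h1 := fun u w a q => contDiffAt_fderiv_metricL g (p := q) u w a
  have h2 : ContDiffAt ℝ ∞ (fun p => sharpL g p ((1 / 2 : ℝ) • (fderiv ℝ (metricL g) p u w
      + fderiv ℝ (metricL g) p w u - ((fderiv ℝ (metricL g) p).flip u).flip w))) p := by
    refine (contDiffAt_sharpL g hp).clm_apply (contDiffOn_clm (fun a q hq => ?_) hp)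
    exact (contDiffAt_const (c := (1 / 2 : ℝ))).mul (((h1 u w a q hq).add (h1 w u a q hq)).sub (h1 a u w q hq))
  refine h2.congr_of_eventuallyEq ?_
  filter_upwards [isOpen_ne_zero.mem_nhds hp] with q hq
  rw [christoffelL_apply g hq]
  refine eq_of_metricL g hq fun a => ?_
  rw [metricL_sharpL g hq, metricL_christoffel g hq]
  rfl

lemma inner_radial_christoffel (g : SphereMetric) {p : E3} (hp : p ≠ 0) (u w : E3) :
    inner ℝ (radial p : E3) (christoffel g p u w) = ‖p‖⁻¹ * (inner ℝ u w
      - inner ℝ (radial p : E3) u * inner ℝ (radial p : E3) w) := by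
  have hr : HasFDerivAt (fun q => (radial q : E3)) (fderiv ℝ (fun q => (radial q : E3)) p) p :=
    ((contDiffAt_radial_coe hp).differentiableAt (by simp)).hasFDerivAt
  have hG := hasFDerivAt_metricL g hp
  have hn := norm_ne_zero_iff.2 hp
  set n : E3 := (radial p : E3) with hn_def
  -- derivatives of `g(n, w) = ⟨n, w⟩`
  have h1 : ∀ u w, fderiv ℝ (metricL g) p u n w
      = ‖p‖⁻¹ * (inner ℝ u w - metricL g p u w) := by
    intro u w
    have h2 := (hG.clm_apply hr).clm_apply (hasFDerivAt_const w p)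
    have h3 := (hr.inner ℝ (hasFDerivAt_const w p)).congr_of_eventuallyEq
      (f₁ := fun q => metricL g q (radial q : E3) w) (by
      filter_upwards [isOpen_ne_zero.mem_nhds hp] with q hq
      exact metricL_radial g hq w)
    have h4 := congrArg (fun L : E3 →L[ℝ] ℝ => L u) (h2.unique h3)
    have h5 : fderiv ℝ (metricL g) p u n w
        + metricL g p (fderiv ℝ (fun q => (radial q : E3)) p u) w
        = inner ℝ (fderiv ℝ (fun q => (radial q : E3)) p u) w := by
      simpa [add_comm] using h4
    rw [fderiv_radial hp, ← hn_def, map_smul, map_sub, map_smul, smul_apply, sub_apply, smul_apply,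
      metricL_radial g hp, ← hn_def, real_inner_smul_left, inner_sub_left, real_inner_smul_left,
      smul_eq_mul, smul_eq_mul] at h5
    linear_combination h5
  -- the metric scales along the rays
  have h2 : fderiv ℝ (metricL g) p n u w
      = - 2 * ‖p‖⁻¹ * (metricL g p u w - inner ℝ n u * inner ℝ n w) := by
    have h3 : HasDerivAt (fun t : ℝ => p + t • n) n 0 := by
      have := ((hasDerivAt_id (0 : ℝ)).smul_const n).const_add p
      rw [one_smul] at this
      exact this
    have h4 : HasDerivAt (fun t : ℝ => metricL g (p + t • n) u w)
        (fderiv ℝ (metricL g) p n u w) 0 := by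
      have h5 : HasDerivAt (fun t : ℝ => metricL g (p + t • n)) (fderiv ℝ (metricL g) p n) 0 :=
        HasFDerivAt.comp_hasDerivAt (l := metricL g) (0 : ℝ)
          (by rw [zero_smul, add_zero]; exact hG) h3
      have h6 := (h5.clm_apply (hasDerivAt_const (0 : ℝ) u)).clm_apply (hasDerivAt_const (0 : ℝ) w)
      simpa using h6
    have h5 : HasDerivAt (fun t : ℝ => inner ℝ n u * inner ℝ n w
        + ((1 + t * ‖p‖⁻¹)⁻¹) ^ 2 * (metricL g p u w - inner ℝ n u * inner ℝ n w))
        (- 2 * ‖p‖⁻¹ * (metricL g p u w - inner ℝ n u * inner ℝ n w)) 0 := by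
      have h6 : HasDerivAt (fun t : ℝ => 1 + t * ‖p‖⁻¹) ‖p‖⁻¹ 0 := by
        simpa using ((hasDerivAt_id (0 : ℝ)).mul_const ‖p‖⁻¹).const_add 1
      have h7 := (((h6.inv (by simp)).pow 2).mul_const
        (metricL g p u w - inner ℝ n u * inner ℝ n w)).const_add (inner ℝ n u * inner ℝ n w)
      convert! h7 using 1
      simp
    refine h4.unique (h5.congr_of_eventuallyEq ?_)
    have h7 : ∀ᶠ t : ℝ in 𝓝 0, 0 < 1 + t * ‖p‖⁻¹ := by
      have : ContinuousAt (fun t : ℝ => 1 + t * ‖p‖⁻¹) 0 := by fun_prop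
      exact continuousAt_const.eventually_lt this (by simp)
    filter_upwards [h7] with t ht
    have h8 : p + t • n = (1 + t * ‖p‖⁻¹) • p := by
      rw [hn_def, radial_coe hp, add_smul, one_smul, smul_smul]
    have h9 : (radial ((1 + t * ‖p‖⁻¹) • p) : E3) = n := by
      rw [hn_def, radial_coe hp, radial_coe (smul_ne_zero ht.ne' hp), norm_smul,
        Real.norm_of_nonneg ht.le, smul_smul, mul_inv, mul_comm (1 + t * ‖p‖⁻¹)⁻¹, mul_assoc,
        inv_mul_cancel₀ ht.ne', mul_one]
    rw [h8, metricL_apply, metricL_apply, metric, metric, h9, inner_dradial_smul g hp ht, ← hn_def]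
    ring
  rw [hn_def, ← metricL_radial g hp, metricL_comm, metricL_christoffel g hp, ← hn_def,
    fderiv_metricL_comm g hp u w n, fderiv_metricL_comm g hp w u n, h1, h1, h2,
    metricL_comm g p w u, real_inner_comm w u]
  ring

lemma fderiv_christoffel (g : SphereMetric) {p : E3} (hp : p ≠ 0) (u w a : E3) :
    fderiv ℝ (fun q => christoffel g q w a) p u = fderiv ℝ (christoffelL g) p u w a := by
  have h0 : HasFDerivAt (christoffelL g) (fderiv ℝ (christoffelL g) p) p :=
    ((contDiffAt_christoffelL g hp).differentiableAt (by simp)).hasFDerivAt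
  have h : HasFDerivAt (fun q => christoffelL g q w a)
      (((fderiv ℝ (christoffelL g) p).flip w).flip a) p := by
    have h1 := (h0.clm_apply (hasFDerivAt_const w p)).clm_apply (hasFDerivAt_const a p)
    convert! h1 using 1
    (ext; simp)
  have h2 := h.congr_of_eventuallyEq (f₁ := fun q => christoffel g q w a) (by
    filter_upwards [isOpen_ne_zero.mem_nhds hp] with q hq
    rw [christoffelL_apply g hq])
  exact congrArg (fun L : E3 →L[ℝ] E3 => L u) h2.fderiv

lemma riemann_eq (g : SphereMetric) {p : E3} (hp : p ≠ 0) (u w a : E3) :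
    riemann g p u w a = fderiv ℝ (christoffelL g) p u w a - fderiv ℝ (christoffelL g) p w u a
      + christoffelL g p u (christoffelL g p w a) - christoffelL g p w (christoffelL g p u a) := by
  simp only [riemann, fderiv_christoffel g hp, christoffelL_apply g hp]

/-- The curvature operators are skew-symmetric, since the connection is compatible with the
metric. -/
lemma metricL_riemann_skew (g : SphereMetric) {p : E3} (hp : p ≠ 0) (u w a b : E3) :
    metricL g p (riemann g p u w a) b = - metricL g p (riemann g p u w b) a := by
  have h0 : HasFDerivAt (christoffelL g) (fderiv ℝ (christoffelL g) p) p :=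
    ((contDiffAt_christoffelL g hp).differentiableAt (by simp)).hasFDerivAt
  have hG := hasFDerivAt_metricL g hp
  have hC : ContDiffAt ℝ ∞ (fun q => metricL g q a b) p := contDiffAt_metric g hp a b
  have hsym : IsSymmSndFDerivAt ℝ (fun q => metricL g q a b) p :=
    hC.isSymmSndFDerivAt (by simp; norm_cast)
  have key : ∀ u w, fderiv ℝ (fderiv ℝ (fun q => metricL g q a b)) p w u
      = fderiv ℝ (metricL g) p w (christoffelL g p u a) b
        + metricL g p (fderiv ℝ (christoffelL g) p w u a) b
        + fderiv ℝ (metricL g) p w a (christoffelL g p u b)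
        + metricL g p a (fderiv ℝ (christoffelL g) p w u b) := by
    intro u w
    have h1 : HasFDerivAt (fun q => fderiv ℝ (fun q => metricL g q a b) q u)
        ((fderiv ℝ (fderiv ℝ (fun q => metricL g q a b)) p).flip u) p := by
      have h2 : HasFDerivAt (fderiv ℝ (fun q => metricL g q a b)) _ p :=
        ((hC.fderiv_right (m := ∞) (by simp)).differentiableAt (by simp)).hasFDerivAt
      convert! h2.clm_apply (hasFDerivAt_const u p) using 1
      ext; simp
    have h3 : ∀ c, HasFDerivAt (fun q => christoffelL g q u c)
        (((fderiv ℝ (christoffelL g) p).flip u).flip c) p := fun c => by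
      convert! (h0.clm_apply (hasFDerivAt_const u p)).clm_apply (hasFDerivAt_const c p) using 1
      (ext; simp)
    have h4 := ((hG.clm_apply (h3 a)).clm_apply (hasFDerivAt_const b p)).add
      ((hG.clm_apply (hasFDerivAt_const a p)).clm_apply (h3 b))
    have h5 := h1.unique (h4.congr_of_eventuallyEq (by
      filter_upwards [isOpen_ne_zero.mem_nhds hp] with q hq
      have := fderiv_metricL_eq g hq u a b
      rw [← fderiv_metric g hq] at this
      rw [← christoffelL_apply g hq, ← christoffelL_apply g hq] at this
      exact this))
    have h6 := congrArg (fun L : E3 →L[ℝ] ℝ => L w) h5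
    simp at h6
    rw [h6]
    ring
  have h1 := key u w
  have h2 := key w u
  have h3 := hsym u w
  simp only [fderiv_metricL_eq g hp, ← christoffelL_apply g hp] at h1 h2
  rw [h1, h2] at h3
  rw [riemann_eq g hp, riemann_eq g hp]
  simp only [map_sub, map_add, sub_apply, add_apply]
  have e := metricL_comm g p
  rw [e a, e a, e a, e a, e (christoffelL g p w a), e (christoffelL g p u a)] at h3
  linarith

lemma riemann_combination (g : SphereMetric) {p : E3} (hp : p ≠ 0) (u w z : E3) (a b a' b' : ℝ) :
    riemann g p (a • u + b • w) (a' • u + b' • w) z = (a * b' - a' * b) • riemann g p u w z := by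
  simp only [riemann_eq g hp, map_add, map_smul, add_apply, smul_apply]
  module

/-! ### The area form and the rotation of the tangent planes -/

lemma area_eq (g : SphereMetric) (x u w : E3) :
    area g x u w = Real.sqrt (gram g x).det
      * (x 0 * u 1 * w 2 - x 0 * u 2 * w 1 - x 1 * u 0 * w 2 + x 1 * u 2 * w 0
        + x 2 * u 0 * w 1 - x 2 * u 1 * w 0) := by
  simp [area, Matrix.det_fin_three]

lemma isBilinearMap_area (g : SphereMetric) (x : E3) : IsBilinearMap ℝ (area g x) where
  add_left u u' w := by simp only [area_eq, PiLp.add_apply]; ring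
  smul_left c u w := by simp only [area_eq, PiLp.smul_apply, smul_eq_mul]; ring
  add_right u w w' := by simp only [area_eq, PiLp.add_apply]; ring
  smul_right c u w := by simp only [area_eq, PiLp.smul_apply, smul_eq_mul]; ring

/-- The area form as a field of continuous bilinear forms. -/
def areaL (g : SphereMetric) (x : E3) : E3 →L[ℝ] E3 →L[ℝ] ℝ :=
  (isBilinearMap_area g x).toContinuousBilinearMap

lemma areaL_apply (g : SphereMetric) (x u w : E3) : areaL g x u w = area g x u w := rfl

lemma contDiffAt_coord {p : E3} (i : Fin 3) : ContDiffAt ℝ ∞ (fun p : E3 => p i) p :=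
  (EuclideanSpace.proj (𝕜 := ℝ) i).contDiff.contDiffAt

lemma contDiffAt_areaL (g : SphereMetric) {p : E3} (hp : p ≠ 0) :
    ContDiffAt ℝ ∞ (areaL g) p := by
  refine contDiffOn_clm (fun u _ hp => contDiffOn_clm (fun w p hp => ?_) hp) hp
  simp only [areaL_apply, area_eq]
  refine ((contDiffAt_det_gram g hp).sqrt (det_gram_pos g hp).ne').mul ?_
  have h := fun i => contDiffAt_coord (p := p) i
  have h0 := h 0
  have h1 := h 1
  have h2 := h 2
  fun_prop

/-- The rotation by `π / 2` in the tangent planes, as a field of continuous linear maps. -/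
def rotL (g : SphereMetric) (x : E3) : E3 →L[ℝ] E3 := (sharpL g x).comp (areaL g x)

lemma rot_eq (g : SphereMetric) {x : E3} (hx : x ≠ 0) (v : E3) : rot g x v = rotL g x v :=
  sharp_eq g hx (areaL g x v)

lemma contDiffAt_rotL (g : SphereMetric) {p : E3} (hp : p ≠ 0) : ContDiffAt ℝ ∞ (rotL g) p :=
  (contDiffAt_sharpL g hp).clm_comp (contDiffAt_areaL g hp)

lemma metricL_rotL (g : SphereMetric) {x : E3} (hx : x ≠ 0) (v w : E3) :
    metricL g x (rotL g x v) w = area g x v w := by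
  rw [rotL, ContinuousLinearMap.comp_apply, metricL_sharpL g hx, areaL_apply]

lemma metricL_base (g : SphereMetric) {x : E3} (hx : x ≠ 0) (w : E3) :
    metricL g x x w = inner ℝ x w := by
  conv_lhs => arg 1; arg 2; rw [← norm_smul_radial hx]
  rw [map_smul, smul_apply, metricL_radial g hx, smul_eq_mul, ← real_inner_smul_left,
    norm_smul_radial hx]

lemma metricL_rotL_self (g : SphereMetric) {x : E3} (hx : x ≠ 0) (v : E3) :
    metricL g x (rotL g x v) v = 0 := by
  rw [metricL_rotL g hx, area_eq]; ring

lemma inner_base_rotL (g : SphereMetric) {x : E3} (hx : x ≠ 0) (v : E3) :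
    inner ℝ x (rotL g x v) = 0 := by
  rw [← metricL_base g hx, metricL_comm, metricL_rotL g hx, area_eq]; ring

lemma area_swap (g : SphereMetric) (x v w : E3) : area g x v w = - area g x w v := by
  rw [area_eq, area_eq]; ring

/-- The square of the area form is a Gram determinant. -/
lemma area_sq (g : SphereMetric) {x : E3} (hx : x ≠ 0) (v w : E3) :
    area g x v w ^ 2 = metricL g x x x * (metricL g x v v * metricL g x w w - metricL g x v w ^ 2)
      - metricL g x x v * (metricL g x x v * metricL g x w w - metricL g x v w * metricL g x x w)
      + metricL g x x w * (metricL g x x v * metricL g x v w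
        - metricL g x v v * metricL g x x w) := by
  let M : Matrix (Fin 3) (Fin 3) ℝ := Matrix.of ![⇑x, ⇑v, ⇑w]
  let y : Fin 3 → E3 := ![x, v, w]
  have h1 : M * gram g x * M.transpose = Matrix.of fun i j => metricL g x (y i) (y j) := by
    have hM : ∀ i j, M i j = y i j := by
      intro i j
      fin_cases i <;> rfl
    ext i j
    rw [Matrix.mul_assoc, Matrix.of_apply, Matrix.mul_apply]
    conv_rhs => rw [metricL_comm, ← sum_smul_basisVec (y i)]
    simp only [map_sum, map_smul, smul_eq_mul]
    refine Finset.sum_congr rfl fun k _ => ?_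
    rw [hM, ← gram_mulVec]
    simp only [Matrix.mul_apply, Matrix.transpose_apply, hM]
    rfl
  have h2 : (M * gram g x * M.transpose).det = area g x v w ^ 2 := by
    rw [Matrix.det_mul, Matrix.det_mul, Matrix.det_transpose, area, mul_pow,
      Real.sq_sqrt (det_gram_pos g hx).le]
    ring
  rw [← h2, h1, Matrix.det_fin_three]
  simp only [Matrix.of_apply, y, Matrix.cons_val_zero, Matrix.cons_val_one, Matrix.cons_val]
  rw [metricL_comm g x v x, metricL_comm g x w x, metricL_comm g x w v]
  ring

lemma rotL_ne_zero (g : SphereMetric) {x v : E3} (hx : x ≠ 0) (hv : v ≠ 0)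
    (hxv : inner ℝ x v = 0) : rotL g x v ≠ 0 := by
  intro h
  -- the area spanned by `v` and `x × v` is not zero
  have h1 := metricL_rotL g hx v
    (!₂[x 1 * v 2 - x 2 * v 1, x 2 * v 0 - x 0 * v 2, x 0 * v 1 - x 1 * v 0] : E3)
  rw [h, map_zero, zero_apply, area_eq] at h1
  have h2 := (mul_eq_zero.1 h1.symm).resolve_left (Real.sqrt_pos.2 (det_gram_pos g hx)).ne'
  have h3 : (0 : ℝ) < inner ℝ x x * inner ℝ v v - inner ℝ x v ^ 2 := by
    rw [hxv, real_inner_self_eq_norm_sq, real_inner_self_eq_norm_sq]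
    have := norm_pos_iff.2 hx
    have := norm_pos_iff.2 hv
    simp only [ne_eq, OfNat.ofNat_ne_zero, not_false_eq_true, zero_pow, sub_zero]
    positivity
  refine h3.ne' ?_
  simp only [PiLp.inner_apply, Fin.sum_univ_three, RCLike.inner_apply, conj_trivial]
  simp at h2
  linear_combination h2

/-- `|jv|² = |x|² |v|² - ⟨x, v⟩²`. -/
lemma metricL_rotL_rotL (g : SphereMetric) {x v : E3} (hx : x ≠ 0) (h : rotL g x v ≠ 0) :
    metricL g x (rotL g x v) (rotL g x v)
      = inner ℝ x x * metricL g x v v - inner ℝ x v ^ 2 := by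
  have h1 := area_sq g hx v (rotL g x v)
  rw [← metricL_rotL g hx, metricL_comm g x v (rotL g x v), metricL_rotL_self g hx,
    metricL_base g hx, metricL_base g hx, metricL_base g hx, inner_base_rotL g hx] at h1
  have h2 := (metricL_self_pos g hx h).ne'
  refine mul_left_cancel₀ h2 ?_
  linear_combination h1

/-! ### The unit tangent bundle -/

section UnitBundle

variable (g : SphereMetric) {z : Phase}

lemma fst_ne_zero_of_mem (hz : z ∈ unitBundle g) : z.1 ≠ 0 := by
  rw [← norm_ne_zero_iff, hz.1]; exact one_ne_zero

lemma radial_of_norm {p : E3} (hp : ‖p‖ = 1) : (radial p : E3) = p := by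
  rw [radial_coe (by rw [← norm_ne_zero_iff, hp]; exact one_ne_zero), hp, inv_one, one_smul]

lemma inner_of_mem (hz : z ∈ unitBundle g) : inner ℝ z.1 z.2 = 0 := hz.2.1

lemma metricL_of_mem (hz : z ∈ unitBundle g) : metricL g z.1 z.2 z.2 = 1 := by
  have h := hz.2.2
  rw [energy] at h
  rw [metricL_apply]
  linarith

lemma mem_unitBundle (h1 : ‖z.1‖ = 1) (h2 : inner ℝ z.1 z.2 = 0)
    (h3 : metricL g z.1 z.2 z.2 = 1) : z ∈ unitBundle g :=
  ⟨h1, h2, by rw [energy, ← metricL_apply, h3]; norm_num⟩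

lemma snd_ne_zero_of_mem (hz : z ∈ unitBundle g) : z.2 ≠ 0 := by
  intro h
  have := metricL_of_mem g hz
  rw [h, map_zero] at this
  exact zero_ne_one this

/-- The vector `jv` at `(x, v)`. -/
def perp (g : SphereMetric) (z : Phase) : E3 := rotL g z.1 z.2

lemma rot_of_mem (hz : z ∈ unitBundle g) : rot g z.1 z.2 = perp g z :=
  rot_eq g (fst_ne_zero_of_mem g hz) z.2

lemma metricL_perp_snd (hz : z ∈ unitBundle g) : metricL g z.1 (perp g z) z.2 = 0 :=
  metricL_rotL_self g (fst_ne_zero_of_mem g hz) z.2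

lemma metricL_snd_perp (hz : z ∈ unitBundle g) : metricL g z.1 z.2 (perp g z) = 0 := by
  rw [metricL_comm, metricL_perp_snd g hz]

lemma inner_fst_perp (hz : z ∈ unitBundle g) : inner ℝ z.1 (perp g z) = 0 :=
  inner_base_rotL g (fst_ne_zero_of_mem g hz) z.2

lemma perp_ne_zero (hz : z ∈ unitBundle g) : perp g z ≠ 0 :=
  rotL_ne_zero g (fst_ne_zero_of_mem g hz) (snd_ne_zero_of_mem g hz) (inner_of_mem g hz)

lemma metricL_perp_perp (hz : z ∈ unitBundle g) : metricL g z.1 (perp g z) (perp g z) = 1 := by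
  have h := metricL_rotL_rotL g (fst_ne_zero_of_mem g hz) (perp_ne_zero g hz)
  rw [metricL_of_mem g hz, inner_of_mem g hz, real_inner_self_eq_norm_sq, hz.1] at h
  change metricL g z.1 (perp g z) (perp g z) = _ at h
  rw [h]
  norm_num

lemma area_snd_perp (hz : z ∈ unitBundle g) : area g z.1 z.2 (perp g z) = 1 := by
  rw [← metricL_rotL g (fst_ne_zero_of_mem g hz)]
  exact metricL_perp_perp g hz

/-- The vectors `x, v, jv` are an orthonormal frame of the cylinder metric. -/
lemma eq_frame (hz : z ∈ unitBundle g) (u : E3) :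
    u = inner ℝ z.1 u • z.1 + metricL g z.1 z.2 u • z.2
      + metricL g z.1 (perp g z) u • perp g z := by
  have hx := fst_ne_zero_of_mem g hz
  set y := u - (inner ℝ z.1 u • z.1 + metricL g z.1 z.2 u • z.2
    + metricL g z.1 (perp g z) u • perp g z) with hy
  have e1 : metricL g z.1 z.1 y = 0 := by
    rw [metricL_base g hx, hy, inner_sub_right, inner_add_right, inner_add_right,
      inner_smul_right, inner_smul_right, inner_smul_right, inner_of_mem g hz,
      inner_fst_perp g hz, real_inner_self_eq_norm_sq, hz.1]
    ring
  have e2 : metricL g z.1 z.2 y = 0 := by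
    rw [hy, map_sub, map_add, map_add, map_smul, map_smul, map_smul, metricL_of_mem g hz,
      metricL_snd_perp g hz, metricL_comm g z.1 z.2 z.1, metricL_base g hx, inner_of_mem g hz]
    simp
  have e3 : metricL g z.1 (perp g z) y = 0 := by
    rw [hy, map_sub, map_add, map_add, map_smul, map_smul, map_smul, metricL_perp_perp g hz,
      metricL_perp_snd g hz, metricL_comm g z.1 (perp g z) z.1, metricL_base g hx,
      inner_fst_perp g hz]
    simp
  have h1 := area_sq g hx z.2 y
  rw [← metricL_rotL g hx] at h1
  change metricL g z.1 (perp g z) y ^ 2 = _ at h1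
  rw [e1, e2, e3, metricL_of_mem g hz, metricL_base g hx, metricL_base g hx, inner_of_mem g hz,
    real_inner_self_eq_norm_sq, hz.1] at h1
  have h2 : y = 0 := by
    by_contra h
    have := metricL_self_pos g hx h
    linarith
  rw [hy, sub_eq_zero] at h2
  exact h2

lemma rotL_perp (hz : z ∈ unitBundle g) : rotL g z.1 (perp g z) = - z.2 := by
  have hx := fst_ne_zero_of_mem g hz
  rw [eq_frame g hz (rotL g z.1 (perp g z)), inner_base_rotL g hx, metricL_comm g z.1 z.2,
    metricL_rotL g hx, area_swap, area_snd_perp g hz, metricL_comm g z.1 (perp g z),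
    metricL_rotL_self g hx]
  simp

/-! ### Covariant derivatives -/

lemma hasDerivAt_metricL {x a b : ℝ → E3} {x' a' b' : E3} {t : ℝ} (hx : HasDerivAt x x' t)
    (ha : HasDerivAt a a' t) (hb : HasDerivAt b b' t) (h0 : x t ≠ 0) :
    HasDerivAt (fun s => metricL g (x s) (a s) (b s))
      (metricL g (x t) (a' + christoffelL g (x t) x' (a t)) (b t)
        + metricL g (x t) (a t) (b' + christoffelL g (x t) x' (b t))) t := by
  have h1 : HasDerivAt (fun s => metricL g (x s)) (fderiv ℝ (metricL g) (x t) x') t :=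
    HasFDerivAt.comp_hasDerivAt (l := metricL g) t (hasFDerivAt_metricL g h0) hx
  convert! (h1.clm_apply ha).clm_apply hb using 1
  simp only [add_apply, fderiv_metricL_eq g h0, ← christoffelL_apply g h0, map_add]
  ring

lemma inner_base_christoffelL {p : E3} (hp : p ≠ 0) (u w : E3) :
    inner ℝ p (christoffelL g p u w)
      = inner ℝ u w - inner ℝ (radial p : E3) u * inner ℝ (radial p : E3) w := by
  conv_lhs => arg 2; rw [← norm_smul_radial hp]
  rw [real_inner_smul_left, christoffelL_apply g hp, inner_radial_christoffel g hp,
    mul_inv_cancel_left₀ (norm_ne_zero_iff.2 hp)]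

lemma hasDerivAt_inner_base {x a : ℝ → E3} {x' a' : E3} {t : ℝ} (hx : HasDerivAt x x' t)
    (ha : HasDerivAt a a' t) (h0 : x t ≠ 0) :
    HasDerivAt (fun s => inner ℝ (x s) (a s))
      (inner ℝ (x t) (a' + christoffelL g (x t) x' (a t))
        + inner ℝ (radial (x t) : E3) x' * inner ℝ (radial (x t) : E3) (a t)) t := by
  convert! hx.inner ℝ ha using 1
  rw [inner_add_right, inner_base_christoffelL g h0]
  ring

lemma contDiffAt_perp (h0 : z.1 ≠ 0) : ContDiffAt ℝ ∞ (perp g) z :=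
  ((contDiffAt_rotL g h0).comp z contDiffAt_fst).clm_apply contDiffAt_snd

/-- The covariant derivative of `v` on the phase space, `ξ ↦ ∇_ξ v`. -/
def nablaL (g : SphereMetric) (z : Phase) : Phase →L[ℝ] E3 :=
  ContinuousLinearMap.snd ℝ E3 E3
    + ((christoffelL g z.1).flip z.2).comp (ContinuousLinearMap.fst ℝ E3 E3)

lemma nablaL_apply (z ξ : Phase) : nablaL g z ξ = ξ.2 + christoffelL g z.1 ξ.1 z.2 := rfl

lemma hasDerivAt_line (z ξ : Phase) : HasDerivAt (fun t : ℝ => z + t • ξ) ξ 0 := by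
  have := ((hasDerivAt_id (0 : ℝ)).smul_const ξ).const_add z
  rw [one_smul] at this
  exact this

lemma hasDerivAt_comp_line {F : Type} [NormedAddCommGroup F] [NormedSpace ℝ F] {h : Phase → F}
    (hh : DifferentiableAt ℝ h z) (ξ : Phase) :
    HasDerivAt (fun t : ℝ => h (z + t • ξ)) (fderiv ℝ h z ξ) 0 :=
  HasFDerivAt.comp_hasDerivAt (l := h) (0 : ℝ) (by rw [zero_smul, add_zero]; exact hh.hasFDerivAt)
    (hasDerivAt_line z ξ)

/-- The rotation `j` is parallel: `∇(jv) = j ∇v`. -/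
lemma nabla_perp (hz : z ∈ unitBundle g) {ξ : Phase} (h1 : inner ℝ z.1 ξ.1 = 0)
    (h2 : metricL g z.1 z.2 (nablaL g z ξ) = 0) :
    fderiv ℝ (perp g) z ξ + christoffelL g z.1 ξ.1 (perp g z)
      = - metricL g z.1 (perp g z) (nablaL g z ξ) • z.2 := by
  have hx := fst_ne_zero_of_mem g hz
  have d0 := hasDerivAt_line z ξ
  have d1 : HasDerivAt (fun t : ℝ => (z + t • ξ).1) ξ.1 0 := d0.fst
  have d2 : HasDerivAt (fun t : ℝ => (z + t • ξ).2) ξ.2 0 := d0.snd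
  have d3 := hasDerivAt_comp_line ((contDiffAt_perp g hx).differentiableAt (by simp)) ξ
  have hx0 : (z + (0 : ℝ) • ξ).1 ≠ 0 := by rwa [zero_smul, add_zero]
  have hev : ∀ᶠ t : ℝ in 𝓝 0, (z + t • ξ).1 ≠ 0 := d1.continuousAt.eventually_ne hx0
  have hev' : ∀ᶠ t : ℝ in 𝓝 0, perp g (z + t • ξ) ≠ 0 :=
    d3.continuousAt.eventually_ne (by rw [zero_smul, add_zero]; exact perp_ne_zero g hz)
  set y := fderiv ℝ (perp g) z ξ + christoffelL g z.1 ξ.1 (perp g z) with hy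
  have e1 := (hasDerivAt_metricL g d1 d3 d2 hx0).unique
    ((hasDerivAt_const (0 : ℝ) (0 : ℝ)).congr_of_eventuallyEq (by
      filter_upwards [hev] with t ht
      exact metricL_rotL_self g ht _))
  have e2 := (hasDerivAt_inner_base g d1 d3 hx0).unique
    ((hasDerivAt_const (0 : ℝ) (0 : ℝ)).congr_of_eventuallyEq (by
      filter_upwards [hev] with t ht
      exact inner_base_rotL g ht _))
  have e3 := (hasDerivAt_metricL g d1 d3 d3 hx0).unique
    ((((d1.inner ℝ d1).mul (hasDerivAt_metricL g d1 d2 d2 hx0)).sub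
      ((hasDerivAt_inner_base g d1 d2 hx0).pow 2)).congr_of_eventuallyEq (by
      filter_upwards [hev, hev'] with t ht ht'
      exact metricL_rotL_rotL g ht ht'))
  simp only [zero_smul, add_zero, ← hy, ← nablaL_apply] at e1 e2 e3
  rw [radial_of_norm hz.1, inner_fst_perp g hz, mul_zero, add_zero] at e2
  rw [metricL_comm g z.1 y, metricL_of_mem g hz, inner_of_mem g hz,
    metricL_comm g z.1 (nablaL g z ξ), h2, real_inner_comm z.1 ξ.1, h1] at e3
  have e4 : metricL g z.1 (perp g z) y = 0 := by
    have h0 : (0 : ℝ) ^ (2 - 1) = 0 := by norm_num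
    rw [h0] at e3
    linarith
  have e5 : metricL g z.1 z.2 y = - metricL g z.1 (perp g z) (nablaL g z ξ) := by
    rw [metricL_comm]; linarith
  conv_lhs => rw [eq_frame g hz y, e2, e4, e5]
  simp

end UnitBundle

/-! ### The frame of the unit tangent bundle and its structure equations -/

section Frame

variable (g : SphereMetric) {z : Phase}

/-- The lift of `u` to a tangent vector at `z = (x, v)` along which `v` is parallel. -/
def horizontal (g : SphereMetric) (z : Phase) (u : E3) : Phase :=
  (u, - christoffelL g z.1 u z.2)

lemma nablaL_horizontal (z : Phase) (u : E3) : nablaL g z (horizontal g z u) = 0 := by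
  rw [nablaL_apply, horizontal, neg_add_cancel]

/-- The geodesic vector field, extended to pairs `(x, v)` with `v` not orthogonal to `x` so as to
preserve the norm of `x`. -/
def geodesicExt (g : SphereMetric) (z : Phase) : Phase :=
  horizontal g z (z.2 - inner ℝ (radial z.1 : E3) z.2 • (radial z.1 : E3))

/-- The horizontal lift of `jv`. -/
def perpField (g : SphereMetric) (z : Phase) : Phase := horizontal g z (perp g z)

/-- The generator of the rotation of the fibres. -/
def vertExt (g : SphereMetric) (z : Phase) : Phase := (0, perp g z)

lemma geodesicExt_of_mem (hz : z ∈ unitBundle g) : geodesicExt g z = horizontal g z z.2 := by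
  rw [geodesicExt, radial_of_norm hz.1, inner_of_mem g hz, zero_smul, sub_zero]

lemma geodesicField_of_mem (hz : z ∈ unitBundle g) : geodesicField g z = geodesicExt g z := by
  rw [geodesicExt_of_mem g hz, horizontal, geodesicField,
    christoffelL_apply g (fst_ne_zero_of_mem g hz)]

lemma verticalField_of_mem (hz : z ∈ unitBundle g) : verticalField g z = vertExt g z := by
  rw [verticalField, vertExt, rot_of_mem g hz]

/-- A vector in the span of the frame. -/
def frameVec (g : SphereMetric) (z : Phase) (a b c : ℝ) : Phase :=
  a • geodesicExt g z + b • perpField g z + c • vertExt g z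

lemma frameVec_fst (hz : z ∈ unitBundle g) (a b c : ℝ) :
    (frameVec g z a b c).1 = a • z.2 + b • perp g z := by
  rw [frameVec, geodesicExt_of_mem g hz]
  simp [perpField, horizontal, vertExt]

lemma nablaL_frameVec (z : Phase) (a b c : ℝ) :
    nablaL g z (frameVec g z a b c) = c • perp g z := by
  rw [frameVec, map_add, map_add, map_smul, map_smul, map_smul, geodesicExt, perpField,
    nablaL_horizontal, nablaL_horizontal, nablaL_apply, vertExt]
  simp

lemma eq_frameVec (hz : z ∈ unitBundle g) {ξ : Phase} (h1 : inner ℝ z.1 ξ.1 = 0)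
    (h2 : inner ℝ z.1 (nablaL g z ξ) = 0) (h3 : metricL g z.1 z.2 (nablaL g z ξ) = 0) :
    ξ = frameVec g z (metricL g z.1 z.2 ξ.1) (metricL g z.1 (perp g z) ξ.1)
      (metricL g z.1 (perp g z) (nablaL g z ξ)) := by
  have e1 := eq_frame g hz ξ.1
  rw [h1, zero_smul, zero_add] at e1
  have e2 := eq_frame g hz (nablaL g z ξ)
  rw [h2, h3, zero_smul, zero_smul, zero_add, zero_add] at e2
  have e3 : ξ.1 = (frameVec g z (metricL g z.1 z.2 ξ.1) (metricL g z.1 (perp g z) ξ.1)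
      (metricL g z.1 (perp g z) (nablaL g z ξ))).1 := by rw [frameVec_fst g hz, ← e1]
  refine Prod.ext e3 ?_
  have e4 : nablaL g z ξ = nablaL g z (frameVec g z (metricL g z.1 z.2 ξ.1)
      (metricL g z.1 (perp g z) ξ.1) (metricL g z.1 (perp g z) (nablaL g z ξ))) := by
    rw [nablaL_frameVec]; exact e2
  generalize frameVec g z _ _ _ = Y at e3 e4 ⊢
  rw [nablaL_apply, nablaL_apply, ← e3] at e4
  exact add_right_cancel e4

/-- The derivatives along a curve of the three functions that define the unit bundle. -/
lemma hasDerivAt_constraints {c : ℝ → Phase} {ξ : Phase} {t : ℝ} (hc : HasDerivAt c ξ t)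
    (h0 : (c t).1 ≠ 0) :
    HasDerivAt (fun s => inner ℝ (c s).1 (c s).1) (2 * inner ℝ (c t).1 ξ.1) t ∧
    HasDerivAt (fun s => inner ℝ (c s).1 (c s).2) (inner ℝ (c t).1 (nablaL g (c t) ξ)
      + inner ℝ (radial (c t).1 : E3) ξ.1 * inner ℝ (radial (c t).1 : E3) (c t).2) t ∧
    HasDerivAt (fun s => metricL g (c s).1 (c s).2 (c s).2)
      (2 * metricL g (c t).1 (c t).2 (nablaL g (c t) ξ)) t := by
  have d1 : HasDerivAt (fun s => (c s).1) ξ.1 t := hc.fst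
  have d2 : HasDerivAt (fun s => (c s).2) ξ.2 t := hc.snd
  refine ⟨?_, hasDerivAt_inner_base g d1 d2 h0, ?_⟩
  · convert! d1.inner ℝ d1 using 1
    rw [real_inner_comm (c t).1 ξ.1]; ring
  · convert! hasDerivAt_metricL g d1 d2 d2 h0 using 1
    rw [metricL_comm g (c t).1 (ξ.2 + _), nablaL_apply]; ring

lemma mem_unitBundle_iff : z ∈ unitBundle g ↔ inner ℝ z.1 z.1 = (1 : ℝ) ∧ inner ℝ z.1 z.2 = 0 ∧
    metricL g z.1 z.2 z.2 = 1 := by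
  have h : inner ℝ z.1 z.1 = (1 : ℝ) ↔ ‖z.1‖ = 1 := by
    rw [real_inner_self_eq_norm_sq, pow_eq_one_iff_of_nonneg (norm_nonneg _) two_ne_zero]
  rw [h]
  exact ⟨fun hz => ⟨hz.1, inner_of_mem g hz, metricL_of_mem g hz⟩,
    fun ⟨h1, h2, h3⟩ => mem_unitBundle g h1 h2 h3⟩

lemma tangent_eq_frameVec {c : ℝ → Phase} {ξ : Phase} {t : ℝ} (hN : ∀ᶠ s in 𝓝 t, c s ∈ unitBundle g)
    (hc : HasDerivAt c ξ t) :
    inner ℝ (c t).1 ξ.1 = 0 ∧ ξ = frameVec g (c t) (metricL g (c t).1 (c t).2 ξ.1)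
      (metricL g (c t).1 (perp g (c t)) ξ.1) (metricL g (c t).1 (perp g (c t)) (nablaL g (c t) ξ)) := by
  have hz := hN.self_of_nhds
  obtain ⟨d1, d2, d3⟩ := hasDerivAt_constraints g hc (fst_ne_zero_of_mem g hz)
  have e1 := d1.unique ((hasDerivAt_const t (1 : ℝ)).congr_of_eventuallyEq (by
    filter_upwards [hN] with s hs
    exact ((mem_unitBundle_iff g).1 hs).1))
  have e2 := d2.unique ((hasDerivAt_const t (0 : ℝ)).congr_of_eventuallyEq (by
    filter_upwards [hN] with s hs
    exact ((mem_unitBundle_iff g).1 hs).2.1))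
  have e3 := d3.unique ((hasDerivAt_const t (1 : ℝ)).congr_of_eventuallyEq (by
    filter_upwards [hN] with s hs
    exact ((mem_unitBundle_iff g).1 hs).2.2))
  have e4 : inner ℝ (c t).1 ξ.1 = 0 := by linarith
  rw [radial_of_norm hz.1, e4, zero_mul, add_zero] at e2
  exact ⟨e4, eq_frameVec g hz e4 e2 (by linarith)⟩

/-- The frame is tangent to the level sets of the three functions that define the unit bundle. -/
lemma frameVec_constraints (h0 : z.1 ≠ 0) (a b c : ℝ) :
    inner ℝ z.1 (frameVec g z a b c).1 = 0 ∧
    inner ℝ z.1 (nablaL g z (frameVec g z a b c)) = 0 ∧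
    metricL g z.1 z.2 (nablaL g z (frameVec g z a b c)) = 0 := by
  rw [nablaL_frameVec]
  refine ⟨?_, ?_, ?_⟩
  · have e1 : inner ℝ z.1 (z.2 - inner ℝ (radial z.1 : E3) z.2 • (radial z.1 : E3)) = 0 := by
      conv_lhs => arg 2; rw [← norm_smul_radial h0]
      rw [real_inner_smul_left, inner_sub_right, inner_smul_right, real_inner_self_eq_norm_sq,
        norm_radial]
      ring
    have e2 : inner ℝ z.1 (perp g z) = 0 := inner_base_rotL g h0 z.2
    simp [frameVec, geodesicExt, perpField, horizontal, vertExt, inner_add_right,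
      inner_smul_right, e1, e2]
  · rw [inner_smul_right, show inner ℝ z.1 (perp g z) = 0 from inner_base_rotL g h0 z.2, mul_zero]
  · rw [map_smul, metricL_comm, show metricL g z.1 (perp g z) z.2 = 0 from
      metricL_rotL_self g h0 z.2, smul_zero]

lemma isClosed_unitBundle : IsClosed (unitBundle g) := by
  have h1 : IsClosed {z : Phase | ‖z.1‖ = 1} := isClosed_eq (by fun_prop) continuous_const
  have h2 : IsClosed {z : Phase | inner ℝ z.1 z.2 = (0 : ℝ)} :=
    isClosed_eq (by fun_prop) continuous_const
  have h3 : ContinuousOn (fun z : Phase => metricL g z.1 z.2 z.2)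
      ({z : Phase | ‖z.1‖ = 1} ∩ {z : Phase | inner ℝ z.1 z.2 = (0 : ℝ)}) := by
    intro z hz
    have h0 : z.1 ≠ 0 := by
      rw [← norm_ne_zero_iff, show ‖z.1‖ = 1 from hz.1]; exact one_ne_zero
    exact ((((contDiffAt_metricL g h0).comp z contDiffAt_fst).clm_apply
      contDiffAt_snd).clm_apply contDiffAt_snd).continuousAt.continuousWithinAt
  have h4 := h3.preimage_isClosed_of_isClosed (h1.inter h2) (isClosed_singleton (x := (1 : ℝ)))
  convert! h4 using 1
  ext z
  exact ⟨fun hz => ⟨⟨hz.1, hz.2.1⟩, metricL_of_mem g hz⟩, fun hz => mem_unitBundle g hz.1.1 hz.1.2 hz.2⟩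

lemma isCompact_unitBundle : IsCompact (unitBundle g) := by
  -- the metric is bounded below on the product of two unit spheres
  have hK : IsCompact (Metric.sphere (0 : E3) 1 ×ˢ Metric.sphere (0 : E3) 1) :=
    (isCompact_sphere _ _).prod (isCompact_sphere _ _)
  have hne : ∀ y : E3, y ∈ Metric.sphere (0 : E3) 1 → y ≠ 0 := fun y hy h => by
    rw [h] at hy; simp at hy
  obtain ⟨κ, hκ, hmin⟩ : ∃ κ > 0, ∀ x u : E3, ‖x‖ = 1 → ‖u‖ = 1 → κ ≤ metricL g x u u := by
    have hcont : ContinuousOn (fun z : Phase => metricL g z.1 z.2 z.2)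
        (Metric.sphere (0 : E3) 1 ×ˢ Metric.sphere (0 : E3) 1) := fun z hz =>
      ((((contDiffAt_metricL g (hne _ hz.1)).comp z contDiffAt_fst).clm_apply
        contDiffAt_snd).clm_apply contDiffAt_snd).continuousAt.continuousWithinAt
    obtain ⟨z₀, hz₀, hm⟩ := hK.exists_isMinOn ⟨(basisVec 0, basisVec 0), by
      simp [norm_basisVec]⟩ hcont
    exact ⟨metricL g z₀.1 z₀.2 z₀.2, metricL_self_pos g (hne _ hz₀.1) (hne _ hz₀.2),
      fun x u hx hu => hm (a := (x, u)) ⟨by simpa using hx, by simpa using hu⟩⟩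
  have hsub : unitBundle g ⊆ Metric.closedBall (0 : E3) 1 ×ˢ
      Metric.closedBall (0 : E3) (Real.sqrt κ⁻¹) := by
    intro z hz
    refine ⟨by simp [hz.1], ?_⟩
    rw [mem_closedBall_zero_iff]
    refine Real.le_sqrt_of_sq_le ?_
    have hn := norm_pos_iff.2 (snd_ne_zero_of_mem g hz)
    have h1 := hmin z.1 (‖z.2‖⁻¹ • z.2) hz.1 (by
      rw [norm_smul, norm_inv, norm_norm, inv_mul_cancel₀ hn.ne'])
    rw [map_smul, map_smul, smul_apply, metricL_of_mem g hz, smul_eq_mul, smul_eq_mul,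
      mul_one, ← mul_inv, ← sq] at h1
    have h2 := inv_anti₀ hκ h1
    rwa [inv_inv] at h2
  exact ((isCompact_closedBall _ _).prod (isCompact_closedBall _ _)).of_isClosed_subset
    (isClosed_unitBundle g) hsub

/-! ### The exterior derivatives of the Liouville form and of the connection form -/

/-- The Liouville form `g(v, dπ ξ)`. -/
def liouvilleL (g : SphereMetric) (z : Phase) : Phase →L[ℝ] ℝ :=
  (metricL g z.1 z.2).comp (ContinuousLinearMap.fst ℝ E3 E3)

/-- The form `g(jv, dπ ξ)`. -/
def perpFormL (g : SphereMetric) (z : Phase) : Phase →L[ℝ] ℝ :=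
  (metricL g z.1 (perp g z)).comp (ContinuousLinearMap.fst ℝ E3 E3)

/-- The angular form of the Levi-Civita connection. -/
def angularL (g : SphereMetric) (z : Phase) : Phase →L[ℝ] ℝ :=
  (metricL g z.1 (perp g z)).comp (nablaL g z)

/-- The pull-back to the phase space of a one-form on the base. -/
def basicForm (b : E3 → E3 →L[ℝ] ℝ) (z : Phase) : Phase →L[ℝ] ℝ :=
  (b z.1).comp (ContinuousLinearMap.fst ℝ E3 E3)

lemma contDiffAt_liouvilleL (h0 : z.1 ≠ 0) : ContDiffAt ℝ ∞ (liouvilleL g) z :=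
  (((contDiffAt_metricL g h0).comp z contDiffAt_fst).clm_apply contDiffAt_snd).clm_comp
    contDiffAt_const

lemma contDiffAt_perpFormL (h0 : z.1 ≠ 0) : ContDiffAt ℝ ∞ (perpFormL g) z :=
  (((contDiffAt_metricL g h0).comp z contDiffAt_fst).clm_apply (contDiffAt_perp g h0)).clm_comp
    contDiffAt_const

lemma contDiffAt_nablaL (h0 : z.1 ≠ 0) : ContDiffAt ℝ ∞ (nablaL g) z := by
  refine contDiffAt_const.add (ContDiffAt.clm_comp ?_ contDiffAt_const)
  have h1 : ContDiffAt ℝ ∞ (fun z : Phase => christoffelL g z.1) z :=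
    (contDiffAt_christoffelL g h0).comp z contDiffAt_fst
  exact ((ContinuousLinearMap.flipₗᵢ ℝ E3 E3 E3).contDiff.contDiffAt.comp z h1).clm_apply
    contDiffAt_snd

lemma contDiffAt_angularL (h0 : z.1 ≠ 0) : ContDiffAt ℝ ∞ (angularL g) z :=
  (((contDiffAt_metricL g h0).comp z contDiffAt_fst).clm_apply (contDiffAt_perp g h0)).clm_comp
    (contDiffAt_nablaL g h0)

lemma contDiffAt_basicForm {b : E3 → E3 →L[ℝ] ℝ} (hb : ContDiffAt ℝ ∞ b z.1) :
    ContDiffAt ℝ ∞ (basicForm b) z :=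
  (hb.comp z contDiffAt_fst).clm_comp contDiffAt_const

lemma extD_eq_of_hasDerivAt {α : Phase → Phase →L[ℝ] ℝ} (hα : DifferentiableAt ℝ α z)
    {ξ η : Phase} {A B : ℝ} (hA : HasDerivAt (fun t : ℝ => α (z + t • ξ) η) A 0)
    (hB : HasDerivAt (fun t : ℝ => α (z + t • η) ξ) B 0) : extD α z ξ η = A - B := by
  have key : ∀ ξ η, HasDerivAt (fun t : ℝ => α (z + t • ξ) η) (fderiv ℝ α z ξ η) 0 := fun ξ η => by
    have := (hasDerivAt_comp_line hα ξ).clm_apply (hasDerivAt_const (0 : ℝ) η)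
    simpa using this
  rw [extD, (key ξ η).unique hA, (key η ξ).unique hB]

lemma extD_liouvilleL (h0 : z.1 ≠ 0) (ξ η : Phase) :
    extD (liouvilleL g) z ξ η
      = metricL g z.1 (nablaL g z ξ) η.1 - metricL g z.1 (nablaL g z η) ξ.1 := by
  have key : ∀ ξ η : Phase, HasDerivAt (fun t : ℝ => liouvilleL g (z + t • ξ) η)
      (metricL g z.1 (nablaL g z ξ) η.1 + metricL g z.1 z.2 (christoffelL g z.1 ξ.1 η.1)) 0 := by
    intro ξ η
    have d0 := hasDerivAt_line z ξ
    have h := hasDerivAt_metricL g d0.fst d0.snd (hasDerivAt_const (0 : ℝ) η.1)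
      (by rwa [zero_smul, add_zero])
    simp only [zero_smul, add_zero, zero_add] at h
    exact h
  rw [extD_eq_of_hasDerivAt ((contDiffAt_liouvilleL g h0).differentiableAt (by simp)) (key ξ η)
    (key η ξ), christoffelL_apply g h0, christoffelL_apply g h0, christoffel_comm g h0 η.1]
  ring

lemma extD_angularL (h0 : z.1 ≠ 0) (ξ η : Phase) :
    extD (angularL g) z ξ η
      = metricL g z.1 (fderiv ℝ (perp g) z ξ + christoffelL g z.1 ξ.1 (perp g z)) (nablaL g z η)
        - metricL g z.1 (fderiv ℝ (perp g) z η + christoffelL g z.1 η.1 (perp g z)) (nablaL g z ξ)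
        + metricL g z.1 (perp g z) (riemann g z.1 ξ.1 η.1 z.2) := by
  have key : ∀ ξ η : Phase, HasDerivAt (fun t : ℝ => angularL g (z + t • ξ) η)
      (metricL g z.1 (fderiv ℝ (perp g) z ξ + christoffelL g z.1 ξ.1 (perp g z)) (nablaL g z η)
        + metricL g z.1 (perp g z) (fderiv ℝ (christoffelL g) z.1 ξ.1 η.1 z.2
          + christoffelL g z.1 η.1 ξ.2 + christoffelL g z.1 ξ.1 (nablaL g z η))) 0 := by
    intro ξ η
    have d0 := hasDerivAt_line z ξ
    have hC : HasFDerivAt (christoffelL g) (fderiv ℝ (christoffelL g) z.1) (z + (0 : ℝ) • ξ).1 := by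
      rw [zero_smul, add_zero]
      exact ((contDiffAt_christoffelL g h0).differentiableAt (by simp)).hasFDerivAt
    have d1 : HasDerivAt (fun t : ℝ => christoffelL g (z + t • ξ).1)
        (fderiv ℝ (christoffelL g) z.1 ξ.1) 0 :=
      HasFDerivAt.comp_hasDerivAt (l := christoffelL g) (0 : ℝ) hC d0.fst
    have d2 := ((d1.clm_apply (hasDerivAt_const (0 : ℝ) η.1)).clm_apply d0.snd).const_add η.2
    have h := hasDerivAt_metricL g d0.fst
      (hasDerivAt_comp_line ((contDiffAt_perp g h0).differentiableAt (by simp)) ξ) d2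
      (by rwa [zero_smul, add_zero])
    simp only [zero_smul, add_zero, map_zero] at h
    exact h
  rw [extD_eq_of_hasDerivAt ((contDiffAt_angularL g h0).differentiableAt (by simp)) (key ξ η)
    (key η ξ), riemann_eq g h0]
  simp only [nablaL_apply, map_add, map_sub]
  rw [christoffelL_apply g h0 η.1 ξ.2, christoffelL_apply g h0 ξ.1 η.2]
  ring

lemma extD_basicForm {b : E3 → E3 →L[ℝ] ℝ} (hb : DifferentiableAt ℝ b z.1) (ξ η : Phase) :
    extD (basicForm b) z ξ η = extD b z.1 ξ.1 η.1 := by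
  have h1 : HasFDerivAt (fun z : Phase => b z.1)
      ((fderiv ℝ b z.1).comp (ContinuousLinearMap.fst ℝ E3 E3)) z :=
    HasFDerivAt.comp (g := b) z hb.hasFDerivAt hasFDerivAt_fst
  have h2 : HasFDerivAt (basicForm b) _ z :=
    h1.clm_comp (hasFDerivAt_const (ContinuousLinearMap.fst ℝ E3 E3) z)
  rw [extD, h2.fderiv]
  simp [extD]

end Frame

/-! ### The unit tangent bundle as a contact circle bundle -/

section Bundle

/-- A smooth function on `ℝ³` that vanishes near the origin and is `1` near the unit sphere. -/
def cutoff (p : E3) : ℝ := Real.smoothTransition (4 * ‖p‖ ^ 2 - 1)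

lemma contDiff_cutoff : ContDiff ℝ ∞ cutoff :=
  Real.smoothTransition.contDiff.comp ((contDiff_const.mul (contDiff_norm_sq ℝ)).sub contDiff_const)

lemma eventually_cutoff_eq_one {p : E3} (hp : ‖p‖ = 1) : ∀ᶠ q in 𝓝 p, cutoff q = 1 ∧ q ≠ 0 := by
  have h : ∀ᶠ q : E3 in 𝓝 p, 1 / 2 < ‖q‖ ^ 2 := by
    have hc : ContinuousAt (fun q : E3 => ‖q‖ ^ 2) p := by fun_prop
    exact continuousAt_const.eventually_lt hc (by rw [hp]; norm_num)
  filter_upwards [h] with q hq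
  refine ⟨Real.smoothTransition.one_of_one_le (by linarith), fun h0 => ?_⟩
  rw [h0] at hq
  norm_num at hq

lemma cutoff_of_norm {p : E3} (hp : ‖p‖ = 1) : cutoff p = 1 :=
  (eventually_cutoff_eq_one hp).self_of_nhds.1

lemma contDiff_cutoff_fst_smul {F : Type} [NormedAddCommGroup F] [NormedSpace ℝ F] {h : Phase → F}
    (hh : ∀ z : Phase, z.1 ≠ 0 → ContDiffAt ℝ ∞ h z) :
    ContDiff ℝ ∞ fun z : Phase => cutoff z.1 • h z := by
  rw [contDiff_iff_contDiffAt]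
  intro z
  by_cases hz : z.1 = 0
  · have h1 : ∀ᶠ w : Phase in 𝓝 z, ‖w.1‖ ^ 2 < 1 / 4 := by
      have hc : ContinuousAt (fun w : Phase => ‖w.1‖ ^ 2) z := by fun_prop
      exact hc.eventually_lt continuousAt_const (by rw [hz]; norm_num)
    refine (contDiffAt_const (c := (0 : F))).congr_of_eventuallyEq ?_
    filter_upwards [h1] with w hw
    rw [cutoff, Real.smoothTransition.zero_of_nonpos (by linarith), zero_smul]
  · exact (contDiff_cutoff.contDiffAt.comp z contDiffAt_fst).smul (hh z hz)

variable (g : SphereMetric) {z : Phase}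

lemma cutoff_of_mem (hz : z ∈ unitBundle g) : cutoff z.1 = 1 := cutoff_of_norm hz.1

lemma extD_cutoff_smul {α : Phase → Phase →L[ℝ] ℝ} (hz : z ∈ unitBundle g) (ξ η : Phase) :
    extD (fun z => cutoff z.1 • α z) z ξ η = extD α z ξ η := by
  have h : (fun z : Phase => cutoff z.1 • α z) =ᶠ[𝓝 z] α := by
    filter_upwards [continuousAt_fst.eventually (eventually_cutoff_eq_one hz.1)] with w hw
    rw [hw.1, one_smul]
  rw [extD, extD, h.fderiv_eq]

lemma contDiffAt_horizontal {u : Phase → E3} (h0 : z.1 ≠ 0) (hu : ContDiffAt ℝ ∞ u z) :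
    ContDiffAt ℝ ∞ (fun z => horizontal g z (u z)) z :=
  hu.prodMk ((((contDiffAt_christoffelL g h0).comp z contDiffAt_fst).clm_apply hu).clm_apply
    contDiffAt_snd).neg

lemma contDiffAt_geodesicExt (h0 : z.1 ≠ 0) : ContDiffAt ℝ ∞ (geodesicExt g) z := by
  have h : ContDiffAt ℝ ∞ (fun z : Phase => (radial z.1 : E3)) z :=
    ContDiffAt.comp (g := fun p => (radial p : E3)) z (contDiffAt_radial_coe h0) contDiffAt_fst
  exact contDiffAt_horizontal g h0 (contDiffAt_snd.sub ((h.inner ℝ contDiffAt_snd).smul h))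

lemma fibreRotation_of_mem (hz : z ∈ unitBundle g) (θ : ℝ) :
    fibreRotation g θ z = (z.1, Real.cos θ • z.2 + Real.sin θ • perp g z) := by
  rw [fibreRotation, rot_of_mem g hz]

lemma fibreRotation_mem (hz : z ∈ unitBundle g) (θ : ℝ) : fibreRotation g θ z ∈ unitBundle g := by
  rw [fibreRotation_of_mem g hz]
  refine mem_unitBundle g hz.1 ?_ ?_
  · rw [inner_add_right, inner_smul_right, inner_smul_right, inner_of_mem g hz,
      inner_fst_perp g hz]
    ring
  · simp only [map_add, map_smul, add_apply, smul_apply, smul_eq_mul, metricL_of_mem g hz,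
      metricL_perp_perp g hz, metricL_perp_snd g hz, metricL_snd_perp g hz]
    linear_combination Real.cos_sq_add_sin_sq θ

lemma perp_fibreRotation (hz : z ∈ unitBundle g) (θ : ℝ) :
    perp g (fibreRotation g θ z) = - Real.sin θ • z.2 + Real.cos θ • perp g z := by
  rw [fibreRotation_of_mem g hz, perp]
  simp only [map_add, map_smul]
  rw [rotL_perp g hz]
  change Real.cos θ • perp g z + _ = _
  module

lemma hasDerivAt_fibreRotation (hz : z ∈ unitBundle g) (θ : ℝ) :
    HasDerivAt (fun θ => fibreRotation g θ z) (vertExt g (fibreRotation g θ z)) θ := by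
  rw [vertExt, perp_fibreRotation g hz]
  simp only [fibreRotation_of_mem g hz]
  exact (hasDerivAt_const θ z.1).prodMk
    (((Real.hasDerivAt_cos θ).smul_const z.2).add ((Real.hasDerivAt_sin θ).smul_const (perp g z)))

lemma fibreRotation_ne (hz : z ∈ unitBundle g) {θ : ℝ} (hθ : θ ∈ Ioo 0 (2 * Real.pi)) :
    fibreRotation g θ z ≠ z := by
  intro h
  rw [fibreRotation_of_mem g hz] at h
  have h1 := congrArg (fun y => metricL g z.1 z.2 y) (congrArg Prod.snd h)
  simp only [map_add, map_smul, smul_eq_mul, metricL_of_mem g hz, metricL_snd_perp g hz] at h1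
  have h2 : Real.cos θ = 1 := by linarith
  obtain ⟨n, hn⟩ := (Real.cos_eq_one_iff θ).1 h2
  have hpi := Real.pi_pos
  have h3 : (0 : ℝ) < n := by
    by_contra h4
    have := hθ.1
    nlinarith
  have h4 : (n : ℝ) < 1 := by
    by_contra h4
    have := hθ.2
    nlinarith
  have h5 : (0 : ℤ) < n := by exact_mod_cast h3
  have h6 : n < (1 : ℤ) := by exact_mod_cast h4
  omega

/-- An integral curve of a combination of the frame that starts in the unit bundle stays in it. -/
lemma mem_unitBundle_of_hasDerivAt {c : ℝ → Phase} {α β γ : ℝ → ℝ}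
    (hc : ∀ t, HasDerivAt c (cutoff (c t).1 • frameVec g (c t) (α t) (β t) (γ t)) t)
    (h0 : c 0 ∈ unitBundle g) (t : ℝ) : c t ∈ unitBundle g := by
  have hcont : Continuous c := continuous_iff_continuousAt.2 fun t => (hc t).continuousAt
  have hcl : IsClosed {t | c t ∈ unitBundle g} := (isClosed_unitBundle g).preimage hcont
  have hop : IsOpen {t | c t ∈ unitBundle g} := by
    rw [isOpen_iff_mem_nhds]
    intro t ht
    have ht' : c t ∈ unitBundle g := ht
    have hev : ∀ᶠ s in 𝓝 t, cutoff (c s).1 = 1 ∧ (c s).1 ≠ 0 :=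
      (continuous_fst.comp hcont).continuousAt.eventually (eventually_cutoff_eq_one ht'.1)
    obtain ⟨ε, hε, hball⟩ := Metric.eventually_nhds_iff_ball.1 hev
    have hd : ∀ s ∈ Metric.ball t ε,
        HasDerivAt (fun s => inner ℝ (c s).1 (c s).1) (0 : ℝ) s ∧
        HasDerivAt (fun s => inner ℝ (c s).1 (c s).2) (0 : ℝ) s ∧
        HasDerivAt (fun s => metricL g (c s).1 (c s).2 (c s).2) 0 s := by
      intro s hs
      obtain ⟨h1, h2⟩ := hball s hs
      have h3 := hc s
      rw [h1, one_smul] at h3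
      obtain ⟨e1, e2, e3⟩ := frameVec_constraints g h2 (α s) (β s) (γ s)
      have e4 : inner ℝ (radial (c s).1 : E3) (frameVec g (c s) (α s) (β s) (γ s)).1 = 0 := by
        rw [radial_coe h2, real_inner_smul_left, e1, mul_zero]
      have h4 := hasDerivAt_constraints g h3 h2
      rw [e1, e2, e3, e4] at h4
      simpa using h4
    have key : ∀ h : ℝ → ℝ, (∀ s ∈ Metric.ball t ε, HasDerivAt h 0 s) →
        ∀ s ∈ Metric.ball t ε, h s = h t := fun h hh s hs =>
      Metric.isOpen_ball.is_const_of_deriv_eq_zero (convex_ball t ε).isPreconnected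
        (fun s hs => (hh s hs).differentiableAt.differentiableWithinAt)
        (fun s hs => (hh s hs).deriv) hs (Metric.mem_ball_self hε)
    filter_upwards [Metric.ball_mem_nhds t hε] with s hs
    obtain ⟨k1, k2, k3⟩ := (mem_unitBundle_iff g).1 ht'
    exact (mem_unitBundle_iff g).2 ⟨(key _ (fun s hs => (hd s hs).1) s hs).trans k1,
      (key _ (fun s hs => (hd s hs).2.1) s hs).trans k2,
      (key _ (fun s hs => (hd s hs).2.2) s hs).trans k3⟩
  have huniv := IsClopen.eq_univ ⟨hcl, hop⟩ ⟨0, h0⟩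
  exact (huniv ▸ mem_univ t : t ∈ {t | c t ∈ unitBundle g})

/-- The curvature identity `g(jv, R(v, jv) v) = - K`. -/
lemma metricL_perp_riemann (hz : z ∈ unitBundle g) :
    metricL g z.1 (perp g z) (riemann g z.1 z.2 (perp g z) z.2)
      = - curvatureForm g z.1 z.2 (perp g z) := by
  rw [curvatureForm, gaussCurvature, area_snd_perp g hz, ← metricL_apply, ← metricL_apply,
    ← metricL_apply, ← metricL_apply, metricL_of_mem g hz, metricL_perp_perp g hz,
    metricL_snd_perp g hz, metricL_comm,
    metricL_riemann_skew g (fst_ne_zero_of_mem g hz) z.2 (perp g z) z.2]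
  norm_num

/-- A smooth one-form on `ℝ³ \ {0}` that restricts, over the part of the sphere in the open set
`domain`, to a primitive of `σ - K μ`. -/
structure LocalPrimitive (g : SphereMetric) (f : SphereFun) where
  form : E3 → E3 →L[ℝ] ℝ
  domain : Set E3
  smooth : ∀ p : E3, p ≠ 0 → ContDiffAt ℝ ∞ form p
  isOpen_domain : IsOpen domain
  extD_eq : ∀ x ∈ domain, ‖x‖ = 1 → ∀ u w : E3, inner ℝ x u = 0 → inner ℝ x w = 0 →
    extD form x u w = funExt f x * area g x u w - curvatureForm g x u w

variable {f : SphereFun} (b : LocalPrimitive g f)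

/-- The connection form `τ - π^*β`. -/
def connectionL (z : Phase) : Phase →L[ℝ] ℝ := angularL g z - basicForm b.form z

lemma contDiffAt_connectionL (h0 : z.1 ≠ 0) : ContDiffAt ℝ ∞ (connectionL g b) z :=
  (contDiffAt_angularL g h0).sub (contDiffAt_basicForm (b.smooth _ h0))

lemma extD_connectionL (hz : z ∈ unitBundle g) (hO : z.1 ∈ b.domain) (a₁ b₁ c₁ a₂ b₂ c₂ : ℝ) :
    extD (connectionL g b) z (frameVec g z a₁ b₁ c₁) (frameVec g z a₂ b₂ c₂)
      = - funExt f z.1 * (a₁ * b₂ - a₂ * b₁) := by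
  have h0 := fst_ne_zero_of_mem g hz
  have hd1 := (contDiffAt_angularL g h0).differentiableAt (by simp)
  have hd2 := (contDiffAt_basicForm (b.smooth _ h0)).differentiableAt (by simp)
  have e1 : extD (connectionL g b) z (frameVec g z a₁ b₁ c₁) (frameVec g z a₂ b₂ c₂)
      = extD (angularL g) z (frameVec g z a₁ b₁ c₁) (frameVec g z a₂ b₂ c₂)
        - extD (basicForm b.form) z (frameVec g z a₁ b₁ c₁) (frameVec g z a₂ b₂ c₂) := by
    have : fderiv ℝ (connectionL g b) z = fderiv ℝ (angularL g) z - fderiv ℝ (basicForm b.form) z :=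
      (hd1.hasFDerivAt.sub hd2.hasFDerivAt).fderiv
    rw [extD, extD, extD, this]
    simp only [sub_apply]
    ring
  have e2 : ∀ a b c, fderiv ℝ (perp g) z (frameVec g z a b c)
      + christoffelL g z.1 (frameVec g z a b c).1 (perp g z) = - c • z.2 := by
    intro a b c
    obtain ⟨k1, -, k3⟩ := frameVec_constraints g h0 a b c
    rw [nabla_perp g hz k1 k3, nablaL_frameVec, map_smul, metricL_perp_perp g hz, smul_eq_mul,
      mul_one]
  have e3 : extD b.form z.1 (a₁ • z.2 + b₁ • perp g z) (a₂ • z.2 + b₂ • perp g z)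
      = (a₁ * b₂ - a₂ * b₁) * extD b.form z.1 z.2 (perp g z) := by
    simp only [extD, map_add, map_smul, add_apply, smul_apply, smul_eq_mul]
    ring
  rw [e1, extD_angularL g h0, extD_basicForm ((b.smooth _ h0).differentiableAt (by simp)),
    e2, e2, nablaL_frameVec, nablaL_frameVec, frameVec_fst g hz, frameVec_fst g hz,
    riemann_combination g h0, e3, b.extD_eq _ hO hz.1 _ _ (inner_of_mem g hz) (inner_fst_perp g hz),
    area_snd_perp g hz, map_smul (metricL g z.1 (perp g z)), metricL_perp_riemann g hz]
  simp only [map_smul, smul_apply, smul_eq_mul, metricL_snd_perp g hz]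
  ring

/-- Near a point `z` of the unit bundle, a point is determined by the three functions that define
the unit bundle and by the values at it of the coframe at `z`. -/
lemma exists_coframe_injOn :
    ∃ r > 0, ∀ z ∈ unitBundle g, ∀ w ∈ unitBundle g, ∀ w' ∈ unitBundle g,
      dist w z < r → dist w' z < r → cutoff z.1 • liouvilleL g z (w - w') = 0 →
      cutoff z.1 • perpFormL g z (w - w') = 0 → cutoff z.1 • connectionL g b z (w - w') = 0 →
      w = w' := by
  let G : Phase × Phase → Phase := fun p =>
    (!₂[inner ℝ p.2.1 p.2.1, inner ℝ p.2.1 p.2.2, metricL g p.2.1 p.2.2 p.2.2],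
      !₂[liouvilleL g p.1 p.2, perpFormL g p.1 p.2, connectionL g b p.1 p.2])
  have hG : ∀ z ∈ unitBundle g, ContDiffAt ℝ ∞ G (z, z) := by
    intro z hz
    have h0 := fst_ne_zero_of_mem g hz
    have d1 : ContDiffAt ℝ ∞ (fun p : Phase × Phase => p.2.1) (z, z) := by fun_prop
    have d2 : ContDiffAt ℝ ∞ (fun p : Phase × Phase => p.2.2) (z, z) := by fun_prop
    have d3 : ContDiffAt ℝ ∞ (fun p : Phase × Phase => p.2) (z, z) := by fun_prop
    have d4 : ContDiffAt ℝ ∞ (fun p : Phase × Phase => p.1) (z, z) := by fun_prop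
    refine ContDiffAt.prodMk ?_ ?_
    · refine contDiffAt_euclidean.2 fun i => ?_
      fin_cases i
      · exact d1.inner ℝ d1
      · exact d1.inner ℝ d2
      · exact ((ContDiffAt.comp (g := metricL g) (z, z) (contDiffAt_metricL g h0) d1).clm_apply
          d2).clm_apply d2
    · refine contDiffAt_euclidean.2 fun i => ?_
      fin_cases i
      · exact (ContDiffAt.comp (g := liouvilleL g) (z, z) (contDiffAt_liouvilleL g h0) d4).clm_apply
          d3
      · exact (ContDiffAt.comp (g := perpFormL g) (z, z) (contDiffAt_perpFormL g h0) d4).clm_apply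
          d3
      · exact (ContDiffAt.comp (g := connectionL g b) (z, z)
          (contDiffAt_connectionL g b h0) d4).clm_apply d3
  obtain ⟨r, hr, hinj⟩ := exists_uniform_injOn (isCompact_unitBundle g) hG (by
    intro z hz ξ hξ
    have h0 := fst_ne_zero_of_mem g hz
    have d0 := hasDerivAt_line z ξ
    have h1 : HasDerivAt (fun t : ℝ => G (z, z + t • ξ)) 0 0 := by
      rw [← hξ]
      refine HasFDerivAt.comp_hasDerivAt (l := G) (0 : ℝ) (f := fun t : ℝ => (z, z + t • ξ)) ?_
        ((hasDerivAt_const (0 : ℝ) z).prodMk d0)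
      rw [zero_smul, add_zero]
      exact ((hG z hz).differentiableAt (by simp)).hasFDerivAt
    have p1 : ∀ i : Fin 3, HasDerivAt (fun t : ℝ => (G (z, z + t • ξ)).1 i) 0 0 := fun i =>
      (EuclideanSpace.proj i : E3 →L[ℝ] ℝ).hasFDerivAt.comp_hasDerivAt
        (0 : ℝ) h1.fst
    have p2 : ∀ i : Fin 3, HasDerivAt (fun t : ℝ => (G (z, z + t • ξ)).2 i) 0 0 := fun i =>
      (EuclideanSpace.proj i : E3 →L[ℝ] ℝ).hasFDerivAt.comp_hasDerivAt
        (0 : ℝ) h1.snd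
    obtain ⟨k1, k2, k3⟩ := hasDerivAt_constraints g d0 (by rwa [zero_smul, add_zero])
    have lin : ∀ A : Phase →L[ℝ] ℝ, HasDerivAt (fun t : ℝ => A (z + t • ξ)) (A ξ) 0 := fun A =>
      A.hasFDerivAt.comp_hasDerivAt (0 : ℝ) d0
    have e1 := k1.unique (p1 0)
    have e2 := k2.unique (p1 1)
    have e3 := k3.unique (p1 2)
    have e4 := (lin (liouvilleL g z)).unique (p2 0)
    have e5 := (lin (perpFormL g z)).unique (p2 1)
    have e6 := (lin (connectionL g b z)).unique (p2 2)
    rw [zero_smul, add_zero] at e1 e2 e3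
    have e1' : inner ℝ z.1 ξ.1 = 0 := by linarith
    rw [radial_of_norm hz.1, e1', zero_mul, add_zero] at e2
    have e7 := eq_frameVec g hz e1' e2 (by linarith)
    have e4' : metricL g z.1 z.2 ξ.1 = 0 := e4
    have e5' : metricL g z.1 (perp g z) ξ.1 = 0 := e5
    have e8 : ξ.1 = 0 := by
      rw [eq_frame g hz ξ.1, e1', e4', e5']; simp
    have e6' : metricL g z.1 (perp g z) (nablaL g z ξ) - b.form z.1 ξ.1 = 0 := e6
    rw [e8, map_zero, sub_zero] at e6'
    rw [e7, e4', e5', e6', frameVec]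
    simp)
  refine ⟨r, hr, fun z hz w hw w' hw' h1 h2 a1 a2 a3 => hinj z hz w w' h1 h2 ?_⟩
  rw [cutoff_of_mem g hz, one_smul, map_sub, sub_eq_zero] at a1 a2 a3
  obtain ⟨k1, k2, k3⟩ := (mem_unitBundle_iff g).1 hw
  obtain ⟨l1, l2, l3⟩ := (mem_unitBundle_iff g).1 hw'
  simp only [G, k1, k2, k3, l1, l2, l3, a1, a2, a3]

/-- The unit tangent bundle with its magnetic fields, as a contact circle bundle. The fields, forms
and functions are smooth where `x ≠ 0`, and are multiplied by a cut-off function of `x` that is `1`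
near the unit sphere. -/
def contactData (hf : ∀ x : S2, 0 < f x) : ContactData Phase where
  N := unitBundle g
  X z := cutoff z.1 • geodesicExt g z
  H z := cutoff z.1 • perpField g z
  V z := cutoff z.1 • vertExt g z
  L z := cutoff z.1 • liouvilleL g z
  B z := cutoff z.1 • perpFormL g z
  L₀ z := cutoff z.1 • connectionL g b z
  f z := cutoff z.1 • funExt f z.1
  bX z := cutoff z.1 • b.form z.1 z.2
  bH z := cutoff z.1 • b.form z.1 (perp g z)
  U := {z | z.1 ∈ b.domain}
  rot := fibreRotation g
  isCompact := isCompact_unitBundle g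
  smooth_X := contDiff_cutoff_fst_smul fun _ h => contDiffAt_geodesicExt g h
  smooth_H := contDiff_cutoff_fst_smul fun _ h => contDiffAt_horizontal g h (contDiffAt_perp g h)
  smooth_V := contDiff_cutoff_fst_smul fun _ h => contDiffAt_const.prodMk (contDiffAt_perp g h)
  smooth_L := contDiff_cutoff_fst_smul fun _ h => contDiffAt_liouvilleL g h
  smooth_B := contDiff_cutoff_fst_smul fun _ h => contDiffAt_perpFormL g h
  smooth_L₀ := contDiff_cutoff_fst_smul fun _ h => contDiffAt_connectionL g b h
  smooth_f := contDiff_cutoff_fst_smul fun z h => (contDiffAt_funExt f h).comp z contDiffAt_fst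
  smooth_bX := contDiff_cutoff_fst_smul fun z h =>
    ((b.smooth _ h).comp z contDiffAt_fst).clm_apply contDiffAt_snd
  smooth_bH := contDiff_cutoff_fst_smul fun z h =>
    ((b.smooth _ h).comp z contDiffAt_fst).clm_apply (contDiffAt_perp g h)
  f_pos z hz := by
    rw [cutoff_of_mem g hz, one_smul]
    exact hf _
  L_X z hz := by
    simp only [cutoff_of_mem g hz, one_smul, geodesicExt_of_mem g hz]
    exact metricL_of_mem g hz
  L_H z hz := by
    simp only [cutoff_of_mem g hz, one_smul]
    exact metricL_snd_perp g hz
  L_V z hz := by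
    simp only [cutoff_of_mem g hz, one_smul]
    exact map_zero (metricL g z.1 z.2)
  B_X z hz := by
    simp only [cutoff_of_mem g hz, one_smul, geodesicExt_of_mem g hz]
    exact metricL_perp_snd g hz
  B_H z hz := by
    simp only [cutoff_of_mem g hz, one_smul]
    exact metricL_perp_perp g hz
  B_V z hz := by
    simp only [cutoff_of_mem g hz, one_smul]
    exact map_zero (metricL g z.1 (perp g z))
  L₀_X z hz := by
    simp only [cutoff_of_mem g hz, one_smul, geodesicExt_of_mem g hz]
    change metricL g z.1 (perp g z) (nablaL g z (horizontal g z z.2)) - b.form z.1 z.2 = _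
    rw [nablaL_horizontal, map_zero, zero_sub]
  L₀_H z hz := by
    simp only [cutoff_of_mem g hz, one_smul]
    change metricL g z.1 (perp g z) (nablaL g z (horizontal g z (perp g z)))
      - b.form z.1 (perp g z) = _
    rw [nablaL_horizontal, map_zero, zero_sub]
  L₀_V z hz := by
    simp only [cutoff_of_mem g hz, one_smul]
    change metricL g z.1 (perp g z) (nablaL g z (0, perp g z)) - b.form z.1 0 = 1
    rw [nablaL_apply, map_zero, map_zero, zero_apply, add_zero, metricL_perp_perp g hz, sub_zero]
  tangent c t ξ hN hc := by
    have hz := hN.self_of_nhds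
    obtain ⟨e1, e2⟩ := tangent_eq_frameVec g hN hc
    simp only [cutoff_of_mem g hz, one_smul]
    have e3 := eq_frame g hz ξ.1
    rw [e1, zero_smul, zero_add] at e3
    have e4 : connectionL g b (c t) ξ + b.form (c t).1 (c t).2 * liouvilleL g (c t) ξ
        + b.form (c t).1 (perp g (c t)) * perpFormL g (c t) ξ
        = metricL g (c t).1 (perp g (c t)) (nablaL g (c t) ξ) := by
      change metricL g (c t).1 (perp g (c t)) (nablaL g (c t) ξ) - b.form (c t).1 ξ.1
        + b.form (c t).1 (c t).2 * metricL g (c t).1 (c t).2 ξ.1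
        + b.form (c t).1 (perp g (c t)) * metricL g (c t).1 (perp g (c t)) ξ.1 = _
      conv_lhs => arg 1; arg 1; arg 2; rw [e3, map_add, map_smul, map_smul]
      simp only [smul_eq_mul]
      ring
    rw [e4]
    exact e2
  invariant c α β γ hc h0 := by
    refine mem_unitBundle_of_hasDerivAt g (α := α) (β := β) (γ := γ) (fun t => ?_) h0
    rw [frameVec, smul_add, smul_add, smul_comm _ (α t), smul_comm _ (β t), smul_comm _ (γ t)]
    exact hc t
  isOpen_U := b.isOpen_domain.preimage continuous_fst
  extD_L z hz a₁ b₁ c₁ a₂ b₂ c₂ := by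
    rw [extD_cutoff_smul g hz]
    simp only [cutoff_of_mem g hz, one_smul]
    change extD (liouvilleL g) z (frameVec g z a₁ b₁ c₁) (frameVec g z a₂ b₂ c₂) = _
    rw [extD_liouvilleL g (fst_ne_zero_of_mem g hz), nablaL_frameVec, nablaL_frameVec,
      frameVec_fst g hz, frameVec_fst g hz]
    simp only [map_add, map_smul, smul_apply, smul_eq_mul, metricL_perp_snd g hz,
      metricL_perp_perp g hz]
    ring
  extD_L₀ z hz hU a₁ b₁ c₁ a₂ b₂ c₂ := by
    rw [extD_cutoff_smul g hz]
    simp only [cutoff_of_mem g hz, one_smul]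
    exact extD_connectionL g b hz hU a₁ b₁ c₁ a₂ b₂ c₂
  rot_zero z := by simp [fibreRotation]
  rot_mem z hz θ := fibreRotation_mem g hz θ
  hasDerivAt_rot z hz θ := by
    rw [cutoff_of_mem g (fibreRotation_mem g hz θ), one_smul]
    exact hasDerivAt_fibreRotation g hz θ
  rot_two_pi z hz := by simp [fibreRotation]
  rot_ne z hz θ hθ := fibreRotation_ne g hz hθ
  f_rot z hz θ := rfl
  rot_mem_U z hz hU θ := hU
  injective := exists_coframe_injOn g b

end Bundle

/-! ### Local primitives of `σ - K μ` -/

section Primitive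

variable (g : SphereMetric)

lemma eq_sum_of_isLinearMap {F : Type} [AddCommGroup F] [Module ℝ F] {L : E3 → F}
    (h : IsLinearMap ℝ L) (u : E3) : L u = ∑ i, u i • L (basisVec i) := by
  have h1 := map_sum (h.mk' L) (fun i => u i • basisVec i) Finset.univ
  rw [sum_smul_basisVec] at h1
  simp only [map_smul] at h1
  exact h1

lemma riemann_eq_sum {p : E3} (hp : p ≠ 0) (u w a : E3) :
    riemann g p u w a
      = ∑ i, u i • ∑ j, w j • ∑ k, a k • riemann g p (basisVec i) (basisVec j) (basisVec k) := by
  have h1 : ∀ w a, IsLinearMap ℝ fun u => riemann g p u w a := fun w a => by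
    constructor
    · intro u u'
      simp only [riemann_eq g hp, map_add, add_apply]
      abel
    · intro c u
      simp only [riemann_eq g hp, map_smul, smul_apply]
      module
  have h2 : ∀ u a, IsLinearMap ℝ fun w => riemann g p u w a := fun u a => by
    constructor
    · intro u u'
      simp only [riemann_eq g hp, map_add, add_apply]
      abel
    · intro c u
      simp only [riemann_eq g hp, map_smul, smul_apply]
      module
  have h3 : ∀ u w, IsLinearMap ℝ fun a => riemann g p u w a := fun u w => by
    constructor
    · intro a a'
      simp only [riemann_eq g hp, map_add]
      abel
    · intro c a
      simp only [riemann_eq g hp, map_smul]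
      module
  rw [eq_sum_of_isLinearMap (h1 w a) u]
  refine Finset.sum_congr rfl fun i _ => congrArg _ ?_
  rw [eq_sum_of_isLinearMap (h2 _ a) w]
  refine Finset.sum_congr rfl fun j _ => congrArg _ ?_
  rw [eq_sum_of_isLinearMap (h3 _ _) a]

lemma contDiffAt_riemann {p : E3} (hp : p ≠ 0) (u w a : E3) :
    ContDiffAt ℝ ∞ (fun p => riemann g p u w a) p := by
  have h1 : ∀ u w a : E3, ∀ q ≠ 0, ContDiffAt ℝ ∞ (fun q => christoffel g q w a) q :=
    fun u w a q hq => by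
    have : ContDiffAt ℝ ∞ (fun q => christoffelL g q w a) q :=
      ((contDiffAt_christoffelL g hq).clm_apply contDiffAt_const).clm_apply contDiffAt_const
    refine this.congr_of_eventuallyEq ?_
    filter_upwards [isOpen_ne_zero.mem_nhds hq] with r hr
    rw [christoffelL_apply g hr]
  have h2 : ∀ u w a : E3, ContDiffAt ℝ ∞ (fun q => fderiv ℝ (fun q => christoffel g q w a) q u) p :=
    fun u w a => ((h1 u w a p hp).fderiv_right (m := ∞) (by simp)).clm_apply contDiffAt_const
  have h3 : ∀ u w a : E3, ContDiffAt ℝ ∞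
      (fun q => christoffelL g q u (christoffelL g q w a)) p := fun u w a =>
    ((contDiffAt_christoffelL g hp).clm_apply contDiffAt_const).clm_apply
      (((contDiffAt_christoffelL g hp).clm_apply contDiffAt_const).clm_apply contDiffAt_const)
  refine ((((h2 u w a).sub (h2 w u a)).add (h3 u w a)).sub (h3 w u a)).congr_of_eventuallyEq ?_
  filter_upwards [isOpen_ne_zero.mem_nhds hp] with q hq
  simp only [riemann, christoffelL_apply g hq]

lemma contDiff_coord {E : Type} [NormedAddCommGroup E] [NormedSpace ℝ E] {u : E → E3}
    (hu : ContDiff ℝ ∞ u) (i : Fin 3) : ContDiff ℝ ∞ fun s => u s i :=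
  (EuclideanSpace.proj i : E3 →L[ℝ] ℝ).contDiff.comp hu

lemma contDiff_riemann_comp {E : Type} [NormedAddCommGroup E] [NormedSpace ℝ E] {x u w a : E → E3}
    (hx : ContDiff ℝ ∞ x) (hu : ContDiff ℝ ∞ u) (hw : ContDiff ℝ ∞ w) (ha : ContDiff ℝ ∞ a)
    (h0 : ∀ s, x s ≠ 0) : ContDiff ℝ ∞ fun s => riemann g (x s) (u s) (w s) (a s) := by
  rw [funext fun s => riemann_eq_sum g (h0 s) (u s) (w s) (a s)]
  refine ContDiff.sum fun i _ => (contDiff_coord hu i).smul (ContDiff.sum fun j _ => (contDiff_coord hw j).smul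
    (ContDiff.sum fun k _ => (contDiff_coord ha k).smul ?_))
  rw [contDiff_iff_contDiffAt]
  exact fun s => ContDiffAt.comp (g := fun p => riemann g p (basisVec i) (basisVec j) (basisVec k)) s
    (contDiffAt_riemann g (h0 s) _ _ _) hx.contDiffAt

/-- The curvature form is bilinear and alternating. -/
lemma curvatureForm_combination {x : E3} (hx : x ≠ 0) (u w : E3) (a b a' b' : ℝ) :
    curvatureForm g x (a • u + b • w) (a' • u + b' • w)
      = (a * b' - a' * b) * curvatureForm g x u w := by
  have h1 : area g x (a • u + b • w) (a' • u + b' • w) = (a * b' - a' * b) * area g x u w := by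
    simp only [area_eq, PiLp.add_apply, PiLp.smul_apply, smul_eq_mul]
    ring
  rw [curvatureForm, curvatureForm, h1]
  by_cases h2 : a * b' - a' * b = 0
  · simp [h2]
  have h3 : ∀ y, metricL g x (riemann g x u w y) y = 0 := fun y => by
    have := metricL_riemann_skew g hx u w y y
    linarith
  have h4 := metricL_riemann_skew g hx u w u w
  have hlin : ∀ c c' : ℝ, riemann g x u w (c • u + c' • w)
      = c • riemann g x u w u + c' • riemann g x u w w := fun c c' => by
    simp only [riemann_eq g hx, map_add, map_smul]
    module
  have e1 : metricL g x (riemann g x (a • u + b • w) (a' • u + b' • w) (a' • u + b' • w))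
      (a • u + b • w) = (a * b' - a' * b) ^ 2 * metricL g x (riemann g x u w w) u := by
    rw [riemann_combination g hx, hlin]
    simp only [map_add, map_smul, add_apply, smul_apply, smul_eq_mul, h3, h4]
    ring
  have e2 : metricL g x (a • u + b • w) (a • u + b • w)
      * metricL g x (a' • u + b' • w) (a' • u + b' • w)
      - metricL g x (a • u + b • w) (a' • u + b' • w) ^ 2
      = (a * b' - a' * b) ^ 2 * (metricL g x u u * metricL g x w w - metricL g x u w ^ 2) := by
    simp only [map_add, map_smul, add_apply, smul_apply, smul_eq_mul]
    rw [metricL_comm g x w u]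
    ring
  have e3 : gaussCurvature g x (a • u + b • w) (a' • u + b' • w) = gaussCurvature g x u w := by
    rw [gaussCurvature, gaussCurvature]
    simp only [← metricL_apply]
    rw [e1, e2]
    exact mul_div_mul_left _ _ (pow_ne_zero 2 h2)
  rw [e3]
  ring

/-- A global primitive of `σ - K μ` on the sphere. -/
def globalPrimitive {g : SphereMetric} {f : SphereFun} {β : SphereOneForm}
    (hβ : IsPrimitive g f β) : LocalPrimitive g f where
  form p := LinearMap.toContinuousLinearMap
    { toFun := formExt β p
      map_add' := fun u w => by simp only [formExt, map_add]
      map_smul' := fun c u => by simp only [formExt, map_smul, RingHom.id_apply] }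
  domain := univ
  smooth p hp := contDiffOn_clm (fun u _ hp => contDiffAt_formExt β hp u) hp
  isOpen_domain := isOpen_univ
  extD_eq x _ hx u w hu hw := by
    have h0 : x ≠ 0 := by rw [← norm_ne_zero_iff, hx]; exact one_ne_zero
    set b : E3 → E3 →L[ℝ] ℝ := fun p => LinearMap.toContinuousLinearMap
      { toFun := formExt β p
        map_add' := fun u w => by simp only [formExt, map_add]
        map_smul' := fun c u => by simp only [formExt, map_smul, RingHom.id_apply] } with hb
    have hd : DifferentiableAt ℝ b x :=
      (contDiffOn_clm (fun u _ hp => contDiffAt_formExt β hp u) h0 :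
        ContDiffAt ℝ ∞ b x).differentiableAt (by simp)
    have h1 : ∀ u w : E3, fderiv ℝ (fun q => formExt β q w) x u = fderiv ℝ b x u w := by
      intro u w
      have h2 : HasFDerivAt (fun q => b q w) ((fderiv ℝ b x).flip w) x := by
        convert! hd.hasFDerivAt.clm_apply (hasFDerivAt_const w x) using 1
        ext; simp
      exact congrArg (fun L : E3 →L[ℝ] ℝ => L u) h2.fderiv
    have hx' : x ∈ Metric.sphere (0 : E3) 1 := by simpa using hx
    have h2 := hβ ⟨x, hx'⟩ u w hu hw
    have h3 : funExt f x = f ⟨x, hx'⟩ := by rw [funExt, radial_of_mem ⟨x, hx'⟩]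
    rw [extDerivForm, h1, h1] at h2
    rw [extD, h3]
    exact h2

/-- An antiderivative in the first variable, depending smoothly on the second one. -/
lemma exists_antiderivative {κ : ℝ × ℝ → ℝ} (hκ : ContDiff ℝ ∞ κ) :
    ∃ B : ℝ × ℝ → ℝ, ContDiff ℝ ∞ B ∧ ∀ s, fderiv ℝ B s (1, 0) = κ s := by
  let B : ℝ × ℝ → ℝ := fun s => s.1 * ∫ σ in (0 : ℝ)..1, κ (s.1 * σ, s.2)
  have hB : ContDiff ℝ ∞ B := by
    refine contDiff_fst.mul ?_
    refine contDiff_parametricIntegral (g := fun q : (ℝ × ℝ) × ℝ => κ (q.1.1 * q.2, q.1.2)) ?_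
    exact hκ.comp (by fun_prop)
  refine ⟨B, hB, fun s => ?_⟩
  have h1 := fderiv_apply_one_zero (hB.differentiable (by simp) (s.1, s.2))
  have h2 : (fun s' => B (s', s.2)) = fun s' => ∫ σ in (0 : ℝ)..s', κ (σ, s.2) := by
    funext s'
    have := intervalIntegral.smul_integral_comp_mul_left (a := 0) (b := 1)
      (fun σ => κ (σ, s.2)) s'
    rw [mul_zero, mul_one] at this
    exact this
  rw [h2] at h1
  have hc : Continuous fun σ => κ (σ, s.2) := hκ.continuous.comp (by fun_prop)
  exact h1.unique (intervalIntegral.integral_hasDerivAt_right (hc.intervalIntegrable _ _)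
    (hc.stronglyMeasurableAtFilter _ _) hc.continuousAt)

/-- The exterior derivative of `B(s) ds₂`. -/
lemma extD_smul_fderiv {s₁ s₂ : E3 → ℝ} {B : ℝ × ℝ → ℝ} {p : E3} (h1 : ContDiffAt ℝ ∞ s₁ p)
    (h2 : ContDiffAt ℝ ∞ s₂ p) (hB : ContDiff ℝ ∞ B) (u w : E3) :
    extD (fun q => B (s₁ q, s₂ q) • fderiv ℝ s₂ q) p u w
      = fderiv ℝ B (s₁ p, s₂ p) (1, 0)
        * (fderiv ℝ s₁ p u * fderiv ℝ s₂ p w - fderiv ℝ s₁ p w * fderiv ℝ s₂ p u) := by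
  have d1 := (h1.differentiableAt (by simp)).hasFDerivAt
  have d2 := (h2.differentiableAt (by simp)).hasFDerivAt
  have d3 := ((h2.fderiv_right (m := ∞) (by simp)).differentiableAt (by simp)).hasFDerivAt
  have d4 : HasFDerivAt (fun q => B (s₁ q, s₂ q)) _ p :=
    HasFDerivAt.comp (g := B) p ((hB.differentiable (by simp)) _).hasFDerivAt (d1.prodMk d2)
  have hsym : IsSymmSndFDerivAt ℝ s₂ p := h2.isSymmSndFDerivAt (by simp; norm_cast)
  have e : ∀ a b : ℝ, fderiv ℝ B (s₁ p, s₂ p) (a, b)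
      = a * fderiv ℝ B (s₁ p, s₂ p) (1, 0) + b * fderiv ℝ B (s₁ p, s₂ p) (0, 1) := by
    intro a b
    have : ((a, b) : ℝ × ℝ) = a • (1, 0) + b • (0, 1) := by simp
    rw [this, map_add, map_smul, map_smul, smul_eq_mul, smul_eq_mul]
  have d5 : HasFDerivAt (fun q => B (s₁ q, s₂ q) • fderiv ℝ s₂ q) _ p := d4.smul d3
  rw [extD, d5.fderiv]
  simp only [add_apply, smul_apply, ContinuousLinearMap.comp_apply,
    ContinuousLinearMap.smulRight_apply, ContinuousLinearMap.prod_apply, smul_eq_mul]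
  rw [hsym u w, e (fderiv ℝ s₁ p u), e (fderiv ℝ s₁ p w)]
  ring

lemma exists_orthonormalBasis_zero_eq {x₀ : E3} (hx₀ : ‖x₀‖ = 1) :
    ∃ e : OrthonormalBasis (Fin 3) ℝ E3, e 0 = x₀ := by
  have h : Orthonormal ℝ (({0} : Set (Fin 3)).domRestrict fun _ : Fin 3 => x₀) := by
    refine ⟨fun i => hx₀, fun i j hij => absurd (Subtype.ext ?_) hij⟩
    exact i.2.trans j.2.symm
  obtain ⟨e, he⟩ := h.exists_orthonormalBasis_extension_of_card_eq (by simp)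
  exact ⟨e, he 0 rfl⟩

/-- Every point of the sphere has a neighbourhood on which `σ - K μ` is exact: in the chart
`s = (⟨x, e₁⟩, ⟨x, e₂⟩) / ⟨x, x₀⟩` it is `κ(s) ds₁ ∧ ds₂ = d (B(s) ds₂)` where `∂₁ B = κ`. -/
lemma exists_localPrimitive (f : SphereFun) {x₀ : E3} (hx₀ : ‖x₀‖ = 1) :
    ∃ b : LocalPrimitive g f, x₀ ∈ b.domain := by
  obtain ⟨e, he⟩ := exists_orthonormalBasis_zero_eq hx₀
  have ort : ∀ i j, inner ℝ (e i) (e j) = if i = j then (1 : ℝ) else 0 :=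
    orthonormal_iff_ite.1 e.orthonormal
  have o00 : inner ℝ (e 0) (e 0) = (1 : ℝ) := by rw [ort]; rfl
  have o11 : inner ℝ (e 1) (e 1) = (1 : ℝ) := by rw [ort]; rfl
  have o22 : inner ℝ (e 2) (e 2) = (1 : ℝ) := by rw [ort]; rfl
  have o01 : inner ℝ (e 0) (e 1) = (0 : ℝ) := by rw [ort]; rfl
  have o02 : inner ℝ (e 0) (e 2) = (0 : ℝ) := by rw [ort]; rfl
  have o12 : inner ℝ (e 1) (e 2) = (0 : ℝ) := by rw [ort]; rfl
  have o10 : inner ℝ (e 1) (e 0) = (0 : ℝ) := by rw [ort]; rfl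
  have o20 : inner ℝ (e 2) (e 0) = (0 : ℝ) := by rw [ort]; rfl
  have o21 : inner ℝ (e 2) (e 1) = (0 : ℝ) := by rw [ort]; rfl
  -- the inverse of the chart, and the coordinate frame up to normalisation
  let Y : ℝ × ℝ → E3 := fun s => e 0 + s.1 • e 1 + s.2 • e 2
  let P : ℝ × ℝ → E3 := fun s => (radial (Y s) : E3)
  let W₁ : ℝ × ℝ → E3 := fun s => e 1 - s.1 • e 0
  let W₂ : ℝ × ℝ → E3 := fun s => e 2 - s.2 • e 0
  have hY0 : ∀ s, inner ℝ (e 0) (Y s) = 1 := fun s => by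
    simp only [Y, inner_add_right, inner_smul_right, o00, o01, o02]; ring
  have hYne : ∀ s, Y s ≠ 0 := fun s h => by
    have := hY0 s
    rw [h, inner_zero_right] at this
    exact zero_ne_one this
  have hY : ContDiff ℝ ∞ Y := by fun_prop
  have hP : ContDiff ℝ ∞ P := contDiff_iff_contDiffAt.2 fun s =>
    ContDiffAt.comp (g := fun p => (radial p : E3)) s (contDiffAt_radial_coe (hYne s))
      hY.contDiffAt
  have hPn : ∀ s, ‖P s‖ = 1 := fun s => norm_radial _
  have hPne : ∀ s, P s ≠ 0 := fun s => by rw [← norm_ne_zero_iff, hPn]; exact one_ne_zero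
  have hW₁ : ContDiff ℝ ∞ W₁ := by fun_prop
  have hW₂ : ContDiff ℝ ∞ W₂ := by fun_prop
  have hPW₁ : ∀ s, inner ℝ (P s) (W₁ s) = 0 := fun s => by
    simp only [P, W₁, radial_coe (hYne s), Y, inner_sub_right, inner_smul_right,
      real_inner_smul_left, inner_add_left, o00, o01, o10, o11, o20, o21]
    ring
  have hPW₂ : ∀ s, inner ℝ (P s) (W₂ s) = 0 := fun s => by
    simp only [P, W₂, radial_coe (hYne s), Y, inner_sub_right, inner_smul_right,
      real_inner_smul_left, inner_add_left, o00, o02, o10, o12, o20, o22]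
    ring
  have hW₁ne : ∀ s, W₁ s ≠ 0 := fun s h => by
    have : inner ℝ (e 1) (W₁ s) = 1 := by
      simp only [W₁, inner_sub_right, inner_smul_right, o11, o10]; ring
    rw [h, inner_zero_right] at this
    exact zero_ne_one this
  have hspan : ∀ s u, inner ℝ (P s) u = 0 →
      u = inner ℝ (e 1) u • W₁ s + inner ℝ (e 2) u • W₂ s := by
    intro s u hu
    have h1 := e.sum_repr' u
    rw [Fin.sum_univ_three] at h1
    have h2 : inner ℝ (Y s) u = 0 := by
      rw [← norm_smul_radial (hYne s), real_inner_smul_left]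
      rw [show inner ℝ (radial (Y s) : E3) u = 0 from hu, mul_zero]
    simp only [Y, inner_add_left, real_inner_smul_left] at h2
    have h3 : inner ℝ (e 0) u = - (s.1 * inner ℝ (e 1) u + s.2 * inner ℝ (e 2) u) := by linarith
    conv_lhs => rw [← h1, h3]
    simp only [W₁, W₂]
    module
  have harea_comb : ∀ s (a b a' b' : ℝ), area g (P s) (a • W₁ s + b • W₂ s) (a' • W₁ s + b' • W₂ s)
      = (a * b' - a' * b) * area g (P s) (W₁ s) (W₂ s) := fun s a b a' b' => by
    simp only [area_eq, PiLp.add_apply, PiLp.smul_apply, smul_eq_mul]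
    ring
  have harea : ∀ s, area g (P s) (W₁ s) (W₂ s) ≠ 0 := by
    intro s h
    have h1 := rotL_ne_zero g (hPne s) (hW₁ne s) (hPW₁ s)
    have h2 := metricL_self_pos g (hPne s) h1
    have h3 := hspan s _ (inner_base_rotL g (hPne s) (W₁ s))
    rw [metricL_rotL g (hPne s)] at h2
    have h4 := harea_comb s 1 0 (inner ℝ (e 1) (rotL g (P s) (W₁ s)))
      (inner ℝ (e 2) (rotL g (P s) (W₁ s)))
    rw [← h3, h, mul_zero, one_smul, zero_smul, add_zero] at h4
    exact h2.ne' h4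
  have hmetric : ∀ {u w : ℝ × ℝ → E3}, ContDiff ℝ ∞ u → ContDiff ℝ ∞ w →
      ContDiff ℝ ∞ fun s => metricL g (P s) (u s) (w s) := fun hu hw => by
    have : ContDiff ℝ ∞ fun s => metricL g (P s) := contDiff_iff_contDiffAt.2 fun s =>
      (contDiffAt_metricL g (hPne s)).comp s hP.contDiffAt
    exact (this.clm_apply hu).clm_apply hw
  have hareaL : ContDiff ℝ ∞ fun s => area g (P s) (W₁ s) (W₂ s) := by
    have : ContDiff ℝ ∞ fun s => areaL g (P s) := contDiff_iff_contDiffAt.2 fun s =>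
      (contDiffAt_areaL g (hPne s)).comp s hP.contDiffAt
    exact (this.clm_apply hW₁).clm_apply hW₂
  have hgram : ∀ s, metricL g (P s) (W₁ s) (W₁ s) * metricL g (P s) (W₂ s) (W₂ s)
      - metricL g (P s) (W₁ s) (W₂ s) ^ 2 = area g (P s) (W₁ s) (W₂ s) ^ 2 := fun s => by
    rw [area_sq g (hPne s), metricL_base g (hPne s), metricL_base g (hPne s),
      metricL_base g (hPne s), hPW₁, hPW₂, real_inner_self_eq_norm_sq, hPn]
    ring
  have hK : ContDiff ℝ ∞ fun s => curvatureForm g (P s) (W₁ s) (W₂ s) := by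
    have h1 : ∀ s, curvatureForm g (P s) (W₁ s) (W₂ s)
        = metricL g (P s) (riemann g (P s) (W₁ s) (W₂ s) (W₂ s)) (W₁ s)
          * (area g (P s) (W₁ s) (W₂ s))⁻¹ := fun s => by
      rw [curvatureForm, gaussCurvature]
      simp only [← metricL_apply]
      rw [hgram]
      have := harea s
      field_simp
    rw [funext h1]
    exact (hmetric (contDiff_riemann_comp g hP hW₁ hW₂ hW₂ hPne) hW₁).mul (hareaL.inv harea)
  let κ : ℝ × ℝ → ℝ := fun s => (funExt f (P s) * area g (P s) (W₁ s) (W₂ s)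
    - curvatureForm g (P s) (W₁ s) (W₂ s)) * (inner ℝ (P s) (e 0) ^ 2 / (1 + s.1 ^ 2 + s.2 ^ 2))
  have hκ : ContDiff ℝ ∞ κ := by
    have h1 : ContDiff ℝ ∞ fun s => funExt f (P s) := contDiff_iff_contDiffAt.2 fun s =>
      (contDiffAt_funExt f (hPne s)).comp s hP.contDiffAt
    refine ((h1.mul hareaL).sub hK).mul (((hP.inner ℝ contDiff_const).pow 2).div (by fun_prop)
      fun s => ?_)
    positivity
  obtain ⟨B, hB, hBκ⟩ := exists_antiderivative hκ
  -- the chart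
  let C : Set E3 := {p | 0 < inner ℝ p (e 0)}
  have hC : IsOpen C := isOpen_lt continuous_const (by fun_prop)
  let σ : E3 → E3 → ℝ := fun a p => inner ℝ p a / inner ℝ p (e 0)
  have hσ : ∀ a, ∀ p ∈ C, ContDiffAt ℝ ∞ (σ a) p := fun a p hp =>
    (contDiffAt_id.inner ℝ contDiffAt_const).div (contDiffAt_id.inner ℝ contDiffAt_const) (ne_of_gt hp)
  have hdσ : ∀ a, ∀ p ∈ C, ∀ u, fderiv ℝ (σ a) p u
      = (inner ℝ u a * inner ℝ p (e 0) - inner ℝ p a * inner ℝ u (e 0)) / inner ℝ p (e 0) ^ 2 := by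
    intro a p hp u
    have h1 : ∀ a : E3, HasDerivAt (fun t : ℝ => inner ℝ (p + t • u) a) (inner ℝ u a) 0 := by
      intro a
      have : HasDerivAt (fun t : ℝ => inner ℝ p a + t * inner ℝ u a) (inner ℝ u a) 0 := by
        simpa using ((hasDerivAt_id (0 : ℝ)).mul_const (inner ℝ u a)).const_add (inner ℝ p a)
      refine this.congr_of_eventuallyEq (Eventually.of_forall fun t => ?_)
      simp only [inner_add_left, real_inner_smul_left]
    have h2 := (h1 a).div (h1 (e 0)) (by rw [zero_smul, add_zero]; exact ne_of_gt hp)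
    have h3 : HasDerivAt (fun t : ℝ => p + t • u) u 0 := by
      have := ((hasDerivAt_id (0 : ℝ)).smul_const u).const_add p
      rw [one_smul] at this
      exact this
    have h4 : HasDerivAt (fun t : ℝ => σ a (p + t • u)) (fderiv ℝ (σ a) p u) 0 :=
      HasFDerivAt.comp_hasDerivAt (l := σ a) (0 : ℝ) (by
        rw [zero_smul, add_zero]
        exact ((hσ a p hp).differentiableAt (by simp)).hasFDerivAt) h3
    have h5 := h4.unique h2
    rw [zero_smul, add_zero] at h5
    exact h5
  have hPs : ∀ x ∈ C, ‖x‖ = 1 → P (σ (e 1) x, σ (e 2) x) = x := by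
    intro x hx hx1
    have hc : inner ℝ x (e 0) ≠ 0 := ne_of_gt hx
    have hx' : 0 < inner ℝ x (e 0) := hx
    have h1 : Y (σ (e 1) x, σ (e 2) x) = (inner ℝ x (e 0))⁻¹ • x := by
      have h2 := e.sum_repr' x
      rw [Fin.sum_univ_three] at h2
      rw [real_inner_comm x (e 0), real_inner_comm x (e 1), real_inner_comm x (e 2)] at h2
      conv_rhs => arg 2; rw [← h2]
      simp only [Y, σ, smul_add, smul_smul]
      rw [inv_mul_cancel₀ hc, one_smul, div_eq_inv_mul, div_eq_inv_mul]
    simp only [P]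
    rw [radial_coe (hYne _), h1, norm_smul, hx1, mul_one, norm_inv, Real.norm_of_nonneg hx'.le,
      inv_inv, smul_smul, mul_inv_cancel₀ hc, one_smul]
  obtain ⟨χ, hχ, -, hχC, hχ1⟩ := exists_cutoff (isCompact_singleton (x := x₀)) hC (by
    rw [singleton_subset_iff]
    change 0 < inner ℝ x₀ (e 0)
    rw [← he, o00]; exact one_pos)
  rw [nhdsSet_singleton] at hχ1
  obtain ⟨O, hO1, hOo, hOx⟩ := eventually_nhds_iff.1 hχ1
  let b : E3 → E3 →L[ℝ] ℝ := fun p => B (σ (e 1) p, σ (e 2) p) • fderiv ℝ (σ (e 2)) p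
  have hb : ContDiff ℝ ∞ fun p => χ p • b p := by
    refine contDiff_cutoff_smul hχ hC hχC fun p hp => ContDiffAt.contDiffWithinAt ?_
    exact (hB.contDiffAt.comp p ((hσ _ p hp).prodMk (hσ _ p hp))).smul
      ((hσ _ p hp).fderiv_right (m := ∞) (by simp))
  refine ⟨⟨fun p => χ p • b p, O ∩ C, fun p _ => hb.contDiffAt, hOo.inter hC, ?_⟩, hOx, ?_⟩
  · rintro x ⟨hxO, hxC⟩ hx u w hu hw
    have hc : inner ℝ x (e 0) ≠ 0 := ne_of_gt hxC
    have e1 : extD (fun p => χ p • b p) x u w = extD b x u w := by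
      have : (fun p => χ p • b p) =ᶠ[𝓝 x] b := by
        filter_upwards [hOo.mem_nhds hxO] with p hp
        rw [hO1 p hp, one_smul]
      rw [extD, extD, this.fderiv_eq]
    rw [e1, extD_smul_fderiv (hσ _ x hxC) (hσ _ x hxC) hB, hBκ]
    obtain ⟨s, hs⟩ : ∃ s, s = (σ (e 1) x, σ (e 2) x) := ⟨_, rfl⟩
    have hxP : P s = x := hs ▸ hPs x hxC hx
    have hu' := hspan s u (by rwa [hxP])
    have hw' := hspan s w (by rwa [hxP])
    set u₁ := inner ℝ (e 1) u
    set u₂ := inner ℝ (e 2) u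
    set w₁ := inner ℝ (e 1) w
    set w₂ := inner ℝ (e 2) w
    have e2 : fderiv ℝ (σ (e 1)) x u * fderiv ℝ (σ (e 2)) x w
        - fderiv ℝ (σ (e 1)) x w * fderiv ℝ (σ (e 2)) x u
        = (u₁ * w₂ - w₁ * u₂) * ((1 + s.1 ^ 2 + s.2 ^ 2) / inner ℝ x (e 0) ^ 2) := by
      have k1 : inner ℝ x (e 1) = s.1 * inner ℝ x (e 0) := by
        rw [hs]; exact (div_mul_cancel₀ _ hc).symm
      have k2 : inner ℝ x (e 2) = s.2 * inner ℝ x (e 0) := by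
        rw [hs]; exact (div_mul_cancel₀ _ hc).symm
      rw [hdσ _ x hxC, hdσ _ x hxC, hdσ _ x hxC, hdσ _ x hxC, hu', hw']
      simp only [W₁, W₂, inner_add_left, inner_sub_left, real_inner_smul_left, o00, o01, o02, o10,
        o11, o12, o20, o21, o22, k1, k2]
      field_simp
      ring
    rw [← hs, e2]
    simp only [κ]
    rw [hxP, hu', hw']
    have e3 := harea_comb s u₁ u₂ w₁ w₂
    have e4 := curvatureForm_combination g (hPne s) (W₁ s) (W₂ s) u₁ u₂ w₁ w₂
    rw [hxP] at e3 e4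
    rw [e3, e4]
    have : 1 + s.1 ^ 2 + s.2 ^ 2 ≠ 0 := by positivity
    field_simp
  · change 0 < inner ℝ x₀ (e 0)
    rw [← he, o00]; exact one_pos

end Primitive

/-! ### Parallel lifts of geodesics -/

section Lift

variable (g : SphereMetric) {f : SphereFun} (b : LocalPrimitive g f) (hf : ∀ x : S2, 0 < f x)
  {z : Phase}

lemma contactData_frame (hz : z ∈ unitBundle g) :
    (contactData g b hf).X z = geodesicExt g z ∧ (contactData g b hf).H z = perpField g z ∧
    (contactData g b hf).V z = vertExt g z := by
  simp only [contactData, cutoff_of_mem g hz, one_smul, and_self]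

lemma contactData_coframe (hz : z ∈ unitBundle g) :
    (contactData g b hf).L z = liouvilleL g z ∧ (contactData g b hf).B z = perpFormL g z ∧
    (contactData g b hf).L₀ z = connectionL g b z := by
  simp only [contactData, cutoff_of_mem g hz, one_smul, and_self]

lemma contactData_fun (hz : z ∈ unitBundle g) :
    (contactData g b hf).f z = funExt f z.1 ∧ (contactData g b hf).bX z = b.form z.1 z.2 ∧
    (contactData g b hf).bH z = b.form z.1 (perp g z) := by
  simp only [contactData, cutoff_of_mem g hz, one_smul, and_self]

lemma contactData_horizontal (hz : z ∈ unitBundle g) (p q : ℝ) :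
    p • (contactData g b hf).hA z + q • (contactData g b hf).hB z
      = frameVec g z p q (p * (contactData g b hf).bX z + q * (contactData g b hf).bH z) := by
  obtain ⟨h1, h2, h3⟩ := contactData_frame g b hf hz
  rw [ContactData.hA, ContactData.hB, h1, h2, h3, frameVec]
  module

variable {g b} in
/-- The covariant derivatives of `v` and `jv` along a curve in the unit bundle. -/
lemma hasDerivAt_snd_perp {c : ℝ → Phase} {t p q s : ℝ} (hz : c t ∈ unitBundle g)
    (hc : HasDerivAt c (frameVec g (c t) p q s) t) :
    HasDerivAt (fun r => (c r).2) (s • perp g (c t)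
      - christoffelL g (c t).1 (p • (c t).2 + q • perp g (c t)) (c t).2) t ∧
    HasDerivAt (fun r => perp g (c r)) (-s • (c t).2
      - christoffelL g (c t).1 (p • (c t).2 + q • perp g (c t)) (perp g (c t))) t := by
  have h0 := fst_ne_zero_of_mem g hz
  obtain ⟨k1, -, k3⟩ := frameVec_constraints g h0 p q s
  constructor
  · have h1 := nablaL_frameVec g (c t) p q s
    rw [nablaL_apply, frameVec_fst g hz] at h1
    have h2 : HasDerivAt (fun r => (c r).2) _ t := hc.snd
    rwa [eq_sub_of_add_eq h1] at h2
  · have h1 := nabla_perp g hz k1 k3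
    rw [nablaL_frameVec, map_smul, metricL_perp_perp g hz, smul_eq_mul, mul_one,
      frameVec_fst g hz] at h1
    have h2 : HasDerivAt (fun r => perp g (c r)) _ t := HasFDerivAt.comp_hasDerivAt (l := perp g) t
      ((contDiffAt_perp g h0).differentiableAt (by simp)).hasFDerivAt hc
    rwa [eq_sub_of_add_eq h1] at h2

/-- The lifts `sec` to the kernel of the connection form project to geodesics. -/
lemma isParallelRadialLift_sec {α₀ : Phase → Phase → ℝ}
    (hα₀ : ∀ z ∈ unitBundle g, ∀ ξ, α₀ z ξ = connectionL g b z ξ) (hz : z ∈ unitBundle g) {δ : ℝ}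
    {w : ℝ × ℝ} (hw : ‖w‖ ≤ 1) (hδ : Real.sqrt (w.1 ^ 2 + w.2 ^ 2) < δ) :
    IsParallelRadialLift g α₀ δ z ((contactData g b hf).sec z w) := by
  set D := contactData g b hf with hD
  have hN : ∀ r, D.sec z w r ∈ unitBundle g := fun r => D.sec_mem hz w r
  set p : ℝ → ℝ := fun r => (D.secFrame z w r).1 * w.1 - (D.secFrame z w r).2 * w.2 with hp
  set q : ℝ → ℝ := fun r => (D.secFrame z w r).2 * w.1 + (D.secFrame z w r).1 * w.2 with hq
  set s : ℝ → ℝ := fun r => p r * D.bX (D.sec z w r) + q r * D.bH (D.sec z w r) with hs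
  have hflow : ∀ r, HasDerivAt (fun r => (D.sec z w r, (D.secFrame z w r, w)))
      (D.sectionField (D.sec z w r, (D.secFrame z w r, w))) r := fun r => by
    have h := D.isTame_sectionFieldCut.hasDerivAt_flow r (z, ((1, 0), w))
    simp only [D.flow_section] at h
    rwa [ContactData.sectionFieldCut_eq (hN r) (D.norm_secFrame_le _ _ _) hw] at h
  have hsec : ∀ r, HasDerivAt (D.sec z w) (frameVec g (D.sec z w r) (p r) (q r) (s r)) r := by
    intro r
    have h1 : HasDerivAt (D.sec z w) _ r := (hflow r).fst
    rw [← contactData_horizontal g b hf (hN r)]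
    exact h1
  have hC : ∀ r, HasDerivAt (fun r => (D.secFrame z w r).1) (s r * (D.secFrame z w r).2) r :=
    fun r => (hflow r).snd.fst.fst
  have hS : ∀ r, HasDerivAt (fun r => (D.secFrame z w r).2) (-(s r * (D.secFrame z w r).1)) r :=
    fun r => (hflow r).snd.fst.snd
  have hy : ∀ r, HasDerivAt (fun r => (D.sec z w r).1)
      (p r • (D.sec z w r).2 + q r • perp g (D.sec z w r)) r := fun r => by
    rw [← frameVec_fst g (hN r) (p r) (q r) (s r)]
    exact (hsec r).fst
  have hdy : deriv (fun r => (D.sec z w r).1)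
      = fun r => p r • (D.sec z w r).2 + q r • perp g (D.sec z w r) := funext fun r => (hy r).deriv
  refine ⟨D.smooth_sec_curve z w, by simp, hN, fun r => ?_, fun r => (D.sec z w r).1,
    fun r => rfl, fun r => ?_, ?_⟩
  · rw [hα₀ _ (hN r), (D.hasDerivAt_sec hz hw r).deriv, ← (contactData_coframe g b hf (hN r)).2.2]
    simp only [map_add, map_smul, ← hD, (D.L_hA (hN r)).2.2, (D.L_hB (hN r)).2.2]
    simp
  · obtain ⟨hv, hj⟩ := hasDerivAt_snd_perp (hN r) (hsec r)
    have hp' : HasDerivAt p (s r * q r) r := by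
      convert! ((hC r).mul_const w.1).sub ((hS r).mul_const w.2) using 1
      simp only [hq]; ring
    have hq' : HasDerivAt q (-(s r * p r)) r := by
      convert! ((hS r).mul_const w.1).add ((hC r).mul_const w.2) using 1
      simp only [hp]; ring
    rw [hdy]
    convert! (hp'.smul hv).add (hq'.smul hj) using 1
    simp only [← christoffelL_apply g (fst_ne_zero_of_mem g (hN r)), map_add, map_smul]
    module
  · have h0 : deriv (fun r => (D.sec z w r).1) 0 = w.1 • z.2 + w.2 • perp g z := by
      rw [hdy]
      simp [hp, hq]
    rw [h0]
    simp only [ContactData.sec_zero_right, ← metricL_apply, map_add, map_smul, add_apply,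
      smul_apply, smul_eq_mul, metricL_of_mem g hz, metricL_perp_perp g hz, metricL_perp_snd g hz,
      metricL_snd_perp g hz]
    convert! hδ using 2
    ring

/-- Every parallel lift of a geodesic is one of the lifts `sec`: the components of the velocity of
the geodesic in the frame `(v, jv)` rotate by an angle which is found by integrating `spin`. -/
lemma eq_sec_of_isParallelRadialLift {α₀ : Phase → Phase → ℝ}
    (hα₀ : ∀ z ∈ unitBundle g, ∀ ξ, α₀ z ξ = connectionL g b z ξ) {δ : ℝ} (hδ : δ ≤ 1)
    {c : ℝ → Phase} (hc : IsParallelRadialLift g α₀ δ z c) :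
    ∃ w : ℝ × ℝ, Real.sqrt (w.1 ^ 2 + w.2 ^ 2) < δ ∧ c = (contactData g b hf).sec z w := by
  set D := contactData g b hf with hD
  obtain ⟨hcs, hc0, hN, hker, y, hy, hgeo, hlen⟩ := hc
  obtain rfl : y = fun r => (c r).1 := funext hy
  have hcd : ∀ r, HasDerivAt c (deriv c r) r := fun r =>
    (hcs.differentiable (by simp) r).hasDerivAt
  have hz : z ∈ unitBundle g := hc0 ▸ hN 0
  set p : ℝ → ℝ := fun r => liouvilleL g (c r) (deriv c r) with hp
  set q : ℝ → ℝ := fun r => perpFormL g (c r) (deriv c r) with hq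
  set s : ℝ → ℝ := fun r => p r * D.bX (c r) + q r * D.bH (c r) with hs
  have hd : ∀ r, deriv c r = frameVec g (c r) (p r) (q r) (s r) := by
    intro r
    have h1 := D.tangent c r _ (Eventually.of_forall hN) (hcd r)
    have h2 := contactData_frame g b hf (hN r)
    have h3 := contactData_coframe g b hf (hN r)
    rw [← hD] at h2 h3
    rw [h2.1, h2.2.1, h2.2.2, h3.1, h3.2.1, h3.2.2, ← hα₀ _ (hN r), hker r] at h1
    refine h1.trans ?_
    simp only [frameVec, hs, hp, hq, zero_add]
    congr 2
    ring
  have hcf : ∀ r, HasDerivAt c (frameVec g (c r) (p r) (q r) (s r)) r := fun r => hd r ▸ hcd r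
  have hfst : ∀ r, HasDerivAt (fun r => (c r).1) (deriv c r).1 r := fun r => (hcd r).fst
  have hdy : deriv (fun r => (c r).1) = fun r => (deriv c r).1 := funext fun r => (hfst r).deriv
  rw [hdy] at hgeo hlen
  have hdv : ∀ r, (deriv c r).1 = p r • (c r).2 + q r • perp g (c r) := fun r => by
    conv_lhs => rw [hd r]
    rw [frameVec_fst g (hN r)]
  have hvJ := fun r => hasDerivAt_snd_perp (hN r) (hcf r)
  have hp' : ∀ r, HasDerivAt p (s r * q r) r := by
    intro r
    have h0 := fst_ne_zero_of_mem g (hN r)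
    convert! hasDerivAt_metricL g (hfst r) (hvJ r).1 (hgeo r) h0 using 1
    rw [← christoffelL_apply g h0, neg_add_cancel, map_zero, add_zero, ← hdv, sub_add_cancel,
      map_smul]
    rfl
  have hq' : ∀ r, HasDerivAt q (-(s r * p r)) r := by
    intro r
    have h0 := fst_ne_zero_of_mem g (hN r)
    convert! hasDerivAt_metricL g (hfst r) (hvJ r).2 (hgeo r) h0 using 1
    rw [← christoffelL_apply g h0, neg_add_cancel, map_zero, add_zero, ← hdv, sub_add_cancel,
      map_smul, neg_mul_eq_neg_mul]
    rfl
  -- the angle between the velocity and the initial frame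
  have hsc : Continuous s := by
    have hpc : Continuous p := continuous_iff_continuousAt.2 fun r => (hp' r).continuousAt
    have hqc : Continuous q := continuous_iff_continuousAt.2 fun r => (hq' r).continuousAt
    exact (hpc.mul (D.smooth_bX.continuous.comp hcs.continuous)).add
      (hqc.mul (D.smooth_bH.continuous.comp hcs.continuous))
  set Θ : ℝ → ℝ := fun r => ∫ σ in (0 : ℝ)..r, s σ with hΘ
  have hΘ' : ∀ r, HasDerivAt Θ (s r) r := fun r =>
    intervalIntegral.integral_hasDerivAt_right (hsc.intervalIntegrable _ _)
      (hsc.stronglyMeasurableAtFilter _ _) hsc.continuousAt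
  have hΘ0 : Θ 0 = 0 := intervalIntegral.integral_same
  have hcos := fun r => (hΘ' r).cos
  have hsin := fun r => (hΘ' r).sin
  let w : ℝ × ℝ := (p 0, q 0)
  have e1 : ∀ r, p r * Real.cos (Θ r) - q r * Real.sin (Θ r) = p 0 := by
    intro r
    have h : ∀ r, HasDerivAt (fun r => p r * Real.cos (Θ r) - q r * Real.sin (Θ r)) 0 r := fun r => by
      convert! ((hp' r).mul (hcos r)).sub ((hq' r).mul (hsin r)) using 1
      ring
    have := is_const_of_deriv_eq_zero (fun r => (h r).differentiableAt) (fun r => (h r).deriv) r 0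
    simpa [hΘ0] using this
  have e2 : ∀ r, p r * Real.sin (Θ r) + q r * Real.cos (Θ r) = q 0 := by
    intro r
    have h : ∀ r, HasDerivAt (fun r => p r * Real.sin (Θ r) + q r * Real.cos (Θ r)) 0 r := fun r => by
      convert! ((hp' r).mul (hsin r)).add ((hq' r).mul (hcos r)) using 1
      ring
    have := is_const_of_deriv_eq_zero (fun r => (h r).differentiableAt) (fun r => (h r).deriv) r 0
    simpa [hΘ0] using this
  have hwδ : Real.sqrt (w.1 ^ 2 + w.2 ^ 2) < δ := by
    convert! hlen using 2
    beta_reduce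
    rw [← metricL_apply, hdv]
    simp only [map_add, map_smul, add_apply, smul_apply, smul_eq_mul, metricL_of_mem g (hN 0),
      metricL_perp_perp g (hN 0), metricL_perp_snd g (hN 0), metricL_snd_perp g (hN 0), w]
    ring
  have hw1 : ‖w‖ ≤ 1 := by
    rw [Prod.norm_def, Real.norm_eq_abs, Real.norm_eq_abs]
    refine max_le ?_ ?_
    · exact ((Real.abs_le_sqrt (by nlinarith [sq_nonneg w.2])).trans hwδ.le).trans hδ
    · exact ((Real.abs_le_sqrt (by nlinarith [sq_nonneg w.1])).trans hwδ.le).trans hδ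
  refine ⟨w, hwδ, funext fun r => ?_⟩
  refine (D.eq_sec hw1 (e := fun r => (Real.cos (Θ r), -Real.sin (Θ r))) hc0 (by simp [hΘ0]) hN
    (fun r => ?_) (fun r => ?_) r).1
  · rw [Prod.norm_def, Real.norm_eq_abs, Real.norm_eq_abs, abs_neg]
    exact max_le (Real.abs_cos_le_one _) (Real.abs_sin_le_one _)
  · have k1 : ContactData.coefA (c r, ((Real.cos (Θ r), -Real.sin (Θ r)), w)) = p r := by
      simp only [ContactData.coefA, w]
      linear_combination (-Real.cos (Θ r)) * e1 r - Real.sin (Θ r) * e2 r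
        + p r * Real.cos_sq_add_sin_sq (Θ r)
    have k2 : ContactData.coefB (c r, ((Real.cos (Θ r), -Real.sin (Θ r)), w)) = q r := by
      simp only [ContactData.coefB, w]
      linear_combination Real.sin (Θ r) * e1 r - Real.cos (Θ r) * e2 r
        + q r * Real.cos_sq_add_sin_sq (Θ r)
    have k3 : D.spin (c r, ((Real.cos (Θ r), -Real.sin (Θ r)), w)) = s r := by
      rw [ContactData.spin, k1, k2]
    rw [ContactData.sectionField, k1, k2, k3, contactData_horizontal g b hf (hN r)]
    refine (hcf r).prodMk (HasDerivAt.prodMk ?_ (hasDerivAt_const r w))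
    convert! (hcos r).prodMk (hsin r).neg using 1
    simp only [Prod.mk.injEq]
    constructor <;> ring

end Lift

/-! ### The first return for small parameters -/

namespace ContactData

variable {E : Type} [NormedAddCommGroup E] [NormedSpace ℝ E] [FiniteDimensional ℝ E]
  [CompleteSpace E] (D : ContactData E)

/-- The first return to the local section, valid for all sufficiently small parameters. The
uniqueness clauses say that there is no other intersection close to the time `2π`, and none at a
positive time before it. -/
theorem exists_isReturn : ∃ ρ > 0, ρ ≤ 1 ∧ ∃ u : ℝ × E → ℝ × (ℝ × ℝ), ∃ δ₀ > 0,
    ∀ᶠ m₁ in 𝓝[>] (0 : ℝ), D.IsReturn u m₁ ∧ ∀ m, |m| < m₁ → ∀ z ∈ D.N,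
      dist (u (m, z)) (2 * Real.pi, (0, 0)) < ρ ∧
      (∀ y : ℝ × (ℝ × ℝ), dist y (2 * Real.pi, (0, 0)) < ρ → D.phi m y.1 z = D.sec z y.2 1 →
        y = u (m, z)) ∧
      ∀ y : ℝ × (ℝ × ℝ), 0 < y.1 → y.1 < 2 * Real.pi + ρ → ‖y.2‖ < δ₀ →
        D.phi m y.1 z = D.sec z y.2 1 → y = u (m, z) := by
  obtain ⟨ρ, hρ, hρ1, u, hu, δ₀, hδ₀, hev⟩ := D.exists_return
  obtain ⟨r, hr, hball⟩ := Metric.eventually_nhds_iff.1 hev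
  refine ⟨ρ, hρ, hρ1, u, δ₀, hδ₀, ?_⟩
  filter_upwards [Ioo_mem_nhdsGT (lt_min hr D.mb_pos)] with m₁ hm₁
  have key : ∀ m : ℝ, |m| < m₁ → dist m 0 < r := fun m hm => by
    rw [Real.dist_eq, sub_zero]
    exact hm.trans (hm₁.2.trans_le (min_le_left _ _))
  refine ⟨⟨hu, hm₁.1, (hm₁.2.trans_le (min_le_right _ _)).le, fun m hm z hz => ?_,
    fun m hm z hz => (hball (key m hm) z hz).2.1, fun z hz => ?_⟩, fun m hm z hz => ?_⟩
  · have h1 : ‖(u (m, z)).2 - 0‖ ≤ ‖u (m, z) - (2 * Real.pi, ((0 : ℝ), (0 : ℝ)))‖ :=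
      norm_snd_le (u (m, z) - (2 * Real.pi, ((0 : ℝ), (0 : ℝ))))
    rw [sub_zero, ← dist_eq_norm] at h1
    exact h1.trans ((hball (key m hm) z hz).1.le.trans hρ1)
  · refine ((hball (by simpa using hr) z hz).2.2.1 (2 * Real.pi, (0, 0)) (by simpa using hρ) ?_).symm
    rw [phi_zero_left hz, D.rot_two_pi z hz]
    exact (sec_zero hz 1).symm
  · exact ⟨(hball (key m hm) z hz).1, (hball (key m hm) z hz).2.2⟩

end ContactData

/-! ### Periodic orbits near the critical points of `f` -/

section Orbits

variable (g : SphereMetric) {f : SphereFun} (b : LocalPrimitive g f) (hf : ∀ x : S2, 0 < f x)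
  {z : Phase}

lemma magneticField_of_mem (hz : z ∈ unitBundle g) (m : ℝ) :
    magneticField g f m z
      = m • (contactData g b hf).X z + (contactData g b hf).f z • (contactData g b hf).V z := by
  obtain ⟨h1, -, h2⟩ := contactData_frame g b hf hz
  rw [h1, h2, (contactData_fun g b hf hz).1, magneticField, geodesicField_of_mem g hz,
    verticalField_of_mem g hz]

lemma isFlowLine_mag {m : ℝ} (hm : |m| < (contactData g b hf).mb) (hz : z ∈ unitBundle g) :
    IsFlowLine (unitBundle g) (magneticField g f m) fun t => (contactData g b hf).mag m t z := by
  intro t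
  have h : (contactData g b hf).mag m t z ∈ unitBundle g :=
    ContactData.mag_mem (D := contactData g b hf) hz m t
  refine ⟨h, ?_⟩
  rw [magneticField_of_mem g b hf h]
  exact ContactData.hasDerivAt_mag (D := contactData g b hf) hm hz t

lemma eq_mag_of_isFlowLine {m : ℝ} (hm : |m| < (contactData g b hf).mb) {c : ℝ → Phase}
    (hc : IsFlowLine (unitBundle g) (magneticField g f m) c) (t : ℝ) :
    c t = (contactData g b hf).mag m t (c 0) :=
  ContactData.eq_mag (D := contactData g b hf) hm (fun t => (hc t).1) (fun t => by
    rw [← magneticField_of_mem g b hf (hc t).1]; exact (hc t).2) t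

/-- The rescaling `(x, v) ↦ (x, m v)` maps the orbits of `X^m` on the unit bundle to the orbits of
the magnetic field on the energy level. -/
lemma isPeriodicOrbitSupport_rescale {g : SphereMetric} {m : ℝ} {K : Set Phase}
    (hK : IsPeriodicOrbitSupport (unitBundle g) (magneticField g f m) K) :
    IsPeriodicOrbitSupport (energyLevel g m) (magneticField g f 1) (rescale m '' K) := by
  obtain ⟨T, hT, c, hc, hp, rfl⟩ := hK
  refine ⟨T, hT, fun t => rescale m (c t), fun t => ⟨?_, ?_⟩, fun t => by
    simp only [hp t], by rw [← range_comp]; rfl⟩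
  · obtain ⟨h1, h2, -⟩ := (hc t).1
    refine ⟨h1, ?_, ?_⟩
    · change inner ℝ (c t).1 (m • (c t).2) = 0
      rw [inner_smul_right, h2, mul_zero]
    have h3 := metricL_of_mem g (hc t).1
    change metricL g (c t).1 (m • (c t).2) (m • (c t).2) / 2 = _
    simp only [map_smul, smul_apply, smul_eq_mul, h3]
    ring
  · have h0 := fst_ne_zero_of_mem g (hc t).1
    have h1 : HasDerivAt (fun t => (c t).1) _ t := (hc t).2.fst
    have h2 : HasDerivAt (fun t => (c t).2) _ t := (hc t).2.snd
    convert! h1.prodMk (h2.const_smul m) using 1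
    simp only [magneticField, rescale, geodesicField, verticalField, rot_eq g h0,
      ← christoffelL_apply g h0, map_smul, smul_apply, Prod.smul_mk, Prod.mk_add_mk, smul_zero,
      add_zero, one_smul, Prod.mk.injEq, true_and, smul_add, smul_neg]
    rw [smul_comm m (funExt f (c t).1)]

/-- At a critical point of `φ`, the second derivative along a vector field `a` of the pull-back of
`φ` does not involve the derivatives of `a`. -/
lemma fderiv_fderiv_apply {φ : E3 → ℝ} {h : Phase → ℝ} {a : Phase → Phase}
    (hφ : ContDiffAt ℝ ∞ φ z.1) (h0 : fderiv ℝ φ z.1 = 0) (hh : h =ᶠ[𝓝 z] fun z => φ z.1)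
    (ha : ContDiff ℝ ∞ a) (ζ : Phase) :
    fderiv ℝ (fun z => fderiv ℝ h z (a z)) z ζ = fderiv ℝ (fderiv ℝ φ) z.1 ζ.1 (a z).1 := by
  have h1 : (fun z => fderiv ℝ h z (a z)) =ᶠ[𝓝 z] fun z => fderiv ℝ φ z.1 (a z).1 := by
    have hφ' : ∀ᶠ q in 𝓝 z, DifferentiableAt ℝ φ q.1 :=
      continuousAt_fst.eventually (((hφ.of_le (m := 1) (by norm_cast)).eventually (by simp)).mono fun q hq =>
        hq.differentiableAt (by simp))
    filter_upwards [hh.eventuallyEq_nhds, hφ'] with q hq hd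
    rw [hq.fderiv_eq]
    have := (hd.hasFDerivAt.comp q (hasFDerivAt_fst (𝕜 := ℝ) (p := q))).fderiv
    rw [show (fun z : Phase => φ z.1) = φ ∘ Prod.fst from rfl, this]
    rfl
  rw [h1.fderiv_eq]
  have h2 : DifferentiableAt ℝ (fderiv ℝ φ) z.1 :=
    (hφ.fderiv_right (m := 1) (by norm_cast)).differentiableAt (by simp)
  have h3 : HasFDerivAt (fun q : Phase => fderiv ℝ φ q.1) _ z :=
    h2.hasFDerivAt.comp z (hasFDerivAt_fst (𝕜 := ℝ) (p := z))
  have h4 : HasFDerivAt (fun q : Phase => (a q).1) _ z :=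
    (ha.differentiable (by simp) z).hasFDerivAt.fst
  rw [(h3.clm_apply h4).fderiv]
  simp [h0]

lemma exists_mem_unitBundle {x : E3} (hx : ‖x‖ = 1) : ∃ v, (x, v) ∈ unitBundle g := by
  obtain ⟨e, he⟩ := exists_orthonormalBasis_zero_eq hx
  have h0 : x ≠ 0 := by rw [← norm_ne_zero_iff, hx]; exact one_ne_zero
  have hpos := metricL_self_pos g h0 (u := e 1) (e.orthonormal.ne_zero 1)
  refine ⟨(Real.sqrt (metricL g x (e 1) (e 1)))⁻¹ • e 1, mem_unitBundle g hx ?_ ?_⟩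
  · have : inner ℝ (e 0) (e 1) = 0 := e.orthonormal.2 (by decide)
    rw [he] at this
    simp only [inner_smul_right, this, mul_zero]
  · simp only [map_smul, smul_apply, smul_eq_mul]
    field_simp
    rw [Real.sq_sqrt hpos.le]

variable {g} in
/-- Over a non-degenerate critical point of `f` the differential of `f` along the section vanishes
and is non-degenerate, hence every point of the fibre extends to a smooth family of points with
vanishing return direction. -/
lemma exists_direction_zero_of_isNondegCrit {x : S2} (hx : IsNondegCrit f x)
    (hU : (x : E3) ∈ b.domain) {v : E3} (hv : ((x : E3), v) ∈ unitBundle g)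
    {u : ℝ × Phase → ℝ × (ℝ × ℝ)} {m₁ : ℝ} (h : (contactData g b hf).IsReturn u m₁) :
    ∃ ζ : ℝ → Phase, ζ 0 = ((x : E3), v) ∧ ∃ O : Set ℝ, IsOpen O ∧ 0 ∈ O ∧ ContDiffOn ℝ ∞ ζ O ∧
      ∀ m ∈ O, ζ m ∈ unitBundle g ∧ (u (m, ζ m)).2 = 0 := by
  set D := contactData g b hf with hD
  set z₀ : Phase := ((x : E3), v) with hz₀
  have h0 : (x : E3) ≠ 0 := fst_ne_zero_of_mem g hv
  have hφ : ContDiffAt ℝ ∞ (funExt f) z₀.1 := contDiffAt_funExt f h0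
  have hDf : D.f =ᶠ[𝓝 z₀] fun z => funExt f z.1 := by
    have h1 : ∀ᶠ z in 𝓝 z₀, cutoff z.1 = 1 ∧ z.1 ≠ 0 :=
      continuousAt_fst.eventually (eventually_cutoff_eq_one (p := z₀.1) hv.1)
    filter_upwards [h1] with z hz
    change cutoff z.1 • funExt f z.1 = _
    rw [hz.1, one_smul]
  have hDf' : ∀ ζ, fderiv ℝ D.f z₀ ζ = 0 := fun ζ => by
    rw [hDf.fderiv_eq]
    have := ((hφ.differentiableAt (by simp)).hasFDerivAt.comp z₀
      (hasFDerivAt_fst (𝕜 := ℝ) (p := z₀))).fderiv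
    rw [show (fun z : Phase => funExt f z.1) = funExt f ∘ Prod.fst from rfl, this, hx.1]
    simp
  have e1 : (D.hA z₀).1 = v := by
    have := contactData_horizontal g b hf hv 1 0
    rw [one_smul, zero_smul, add_zero] at this
    rw [this, frameVec_fst g hv, one_smul, zero_smul, add_zero]
  have e2 : (D.hB z₀).1 = perp g z₀ := by
    have := contactData_horizontal g b hf hv 0 1
    rw [one_smul, zero_smul, zero_add] at this
    rw [this, frameVec_fst g hv, one_smul, zero_smul, zero_add]
  refine h.exists_direction_zero hv hU (hDf' _) (hDf' _) fun w hA hB => ?_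
  rw [fderiv_fderiv_apply hφ hx.1 hDf D.smooth_hA, e1] at hA
  rw [fderiv_fderiv_apply hφ hx.1 hDf D.smooth_hB, e2] at hB
  have e3 : (w.1 • D.hA z₀ + w.2 • D.hB z₀).1 = w.1 • v + w.2 • perp g z₀ := by
    rw [Prod.fst_add, Prod.smul_fst, Prod.smul_fst, e1, e2]
  rw [e3] at hA hB
  have hdd : DifferentiableAt ℝ (fderiv ℝ (funExt f)) (x : E3) :=
    (hφ.fderiv_right (m := 1) (by norm_cast)).differentiableAt (by simp)
  have hsymm : IsSymmSndFDerivAt ℝ (funExt f) (x : E3) :=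
    hφ.isSymmSndFDerivAt (by simp; norm_cast)
  have hin : inner ℝ (x : E3) (w.1 • v + w.2 • perp g z₀) = 0 := by
    have i1 : inner ℝ (x : E3) v = 0 := inner_of_mem g hv
    have i2 : inner ℝ (x : E3) (perp g z₀) = 0 := inner_fst_perp g hv
    rw [inner_add_right, inner_smul_right, inner_smul_right, i1, i2, mul_zero, mul_zero, add_zero]
  have hw := hx.2 (w.1 • v + w.2 • perp g z₀) hin fun y hy => by
    rw [((hdd.hasFDerivAt).clm_apply (hasFDerivAt_const _ _)).fderiv]
    simp only [add_apply, ContinuousLinearMap.comp_apply, zero_apply, map_zero, zero_add,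
      ContinuousLinearMap.flip_apply]
    rw [hsymm, eq_frame g hv y]
    have hy' : inner ℝ z₀.1 y = 0 := hy
    rw [hy', zero_smul, zero_add, map_add, map_smul, map_smul]
    change metricL g z₀.1 z₀.2 y • fderiv ℝ (fderiv ℝ (funExt f)) z₀.1 _ v + _ • _ = _
    rw [hA, hB, smul_zero, smul_zero, add_zero]
  have k1 := congrArg (metricL g z₀.1 v) hw
  have k2 := congrArg (metricL g z₀.1 (perp g z₀)) hw
  have m1 : metricL g z₀.1 v v = 1 := metricL_of_mem g hv
  have m2 : metricL g z₀.1 v (perp g z₀) = 0 := metricL_snd_perp g hv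
  have m3 : metricL g z₀.1 (perp g z₀) v = 0 := metricL_perp_snd g hv
  have m4 := metricL_perp_perp g hv
  simp only [map_add, map_smul, map_zero, smul_eq_mul, m1, m2, m3, m4] at k1 k2
  ext
  · simpa using k1
  · simpa using k2

variable {g} in
/-- The periodic orbits which bifurcate from a non-degenerate critical point of `f`, in the domain
of the contact isotopy. -/
theorem eventually_isOrbitFamily {x : S2} (hx : IsNondegCrit f x) (hU : (x : E3) ∈ b.domain) :
    ∃ γ : ℝ → ℝ → Phase, ∀ᶠ m₁ in 𝓝[>] (0 : ℝ),
      IsOrbitFamily g f m₁ (contactData g b hf).F x γ := by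
  set D := contactData g b hf with hD
  have hx1 : ‖(x : E3)‖ = 1 := by simp
  obtain ⟨v, hv⟩ := exists_mem_unitBundle g hx1
  obtain ⟨ρ, hρ, hρ1, u, δ₀, hδ₀, hev⟩ := D.exists_isReturn
  obtain ⟨m₀, hm₀, -⟩ := hev.exists
  obtain ⟨ζ, hζ0, O, hO, h0O, hζ, hζm⟩ := exists_direction_zero_of_isNondegCrit b hf hx hU hv hm₀
  obtain ⟨γ, hγ⟩ := hm₀.exists_closed_orbits hv hζ0 hO h0O hζ hζm
  refine ⟨γ, ?_⟩
  filter_upwards [hγ, Ioo_mem_nhdsGT D.mb_pos] with m₁ h1 hm₁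
  have horb : ∀ m ∈ Ico 0 m₁,
      IsPeriodicOrbitSupport (unitBundle g) (magneticField g f m) (D.F m '' range (γ m)) := by
    intro m hm
    obtain ⟨-, -, w, hw, T, hT, hp, hr⟩ := h1.2.2 m hm
    exact ⟨T, hT, _, isFlowLine_mag g b hf
      (by rw [abs_of_nonneg hm.1]; exact hm.2.trans hm₁.2) hw, hp, hr⟩
  exact ⟨h1.1, fun m hm => (h1.2.2 m hm).1, fun m hm => (h1.2.2 m hm).2.1, ⟨v, hv, h1.2.1⟩, horb,
    fun m hm => isPeriodicOrbitSupport_rescale (horb m ⟨hm.1.le, hm.2⟩)⟩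

/-- Only the two-form `f μ - K μ` near the critical point matters for the bifurcating orbits, so
that no global primitive is needed. -/
theorem exists_isOrbitFamily (hf : ∀ x : S2, 0 < f x) {x : S2} (hx : IsNondegCrit f x) :
    ∃ m₁ : ℝ, 0 < m₁ ∧ ∃ γ : ℝ → ℝ → Phase, IsOrbitFamily g f m₁ (fun _ z => z) x γ := by
  have hx1 : ‖(x : E3)‖ = 1 := by simp
  obtain ⟨b, hb⟩ := exists_localPrimitive g f hx1
  obtain ⟨γ, hev⟩ := eventually_isOrbitFamily b hf hx hb
  obtain ⟨m₁, h, hm₁⟩ := (hev.and self_mem_nhdsWithin).exists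
  set D := contactData g b hf
  have hr : ∀ m, (fun z : Phase => z) '' range (fun ψ => D.F m (γ m ψ)) = D.F m '' range (γ m) :=
    fun m => by rw [image_id', ← range_comp]; rfl
  refine ⟨m₁, hm₁, fun m ψ => D.F m (γ m ψ), ⟨?_, fun m hm ψ => ?_, fun m hm ψ => ?_, ?_,
    fun m hm => ?_, fun m hm => ?_⟩⟩
  · exact D.smooth_F.comp_contDiffOn (contDiff_fst.contDiffOn.prodMk h.smooth)
  · exact ContactData.F_mem (D := D) (h.mem m hm ψ) m
  · exact congrArg (D.F m) (h.loop m hm ψ)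
  · obtain ⟨v, hv, hγ⟩ := h.initial
    exact ⟨v, hv, fun ψ => by rw [← hγ, D.F_zero]⟩
  · rw [hr]; exact h.orbit m hm
  · rw [hr]; exact h.orbit_level m hm

end Orbits

/-! ### The contact isotopy on the unit tangent bundle -/

section Gray

variable {g : SphereMetric} {f : SphereFun} {β : SphereOneForm} (hβ : IsPrimitive g f β)
  (hf : ∀ x : S2, 0 < f x) {z : Phase}

/-- The contact geometry of the unit bundle determined by a primitive of `σ - K μ`. -/
abbrev globalData (hβ : IsPrimitive g f β) (hf : ∀ x : S2, 0 < f x) : ContactData Phase :=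
  contactData g (globalPrimitive hβ) hf

lemma globalData_U : (globalData hβ hf).U = univ := eq_univ_of_forall fun _ => trivial

lemma lam_zero_eq (hz : z ∈ unitBundle g) (ξ : Phase) :
    lam g β 0 z ξ = connectionL g (globalPrimitive hβ) z ξ := by
  have h0 := fst_ne_zero_of_mem g hz
  rw [lam, angular, zero_mul, zero_sub, rot_of_mem g hz, ← christoffelL_apply g h0,
    neg_add_eq_sub]
  rfl

lemma lam_eq (hz : z ∈ unitBundle g) (m : ℝ) (p : ℝ × Phase) :
    lam g β m z p.2 = (globalData hβ hf).Lam (m, z) p := by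
  have h1 : lam g β m z p.2 = m * liouville g z p.2 + lam g β 0 z p.2 := by
    simp only [lam]; ring
  rw [h1, lam_zero_eq hβ hz]
  obtain ⟨k1, -, k3⟩ := contactData_coframe g (globalPrimitive hβ) hf hz
  simp only [ContactData.Lam, k1, k3]
  rfl

lemma lam_zero_eq_L₀ (hz : z ∈ unitBundle g) (ξ : Phase) :
    lam g β 0 z ξ = (globalData hβ hf).L₀ z ξ := by
  rw [lam_zero_eq hβ hz, (contactData_coframe g (globalPrimitive hβ) hf hz).2.2]

/-- The maps `F_m` are diffeomorphisms for all `m`; for `m` below the bound `mb` the forms `λ_m` are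
contact forms, and the cut-off in the generator of the isotopy plays no role. -/
theorem isGrayIsotopy : IsGrayIsotopy g β (globalData hβ hf).mb (globalData hβ hf).F
    (globalData hβ hf).conf := by
  set D := globalData hβ hf with hD
  have hmb : ∀ {m}, m ∈ Ico 0 D.mb → |m| < D.mb := fun hm => by
    rw [abs_of_nonneg hm.1]; exact hm.2
  have hmem : ∀ {z} m, z ∈ unitBundle g → D.F m z ∈ unitBundle g := fun m hz =>
    ContactData.F_mem (D := D) hz m
  have hmem' : ∀ {z} m, z ∈ unitBundle g → D.Finv m z ∈ unitBundle g := fun m hz =>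
    ContactData.Finv_mem (D := D) hz m
  have hsurj : ∀ m, SurjOn (D.F m) (unitBundle g) (unitBundle g) := fun m w hw =>
    ⟨_, hmem' m hw, D.F_Finv m w⟩
  refine ⟨D.smooth_F.contDiffOn, D.smooth_conf.contDiffOn,
    fun m _ => ⟨fun z hz => hmem m hz, fun z _ w _ h => ?_, hsurj m⟩, fun m _ => ?_,
    fun z _ => D.F_zero z, fun m hm z hz => ?_, fun m hm c hc hN t => ?_⟩
  · rw [← D.Finv_F m z, h, D.Finv_F]
  · refine ContDiffOn.congr (f := D.Finv m)
      (D.smooth_Finv.comp (contDiff_const.prodMk contDiff_id)).contDiffOn fun w hw => ?_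
    rw [← D.Finv_F m (Function.invFunOn (D.F m) (unitBundle g) w),
      Function.invFunOn_eq (hsurj m hw)]
  · rw [(D.hasDerivAt_F m z).hasDerivWithinAt.derivWithin (uniqueDiffOn_Ico _ _ m hm),
      lam_eq hβ hf (hmem m hz)]
    exact ContactData.Lam_grayField (hmb hm) (hmem m hz)
  · have h1 : HasDerivAt (fun s => D.F m (c s)) _ t := (ContactData.hasDerivAt_FF_comp (D := D) m
      ((hc.differentiable (by simp) t).hasDerivAt)).snd
    rw [h1.deriv, lam_eq hβ hf (hmem m (hN t)), lam_zero_eq_L₀ hβ hf (hN t)]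
    exact ContactData.pullback (D := D) hc hN (hmb hm) t fun _ _ => trivial

end Gray

/-! ### The critical points and the expansion of the action -/

lemma eventually_forall_abs_lt {P : ℝ → Prop} (h : ∀ᶠ m in 𝓝 (0 : ℝ), P m) :
    ∀ᶠ r in 𝓝[>] (0 : ℝ), ∀ m, |m| < r → P m := by
  obtain ⟨r, hr, hP⟩ := Metric.eventually_nhds_iff.1 h
  filter_upwards [Ioo_mem_nhdsGT hr] with s hs m hm
  exact hP (by rw [Real.dist_eq, sub_zero]; exact hm.trans hs.2)

lemma exists_forall_Ico {P : ℝ → Prop} (h : ∀ᶠ m in 𝓝 (0 : ℝ), P m) {m₁ : ℝ} (hm₁ : 0 < m₁) :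
    ∃ m₂ ∈ Ioc 0 m₁, ∀ m ∈ Ico 0 m₂, P m := by
  obtain ⟨r, hr, h1⟩ := ((eventually_forall_abs_lt h).and (Ioo_mem_nhdsGT hm₁)).exists
  exact ⟨r, ⟨h1.1, h1.2.le⟩, fun m hm => hr m (by rw [abs_of_nonneg hm.1]; exact hm.2)⟩

namespace ContactData

variable {E : Type} [NormedAddCommGroup E] [NormedSpace ℝ E] [FiniteDimensional ℝ E]
  [CompleteSpace E] {D : ContactData E} {u : ℝ × E → ℝ × (ℝ × ℝ)} {m₁ : ℝ}

lemma eventually_forall_of_eventually {P : ℝ × E → Prop}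
    (h : ∀ z ∈ D.N, ∀ᶠ p in 𝓝 ((0 : ℝ), z), P p) : ∀ᶠ m in 𝓝 (0 : ℝ), ∀ z ∈ D.N, P (m, z) :=
  D.isCompact.exists_nhds_forall_of_eventually (P := fun q => P (q.2, q.1)) fun z hz =>
    (continuous_swap.tendsto (z, (0 : ℝ))).eventually (h z hz)

lemma IsReturn.eventually_direction_lt (h : D.IsReturn u m₁) {δ : ℝ} (hδ : 0 < δ) :
    ∀ᶠ m in 𝓝 (0 : ℝ), ∀ z ∈ D.N,
      Real.sqrt ((u (m, z)).2.1 ^ 2 + (u (m, z)).2.2 ^ 2) < δ := by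
  refine eventually_forall_of_eventually
    (P := fun p => Real.sqrt ((u p).2.1 ^ 2 + (u p).2.2 ^ 2) < δ) fun z hz => ?_
  have hc : Continuous fun p => Real.sqrt ((u p).2.1 ^ 2 + (u p).2.2 ^ 2) := by
    have := h.smooth.continuous
    fun_prop
  refine hc.continuousAt.eventually_lt continuousAt_const ?_
  rw [h.zero z hz]
  simpa using hδ

lemma IsReturn.eventually_abs_lt (h : D.IsReturn u m₁) : ∀ᶠ m in 𝓝 (0 : ℝ), |m| < m₁ :=
  continuous_abs.continuousAt.eventually_lt continuousAt_const (by simpa using h.pos)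

/-- For small `m`, a point is critical for the return time if and only if its orbit returns to it,
that is, the direction of the return vanishes. -/
lemma IsReturn.eventually_critical_iff (h : D.IsReturn u m₁) (hU : D.U = univ) :
    ∀ᶠ m in 𝓝 (0 : ℝ), ∀ z ∈ D.N, ((∀ c : ℝ → E, ContDiff ℝ ∞ c → (∀ t, c t ∈ D.N) → c 0 = z →
      HasDerivAt (fun t => (u (m, c t)).1) 0 0) ↔ (u (m, z)).2 = 0) := by
  have h1 := eventually_forall_of_eventually fun z hz =>
    h.eventually_direction_zero hz (hU ▸ mem_univ z)
  filter_upwards [h1, h.eventually_abs_lt] with m hm hm' z hz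
  constructor
  · intro hcrit
    have key : ∀ (c : ℝ → E) (ζ : E), ContDiff ℝ ∞ c → (∀ t, c t ∈ D.N) → c 0 = z →
        HasDerivAt c ζ 0 → fderiv ℝ (fun p => (u p).1) (m, z) (0, ζ) = 0 := by
      intro c ζ hc hN h0 hd
      have hu : HasFDerivAt (fun p => (u p).1) (fderiv ℝ (fun p => (u p).1) (m, z)) (m, c 0) := by
        rw [h0]
        exact ((contDiff_fst.comp h.smooth).differentiable (by simp) (m, z)).hasFDerivAt
      exact (HasFDerivAt.comp_hasDerivAt (l := fun p => (u p).1) (f := fun t => (m, c t)) 0 hu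
        ((hasDerivAt_const 0 m).prodMk hd)).unique (hcrit c hc hN h0)
    exact hm z hz hz
      (key _ _ (smooth_sec_curve z (1, 0)) (sec_mem hz _) (by simp) (hasDerivAt_sec_A hz))
      (key _ _ (smooth_sec_curve z (0, 1)) (sec_mem hz _) (by simp) (hasDerivAt_sec_B hz))
  · intro hW c hc hN h0
    refine h.hasDerivAt_of_direction_zero hm' hc hN ?_ (by rw [h0, hW])
    exact ⟨fun _ _ => hU ▸ mem_univ _, fun _ _ => hU ▸ mem_univ _⟩

lemma IsReturn.eventually_expansion (h : D.IsReturn u m₁) (hU : D.U = univ) {ε : ℝ} (hε : 0 < ε) :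
    ∀ᶠ m in 𝓝 (0 : ℝ), ∀ z ∈ D.N,
      |(u (m, z)).1 - (2 * Real.pi + Real.pi / D.f z * m ^ 2)| ≤ ε * m ^ 2 := by
  obtain ⟨k, hk, hku⟩ := h.exists_expansion
  have hev := eventually_forall_of_eventually (D := D)
    (P := fun p => |k p - k (0, p.2)| < ε) fun z _ => by
      have hc : Continuous fun p : ℝ × E => |k p - k (0, p.2)| := by
        have := hk.continuous
        fun_prop
      exact hc.continuousAt.eventually_lt continuousAt_const (by simpa using hε)
  filter_upwards [hev] with m hm z hz
  obtain ⟨h1, h2⟩ := hku z hz (hU ▸ mem_univ z)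
  rw [h2 m, ← h1, show 2 * Real.pi + m ^ 2 * k (m, z) - (2 * Real.pi + k (0, z) * m ^ 2)
    = (k (m, z) - k (0, z)) * m ^ 2 by ring, abs_mul, abs_of_nonneg (sq_nonneg m)]
  exact mul_le_mul_of_nonneg_right (hm z hz).le (sq_nonneg m)

end ContactData

/-! ### The action function on the unit tangent bundle -/

section Action

variable {g : SphereMetric} {f : SphereFun} {β : SphereOneForm} (hβ : IsPrimitive g f β)
  (hf : ∀ x : S2, 0 < f x) {z : Phase}

lemma lamCheck_eq (hz : z ∈ unitBundle g) (m : ℝ) (ξ : Phase) :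
    lamCheck g β (globalData hβ hf).conf m z ξ = (globalData hβ hf).lamPull m z ξ := by
  rw [lamCheck, lam_zero_eq_L₀ hβ hf hz, ContactData.lamPull]

lemma isReebField {m : ℝ} (hm : |m| < (globalData hβ hf).mb) :
    IsReebField (unitBundle g) (lamCheck g β (globalData hβ hf).conf m)
      ((globalData hβ hf).reeb m) := by
  set D := globalData hβ hf with hD
  intro z hz
  refine ⟨⟨fun s => D.phi m s z, D.smooth_phi_curve m z,
    ContactData.phi_mem (D := D) hz m, D.phi_zero m z, ?_⟩, ?_, fun Φ hΦ hN h0 hR => ?_⟩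
  · have := ContactData.hasDerivAt_phi (D := D) m 0 z
    rwa [D.phi_zero] at this
  · rw [lamCheck_eq hβ hf hz]
    exact ContactData.lamPull_reeb (globalData_U hβ hf) hm hz
  · rw [extDerivAlong]
    have hα : ∀ p ξ, lamCheck g β D.conf m (Φ p) ξ = D.lamPull m (Φ p) ξ := fun p ξ =>
      lamCheck_eq hβ hf (hN p) m ξ
    simp only [hα]
    exact ContactData.extDerivAlong_lamPull (globalData_U hβ hf) hm hΦ hN (by rw [h0]; exact hR)

/-- The action is the return time: the Reeb orbit contributes its length, and the section, which
consists of curves parallel for `λ_0`, contributes nothing. -/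
lemma isActionValue {u : ℝ × Phase → ℝ × (ℝ × ℝ)} {m₁ : ℝ}
    (h : (globalData hβ hf).IsReturn u m₁) {m : ℝ} (hm : |m| < m₁) (hz : z ∈ unitBundle g)
    {ρ δ₀ δ : ℝ} (hρ : ρ ≤ 1) (hdist : dist (u (m, z)) (2 * Real.pi, (0, 0)) < ρ)
    (hfirst : ∀ y : ℝ × (ℝ × ℝ), 0 < y.1 → y.1 < 2 * Real.pi + ρ → ‖y.2‖ < δ₀ →
      (globalData hβ hf).phi m y.1 z = (globalData hβ hf).sec z y.2 1 → y = u (m, z))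
    (hδ : δ ≤ 1) (hδ₀ : δ ≤ δ₀)
    (hW : Real.sqrt ((u (m, z)).2.1 ^ 2 + (u (m, z)).2.2 ^ 2) < δ) :
    IsActionValue g (lam g β 0) (lamCheck g β (globalData hβ hf).conf m) δ z (u (m, z)).1 := by
  set D := globalData hβ hf with hD
  have hmb := h.abs_lt hm
  have ht : |(u (m, z)).1 - 2 * Real.pi| < ρ := by
    rw [← Real.dist_eq]
    exact lt_of_le_of_lt (le_max_left _ _) hdist
  obtain ⟨ht1, ht2⟩ := _root_.abs_lt.1 ht
  have hα₀ : ∀ z ∈ unitBundle g, ∀ ξ, lam g β 0 z ξ = connectionL g (globalPrimitive hβ) z ξ :=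
    fun z hz => lam_zero_eq hβ hz
  have hlift := isParallelRadialLift_sec g (globalPrimitive hβ) hf hα₀ hz
    (h.norm_le m hm z hz) hW
  have hend : D.sec z (u (m, z)).2 1 = D.phi m (u (m, z)).1 z := (h.phi_eq m hm z hz).symm
  refine ⟨D.reeb m, isReebField hβ hf hmb, fun s => D.phi m s z, D.phi_zero m z,
    fun s => ⟨ContactData.phi_mem (D := D) hz m s, ContactData.hasDerivAt_phi (D := D) m s z⟩,
    (u (m, z)).1, ⟨⟨by linarith [Real.pi_gt_three], _, hlift, hend⟩, ?_⟩, _, hlift, hend, ?_⟩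
  · rintro s ⟨hs, c, hc, hcs⟩
    obtain ⟨w, hw, rfl⟩ :=
      eq_sec_of_isParallelRadialLift g (globalPrimitive hβ) hf hα₀ hδ hc
    by_contra! hlt
    have hwn : ‖w‖ < δ₀ := by
      refine lt_of_le_of_lt ?_ (hw.trans_le hδ₀)
      rw [Prod.norm_def, Real.norm_eq_abs, Real.norm_eq_abs]
      exact max_le (Real.abs_le_sqrt (by linarith [sq_nonneg w.2]))
        (Real.abs_le_sqrt (by linarith [sq_nonneg w.1]))
    have := hfirst (s, w) hs (by linarith) hwn hcs.symm
    exact hlt.ne (congrArg Prod.fst this)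
  · have i1 : pathIntegral (lamCheck g β D.conf m) (fun r => D.phi m ((u (m, z)).1 * r) z)
        = (u (m, z)).1 := by
      have : ∀ r, lamCheck g β D.conf m (D.phi m ((u (m, z)).1 * r) z)
          (deriv (fun r => D.phi m ((u (m, z)).1 * r) z) r) = (u (m, z)).1 := fun r => by
        have hN : D.phi m ((u (m, z)).1 * r) z ∈ unitBundle g :=
          ContactData.phi_mem (D := D) hz m _
        have hd := HasDerivAt.scomp (g₁ := fun s => D.phi m s z) r
          (ContactData.hasDerivAt_phi (D := D) m ((u (m, z)).1 * r) z)
          ((hasDerivAt_id r).const_mul (u (m, z)).1)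
        have hd' : deriv (fun r => D.phi m ((u (m, z)).1 * r) z) r = _ := hd.deriv
        have hr : D.lamPull m (D.phi m ((u (m, z)).1 * r) z) _ = 1 :=
          ContactData.lamPull_reeb (D := D) (globalData_U hβ hf) hmb hN
        rw [hd', lamCheck_eq hβ hf hN]
        rw [ContactData.lamPull] at hr ⊢
        rw [map_smul, smul_eq_mul, mul_left_comm, hr, mul_one, mul_one]
      simp only [pathIntegral, this]
      simp
    have i2 : pathIntegral (lamCheck g β D.conf m) (fun r => D.sec z (u (m, z)).2 (1 - r)) = 0 := by
      have : ∀ r, lamCheck g β D.conf m (D.sec z (u (m, z)).2 (1 - r))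
          (deriv (fun r => D.sec z (u (m, z)).2 (1 - r)) r) = 0 := fun r => by
        have h1 := hlift.2.2.2.1 (1 - r)
        have hN : D.sec z (u (m, z)).2 (1 - r) ∈ unitBundle g := hlift.2.2.1 (1 - r)
        rw [hα₀ _ hN] at h1
        rw [lamCheck, hα₀ _ hN, deriv_comp_const_sub, map_neg, h1, neg_zero, mul_zero]
      simp only [pathIntegral, this]
      simp
    rw [i1, i2, add_zero]

lemma isOnShortOrbit_iff {ε m : ℝ} (hm : |m| < (globalData hβ hf).mb) (hz : z ∈ unitBundle g) :
    IsOnShortOrbit g f ε m z ↔ ∃ T > 0, |(globalData hβ hf).f z * T - 2 * Real.pi| < ε ∧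
      (globalData hβ hf).mag m T z = z ∧ ∀ v ∈ Icc 0 T,
        ‖(globalData hβ hf).mag m v z
          - (globalData hβ hf).rot ((globalData hβ hf).f z * v) z‖ < ε := by
  set D := globalData hβ hf with hD
  have hfz : D.f z = funExt f z.1 := (contactData_fun g (globalPrimitive hβ) hf hz).1
  rw [hfz]
  constructor
  · rintro ⟨T, hT, h1, c, hc0, hc, hp, h2⟩
    have hcm : ∀ t, c t = D.mag m t z := fun t => by
      rw [eq_mag_of_isFlowLine g (globalPrimitive hβ) hf hm hc t, hc0]
    refine ⟨T, hT, h1, ?_, fun v hv => ?_⟩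
    · rw [← hcm, ← zero_add T, hp 0, hc0]
    · rw [← hcm]
      exact h2 v hv
  · rintro ⟨T, hT, h1, hp, h2⟩
    refine ⟨T, hT, h1, fun t => D.mag m t z, D.mag_zero m z,
      isFlowLine_mag g (globalPrimitive hβ) hf hm hz, fun t => ?_, h2⟩
    simp only [D.mag_add m t T z, hp]

end Action

end

end LowEnergyMagnetic

theorem proposition1p4 (g : SphereMetric) (f : SphereFun) (hf : ∀ x : S2, 0 < f x) :
    (∀ β : SphereOneForm, IsPrimitive g f β →
      ∃ m₀ : ℝ, 0 < m₀ ∧ ∃ (F : ℝ → Phase → Phase) (q : ℝ → Phase → ℝ),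
        IsGrayIsotopy g β m₀ F q ∧
        (∃ δ₀ : ℝ, 0 < δ₀ ∧ ∀ δ ∈ Ioo 0 δ₀, ∃ m₁ ∈ Ioc 0 m₀, ∃ S : ℝ → Phase → ℝ,
          (∀ m ∈ Ico 0 m₁, ∀ z ∈ unitBundle g,
            IsActionValue g (lam g β 0) (lamCheck g β q m) δ z (S m z)) ∧
          ContDiffOn ℝ ∞ (fun p : ℝ × Phase => S p.1 p.2) (Ico 0 m₁ ×ˢ unitBundle g) ∧
          (∃ ε₀ : ℝ, 0 < ε₀ ∧ ∀ ε ∈ Ioo 0 ε₀, ∃ m₂ ∈ Ioc 0 m₁, ∀ m ∈ Ico 0 m₂,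
            ∀ z ∈ unitBundle g,
              IsCritOn (unitBundle g) (S m) z ↔ IsOnShortOrbit g f ε m (F m z)) ∧
          (∀ ε : ℝ, 0 < ε → ∃ m₂ ∈ Ioc 0 m₁, ∀ m ∈ Ico 0 m₂, ∀ z ∈ unitBundle g,
            |S m z - (2 * Real.pi + Real.pi / funExt f z.1 * m ^ 2)| ≤ ε * m ^ 2)) ∧
        (∀ x : S2, IsNondegCrit f x →
          ∃ m₁ ∈ Ioc 0 m₀, ∃ γ : ℝ → ℝ → Phase, IsOrbitFamily g f m₁ F x γ)) ∧
    (∀ x : S2, IsNondegCrit f x →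
      ∃ m₁ : ℝ, 0 < m₁ ∧ ∃ γ : ℝ → ℝ → Phase, IsOrbitFamily g f m₁ (fun _ z => z) x γ) := by
  refine ⟨fun β hβ => ?_, fun x hx => exists_isOrbitFamily g hf hx⟩
  set D := globalData hβ hf with hD
  have hU : D.U = univ := globalData_U hβ hf
  refine ⟨D.mb, D.mb_pos, D.F, D.conf, isGrayIsotopy hβ hf, ?_, fun x hx => ?_⟩
  · obtain ⟨ρ, hρ, hρ1, u, δ₀, hδ₀, hev⟩ := D.exists_isReturn
    refine ⟨min 1 δ₀, lt_min one_pos hδ₀, fun δ hδ => ?_⟩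
    obtain ⟨m', hm'⟩ := hev.exists
    obtain ⟨m₁, ⟨h, hu⟩, hW⟩ :=
      (hev.and (eventually_forall_abs_lt (hm'.1.eventually_direction_lt hδ.1))).exists
    have habs : ∀ {m r : ℝ}, m ∈ Ico 0 r → |m| < r := fun hm => by
      rw [abs_of_nonneg hm.1]
      exact hm.2
    refine ⟨m₁, ⟨h.pos, h.le⟩, fun m z => (u (m, z)).1, fun m hm z hz => ?_,
      (contDiff_fst.comp h.smooth).contDiffOn, ⟨ρ / 2, half_pos hρ, fun ε hε => ?_⟩, fun ε hε => ?_⟩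
    · obtain ⟨k1, -, k3⟩ := hu m (habs hm) z hz
      exact isActionValue hβ hf h (habs hm) hz hρ1 k1 k3 (hδ.2.le.trans (min_le_left _ _))
        (hδ.2.le.trans (min_le_right _ _)) (hW m (habs hm) z hz)
    · have huniq := h.eventually_abs_lt.mono fun m hm => fun z hz => (hu m hm z hz).2.1
      refine exists_forall_Ico ?_ h.pos
      filter_upwards [h.eventually_critical_iff hU,
        h.eventually_short_orbit_iff hρ hρ1 huniq hε.1 hε.2, h.eventually_abs_lt] with m hm1 hm2 hm3 z hz
      rw [isOnShortOrbit_iff hβ hf (hm3.trans_le h.le) (ContactData.F_mem (D := D) hz m)]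
      exact (hm1 z hz).trans (hm2 z hz)
    · refine exists_forall_Ico ?_ h.pos
      filter_upwards [h.eventually_expansion hU hε] with m hm z hz
      have hfz : D.f z = funExt f z.1 := (contactData_fun g (globalPrimitive hβ) hf hz).1
      rw [← hfz]
      exact hm z hz
  · obtain ⟨γ, hγ⟩ := eventually_isOrbitFamily (globalPrimitive hβ) hf hx trivial
    obtain ⟨m₁, h1, h2⟩ := (hγ.and (Ioo_mem_nhdsGT D.mb_pos)).exists
    exact ⟨m₁, ⟨h2.1, h2.2.le⟩, γ, h1⟩
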